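/- Let $\Bbbk$ be a field and $r\in\Bbbk^\times$. All 2-categories are weak 2-categories that are graded, additive and $\Bbbk$-linear: each Hom category is additive, $\Bbbk$-linear and carries a grading shift $\langle l\rangle$ ($l\in\mathbb Z$), and horizontal composition is $\Bbbk$-bilinear and commutes with the shifts in each variable. A 2-morphism $f\to g$ of degree $l$ is a 2-morphism $f\to g\langle l\rangle$. For $n\ge 0$ put $\bigoplus_{[n]}f=\bigoplus_{k=0}^{n-1}f\langle n-1-2k\rangle$. Diagrams are read from right to left and from bottom to top. **Strong 2-representations.** A strong 2-representation of $\mathfrak{sl}_2$ on $\mathcal K$ (with parameter $r$) consists of objects $n\in\mathbb Z$ of $\mathcal K$ and 1-morphisms $\mathcal E\mathbf 1_n\colon n\to n+2$ that have both a right adjoint $(\mathcal E\mathbf 1_n)_R$ and a left adjoint; put $\mathbf 1_n\mathcal F=(\mathcal E\mathbf 1_n)_R\langle -n-1\rangle\colon n+2\to n$. The following are required. 1. For every $n$, the object $n+2s$ is a zero object (its identity 1-morphism is zero) for all but finitely many $s\in\mathbb Z$. 2. The categories $\mathcal K(m,n)$ have split idempotents and finite-dimensional spaces of 2-morphisms;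 $\mathrm{Hom}(\mathbf 1_n,\mathbf 1_n\langle l\rangle)=0$ for $l<0$; and $\mathrm{End}(\mathbf 1_n)$ is one-dimensional if the object $n$ is non-zero. 3. $\mathcal F\mathcal E\mathbf 1_n\cong\mathcal E\mathcal F\mathbf 1_n\oplus\bigoplus_{[-n]}\mathbf 1_n$ if $n\le 0$, and $\mathcal E\mathcal F\mathbf 1_n\cong\mathcal F\mathcal E\mathbf 1_n\oplus\bigoplus_{[n]}\mathbf 1_n$ if $n\ge 0$. 4. There are 2-morphisms $X\colon\mathcal E\mathbf 1_n\to\mathcal E\mathbf 1_n$ of degree $2$ and $T\colon\mathcal E\mathcal E\mathbf 1_n\to\mathcal E\mathcal E\mathbf 1_n$ of degree $-2$ satisfying the nilHecke relations with parameter $r$. Namely, let $X_{\mathrm l}=X\mathcal E$ and $X_{\mathrm r}=\mathcal E X$ denote $X$ on the left and on the right strand of $\mathcal E\mathcal E\mathbf 1_n$; then $T\circ X_{\mathrm l}-X_{\mathrm r}\circ T=r\cdot\mathrm{id}=X_{\mathrm l}\circ T-T\circ X_{\mathrm r}$, $T^2=0$, and $(T\mathcal E)(\mathcal E T)(T\mathcal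 E)=(\mathcal E T)(T\mathcal E)(\mathcal E T)$. **The 2-category $\mathcal U_Q(\mathfrak{sl}_2)$.** Its objects are the $n\in\mathbb Z$. Its 1-morphisms are formal direct sums of shifts of composites of $\mathbf 1_n$, $\mathcal E\mathbf 1_n\colon n\to n+2$ and $\mathcal F\mathbf 1_n\colon n\to n-2$. Its 2-morphisms are generated by upward strands (for $\mathcal E$) and downward strands (for $\mathcal F$), by dots (degree $2$) and crossings (degree $-2$) on $\mathcal E$'s and on $\mathcal F$'s, and by cups $\mathbf 1_n\to\mathcal F\mathcal E\mathbf 1_n$, $\mathbf 1_n\to\mathcal E\mathcal F\mathbf 1_n$ and caps $\mathcal F\mathcal E\mathbf 1_n\to\mathbf 1_n$, $\mathcal E\mathcal F\mathbf 1_n\to\mathbf 1_n$ of degrees $1+n$, $1-n$, $1+n$, $1-n$. The relations are: * (a) the cups and caps make $\mathcal E$ and $\mathcal F$ biadjoint, and dots and crossings are cyclic: dots and crossings on downward strands are both the left and the right mates of those on upward strands; * (b) the nilHecke relations with parameter $r$ for upward strands, and with parameter $-r$ for downward strands; * (c) let $\circlearrowright_n^m$ (from $\mathcal E\mathcal F\mathbf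 1_n$) and $\circlearrowleft_n^m$ (from $\mathcal F\mathcal E\mathbf 1_n$) be the clockwise and counterclockwise bubbles with $m\ge 0$ dots in a region of weight $n$. Then $\circlearrowright_n^m=0$ if $m<n-1$, $\circlearrowleft_n^m=0$ if $m<-n-1$, $\circlearrowright_n^{n-1}=\mathrm{id}_{\mathbf 1_n}$ for $n\ge 1$, and $\circlearrowleft_n^{-n-1}=\mathrm{id}_{\mathbf 1_n}$ for $n\le -1$ (in particular $c_{-1}=1$ for the scalar $c_{-1}$ with $\circlearrowleft_{-1}^{0}=c_{-1}\mathrm{id}$). Bubbles with a negative number of dots ("fake bubbles") are defined inductively by $\sum_{a+b=j}\circlearrowright_n^{n-1+a}\,\circlearrowleft_n^{-n-1+b}=\delta_{j,0}$, with $\circlearrowright_0^{-1}=\circlearrowleft_0^{-1}=\mathrm{id}$; * (d) let $R_n$ be the curl on the right of $\mathcal E\mathbf 1_n$ (the region on the right having weight $n$), and $L_n$ the curl on the left of $\mathbf 1_n\mathcal E$ (the region on the left having weight $n$). Then $R_n=0$ if $n>0$; $R_n=-r\sum_{f_1+f_2=-n}X^{f_1}\circlearrowright_n^{n-1+f_2}$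 if $n\le 0$, with the bubbles on the right of the strand; $L_n=0$ if $n<0$; and $L_n=r\sum_{g_1+g_2=n}\circlearrowleft_n^{-n-1+g_2}X^{g_1}$ if $n\ge 0$, with the bubbles on the left of the strand. In particular $R_0=-r\,\mathrm{id}$ and $L_0=r\,\mathrm{id}$; * (e) let $\sigma\colon\mathcal E\mathcal F\mathbf 1_n\to\mathcal F\mathcal E\mathbf 1_n$ and $\sigma'\colon\mathcal F\mathcal E\mathbf 1_n\to\mathcal E\mathcal F\mathbf 1_n$ be the sideways crossings, obtained from the upward crossing by rotation with cups and caps. Then $$\mathrm{id}_{\mathcal E\mathcal F\mathbf 1_n}=-r^{-2}\,\sigma'\sigma+\sum_{f_1+f_2+f_3=n-1}\mathrm{cup}^{f_1}\circ\circlearrowleft_n^{-n-1+f_2}\circ\,\mathrm{cap}^{f_3},$$ $$\mathrm{id}_{\mathcal F\mathcal E\mathbf 1_n}=-r^{-2}\,\sigma\sigma'+\sum_{g_1+g_2+g_3=-n-1}\mathrm{cup}^{g_1}\circ\circlearrowright_n^{n-1+g_2}\circ\,\mathrm{cap}^{g_3},$$ where the sums are over non-negative integers (the first sum is empty if $n\le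 0$, the second if $n\ge 0$), and $\mathrm{cup}^f$, $\mathrm{cap}^f$ are the cup $\mathbf 1_n\to\mathcal E\mathcal F\mathbf 1_n$ (resp. $\mathbf 1_n\to\mathcal F\mathcal E\mathbf 1_n$) and the cap $\mathcal E\mathcal F\mathbf 1_n\to\mathbf 1_n$ (resp. $\mathcal F\mathcal E\mathbf 1_n\to\mathbf 1_n$) with $f$ dots. **Theorem.** Every strong 2-representation of $\mathfrak{sl}_2$ on a 2-category $\mathcal K$ extends to a 2-representation of $\mathcal U_Q(\mathfrak{sl}_2)$. That is, there is a graded additive $\Bbbk$-linear (weak) 2-functor $\Phi\colon\mathcal U_Q(\mathfrak{sl}_2)\to\mathcal K$ that sends $n$ to the object $n$, $\mathcal E\mathbf 1_n$ to $\mathcal E\mathbf 1_n$, $\mathbf 1_n\mathcal F$ to $\mathbf 1_n\mathcal F$, the dot on an upward strand to $X$ and the crossing of two upward strands to $T$. -/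

import Mathlib

open CategoryTheory CategoryTheory.Bicategory CategoryTheory.Limits

universe w v u w' v' u' t

/-! ### Graded additive linear 2-categories and 2-functors

Composition of 1-morphisms is written in diagrammatic order: `f ≫ g` is first `f`, then `g`.
The grading shift `⟨n⟩` of a 1-morphism `f` is `f⟦n⟧`. -/

/-- A graded additive 2-category: the hom categories are additive and carry a grading shift
(a coherent action of `ℤ`), horizontal composition is additive in each variable, and it commutes
with the shifts in each variable, by isomorphisms `f⟦n⟧ ≫ g ≅ (f ≫ g)⟦n⟧ ≅ f ≫ g⟦n⟧` that are
natural and compatible with each other and with the associators and unitors. -/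
class GradedAdditiveBicategory (K : Type u) [Bicategory.{w, v} K] where
  [preadditive : ∀ a b : K, Preadditive (a ⟶ b)]
  [hasFiniteBiproducts : ∀ a b : K, HasFiniteBiproducts (a ⟶ b)]
  [precomp_additive : ∀ {a b : K} (c : K) (f : a ⟶ b), (precomp c f).Additive]
  [postcomp_additive : ∀ (a : K) {b c : K} (g : b ⟶ c), (postcomp a g).Additive]
  [hasShift : ∀ a b : K, HasShift (a ⟶ b) ℤ]
  [shift_additive : ∀ (a b : K) (n : ℤ), (shiftFunctor (a ⟶ b) n).Additive]
  [precompCommShift : ∀ {a b : K} (c : K) (f : a ⟶ b), (precomp c f).CommShift ℤ]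
  [postcompCommShift : ∀ (a : K) {b c : K} (g : b ⟶ c), (postcomp a g).CommShift ℤ]
  precomp_natural : ∀ {a b : K} (c : K) {f f' : a ⟶ b} (η : f ⟶ f') (g : b ⟶ c) (n : ℤ),
    η ▷ (g⟦n⟧) ≫ ((precomp c f').commShiftIso n).hom.app g =
      ((precomp c f).commShiftIso n).hom.app g ≫ (η ▷ g)⟦n⟧'
  postcomp_natural : ∀ (a : K) {b c : K} (f : a ⟶ b) {g g' : b ⟶ c} (η : g ⟶ g') (n : ℤ),
    (f⟦n⟧) ◁ η ≫ ((postcomp a g').commShiftIso n).hom.app f =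
      ((postcomp a g).commShiftIso n).hom.app f ≫ (f ◁ η)⟦n⟧'
  shift_exchange : ∀ {a b c : K} (f : a ⟶ b) (g : b ⟶ c) (m n : ℤ),
    ((precomp c (f⟦m⟧)).commShiftIso n).hom.app g ≫
        (((postcomp a g).commShiftIso m).hom.app f)⟦n⟧' =
      ((postcomp a (g⟦n⟧)).commShiftIso m).hom.app f ≫
        (((precomp c f).commShiftIso n).hom.app g)⟦m⟧' ≫
        (shiftFunctorComm (a ⟶ c) n m).hom.app (f ≫ g)
  associator_shift_left : ∀ {a b c d : K} (f : a ⟶ b) (g : b ⟶ c) (h : c ⟶ d) (n : ℤ),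
    (α_ (f⟦n⟧) g h).hom ≫ ((postcomp a (g ≫ h)).commShiftIso n).hom.app f =
      ((postcomp a g).commShiftIso n).hom.app f ▷ h ≫
        ((postcomp a h).commShiftIso n).hom.app (f ≫ g) ≫ ((α_ f g h).hom)⟦n⟧'
  associator_shift_middle : ∀ {a b c d : K} (f : a ⟶ b) (g : b ⟶ c) (h : c ⟶ d) (n : ℤ),
    (α_ f (g⟦n⟧) h).hom ≫ f ◁ ((postcomp b h).commShiftIso n).hom.app g ≫
        ((precomp d f).commShiftIso n).hom.app (g ≫ h) =
      ((precomp c f).commShiftIso n).hom.app g ▷ h ≫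
        ((postcomp a h).commShiftIso n).hom.app (f ≫ g) ≫ ((α_ f g h).hom)⟦n⟧'
  associator_shift_right : ∀ {a b c d : K} (f : a ⟶ b) (g : b ⟶ c) (h : c ⟶ d) (n : ℤ),
    (α_ f g (h⟦n⟧)).hom ≫ f ◁ ((precomp d g).commShiftIso n).hom.app h ≫
        ((precomp d f).commShiftIso n).hom.app (g ≫ h) =
      ((precomp d (f ≫ g)).commShiftIso n).hom.app h ≫ ((α_ f g h).hom)⟦n⟧'
  leftUnitor_shift : ∀ {a b : K} (f : a ⟶ b) (n : ℤ),
    ((precomp b (𝟙 a)).commShiftIso n).hom.app f ≫ ((λ_ f).hom)⟦n⟧' = (λ_ (f⟦n⟧)).hom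
  rightUnitor_shift : ∀ {a b : K} (f : a ⟶ b) (n : ℤ),
    ((postcomp a (𝟙 b)).commShiftIso n).hom.app f ≫ ((ρ_ f).hom)⟦n⟧' = (ρ_ (f⟦n⟧)).hom

namespace GradedAdditiveBicategory

attribute [reducible] preadditive hasShift precompCommShift postcompCommShift

attribute [instance] preadditive hasFiniteBiproducts precomp_additive postcomp_additive
  hasShift shift_additive precompCommShift postcompCommShift

end GradedAdditiveBicategory

/-- A graded additive 2-category is linear over `k` if its hom categories are `k`-linear and
horizontal composition and the grading shifts are `k`-linear. -/
class GradedLinearBicategory (k : Type t) [Field k] (K : Type u) [Bicategory.{w, v} K]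
    [GradedAdditiveBicategory K] where
  [linear : ∀ a b : K, Linear k (a ⟶ b)]
  [precomp_linear : ∀ {a b : K} (c : K) (f : a ⟶ b), (precomp c f).Linear k]
  [postcomp_linear : ∀ (a : K) {b c : K} (g : b ⟶ c), (postcomp a g).Linear k]
  [shift_linear : ∀ (a b : K) (n : ℤ), (shiftFunctor (a ⟶ b) n).Linear k]

attribute [reducible] GradedLinearBicategory.linear

attribute [instance] GradedLinearBicategory.linear GradedLinearBicategory.precomp_linear
  GradedLinearBicategory.postcomp_linear GradedLinearBicategory.shift_linear

/-- A graded additive `k`-linear (weak) 2-functor: a pseudofunctor that is additive and `k`-linear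
on hom categories and commutes with the grading shifts, compatibly with composition. -/
structure GradedLinearPseudofunctor (k : Type t) [Field k]
    (K : Type u) [Bicategory.{w, v} K] [GradedAdditiveBicategory K] [GradedLinearBicategory k K]
    (L : Type u') [Bicategory.{w', v'} L] [GradedAdditiveBicategory L]
    [GradedLinearBicategory k L] extends Pseudofunctor K L where
  [additive : ∀ a b : K, (toPrelaxFunctor.mapFunctor a b).Additive]
  [linear : ∀ a b : K, (toPrelaxFunctor.mapFunctor a b).Linear k]
  [commShift : ∀ a b : K, (toPrelaxFunctor.mapFunctor a b).CommShift ℤ]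
  mapComp_shift_left : ∀ {a b c : K} (f : a ⟶ b) (g : b ⟶ c) (n : ℤ),
    (mapComp (f⟦n⟧) g).hom ≫
        ((toPrelaxFunctor.mapFunctor a b).commShiftIso n).hom.app f ▷ map g ≫
        ((postcomp (obj a) (map g)).commShiftIso n).hom.app (map f) =
      map₂ (((postcomp a g).commShiftIso n).hom.app f) ≫
        ((toPrelaxFunctor.mapFunctor a c).commShiftIso n).hom.app (f ≫ g) ≫
        ((mapComp f g).hom)⟦n⟧'
  mapComp_shift_right : ∀ {a b c : K} (f : a ⟶ b) (g : b ⟶ c) (n : ℤ),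
    (mapComp f (g⟦n⟧)).hom ≫
        map f ◁ ((toPrelaxFunctor.mapFunctor b c).commShiftIso n).hom.app g ≫
        ((precomp (obj c) (map f)).commShiftIso n).hom.app (map g) =
      map₂ (((precomp c f).commShiftIso n).hom.app g) ≫
        ((toPrelaxFunctor.mapFunctor a c).commShiftIso n).hom.app (f ≫ g) ≫
        ((mapComp f g).hom)⟦n⟧'

attribute [instance] GradedLinearPseudofunctor.additive GradedLinearPseudofunctor.linear
  GradedLinearPseudofunctor.commShift


namespace SL2

/-! ### The 2-category `U_Q(sl₂)` by generators and relations

Weights are integers and the simple root is `2`.  Diagrams in the usual graphical calculus are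
read from right to left and from bottom to top, so that the rightmost strand is the first factor
of a word, and vertical composition `x.comp y` stacks `y` on top of `x`. -/

/-- The 1-morphisms: formal direct sums of grading shifts of compositions of `1_n`,
`E m n h = E 1_m : m ⟶ n` and `F n m h = F 1_n : n ⟶ m`, where `n = m + 2`.  Since `comp f g` is
first `f` and then `g`, the 1-morphism `E F 1_n` is `comp (F n l _) (E l n _)`. -/
inductive Word : ℤ → ℤ → Type
  | one (n : ℤ) : Word n n
  | E (m n : ℤ) (h : m + 2 = n) : Word m n
  | F (n m : ℤ) (h : m + 2 = n) : Word n m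
  | comp {a b c : ℤ} (f : Word a b) (g : Word b c) : Word a c
  | shift {a b : ℤ} (f : Word a b) (l : ℤ) : Word a b
  | zero (a b : ℤ) : Word a b
  | sum {a b : ℤ} (f g : Word a b) : Word a b

local infixr:70 " ⬝ " => Word.comp

/-- Formal expressions for homogeneous 2-morphisms `f ⟶ g` of degree `p`, i.e. for 2-morphisms
`f ⟶ g⟨p⟩`.  The generators are dots and crossings on upward (`E`) and downward (`F`) strands, and
`cupFE : 1_m ⟶ F E 1_m`, `capFE : F E 1_m ⟶ 1_m`, `cupEF : 1_n ⟶ E F 1_n`,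
`capEF : E F 1_n ⟶ 1_n`.  The 2-morphism `unshift f l` is the identity of `f`, regarded as a
morphism `f⟨l⟩ ⟶ f` of degree `l`, and `toShift f l` is its inverse. -/
inductive Diagram (k : Type t) : {a b : ℤ} → Word a b → Word a b → ℤ → Type t
  | ident {a b : ℤ} (f : Word a b) : Diagram k f f 0
  | comp {a b : ℤ} {f g h : Word a b} {p q s : ℤ} (x : Diagram k f g p) (y : Diagram k g h q)
      (e : p + q = s) : Diagram k f h s
  | whiskerLeft {a b c : ℤ} (f : Word a b) {g h : Word b c} {p : ℤ} (x : Diagram k g h p) :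
      Diagram k (f ⬝ g) (f ⬝ h) p
  | whiskerRight {a b c : ℤ} {f g : Word a b} {p : ℤ} (x : Diagram k f g p) (h : Word b c) :
      Diagram k (f ⬝ h) (g ⬝ h) p
  | assoc {a b c d : ℤ} (f : Word a b) (g : Word b c) (h : Word c d) :
      Diagram k ((f ⬝ g) ⬝ h) (f ⬝ g ⬝ h) 0
  | assocInv {a b c d : ℤ} (f : Word a b) (g : Word b c) (h : Word c d) :
      Diagram k (f ⬝ g ⬝ h) ((f ⬝ g) ⬝ h) 0
  | leftUnit {a b : ℤ} (f : Word a b) : Diagram k (Word.one a ⬝ f) f 0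
  | leftUnitInv {a b : ℤ} (f : Word a b) : Diagram k f (Word.one a ⬝ f) 0
  | rightUnit {a b : ℤ} (f : Word a b) : Diagram k (f ⬝ Word.one b) f 0
  | rightUnitInv {a b : ℤ} (f : Word a b) : Diagram k f (f ⬝ Word.one b) 0
  | unshift {a b : ℤ} (f : Word a b) (l : ℤ) : Diagram k (f.shift l) f l
  | toShift {a b : ℤ} (f : Word a b) (l : ℤ) : Diagram k f (f.shift l) (-l)
  | zero {a b : ℤ} (f g : Word a b) (p : ℤ) : Diagram k f g p
  | add {a b : ℤ} {f g : Word a b} {p : ℤ} (x y : Diagram k f g p) : Diagram k f g p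
  | smul {a b : ℤ} {f g : Word a b} {p : ℤ} (c : k) (x : Diagram k f g p) : Diagram k f g p
  | inl {a b : ℤ} (f g : Word a b) : Diagram k f (f.sum g) 0
  | inr {a b : ℤ} (f g : Word a b) : Diagram k g (f.sum g) 0
  | fst {a b : ℤ} (f g : Word a b) : Diagram k (f.sum g) f 0
  | snd {a b : ℤ} (f g : Word a b) : Diagram k (f.sum g) g 0
  | dotE (m n : ℤ) (h : m + 2 = n) : Diagram k (Word.E m n h) (Word.E m n h) 2
  | dotF (n m : ℤ) (h : m + 2 = n) : Diagram k (Word.F n m h) (Word.F n m h) 2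
  | crossE (a b c : ℤ) (h : a + 2 = b) (h' : b + 2 = c) :
      Diagram k (Word.E a b h ⬝ Word.E b c h') (Word.E a b h ⬝ Word.E b c h') (-2)
  | crossF (c b a : ℤ) (h' : b + 2 = c) (h : a + 2 = b) :
      Diagram k (Word.F c b h' ⬝ Word.F b a h) (Word.F c b h' ⬝ Word.F b a h) (-2)
  | cupFE (m n : ℤ) (h : m + 2 = n) :
      Diagram k (Word.one m) (Word.E m n h ⬝ Word.F n m h) (1 + m)
  | capFE (m n : ℤ) (h : m + 2 = n) :
      Diagram k (Word.E m n h ⬝ Word.F n m h) (Word.one m) (1 + m)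
  | cupEF (m n : ℤ) (h : m + 2 = n) :
      Diagram k (Word.one n) (Word.F n m h ⬝ Word.E m n h) (1 - n)
  | capEF (m n : ℤ) (h : m + 2 = n) :
      Diagram k (Word.F n m h ⬝ Word.E m n h) (Word.one n) (1 - n)

namespace Diagram

variable {k : Type t} {a b c d : ℤ}

/-- Vertical composition. -/
def seq {f g h : Word a b} {p q : ℤ} (x : Diagram k f g p) (y : Diagram k g h q) :
    Diagram k f h (p + q) := x.comp y rfl

local infixl:60 " ⨾ " => Diagram.seq

/-- Transport along an equality of degrees. -/
def cast {f g : Word a b} {p q : ℤ} (x : Diagram k f g p) (h : p = q) : Diagram k f g q := h ▸ x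

/-- The sum of `x i` over `i < n`. -/
def sumLt {f g : Word a b} {p : ℤ} : (n : ℕ) → ((i : ℕ) → i < n → Diagram k f g p) → Diagram k f g p
  | 0, _ => zero f g p
  | n + 1, x => (sumLt n fun i hi => x i (Nat.lt_succ_of_lt hi)).add (x n (Nat.lt_succ_self n))

/-- The mate of `x` under the adjunction `W ⊣ V` with unit `cup` and counit `cap`. -/
def mateR {W : Word a b} {V : Word b a} {p s q : ℤ}
    (cup : Diagram k (Word.one a) (W ⬝ V) p) (cap : Diagram k (V ⬝ W) (Word.one b) q)
    (x : Diagram k W W s) : Diagram k V V (p + s + q) :=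
  (rightUnitInv V ⨾ whiskerLeft V cup ⨾ whiskerLeft V (whiskerRight x V) ⨾ assocInv V W V ⨾
    whiskerRight cap V ⨾ leftUnit V).cast (by omega)

/-- The mate of `x` under the adjunction `V ⊣ W` with unit `cup` and counit `cap`. -/
def mateL {W : Word a b} {V : Word b a} {p s q : ℤ}
    (cup : Diagram k (Word.one b) (V ⬝ W) p) (cap : Diagram k (W ⬝ V) (Word.one a) q)
    (x : Diagram k W W s) : Diagram k V V (p + s + q) :=
  (leftUnitInv V ⨾ whiskerRight cup V ⨾ whiskerRight (whiskerLeft V x) V ⨾ assoc V W V ⨾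
    whiskerLeft V cap ⨾ rightUnit V).cast (by omega)

/-- The cup `y` nested inside the cup `x`. -/
def nestCup {W₁ : Word a b} {V₁ : Word b a} {W₂ : Word b c} {V₂ : Word c b} {p q : ℤ}
    (x : Diagram k (Word.one a) (W₁ ⬝ V₁) p) (y : Diagram k (Word.one b) (W₂ ⬝ V₂) q) :
    Diagram k (Word.one a) ((W₁ ⬝ W₂) ⬝ (V₂ ⬝ V₁)) (p + q) :=
  (x ⨾ whiskerLeft W₁ (leftUnitInv V₁ ⨾ whiskerRight y V₁ ⨾ assoc W₂ V₂ V₁) ⨾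
    assocInv W₁ W₂ (V₂ ⬝ V₁)).cast (by omega)

/-- The cap `y` nested inside the cap `x`. -/
def nestCap {W₁ : Word a b} {V₁ : Word b a} {W₂ : Word b c} {V₂ : Word c b} {p q : ℤ}
    (x : Diagram k (W₁ ⬝ V₁) (Word.one a) p) (y : Diagram k (W₂ ⬝ V₂) (Word.one b) q) :
    Diagram k ((W₁ ⬝ W₂) ⬝ (V₂ ⬝ V₁)) (Word.one a) (q + p) :=
  (assoc W₁ W₂ (V₂ ⬝ V₁) ⨾
    whiskerLeft W₁ (assocInv W₂ V₂ V₁ ⨾ whiskerRight y V₁ ⨾ leftUnit V₁) ⨾ x).cast (by omega)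

/-- `j` dots on an upward strand. -/
def dots (m n : ℤ) (h : m + 2 = n) : (j : ℕ) → Diagram k (Word.E m n h) (Word.E m n h) (2 * j)
  | 0 => (ident _).cast (by simp)
  | j + 1 => (dots m n h j ⨾ dotE m n h).cast (by push_cast; ring)

/-- The clockwise bubble with `j` dots in a region of weight `n`. -/
def cw (n : ℤ) (j : ℕ) : Diagram k (Word.one n) (Word.one n) (2 * (1 - n + j)) :=
  (cupEF (n - 2) n (by omega) ⨾ whiskerLeft _ (dots _ _ _ j) ⨾ capEF (n - 2) n (by omega)).cast
    (by omega)

/-- The counterclockwise bubble with `j` dots in a region of weight `n`. -/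
def ccw (n : ℤ) (j : ℕ) : Diagram k (Word.one n) (Word.one n) (2 * (1 + n + j)) :=
  (cupFE n (n + 2) rfl ⨾ whiskerRight (dots _ _ _ j) _ ⨾ capFE n (n + 2) rfl).cast (by omega)

/-- The counterclockwise bubble of degree `2 * j`, with `-N - 1 + j` dots, in weight `N ≥ 0`.
It is a fake bubble for `j ≤ N`, and determined by
`∑ i ≤ j, cw (N - 1 + (j - i)) * fakeCCW i = δ_{j, 0}`. -/
def fakeCCW [Ring k] (N : ℕ) (j : ℕ) : Diagram k (Word.one (N : ℤ)) (Word.one (N : ℤ)) (2 * j) :=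
  match j with
  | 0 => (ident _).cast (by simp)
  | j + 1 => smul (-1) (sumLt (j + 1) fun i hi =>
      (cw (N : ℤ) (N + (j - i)) ⨾ fakeCCW N i).cast (by omega))
termination_by j
decreasing_by exact hi

/-- The clockwise bubble of degree `2 * j`, with `-N - 1 + j` dots, in weight `-N ≤ 0`.
It is a fake bubble for `j ≤ N`, and determined by
`∑ i ≤ j, ccw (N - 1 + (j - i)) * fakeCW i = δ_{j, 0}`. -/
def fakeCW [Ring k] (N : ℕ) (j : ℕ) : Diagram k (Word.one (-N : ℤ)) (Word.one (-N : ℤ)) (2 * j) :=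
  match j with
  | 0 => (ident _).cast (by simp)
  | j + 1 => smul (-1) (sumLt (j + 1) fun i hi =>
      (ccw (-N : ℤ) (N + (j - i)) ⨾ fakeCW N i).cast (by omega))
termination_by j
decreasing_by exact hi

/-- The sideways crossing `E F 1_n ⟶ F E 1_n`. -/
def crossEF (l n p : ℤ) (h : l + 2 = n) (h' : n + 2 = p) :
    Diagram k (Word.F n l h ⬝ Word.E l n h) (Word.E n p h' ⬝ Word.F p n h') 0 :=
  (rightUnitInv _ ⨾ whiskerLeft _ (cupFE n p h') ⨾ assoc _ _ _ ⨾
    whiskerLeft _ (assocInv _ _ _ ⨾ whiskerRight (crossE l n p h h') _ ⨾ assoc _ _ _) ⨾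
    assocInv _ _ _ ⨾ whiskerRight (capEF l n h) _ ⨾ leftUnit _).cast (by omega)

/-- The sideways crossing `F E 1_n ⟶ E F 1_n`. -/
def crossFE (l n p : ℤ) (h : l + 2 = n) (h' : n + 2 = p) :
    Diagram k (Word.E n p h' ⬝ Word.F p n h') (Word.F n l h ⬝ Word.E l n h) 0 :=
  (leftUnitInv _ ⨾ whiskerRight (cupEF l n h) _ ⨾ assoc _ _ _ ⨾
    whiskerLeft _ (assocInv _ _ _ ⨾ whiskerRight (crossE l n p h h') _ ⨾ assoc _ _ _) ⨾
    assocInv _ _ _ ⨾ whiskerLeft _ (capFE n p h') ⨾ rightUnit _).cast (by omega)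

/-- The curl on the right hand side of `E 1_n`. -/
def curlRight (l n p : ℤ) (h : l + 2 = n) (h' : n + 2 = p) :
    Diagram k (Word.E n p h') (Word.E n p h') (-(2 * n)) :=
  (leftUnitInv _ ⨾ whiskerRight (cupEF l n h) _ ⨾ assoc _ _ _ ⨾
    whiskerLeft _ (crossE l n p h h') ⨾ assocInv _ _ _ ⨾ whiskerRight (capEF l n h) _ ⨾
    leftUnit _).cast (by omega)

/-- The curl on the left hand side of `1_n E`. -/
def curlLeft (l n p : ℤ) (h : l + 2 = n) (h' : n + 2 = p) :
    Diagram k (Word.E l n h) (Word.E l n h) (2 * n) :=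
  (rightUnitInv _ ⨾ whiskerLeft _ (cupFE n p h') ⨾ assocInv _ _ _ ⨾
    whiskerRight (crossE l n p h h') _ ⨾ assoc _ _ _ ⨾ whiskerLeft _ (capFE n p h') ⨾
    rightUnit _).cast (by omega)

/-- `x` applied to the last two of three factors that are bracketed to the left. -/
def whiskerMid (f : Word a b) {g g' : Word b c} {h h' : Word c d} {p : ℤ}
    (x : Diagram k (g ⬝ h) (g' ⬝ h') p) : Diagram k ((f ⬝ g) ⬝ h) ((f ⬝ g') ⬝ h') p :=
  (assoc f g h ⨾ whiskerLeft f x ⨾ assocInv f g' h').cast (by omega)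

end Diagram

local infixl:60 " ⨾ " => Diagram.seq

open Diagram in
/-- The defining relations of `U_Q(sl₂)`, for the parameter `r`. -/
inductive Rel {k : Type t} [Field k] (r : kˣ) :
    {a b : ℤ} → {f g : Word a b} → {p : ℤ} → Diagram k f g p → Diagram k f g p → Prop
  -- equivalence relation compatible with all operations
  | refl {a b p : ℤ} {f g : Word a b} (x : Diagram k f g p) : Rel r x x
  | symm {a b p : ℤ} {f g : Word a b} {x y : Diagram k f g p} : Rel r x y → Rel r y x
  | trans {a b p : ℤ} {f g : Word a b} {x y z : Diagram k f g p} :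
      Rel r x y → Rel r y z → Rel r x z
  | comp_congr {a b p q s : ℤ} {f g h : Word a b} {x x' : Diagram k f g p}
      {y y' : Diagram k g h q} (e : p + q = s) :
      Rel r x x' → Rel r y y' → Rel r (x.comp y e) (x'.comp y' e)
  | whiskerLeft_congr {a b c p : ℤ} (f : Word a b) {g h : Word b c} {x x' : Diagram k g h p} :
      Rel r x x' → Rel r (whiskerLeft f x) (whiskerLeft f x')
  | whiskerRight_congr {a b c p : ℤ} {f g : Word a b} {x x' : Diagram k f g p} (h : Word b c) :
      Rel r x x' → Rel r (whiskerRight x h) (whiskerRight x' h)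
  | add_congr {a b p : ℤ} {f g : Word a b} {x x' y y' : Diagram k f g p} :
      Rel r x x' → Rel r y y' → Rel r (x.add y) (x'.add y')
  | smul_congr {a b p : ℤ} {f g : Word a b} (c : k) {x x' : Diagram k f g p} :
      Rel r x x' → Rel r (x.smul c) (x'.smul c)
  -- linear structure
  | add_assoc {a b p : ℤ} {f g : Word a b} (x y z : Diagram k f g p) :
      Rel r ((x.add y).add z) (x.add (y.add z))
  | add_comm {a b p : ℤ} {f g : Word a b} (x y : Diagram k f g p) :
      Rel r (x.add y) (y.add x)
  | zero_add {a b p : ℤ} {f g : Word a b} (x : Diagram k f g p) :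
      Rel r ((Diagram.zero f g p).add x) x
  | neg_add {a b p : ℤ} {f g : Word a b} (x : Diagram k f g p) :
      Rel r ((x.smul (-1)).add x) (Diagram.zero f g p)
  | one_smul {a b p : ℤ} {f g : Word a b} (x : Diagram k f g p) : Rel r (x.smul 1) x
  | mul_smul {a b p : ℤ} {f g : Word a b} (c d : k) (x : Diagram k f g p) :
      Rel r (x.smul (c * d)) ((x.smul d).smul c)
  | smul_add {a b p : ℤ} {f g : Word a b} (c : k) (x y : Diagram k f g p) :
      Rel r ((x.add y).smul c) ((x.smul c).add (y.smul c))
  | add_smul {a b p : ℤ} {f g : Word a b} (c d : k) (x : Diagram k f g p) :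
      Rel r (x.smul (c + d)) ((x.smul c).add (x.smul d))
  | comp_add {a b p q s : ℤ} {f g h : Word a b} (x : Diagram k f g p) (y z : Diagram k g h q)
      (e : p + q = s) : Rel r (x.comp (y.add z) e) ((x.comp y e).add (x.comp z e))
  | add_comp {a b p q s : ℤ} {f g h : Word a b} (x y : Diagram k f g p) (z : Diagram k g h q)
      (e : p + q = s) : Rel r ((x.add y).comp z e) ((x.comp z e).add (y.comp z e))
  | comp_smul {a b p q s : ℤ} {f g h : Word a b} (c : k) (x : Diagram k f g p)
      (y : Diagram k g h q) (e : p + q = s) :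
      Rel r (x.comp (y.smul c) e) ((x.comp y e).smul c)
  | smul_comp {a b p q s : ℤ} {f g h : Word a b} (c : k) (x : Diagram k f g p)
      (y : Diagram k g h q) (e : p + q = s) :
      Rel r ((x.smul c).comp y e) ((x.comp y e).smul c)
  | whiskerLeft_add {a b c p : ℤ} (f : Word a b) {g h : Word b c} (x y : Diagram k g h p) :
      Rel r (whiskerLeft f (x.add y)) ((whiskerLeft f x).add (whiskerLeft f y))
  | whiskerLeft_smul {a b c p : ℤ} (f : Word a b) {g h : Word b c} (z : k)
      (x : Diagram k g h p) : Rel r (whiskerLeft f (x.smul z)) ((whiskerLeft f x).smul z)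
  | whiskerRight_add {a b c p : ℤ} {f g : Word a b} (x y : Diagram k f g p) (h : Word b c) :
      Rel r (whiskerRight (x.add y) h) ((whiskerRight x h).add (whiskerRight y h))
  | whiskerRight_smul {a b c p : ℤ} {f g : Word a b} (z : k) (x : Diagram k f g p)
      (h : Word b c) : Rel r (whiskerRight (x.smul z) h) ((whiskerRight x h).smul z)
  -- 2-category structure
  | id_comp {a b p : ℤ} {f g : Word a b} (x : Diagram k f g p) (e : 0 + p = p) :
      Rel r ((ident f).comp x e) x
  | comp_id {a b p : ℤ} {f g : Word a b} (x : Diagram k f g p) (e : p + 0 = p) :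
      Rel r (x.comp (ident g) e) x
  | comp_assoc {a b p q s pq qs pqs : ℤ} {f g h i : Word a b} (x : Diagram k f g p)
      (y : Diagram k g h q) (z : Diagram k h i s) (e₁ : p + q = pq) (e₂ : pq + s = pqs)
      (e₃ : q + s = qs) (e₄ : p + qs = pqs) :
      Rel r ((x.comp y e₁).comp z e₂) (x.comp (y.comp z e₃) e₄)
  | whiskerLeft_id {a b c : ℤ} (f : Word a b) (g : Word b c) :
      Rel r (whiskerLeft f (ident g)) (ident (f ⬝ g))
  | whiskerLeft_comp {a b c p q s : ℤ} (f : Word a b) {g h i : Word b c} (x : Diagram k g h p)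
      (y : Diagram k h i q) (e : p + q = s) :
      Rel r (whiskerLeft f (x.comp y e)) ((whiskerLeft f x).comp (whiskerLeft f y) e)
  | id_whiskerRight {a b c : ℤ} (f : Word a b) (g : Word b c) :
      Rel r (whiskerRight (ident f) g) (ident (f ⬝ g))
  | comp_whiskerRight {a b c p q s : ℤ} {f g h : Word a b} (x : Diagram k f g p)
      (y : Diagram k g h q) (e : p + q = s) (i : Word b c) :
      Rel r (whiskerRight (x.comp y e) i) ((whiskerRight x i).comp (whiskerRight y i) e)
  | whisker_exchange {a b c p q s : ℤ} {f g : Word a b} {h i : Word b c} (x : Diagram k f g p)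
      (y : Diagram k h i q) (e : q + p = s) (e' : p + q = s) :
      Rel r ((whiskerLeft f y).comp (whiskerRight x i) e)
        ((whiskerRight x h).comp (whiskerLeft g y) e')
  | assoc_hom_inv {a b c d : ℤ} (f : Word a b) (g : Word b c) (h : Word c d) (e : 0 + 0 = (0 : ℤ)) :
      Rel r ((assoc f g h).comp (assocInv f g h) e) (ident _)
  | assoc_inv_hom {a b c d : ℤ} (f : Word a b) (g : Word b c) (h : Word c d) (e : 0 + 0 = (0 : ℤ)) :
      Rel r ((assocInv f g h).comp (assoc f g h) e) (ident _)
  | leftUnit_hom_inv {a b : ℤ} (f : Word a b) (e : 0 + 0 = (0 : ℤ)) :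
      Rel r ((leftUnit f).comp (leftUnitInv f) e) (ident _)
  | leftUnit_inv_hom {a b : ℤ} (f : Word a b) (e : 0 + 0 = (0 : ℤ)) :
      Rel r ((leftUnitInv f).comp (leftUnit f) e) (ident _)
  | rightUnit_hom_inv {a b : ℤ} (f : Word a b) (e : 0 + 0 = (0 : ℤ)) :
      Rel r ((rightUnit f).comp (rightUnitInv f) e) (ident _)
  | rightUnit_inv_hom {a b : ℤ} (f : Word a b) (e : 0 + 0 = (0 : ℤ)) :
      Rel r ((rightUnitInv f).comp (rightUnit f) e) (ident _)
  | assoc_natural_left {a b c d p : ℤ} {f f' : Word a b} (x : Diagram k f f' p) (g : Word b c)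
      (h : Word c d) (e : p + 0 = p) (e' : 0 + p = p) :
      Rel r ((whiskerRight (whiskerRight x g) h).comp (assoc f' g h) e)
        ((assoc f g h).comp (whiskerRight x (g ⬝ h)) e')
  | assoc_natural_middle {a b c d p : ℤ} (f : Word a b) {g g' : Word b c} (x : Diagram k g g' p)
      (h : Word c d) (e : p + 0 = p) (e' : 0 + p = p) :
      Rel r ((whiskerRight (whiskerLeft f x) h).comp (assoc f g' h) e)
        ((assoc f g h).comp (whiskerLeft f (whiskerRight x h)) e')
  | assoc_natural_right {a b c d p : ℤ} (f : Word a b) (g : Word b c) {h h' : Word c d}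
      (x : Diagram k h h' p) (e : p + 0 = p) (e' : 0 + p = p) :
      Rel r ((whiskerLeft (f ⬝ g) x).comp (assoc f g h') e)
        ((assoc f g h).comp (whiskerLeft f (whiskerLeft g x)) e')
  | leftUnit_natural {a b p : ℤ} {f f' : Word a b} (x : Diagram k f f' p) (e : p + 0 = p)
      (e' : 0 + p = p) :
      Rel r ((whiskerLeft (Word.one a) x).comp (leftUnit f') e) ((leftUnit f).comp x e')
  | rightUnit_natural {a b p : ℤ} {f f' : Word a b} (x : Diagram k f f' p) (e : p + 0 = p)
      (e' : 0 + p = p) :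
      Rel r ((whiskerRight x (Word.one b)).comp (rightUnit f') e) ((rightUnit f).comp x e')
  | pentagon {a b c d e' : ℤ} (f : Word a b) (g : Word b c) (h : Word c d) (i : Word d e')
      (e : 0 + 0 = (0 : ℤ)) :
      Rel r ((whiskerRight (assoc f g h) i).comp
          ((assoc f (g ⬝ h) i).comp (whiskerLeft f (assoc g h i)) e) e)
        ((assoc (f ⬝ g) h i).comp (assoc f g (h ⬝ i)) e)
  | triangle {a b c : ℤ} (f : Word a b) (g : Word b c) (e : 0 + 0 = (0 : ℤ)) :
      Rel r ((assoc f (Word.one b) g).comp (whiskerLeft f (leftUnit g)) e)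
        (whiskerRight (rightUnit f) g)
  -- shifts and direct sums
  | toShift_unshift {a b : ℤ} (f : Word a b) (l : ℤ) (e : -l + l = 0) :
      Rel r ((toShift f l).comp (unshift f l) e) (ident f)
  | unshift_toShift {a b : ℤ} (f : Word a b) (l : ℤ) (e : l + -l = 0) :
      Rel r ((unshift f l).comp (toShift f l) e) (ident (f.shift l))
  | ident_zero (a b : ℤ) :
      Rel r (ident (Word.zero a b)) (Diagram.zero _ _ 0)
  | inl_fst {a b : ℤ} (f g : Word a b) (e : 0 + 0 = (0 : ℤ)) :
      Rel r ((inl f g).comp (fst f g) e) (ident f)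
  | inr_snd {a b : ℤ} (f g : Word a b) (e : 0 + 0 = (0 : ℤ)) :
      Rel r ((inr f g).comp (snd f g) e) (ident g)
  | inl_snd {a b : ℤ} (f g : Word a b) (e : 0 + 0 = (0 : ℤ)) :
      Rel r ((inl f g).comp (snd f g) e) (Diagram.zero f g 0)
  | inr_fst {a b : ℤ} (f g : Word a b) (e : 0 + 0 = (0 : ℤ)) :
      Rel r ((inr f g).comp (fst f g) e) (Diagram.zero g f 0)
  | total {a b : ℤ} (f g : Word a b) (e : 0 + 0 = (0 : ℤ)) :
      Rel r (((fst f g).comp (inl f g) e).add ((snd f g).comp (inr f g) e)) (ident (f.sum g))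
  -- `E` and `F` are biadjoint
  | biadjoint_E_right (m n : ℤ) (h : m + 2 = n) :
      Rel r ((leftUnitInv _ ⨾ whiskerRight (cupFE m n h) _ ⨾ assoc _ _ _ ⨾
        whiskerLeft _ (capEF m n h) ⨾ rightUnit _).cast (by omega)) (ident (Word.E m n h))
  | biadjoint_F_left (m n : ℤ) (h : m + 2 = n) :
      Rel r ((rightUnitInv _ ⨾ whiskerLeft _ (cupFE m n h) ⨾ assocInv _ _ _ ⨾
        whiskerRight (capEF m n h) _ ⨾ leftUnit _).cast (by omega)) (ident (Word.F n m h))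
  | biadjoint_E_left (m n : ℤ) (h : m + 2 = n) :
      Rel r ((rightUnitInv _ ⨾ whiskerLeft _ (cupEF m n h) ⨾ assocInv _ _ _ ⨾
        whiskerRight (capFE m n h) _ ⨾ leftUnit _).cast (by omega)) (ident (Word.E m n h))
  | biadjoint_F_right (m n : ℤ) (h : m + 2 = n) :
      Rel r ((leftUnitInv _ ⨾ whiskerRight (cupEF m n h) _ ⨾ assoc _ _ _ ⨾
        whiskerLeft _ (capFE m n h) ⨾ rightUnit _).cast (by omega)) (ident (Word.F n m h))
  -- dots and crossings are cyclic
  | dotF_eq_mateR (m n : ℤ) (h : m + 2 = n) :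
      Rel r (dotF n m h) ((mateR (cupFE m n h) (capEF m n h) (dotE m n h)).cast (by omega))
  | dotF_eq_mateL (m n : ℤ) (h : m + 2 = n) :
      Rel r (dotF n m h) ((mateL (cupEF m n h) (capFE m n h) (dotE m n h)).cast (by omega))
  | crossF_eq_mateR (a b c : ℤ) (h : a + 2 = b) (h' : b + 2 = c) :
      Rel r (crossF c b a h' h)
        ((mateR (nestCup (cupFE a b h) (cupFE b c h')) (nestCap (capEF b c h') (capEF a b h))
          (crossE a b c h h')).cast (by omega))
  | crossF_eq_mateL (a b c : ℤ) (h : a + 2 = b) (h' : b + 2 = c) :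
      Rel r (crossF c b a h' h)
        ((mateL (nestCup (cupEF b c h') (cupEF a b h)) (nestCap (capFE a b h) (capFE b c h'))
          (crossE a b c h h')).cast (by omega))
  -- the nilHecke relations: parameter `r` for upward, `-r` for downward strands
  | crossE_sq (a b c : ℤ) (h : a + 2 = b) (h' : b + 2 = c) :
      Rel r (crossE a b c h h' ⨾ crossE a b c h h') (Diagram.zero _ _ _)
  | dotE_slide (a b c : ℤ) (h : a + 2 = b) (h' : b + 2 = c) :
      Rel r (((whiskerLeft _ (dotE b c h') ⨾ crossE a b c h h').add
          ((crossE a b c h h' ⨾ whiskerRight (dotE a b h) _).smul (-1))).cast (by omega))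
        ((ident (Word.E a b h ⬝ Word.E b c h')).smul (r : k))
  | dotE_slide' (a b c : ℤ) (h : a + 2 = b) (h' : b + 2 = c) :
      Rel r (((crossE a b c h h' ⨾ whiskerLeft _ (dotE b c h')).add
          ((whiskerRight (dotE a b h) _ ⨾ crossE a b c h h').smul (-1))).cast (by omega))
        ((ident (Word.E a b h ⬝ Word.E b c h')).smul (r : k))
  | crossE_braid (a b c d : ℤ) (h : a + 2 = b) (h' : b + 2 = c) (h'' : c + 2 = d) :
      Rel r (whiskerRight (crossE a b c h h') (Word.E c d h'') ⨾
          whiskerMid (Word.E a b h) (crossE b c d h' h'') ⨾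
          whiskerRight (crossE a b c h h') (Word.E c d h''))
        ((whiskerMid (Word.E a b h) (crossE b c d h' h'') ⨾
          whiskerRight (crossE a b c h h') (Word.E c d h'') ⨾
          whiskerMid (Word.E a b h) (crossE b c d h' h'')).cast (by omega))
  | crossF_sq (a b c : ℤ) (h : a + 2 = b) (h' : b + 2 = c) :
      Rel r (crossF c b a h' h ⨾ crossF c b a h' h) (Diagram.zero _ _ _)
  | dotF_slide (a b c : ℤ) (h : a + 2 = b) (h' : b + 2 = c) :
      Rel r (((whiskerLeft (Word.F c b h') (dotF b a h) ⨾ crossF c b a h' h).add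
          ((crossF c b a h' h ⨾ whiskerRight (dotF c b h') (Word.F b a h)).smul (-1))).cast
          (by omega))
        ((ident (Word.F c b h' ⬝ Word.F b a h)).smul (-r : k))
  | dotF_slide' (a b c : ℤ) (h : a + 2 = b) (h' : b + 2 = c) :
      Rel r (((crossF c b a h' h ⨾ whiskerLeft (Word.F c b h') (dotF b a h)).add
          ((whiskerRight (dotF c b h') (Word.F b a h) ⨾ crossF c b a h' h).smul (-1))).cast
          (by omega))
        ((ident (Word.F c b h' ⬝ Word.F b a h)).smul (-r : k))
  | crossF_braid (a b c d : ℤ) (h : a + 2 = b) (h' : b + 2 = c) (h'' : c + 2 = d) :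
      Rel r (whiskerRight (crossF d c b h'' h') (Word.F b a h) ⨾
          whiskerMid (Word.F d c h'') (crossF c b a h' h) ⨾
          whiskerRight (crossF d c b h'' h') (Word.F b a h))
        ((whiskerMid (Word.F d c h'') (crossF c b a h' h) ⨾
          whiskerRight (crossF d c b h'' h') (Word.F b a h) ⨾
          whiskerMid (Word.F d c h'') (crossF c b a h' h)).cast (by omega))
  -- dotted bubbles
  | cw_eq_zero (n : ℤ) (m : ℕ) (hm : (m : ℤ) < n - 1) : Rel r (cw n m) (Diagram.zero _ _ _)
  | ccw_eq_zero (n : ℤ) (m : ℕ) (hm : (m : ℤ) < -n - 1) : Rel r (ccw n m) (Diagram.zero _ _ _)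
  | cw_eq_ident (n : ℤ) (m : ℕ) (hm : (m : ℤ) = n - 1) :
      Rel r ((cw n m).cast (by omega)) (ident (Word.one n))
  | ccw_eq_ident (n : ℤ) (m : ℕ) (hm : (m : ℤ) = -n - 1) :
      Rel r ((ccw n m).cast (by omega)) (ident (Word.one n))
  -- extended relations: curls
  | curlRight_pos (l n p : ℤ) (h : l + 2 = n) (h' : n + 2 = p) (hn : 0 < n) :
      Rel r (curlRight l n p h h') (Diagram.zero _ _ _)
  | curlLeft_neg (l n p : ℤ) (h : l + 2 = n) (h' : n + 2 = p) (hn : n < 0) :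
      Rel r (curlLeft l n p h h') (Diagram.zero _ _ _)
  | curlLeft_nonneg (N : ℕ) (l p : ℤ) (h : l + 2 = N) (h' : (N : ℤ) + 2 = p) :
      Rel r (curlLeft l N p h h')
        ((sumLt (N + 1) fun i hi =>
          (dots l N h i ⨾ rightUnitInv _ ⨾ whiskerLeft _ (fakeCCW N (N - i)) ⨾
            rightUnit _).cast (by omega)).smul (r : k))
  | curlRight_nonpos (N : ℕ) (l p : ℤ) (h : l + 2 = -N) (h' : (-N : ℤ) + 2 = p) :
      Rel r (curlRight l (-N) p h h')
        ((sumLt (N + 1) fun i hi =>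
          (dots (-N) p h' i ⨾ leftUnitInv _ ⨾ whiskerRight (fakeCW N (N - i)) _ ⨾
            leftUnit _).cast (by omega)).smul (-r : k))
  -- extended relations: decomposition of `EF 1_n` and of `FE 1_n`
  | ident_EF_nonpos (l n p : ℤ) (h : l + 2 = n) (h' : n + 2 = p) (hn : n ≤ 0) :
      Rel r (ident (Word.F n l h ⬝ Word.E l n h))
        ((crossEF l n p h h' ⨾ crossFE l n p h h').smul (-((r⁻¹ : kˣ) : k) ^ 2))
  | ident_FE_nonneg (l n p : ℤ) (h : l + 2 = n) (h' : n + 2 = p) (hn : 0 ≤ n) :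
      Rel r (ident (Word.E n p h' ⬝ Word.F p n h'))
        ((crossFE l n p h h' ⨾ crossEF l n p h h').smul (-((r⁻¹ : kˣ) : k) ^ 2))
  | ident_EF_nonneg (N : ℕ) (l p : ℤ) (h : l + 2 = N) (h' : (N : ℤ) + 2 = p) :
      Rel r (ident (Word.F N l h ⬝ Word.E l N h))
        (((crossEF l N p h h' ⨾ crossFE l N p h h').smul (-((r⁻¹ : kˣ) : k) ^ 2)).add
          (sumLt N fun i hi => sumLt (N - i) fun j hj =>
            (whiskerLeft _ (dots l N h (N - 1 - i - j)) ⨾ capEF l N h ⨾ fakeCCW N j ⨾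
              cupEF l N h ⨾ whiskerLeft _ (dots l N h i)).cast (by omega)))
  | ident_FE_nonpos (N : ℕ) (l p : ℤ) (h : l + 2 = -N) (h' : (-N : ℤ) + 2 = p) :
      Rel r (ident (Word.E (-N) p h' ⬝ Word.F p (-N) h'))
        (((crossFE l (-N) p h h' ⨾ crossEF l (-N) p h h').smul (-((r⁻¹ : kˣ) : k) ^ 2)).add
          (sumLt N fun i hi => sumLt (N - i) fun j hj =>
            (whiskerRight (dots (-N) p h' (N - 1 - i - j)) _ ⨾ capFE (-N) p h' ⨾ fakeCW N j ⨾
              cupFE (-N) p h' ⨾ whiskerRight (dots (-N) p h' i) _).cast (by omega)))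

end SL2

namespace SL2

/-! ### The quotient, and its 2-category structure -/

/-- The 2-morphisms `f ⟶ g` of degree `p`: diagrams modulo the defining relations. -/
def Hom2 {k : Type t} [Field k] (r : kˣ) {a b : ℤ} (f g : Word a b) (p : ℤ) : Type t :=
  Quot (Rel r : Diagram k f g p → Diagram k f g p → Prop)

namespace Hom2

variable {k : Type t} [Field k] {r : kˣ} {a b c d : ℤ}

/-- The class of a diagram. -/
def mk (r : kˣ) {f g : Word a b} {p : ℤ} (x : Diagram k f g p) : Hom2 r f g p := Quot.mk _ x

/-- Vertical composition. -/
def comp {f g h : Word a b} {p q s : ℤ} (x : Hom2 r f g p) (y : Hom2 r g h q)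
    (e : p + q = s) : Hom2 r f h s :=
  Quot.map₂ (fun x y => x.comp y e) (fun x _ _ hy => Rel.comp_congr e (Rel.refl x) hy)
    (fun _ _ y hx => Rel.comp_congr e hx (Rel.refl y)) x y

def whiskerLeft (f : Word a b) {g h : Word b c} {p : ℤ} (x : Hom2 r g h p) :
    Hom2 r (f.comp g) (f.comp h) p :=
  Quot.map (Diagram.whiskerLeft f) (fun _ _ hx => Rel.whiskerLeft_congr f hx) x

def whiskerRight {f g : Word a b} {p : ℤ} (x : Hom2 r f g p) (h : Word b c) :
    Hom2 r (f.comp h) (g.comp h) p :=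
  Quot.map (fun x => Diagram.whiskerRight x h) (fun _ _ hx => Rel.whiskerRight_congr h hx) x

instance {f g : Word a b} {p : ℤ} : Add (Hom2 r f g p) where
  add := Quot.map₂ Diagram.add (fun x _ _ hy => Rel.add_congr (Rel.refl x) hy)
    (fun _ _ y hx => Rel.add_congr hx (Rel.refl y))

instance {f g : Word a b} {p : ℤ} : Zero (Hom2 r f g p) where
  zero := mk r (Diagram.zero f g p)

instance {f g : Word a b} {p : ℤ} : Neg (Hom2 r f g p) where
  neg := Quot.map (Diagram.smul (-1)) (fun _ _ hx => Rel.smul_congr _ hx)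

instance {f g : Word a b} {p : ℤ} : AddCommGroup (Hom2 r f g p) where
  nsmul := nsmulRec
  zsmul := zsmulRec
  add_assoc := by rintro ⟨x⟩ ⟨y⟩ ⟨z⟩; exact Quot.sound (Rel.add_assoc x y z)
  zero_add := by rintro ⟨x⟩; exact Quot.sound (Rel.zero_add x)
  add_zero := by
    rintro ⟨x⟩
    exact Quot.sound ((Rel.add_comm _ _).trans (Rel.zero_add x))
  neg_add_cancel := by rintro ⟨x⟩; exact Quot.sound (Rel.neg_add x)
  add_comm := by rintro ⟨x⟩ ⟨y⟩; exact Quot.sound (Rel.add_comm x y)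

theorem mk_add {f g : Word a b} {p : ℤ} (x y : Diagram k f g p) :
    mk r (x.add y) = mk r x + mk r y := rfl

theorem mk_zero {f g : Word a b} {p : ℤ} : mk r (Diagram.zero f g p) = 0 := rfl

instance {f g : Word a b} {p : ℤ} : SMul k (Hom2 r f g p) where
  smul c := Quot.map (Diagram.smul c) (fun _ _ hx => Rel.smul_congr c hx)

instance {f g : Word a b} {p : ℤ} : Module k (Hom2 r f g p) :=
  have add_smul : ∀ (c d : k) (x : Hom2 r f g p), (c + d) • x = c • x + d • x := by
    rintro c d ⟨x⟩; exact Quot.sound (Rel.add_smul c d x)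
  have smul_add : ∀ (c : k) (x y : Hom2 r f g p), c • (x + y) = c • x + c • y := by
    rintro c ⟨x⟩ ⟨y⟩; exact Quot.sound (Rel.smul_add c x y)
  { one_smul := by rintro ⟨x⟩; exact Quot.sound (Rel.one_smul x)
    mul_smul := by rintro c d ⟨x⟩; exact Quot.sound (Rel.mul_smul c d x)
    smul_add := smul_add
    add_smul := add_smul
    smul_zero := fun c => by simpa using smul_add c 0 0
    zero_smul := fun x => by simpa using add_smul 0 0 x }

theorem add_comp {f g h : Word a b} {p q s : ℤ} (x y : Hom2 r f g p) (z : Hom2 r g h q)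
    (e : p + q = s) : comp (x + y) z e = comp x z e + comp y z e := by
  revert x y z; rintro ⟨x⟩ ⟨y⟩ ⟨z⟩; exact Quot.sound (Rel.add_comp x y z e)

theorem comp_add {f g h : Word a b} {p q s : ℤ} (x : Hom2 r f g p) (y z : Hom2 r g h q)
    (e : p + q = s) : comp x (y + z) e = comp x y e + comp x z e := by
  revert x y z; rintro ⟨x⟩ ⟨y⟩ ⟨z⟩; exact Quot.sound (Rel.comp_add x y z e)

theorem smul_comp {f g h : Word a b} {p q s : ℤ} (c : k) (x : Hom2 r f g p) (y : Hom2 r g h q)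
    (e : p + q = s) : comp (c • x) y e = c • comp x y e := by
  revert x y; rintro ⟨x⟩ ⟨y⟩; exact Quot.sound (Rel.smul_comp c x y e)

theorem comp_smul {f g h : Word a b} {p q s : ℤ} (c : k) (x : Hom2 r f g p) (y : Hom2 r g h q)
    (e : p + q = s) : comp x (c • y) e = c • comp x y e := by
  revert x y; rintro ⟨x⟩ ⟨y⟩; exact Quot.sound (Rel.comp_smul c x y e)

theorem whiskerLeft_add (f : Word a b) {g h : Word b c} {p : ℤ} (x y : Hom2 r g h p) :
    whiskerLeft f (x + y) = whiskerLeft f x + whiskerLeft f y := by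
  revert x y; rintro ⟨x⟩ ⟨y⟩; exact Quot.sound (Rel.whiskerLeft_add f x y)

theorem whiskerLeft_smul (f : Word a b) {g h : Word b c} {p : ℤ} (z : k) (x : Hom2 r g h p) :
    whiskerLeft f (z • x) = z • whiskerLeft f x := by
  revert x; rintro ⟨x⟩; exact Quot.sound (Rel.whiskerLeft_smul f z x)

theorem whiskerRight_add {f g : Word a b} {p : ℤ} (x y : Hom2 r f g p) (h : Word b c) :
    whiskerRight (x + y) h = whiskerRight x h + whiskerRight y h := by
  revert x y; rintro ⟨x⟩ ⟨y⟩; exact Quot.sound (Rel.whiskerRight_add x y h)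

theorem whiskerRight_smul {f g : Word a b} {p : ℤ} (z : k) (x : Hom2 r f g p) (h : Word b c) :
    whiskerRight (z • x) h = z • whiskerRight x h := by
  revert x; rintro ⟨x⟩; exact Quot.sound (Rel.whiskerRight_smul z x h)

end Hom2

/-- Auxiliary 2-category with the same objects and 1-morphisms as `UQ r`, whose 2-morphisms are
the homogeneous 2-morphisms of all degrees. -/
structure Graded {k : Type t} [Field k] (r : kˣ) : Type where
  wt : ℤ

namespace Graded

variable {k : Type t} [Field k] {r : kˣ}

theorem mk_comp {a b : ℤ} {f g h : Word a b} {p q s : ℤ} (x : Hom2 r f g p)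
    (y : Hom2 r g h q) (e : p + q = s) :
    (⟨p + q, x.comp y rfl⟩ : Σ p : ℤ, Hom2 r f h p) = ⟨s, x.comp y e⟩ := by
  subst e; rfl

@[reducible] def catHom (r : kˣ) (a b : ℤ) : Category.{t} (Word a b) where
  Hom f g := Σ p : ℤ, Hom2 r f g p
  id f := ⟨0, Hom2.mk r (Diagram.ident f)⟩
  comp x y := ⟨x.1 + y.1, x.2.comp y.2 rfl⟩
  id_comp := by
    rintro f g ⟨p, ⟨x⟩⟩
    exact (mk_comp _ _ (zero_add p)).trans
      (congrArg (Sigma.mk p) (Quot.sound (Rel.id_comp x _)))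
  comp_id := by
    rintro f g ⟨p, ⟨x⟩⟩
    exact (mk_comp _ _ (add_zero p)).trans
      (congrArg (Sigma.mk p) (Quot.sound (Rel.comp_id x _)))
  assoc := by
    rintro f g h i ⟨p, ⟨x⟩⟩ ⟨q, ⟨y⟩⟩ ⟨s, ⟨z⟩⟩
    exact (mk_comp _ _ (add_assoc p q s)).trans
      (congrArg (Sigma.mk _) (Quot.sound (Rel.comp_assoc x y z _ _ _ _)))

theorem eq_conj {C : Type*} [Category* C] {f g h i : C} {x : f ⟶ g} {e : g ≅ h} {j : f ≅ i}
    {y : i ⟶ h} (H : x ≫ e.hom = j.hom ≫ y) : x = j.hom ≫ y ≫ e.inv := by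
  rw [← Category.assoc, ← H]; simp

theorem eq_conj' {C : Type*} [Category* C] {f g h i : C} {x : f ⟶ g} {e : h ≅ g} {j : i ≅ f}
    {y : i ⟶ h} (H : y ≫ e.hom = j.hom ≫ x) : x = j.inv ≫ y ≫ e.hom := by
  rw [H]; simp

theorem ext' {a b : ℤ} {f g : Word a b} {p : ℤ} {x y : Diagram k f g p} (h : Rel r x y) :
    (⟨p, Hom2.mk r x⟩ : Σ p : ℤ, Hom2 r f g p) = ⟨p, Hom2.mk r y⟩ :=
  congrArg (Sigma.mk p) (Quot.sound h)

theorem ext'' {a b : ℤ} {f g h i : Word a b} {p q p' q' s : ℤ} {x : Diagram k f g p}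
    {y : Diagram k g i q} {x' : Diagram k f h p'} {y' : Diagram k h i q'} (e : p + q = s)
    (e' : p' + q' = s)
    (h : Rel r (x.comp y e) (x'.comp y' e')) :
    (⟨p + q, (Hom2.mk r x).comp (Hom2.mk r y) rfl⟩ : Σ p : ℤ, Hom2 r f i p) =
      ⟨p' + q', (Hom2.mk r x').comp (Hom2.mk r y') rfl⟩ :=
  (mk_comp _ _ e).trans ((congrArg (Sigma.mk s) (Quot.sound h)).trans (mk_comp _ _ e').symm)

theorem ext₁ {a b : ℤ} {f g h : Word a b} {p q s : ℤ} {x : Diagram k f g p}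
    {y : Diagram k g h q} {z : Diagram k f h s} (e : p + q = s)
    (H : Rel r (x.comp y e) z) :
    (⟨p + q, (Hom2.mk r x).comp (Hom2.mk r y) rfl⟩ : Σ p : ℤ, Hom2 r f h p) =
      ⟨s, Hom2.mk r z⟩ :=
  (mk_comp _ _ e).trans (congrArg (Sigma.mk s) (Quot.sound H))

/-- An invertible 2-morphism, possibly of non-zero degree. -/
def isoMk {a b : ℤ} {f g : Word a b} {p q : ℤ} (x : Diagram k f g p) (y : Diagram k g f q)
    (e : p + q = 0) (e' : q + p = 0) (h : Rel r (x.comp y e) (Diagram.ident f))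
    (h' : Rel r (y.comp x e') (Diagram.ident g)) :
    @Iso _ (catHom r a b) f g :=
  @Iso.mk _ (catHom r a b) f g ⟨p, Hom2.mk r x⟩ ⟨q, Hom2.mk r y⟩ (ext₁ e h) (ext₁ e' h')

instance : Bicategory.{t, 0} (Graded r) where
  Hom x y := Word x.wt y.wt
  id x := Word.one x.wt
  comp f g := f.comp g
  homCategory x y := catHom r x.wt y.wt
  whiskerLeft f _ _ x := ⟨x.1, x.2.whiskerLeft f⟩
  whiskerRight x h := ⟨x.1, x.2.whiskerRight h⟩
  associator f g h := isoMk (Diagram.assoc f g h) (Diagram.assocInv f g h) rfl rfl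
    (Rel.assoc_hom_inv f g h rfl) (Rel.assoc_inv_hom f g h rfl)
  leftUnitor f := isoMk (Diagram.leftUnit f) (Diagram.leftUnitInv f) rfl rfl
    (Rel.leftUnit_hom_inv f rfl) (Rel.leftUnit_inv_hom f rfl)
  rightUnitor f := isoMk (Diagram.rightUnit f) (Diagram.rightUnitInv f) rfl rfl
    (Rel.rightUnit_hom_inv f rfl) (Rel.rightUnit_inv_hom f rfl)
  whiskerLeft_id f g := ext' (Rel.whiskerLeft_id f g)
  whiskerLeft_comp := by
    rintro _ _ _ f g h i ⟨p, ⟨x⟩⟩ ⟨q, ⟨y⟩⟩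
    exact ext' (Rel.whiskerLeft_comp f x y _)
  id_whiskerLeft := by
    rintro _ _ f g ⟨p, ⟨x⟩⟩
    refine @eq_conj _ (catHom r _ _) _ _ _ _ _ _ _ _ ?_
    exact ext'' (add_zero _) (zero_add _) (Rel.leftUnit_natural x _ _)
  comp_whiskerLeft := by
    rintro _ _ _ _ f g h h' ⟨p, ⟨x⟩⟩
    refine @eq_conj _ (catHom r _ _) _ _ _ _ _ _ _ _ ?_
    exact ext'' (add_zero _) (zero_add _) (Rel.assoc_natural_right f g x _ _)
  id_whiskerRight f g := ext' (Rel.id_whiskerRight f g)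
  comp_whiskerRight := by
    rintro _ _ _ f g h ⟨p, ⟨x⟩⟩ ⟨q, ⟨y⟩⟩ i
    exact ext' (Rel.comp_whiskerRight x y _ i)
  whiskerRight_id := by
    rintro _ _ f g ⟨p, ⟨x⟩⟩
    refine @eq_conj _ (catHom r _ _) _ _ _ _ _ _ _ _ ?_
    exact ext'' (add_zero _) (zero_add _) (Rel.rightUnit_natural x _ _)
  whiskerRight_comp := by
    rintro _ _ _ _ f f' ⟨p, ⟨x⟩⟩ g h
    refine @eq_conj' _ (catHom r _ _) _ _ _ _ _ _ _ _ ?_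
    exact ext'' (add_zero _) (zero_add _) (Rel.assoc_natural_left x g h _ _)
  whisker_assoc := by
    rintro _ _ _ _ f g g' ⟨p, ⟨x⟩⟩ h
    refine @eq_conj _ (catHom r _ _) _ _ _ _ _ _ _ _ ?_
    exact ext'' (add_zero _) (zero_add _) (Rel.assoc_natural_middle f x h _ _)
  whisker_exchange := by
    rintro _ _ _ f g h i ⟨p, ⟨x⟩⟩ ⟨q, ⟨y⟩⟩
    exact ext'' (add_comm _ _) rfl (Rel.whisker_exchange x y _ _)
  pentagon f g h i := by
    exact ext'' rfl rfl (Rel.pentagon f g h i rfl)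
  triangle f g := by
    exact ext₁ rfl (Rel.triangle f g rfl)

end Graded

/-- The 2-category `U_Q(sl₂)` with parameter `r`: the objects are the weights, the 1-morphisms are
the words, and the 2-morphisms are the linear combinations of diagrams of degree zero modulo the
defining relations; a diagram `f ⟶ g` of degree `p` is the 2-morphism `f ⟶ g⟦p⟧`. -/
structure UQ {k : Type t} [Field k] (r : kˣ) : Type where
  wt : ℤ

namespace UQ

variable {k : Type t} [Field k] {r : kˣ}

/-- The category of words `a ⟶ b`. -/
@[reducible] def catHom (r : kˣ) (a b : ℤ) : Category.{t} (Word a b) where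
  Hom f g := Hom2 r f g 0
  id f := Hom2.mk r (Diagram.ident f)
  comp x y := x.comp y (add_zero 0)
  id_comp := by
    rintro f g ⟨x⟩
    exact Quot.sound (Rel.id_comp x _)
  comp_id := by
    rintro f g ⟨x⟩
    exact Quot.sound (Rel.comp_id x _)
  assoc := by
    rintro f g h i ⟨x⟩ ⟨y⟩ ⟨z⟩
    exact Quot.sound (Rel.comp_assoc x y z _ _ _ _)

def isoMk {a b : ℤ} {f g : Word a b} (x : Diagram k f g 0) (y : Diagram k g f 0)
    (h : Rel r (x.comp y (add_zero 0)) (Diagram.ident f))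
    (h' : Rel r (y.comp x (add_zero 0)) (Diagram.ident g)) :
    @Iso _ (catHom r a b) f g :=
  @Iso.mk _ (catHom r a b) f g (Hom2.mk r x) (Hom2.mk r y) (Quot.sound h) (Quot.sound h')

instance : Bicategory.{t, 0} (UQ r) where
  Hom x y := Word x.wt y.wt
  id x := Word.one x.wt
  comp f g := f.comp g
  homCategory x y := catHom r x.wt y.wt
  whiskerLeft f _ _ x := x.whiskerLeft f
  whiskerRight x h := x.whiskerRight h
  associator f g h := isoMk (Diagram.assoc f g h) (Diagram.assocInv f g h)
    (Rel.assoc_hom_inv f g h _) (Rel.assoc_inv_hom f g h _)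
  leftUnitor f := isoMk (Diagram.leftUnit f) (Diagram.leftUnitInv f)
    (Rel.leftUnit_hom_inv f _) (Rel.leftUnit_inv_hom f _)
  rightUnitor f := isoMk (Diagram.rightUnit f) (Diagram.rightUnitInv f)
    (Rel.rightUnit_hom_inv f _) (Rel.rightUnit_inv_hom f _)
  whiskerLeft_id f g := Quot.sound (Rel.whiskerLeft_id f g)
  whiskerLeft_comp := by
    rintro _ _ _ f g h i ⟨x⟩ ⟨y⟩
    exact Quot.sound (Rel.whiskerLeft_comp f x y _)
  id_whiskerLeft := by
    rintro _ _ f g ⟨x⟩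
    refine @Graded.eq_conj _ (catHom r _ _) _ _ _ _ _ _ _ _ ?_
    exact Quot.sound (Rel.leftUnit_natural x _ _)
  comp_whiskerLeft := by
    rintro _ _ _ _ f g h h' ⟨x⟩
    refine @Graded.eq_conj _ (catHom r _ _) _ _ _ _ _ _ _ _ ?_
    exact Quot.sound (Rel.assoc_natural_right f g x _ _)
  id_whiskerRight f g := Quot.sound (Rel.id_whiskerRight f g)
  comp_whiskerRight := by
    rintro _ _ _ f g h ⟨x⟩ ⟨y⟩ i
    exact Quot.sound (Rel.comp_whiskerRight x y _ i)
  whiskerRight_id := by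
    rintro _ _ f g ⟨x⟩
    refine @Graded.eq_conj _ (catHom r _ _) _ _ _ _ _ _ _ _ ?_
    exact Quot.sound (Rel.rightUnit_natural x _ _)
  whiskerRight_comp := by
    rintro _ _ _ _ f f' ⟨x⟩ g h
    refine @Graded.eq_conj' _ (catHom r _ _) _ _ _ _ _ _ _ _ ?_
    exact Quot.sound (Rel.assoc_natural_left x g h _ _)
  whisker_assoc := by
    rintro _ _ _ _ f g g' ⟨x⟩ h
    refine @Graded.eq_conj _ (catHom r _ _) _ _ _ _ _ _ _ _ ?_
    exact Quot.sound (Rel.assoc_natural_middle f x h _ _)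
  whisker_exchange := by
    rintro _ _ _ f g h i ⟨x⟩ ⟨y⟩
    exact Quot.sound (Rel.whisker_exchange x y _ _)
  pentagon f g h i := Quot.sound (Rel.pentagon f g h i _)
  triangle f g := Quot.sound (Rel.triangle f g _)

/-- The object of `Graded r` of the same weight. -/
abbrev tot (x : UQ r) : Graded r := ⟨x.wt⟩

/-- A 1-morphism, regarded as a 1-morphism of `Graded r`. -/
abbrev tot₁ {x y : UQ r} (f : x ⟶ y) : tot x ⟶ tot y := f

/-- A 2-morphism, regarded as a 2-morphism of `Graded r`. -/
def tot₂ {x y : UQ r} {f g : x ⟶ y} (η : f ⟶ g) : tot₁ f ⟶ tot₁ g := ⟨0, η⟩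

theorem tot₂_injective {x y : UQ r} {f g : x ⟶ y} {η θ : f ⟶ g} (h : tot₂ η = tot₂ θ) :
    η = θ := eq_of_heq (Sigma.mk.inj h).2

theorem tot₁_comp {x y z : UQ r} (f : x ⟶ y) (g : y ⟶ z) :
    tot₁ (f ≫ g) = tot₁ f ≫ tot₁ g := rfl

theorem tot₁_id (x : UQ r) : tot₁ (𝟙 x) = 𝟙 (tot x) := rfl

@[simp] theorem tot₂_id {x y : UQ r} (f : x ⟶ y) : tot₂ (𝟙 f) = 𝟙 (tot₁ f) := rfl

@[simp] theorem tot₂_comp {x y : UQ r} {f g h : x ⟶ y} (η : f ⟶ g) (θ : g ⟶ h) :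
    tot₂ (η ≫ θ) = tot₂ η ≫ tot₂ θ := (Graded.mk_comp _ _ _).symm

@[simp] theorem tot₂_whiskerLeft {x y z : UQ r} (f : x ⟶ y) {g h : y ⟶ z} (η : g ⟶ h) :
    tot₂ (f ◁ η) = tot₁ f ◁ tot₂ η := rfl

@[simp] theorem tot₂_whiskerRight {x y z : UQ r} {f g : x ⟶ y} (η : f ⟶ g) (h : y ⟶ z) :
    tot₂ (η ▷ h) = tot₂ η ▷ tot₁ h := rfl

@[simp] theorem tot₂_associator {w x y z : UQ r} (f : w ⟶ x) (g : x ⟶ y) (h : y ⟶ z) :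
    tot₂ (α_ f g h).hom = (α_ (tot₁ f) (tot₁ g) (tot₁ h)).hom := rfl

@[simp] theorem tot₂_leftUnitor {x y : UQ r} (f : x ⟶ y) :
    tot₂ (λ_ f).hom = (λ_ (tot₁ f)).hom := rfl

@[simp] theorem tot₂_rightUnitor {x y : UQ r} (f : x ⟶ y) :
    tot₂ (ρ_ f).hom = (ρ_ (tot₁ f)).hom := rfl

/-- The 1-morphism `f⟨l⟩`. -/
def sh {x y : UQ r} (f : x ⟶ y) (l : ℤ) : x ⟶ y := Word.shift f l

/-- The isomorphism of degree `l` from `f⟨l⟩` to `f`. -/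
def unsh {x y : UQ r} (f : x ⟶ y) (l : ℤ) : tot₁ (sh f l) ≅ tot₁ f :=
  Graded.isoMk (Diagram.unshift f l) (Diagram.toShift f l) (by omega) (by omega)
    (Rel.unshift_toShift f l _) (Rel.toShift_unshift f l _)

/-- A homogeneous 2-morphism of degree zero, as a 2-morphism of `UQ r`. -/
def ofTot {x y : UQ r} {f g : x ⟶ y} (η : tot₁ f ⟶ tot₁ g) (h : η.1 = 0) : f ⟶ g :=
  (h ▸ η.2 : Hom2 r f g 0)

@[simp] theorem tot₂_ofTot {x y : UQ r} {f g : x ⟶ y} (η : tot₁ f ⟶ tot₁ g) (h : η.1 = 0) :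
    tot₂ (ofTot η h) = η := by
  obtain ⟨p, η⟩ := η
  obtain rfl : p = 0 := h
  rfl

theorem deg_comp {x y : Graded r} {f g h : x ⟶ y} (η : f ⟶ g) (θ : g ⟶ h) :
    (η ≫ θ).1 = η.1 + θ.1 := rfl

theorem deg_whiskerLeft {x y z : Graded r} (f : x ⟶ y) {g h : y ⟶ z} (η : g ⟶ h) :
    (f ◁ η).1 = η.1 := rfl

theorem deg_whiskerRight {x y z : Graded r} {f g : x ⟶ y} (η : f ⟶ g) (h : y ⟶ z) :
    (η ▷ h).1 = η.1 := rfl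

theorem deg_tot₂ {x y : UQ r} {f g : x ⟶ y} (η : f ⟶ g) : (tot₂ η).1 = 0 := rfl

theorem deg_unsh {x y : UQ r} (f : x ⟶ y) (l : ℤ) : (unsh f l).hom.1 = l := rfl

theorem deg_unsh_inv {x y : UQ r} (f : x ⟶ y) (l : ℤ) : (unsh f l).inv.1 = -l := rfl

/-- The isomorphism of `UQ r` given by a homogeneous isomorphism of degree zero. -/
def isoOfTot {x y : UQ r} {f g : x ⟶ y} (η : tot₁ f ≅ tot₁ g) (h : η.hom.1 = 0)
    (h' : η.inv.1 = 0) : f ≅ g where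
  hom := ofTot η.hom h
  inv := ofTot η.inv h'
  hom_inv_id := tot₂_injective (by simp)
  inv_hom_id := tot₂_injective (by simp)

/-- The shift functor `f ↦ f⟨l⟩`. -/
def shiftF (x y : UQ r) (l : ℤ) : (x ⟶ y) ⥤ (x ⟶ y) where
  obj f := sh f l
  map {f g} η := ofTot ((unsh f l).hom ≫ tot₂ η ≫ (unsh g l).inv)
    (by simp only [deg_comp, deg_unsh, deg_unsh_inv, deg_tot₂]; omega)
  map_id f := tot₂_injective (by simp)
  map_comp η θ := tot₂_injective (by simp)

/-- The isomorphism `f⟨l + m⟩ ≅ f⟨l⟩⟨m⟩`. -/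
def shiftAdd {x y : UQ r} (f : x ⟶ y) (l m : ℤ) : sh f (l + m) ≅ sh (sh f l) m :=
  isoOfTot (unsh f (l + m) ≪≫ (unsh f l).symm ≪≫ (unsh (sh f l) m).symm)
    (by simp only [Iso.trans_hom, Iso.symm_hom, deg_comp, deg_unsh, deg_unsh_inv]; omega)
    (by simp only [Iso.trans_inv, Iso.symm_inv, deg_comp, deg_unsh, deg_unsh_inv]; omega)

/-- The isomorphism `f⟨0⟩ ≅ f`. -/
def shiftZero {x y : UQ r} (f : x ⟶ y) : sh f 0 ≅ f :=
  isoOfTot (unsh f 0) (deg_unsh f 0) (by rw [deg_unsh_inv]; rfl)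

theorem tot₂_shiftZero_hom {x y : UQ r} (f : x ⟶ y) :
    tot₂ (shiftZero f).hom = (unsh f 0).hom := tot₂_ofTot _ (deg_unsh f 0)

theorem tot₂_shiftZero_inv {x y : UQ r} (f : x ⟶ y) :
    tot₂ (shiftZero f).inv = (unsh f 0).inv := tot₂_ofTot _ (deg_unsh_inv f 0)

theorem tot₂_eqToHom {x y : UQ r} (f : x ⟶ y) {l m : ℤ} (h : l = m)
    (h' : (shiftF x y l).obj f = (shiftF x y m).obj f) :
    tot₂ (eqToHom h') = (unsh f l).hom ≫ (unsh f m).inv := by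
  subst h; simp; rfl

def shiftCore (x y : UQ r) : ShiftMkCore (x ⟶ y) ℤ where
  F := shiftF x y
  zero := NatIso.ofComponents shiftZero
    (fun η => tot₂_injective (by simp [shiftF, shiftZero, isoOfTot]))
  add l m := NatIso.ofComponents (fun f => shiftAdd f l m)
    (fun η => tot₂_injective (by simp [shiftF, shiftAdd, isoOfTot]))
  assoc_hom_app l m n f := tot₂_injective (by
    rw [tot₂_comp, tot₂_comp, tot₂_comp, tot₂_eqToHom f (add_assoc l m n)]
    simp [shiftF, shiftAdd, isoOfTot])
  zero_add_hom_app l f := tot₂_injective (by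
    rw [tot₂_comp, tot₂_eqToHom f (zero_add l)]
    simp only [shiftF, shiftAdd, isoOfTot, NatIso.ofComponents_hom_app, tot₂_ofTot]
    simp
    exact (tot₂_shiftZero_inv _).symm)
  add_zero_hom_app l f := tot₂_injective (by
    rw [tot₂_comp, tot₂_eqToHom f (add_zero l)]
    simp only [shiftF, shiftAdd, isoOfTot, NatIso.ofComponents_hom_app, tot₂_ofTot]
    simp
    exact (tot₂_shiftZero_inv _).symm)

theorem tot₂_shiftMap {x y : UQ r} {f g : x ⟶ y} (η : f ⟶ g) (l : ℤ) :
    tot₂ ((shiftF x y l).map η) = (unsh f l).hom ≫ tot₂ η ≫ (unsh g l).inv := tot₂_ofTot _ _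

@[reducible] def preadditive (x y : UQ r) : Preadditive (x ⟶ y) where
  homGroup f g := inferInstanceAs (AddCommGroup (Hom2 r f g 0))
  add_comp _ _ _ f f' g := Hom2.add_comp f f' g _
  comp_add _ _ _ f g g' := Hom2.comp_add f g g' _

attribute [local instance] preadditive

@[reducible] def linear (x y : UQ r) : Linear k (x ⟶ y) where
  homModule f g := inferInstanceAs (Module k (Hom2 r f g 0))
  smul_comp _ _ _ c f g := Hom2.smul_comp c f g _
  comp_smul _ _ _ f c g := Hom2.comp_smul c f g _

attribute [local instance] linear

theorem shiftF_map_eq {x y : UQ r} {f g : x ⟶ y} (η : f ⟶ g) (l : ℤ) :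
    (shiftF x y l).map η = ((Hom2.mk r (Diagram.unshift f l)).comp
      ((show Hom2 r f g 0 from η).comp (Hom2.mk r (Diagram.toShift g l)) rfl) (by omega) :
      Hom2 r _ _ 0) := by
  refine tot₂_injective ((tot₂_shiftMap η l).trans ?_)
  exact Graded.mk_comp (r := r) _ _ _

theorem shiftF_additive (x y : UQ r) (l : ℤ) : (shiftF x y l).Additive where
  map_add {f g η θ} := by
    rw [shiftF_map_eq, shiftF_map_eq, shiftF_map_eq]
    exact (congrArg (fun z => Hom2.comp _ z _) (Hom2.add_comp _ _ _ _)).trans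
      (Hom2.comp_add _ _ _ _)

theorem shiftF_linear (x y : UQ r) (l : ℤ) : (shiftF x y l).Linear k where
  map_smul {f g} η c := by
    rw [shiftF_map_eq, shiftF_map_eq]
    exact (congrArg (fun z => Hom2.comp _ z _) (Hom2.smul_comp _ _ _ _)).trans
      (Hom2.comp_smul _ _ _ _)

theorem isZero_zero (x y : UQ r) : IsZero (show x ⟶ y from Word.zero x.wt y.wt) := by
  rw [IsZero.iff_id_eq_zero]
  exact Quot.sound (Rel.ident_zero _ _)

def bicone {x y : UQ r} (f g : x ⟶ y) : BinaryBicone f g where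
  pt := Word.sum f g
  fst := Hom2.mk r (Diagram.fst f g)
  snd := Hom2.mk r (Diagram.snd f g)
  inl := Hom2.mk r (Diagram.inl f g)
  inr := Hom2.mk r (Diagram.inr f g)
  inl_fst := Quot.sound (Rel.inl_fst f g _)
  inl_snd := Quot.sound (Rel.inl_snd f g _)
  inr_fst := Quot.sound (Rel.inr_fst f g _)
  inr_snd := Quot.sound (Rel.inr_snd f g _)

theorem hasFiniteBiproducts (x y : UQ r) : HasFiniteBiproducts (x ⟶ y) := by
  have : HasBinaryBiproducts (x ⟶ y) :=
    ⟨fun f g => hasBinaryBiproduct_of_total (bicone f g) (Quot.sound (Rel.total f g _))⟩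
  have : HasTerminal (x ⟶ y) := (isZero_zero x y).isTerminal.hasTerminal
  have := hasFiniteProducts_of_has_binary_and_terminal (C := x ⟶ y)
  exact HasFiniteBiproducts.of_hasFiniteProducts

@[reducible] def hasShift (x y : UQ r) : HasShift (x ⟶ y) ℤ := hasShiftMk _ _ (shiftCore x y)

attribute [local instance] hasShift

/-- The isomorphism of degree `l` from `f⟦l⟧` to `f`. -/
def un {x y : UQ r} (f : x ⟶ y) (l : ℤ) : tot₁ (f⟦l⟧) ≅ tot₁ f := unsh f l

theorem deg_un {x y : UQ r} (f : x ⟶ y) (l : ℤ) : (un f l).hom.1 = l := rfl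

theorem deg_un_inv {x y : UQ r} (f : x ⟶ y) (l : ℤ) : (un f l).inv.1 = -l := rfl

theorem tot₂_shift {x y : UQ r} {f g : x ⟶ y} (η : f ⟶ g) (l : ℤ) :
    tot₂ (η⟦l⟧') = (un f l).hom ≫ tot₂ η ≫ (un g l).inv := tot₂_ofTot _ _

theorem tot₂_shiftFunctorAdd_hom {x y : UQ r} (f : x ⟶ y) (l m : ℤ) :
    tot₂ ((shiftFunctorAdd (x ⟶ y) l m).hom.app f) =
      (un f (l + m)).hom ≫ (un f l).inv ≫ (un (f⟦l⟧) m).inv := tot₂_ofTot _ _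

theorem tot₂_shiftFunctorAdd_inv {x y : UQ r} (f : x ⟶ y) (l m : ℤ) :
    tot₂ ((shiftFunctorAdd (x ⟶ y) l m).inv.app f) =
      (un (f⟦l⟧) m).hom ≫ (un f l).hom ≫ (un f (l + m)).inv :=
  (tot₂_ofTot _ _).trans (Category.assoc _ _ _)

theorem tot₂_shiftFunctorZero_hom {x y : UQ r} (f : x ⟶ y) :
    tot₂ ((shiftFunctorZero (x ⟶ y) ℤ).hom.app f) = (un f 0).hom :=
  tot₂_shiftZero_hom f

theorem tot₂_shiftFunctorZero_inv {x y : UQ r} (f : x ⟶ y) :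
    tot₂ ((shiftFunctorZero (x ⟶ y) ℤ).inv.app f) = (un f 0).inv :=
  tot₂_shiftZero_inv f

/-- The isomorphism `f ≫ g⟦l⟧ ≅ (f ≫ g)⟦l⟧`. -/
def compShift {x y z : UQ r} (f : x ⟶ y) (g : y ⟶ z) (l : ℤ) : f ≫ g⟦l⟧ ≅ (f ≫ g)⟦l⟧ :=
  isoOfTot (whiskerLeftIso (tot₁ f) (un g l) ≪≫ (un (f ≫ g) l).symm)
    (add_neg_cancel l) (add_neg_cancel l)

/-- The isomorphism `f⟦l⟧ ≫ g ≅ (f ≫ g)⟦l⟧`. -/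
def shiftComp {x y z : UQ r} (f : x ⟶ y) (g : y ⟶ z) (l : ℤ) : f⟦l⟧ ≫ g ≅ (f ≫ g)⟦l⟧ :=
  isoOfTot (whiskerRightIso (un f l) (tot₁ g) ≪≫ (un (f ≫ g) l).symm)
    (add_neg_cancel l) (add_neg_cancel l)

theorem tot₂_compShift {x y z : UQ r} (f : x ⟶ y) (g : y ⟶ z) (l : ℤ) :
    tot₂ (compShift f g l).hom = tot₁ f ◁ (un g l).hom ≫ (un (f ≫ g) l).inv := tot₂_ofTot _ _

theorem tot₂_shiftComp {x y z : UQ r} (f : x ⟶ y) (g : y ⟶ z) (l : ℤ) :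
    tot₂ (shiftComp f g l).hom = (un f l).hom ▷ tot₁ g ≫ (un (f ≫ g) l).inv := tot₂_ofTot _ _

theorem compShift_natural {x y z : UQ r} (f : x ⟶ y) {g h : y ⟶ z} (η : g ⟶ h) (l : ℤ) :
    f ◁ (η⟦l⟧') ≫ (compShift f h l).hom = (compShift f g l).hom ≫ (f ◁ η)⟦l⟧' := by
  apply tot₂_injective
  rw [tot₂_comp, tot₂_comp, tot₂_whiskerLeft, tot₂_shift, tot₂_shift, tot₂_compShift,
    tot₂_compShift]
  simp

theorem shiftComp_natural {x y z : UQ r} {f g : x ⟶ y} (η : f ⟶ g) (h : y ⟶ z) (l : ℤ) :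
    (η⟦l⟧') ▷ h ≫ (shiftComp g h l).hom = (shiftComp f h l).hom ≫ (η ▷ h)⟦l⟧' := by
  apply tot₂_injective
  rw [tot₂_comp, tot₂_comp, tot₂_whiskerRight, tot₂_shift, tot₂_shift, tot₂_shiftComp,
    tot₂_shiftComp]
  simp

@[reducible] def precompCommShift {x y : UQ r} (z : UQ r) (f : x ⟶ y) :
    (precomp z f).CommShift ℤ where
  commShiftIso l := NatIso.ofComponents (fun g => compShift f g l)
    (fun η => compShift_natural f η l)
  commShiftIso_zero := by
    ext g
    apply tot₂_injective
    refine (tot₂_compShift f g 0).trans ?_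
    rw [Functor.CommShift.isoZero_hom_app, tot₂_comp, tot₂_shiftFunctorZero_inv]
    refine congrArg (· ≫ _) ?_
    exact congrArg (tot₁ f ◁ ·) (tot₂_shiftFunctorZero_hom g).symm
  commShiftIso_add l m := by
    ext g
    apply tot₂_injective
    rw [Functor.CommShift.isoAdd_hom_app]
    change tot₂ (compShift f g (l + m)).hom =
      tot₂ (f ◁ (shiftFunctorAdd (y ⟶ z) l m).hom.app g ≫ (compShift f (g⟦l⟧) m).hom ≫
        (compShift f g l).hom⟦m⟧' ≫ (shiftFunctorAdd (x ⟶ z) l m).inv.app (f ≫ g))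
    rw [tot₂_comp, tot₂_comp, tot₂_comp, tot₂_whiskerLeft, tot₂_shift, tot₂_compShift,
      tot₂_compShift, tot₂_compShift, tot₂_shiftFunctorAdd_inv, tot₂_shiftFunctorAdd_hom]
    simp

@[reducible] def postcompCommShift (x : UQ r) {y z : UQ r} (g : y ⟶ z) :
    (postcomp x g).CommShift ℤ where
  commShiftIso l := NatIso.ofComponents (fun f => shiftComp f g l)
    (fun η => shiftComp_natural η g l)
  commShiftIso_zero := by
    ext f
    apply tot₂_injective
    refine (tot₂_shiftComp f g 0).trans ?_
    rw [Functor.CommShift.isoZero_hom_app, tot₂_comp, tot₂_shiftFunctorZero_inv]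
    refine congrArg (· ≫ _) ?_
    exact congrArg (· ▷ tot₁ g) (tot₂_shiftFunctorZero_hom f).symm
  commShiftIso_add l m := by
    ext f
    apply tot₂_injective
    rw [Functor.CommShift.isoAdd_hom_app]
    change tot₂ (shiftComp f g (l + m)).hom =
      tot₂ ((shiftFunctorAdd (x ⟶ y) l m).hom.app f ▷ g ≫ (shiftComp (f⟦l⟧) g m).hom ≫
        (shiftComp f g l).hom⟦m⟧' ≫ (shiftFunctorAdd (x ⟶ z) l m).inv.app (f ≫ g))
    rw [tot₂_comp, tot₂_comp, tot₂_comp, tot₂_whiskerRight, tot₂_shift, tot₂_shiftComp,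
      tot₂_shiftComp, tot₂_shiftComp, tot₂_shiftFunctorAdd_inv, tot₂_shiftFunctorAdd_hom]
    simp

attribute [local instance] precompCommShift postcompCommShift

theorem tot₂_shiftFunctorAdd'_hom {x y : UQ r} (f : x ⟶ y) (l m n : ℤ) (h : l + m = n) :
    tot₂ ((shiftFunctorAdd' (x ⟶ y) l m n h).hom.app f) =
      (un f n).hom ≫ (un f l).inv ≫ (un (f⟦l⟧) m).inv := by
  subst h
  rw [shiftFunctorAdd'_eq_shiftFunctorAdd]
  exact tot₂_shiftFunctorAdd_hom f l m

theorem tot₂_shiftFunctorComm {x y : UQ r} (f : x ⟶ y) (l m : ℤ) :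
    tot₂ ((shiftFunctorComm (x ⟶ y) l m).hom.app f) =
      (un (f⟦l⟧) m).hom ≫ (un f l).hom ≫ (un f m).inv ≫ (un (f⟦m⟧) l).inv := by
  rw [shiftFunctorComm_eq _ _ _ (l + m) rfl]
  refine (tot₂_comp _ _).trans ?_
  refine (congrArg₂ (· ≫ ·) ?_ (tot₂_shiftFunctorAdd'_hom f m l (l + m) (add_comm m l))).trans
    (?_ : ((un (f⟦l⟧) m).hom ≫ (un f l).hom ≫ (un f (l + m)).inv) ≫ _ = _)
  · rw [shiftFunctorAdd'_eq_shiftFunctorAdd]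
    exact tot₂_shiftFunctorAdd_inv f l m
  · simp

instance : GradedAdditiveBicategory (UQ r) where
  preadditive := preadditive
  hasFiniteBiproducts := hasFiniteBiproducts
  precomp_additive _ f := { map_add := Hom2.whiskerLeft_add f _ _ }
  postcomp_additive _ _ _ g := { map_add := Hom2.whiskerRight_add _ _ g }
  hasShift := hasShift
  shift_additive := shiftF_additive
  precompCommShift := precompCommShift
  postcompCommShift := postcompCommShift
  precomp_natural z f f' η g n := by
    apply tot₂_injective
    change tot₂ (η ▷ (g⟦n⟧) ≫ (compShift f' g n).hom) =
      tot₂ ((compShift f g n).hom ≫ (η ▷ g)⟦n⟧')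
    rw [tot₂_comp, tot₂_comp, tot₂_whiskerRight, tot₂_shift, tot₂_compShift, tot₂_compShift]
    simp [whisker_exchange_assoc]
  postcomp_natural x _ _ f g g' η n := by
    apply tot₂_injective
    change tot₂ ((f⟦n⟧) ◁ η ≫ (shiftComp f g' n).hom) =
      tot₂ ((shiftComp f g n).hom ≫ (f ◁ η)⟦n⟧')
    rw [tot₂_comp, tot₂_comp, tot₂_whiskerLeft, tot₂_shift, tot₂_shiftComp, tot₂_shiftComp]
    simp [whisker_exchange_assoc]
  shift_exchange f g m n := by
    apply tot₂_injective
    change tot₂ ((compShift (f⟦m⟧) g n).hom ≫ (shiftComp f g m).hom⟦n⟧') =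
      tot₂ ((shiftComp f (g⟦n⟧) m).hom ≫ (compShift f g n).hom⟦m⟧' ≫
        (shiftFunctorComm _ n m).hom.app (f ≫ g))
    rw [tot₂_comp, tot₂_comp, tot₂_comp, tot₂_shift, tot₂_shift, tot₂_compShift, tot₂_compShift,
      tot₂_shiftComp, tot₂_shiftComp, tot₂_shiftFunctorComm]
    simp [whisker_exchange_assoc]
  associator_shift_left f g h n := by
    apply tot₂_injective
    change tot₂ ((α_ (f⟦n⟧) g h).hom ≫ (shiftComp f (g ≫ h) n).hom) =
      tot₂ ((shiftComp f g n).hom ▷ h ≫ (shiftComp (f ≫ g) h n).hom ≫ ((α_ f g h).hom)⟦n⟧')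
    rw [tot₂_comp, tot₂_comp, tot₂_comp, tot₂_whiskerRight, tot₂_shift, tot₂_shiftComp,
      tot₂_shiftComp, tot₂_shiftComp, tot₂_associator, tot₂_associator]
    simp [tot₁_comp]
  associator_shift_middle f g h n := by
    apply tot₂_injective
    change tot₂ ((α_ f (g⟦n⟧) h).hom ≫ f ◁ (shiftComp g h n).hom ≫
        (compShift f (g ≫ h) n).hom) =
      tot₂ ((compShift f g n).hom ▷ h ≫ (shiftComp (f ≫ g) h n).hom ≫ ((α_ f g h).hom)⟦n⟧')
    rw [tot₂_comp, tot₂_comp, tot₂_comp, tot₂_comp, tot₂_whiskerRight, tot₂_whiskerLeft,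
      tot₂_shift, tot₂_shiftComp, tot₂_shiftComp, tot₂_compShift, tot₂_compShift,
      tot₂_associator, tot₂_associator]
    simp
  associator_shift_right f g h n := by
    apply tot₂_injective
    change tot₂ ((α_ f g (h⟦n⟧)).hom ≫ f ◁ (compShift g h n).hom ≫
        (compShift f (g ≫ h) n).hom) =
      tot₂ ((compShift (f ≫ g) h n).hom ≫ ((α_ f g h).hom)⟦n⟧')
    rw [tot₂_comp, tot₂_comp, tot₂_comp, tot₂_whiskerLeft,
      tot₂_shift, tot₂_compShift, tot₂_compShift, tot₂_compShift,
      tot₂_associator, tot₂_associator]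
    simp [tot₁_comp]
  leftUnitor_shift f n := by
    apply tot₂_injective
    change tot₂ ((compShift (𝟙 _) f n).hom ≫ ((λ_ f).hom)⟦n⟧') = _
    rw [tot₂_comp, tot₂_shift, tot₂_compShift, tot₂_leftUnitor]
    refine Eq.trans ?_ (tot₂_leftUnitor _).symm
    simp [tot₁_id]
  rightUnitor_shift f n := by
    apply tot₂_injective
    change tot₂ ((shiftComp f (𝟙 _) n).hom ≫ ((ρ_ f).hom)⟦n⟧') = _
    rw [tot₂_comp, tot₂_shift, tot₂_shiftComp, tot₂_rightUnitor]
    refine Eq.trans ?_ (tot₂_rightUnitor _).symm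
    simp [tot₁_id]

instance : GradedLinearBicategory k (UQ r) where
  linear := linear
  precomp_linear _ f := { map_smul := fun η c => Hom2.whiskerLeft_smul f c η }
  postcomp_linear _ _ _ g := { map_smul := fun η c => Hom2.whiskerRight_smul c η g }
  shift_linear := shiftF_linear

end UQ

/-! ### Homogeneous 2-morphisms and strong 2-representations -/

namespace ShiftedHom₂

variable {K : Type u} [Bicategory.{w, v} K] [GradedAdditiveBicategory K]

/-- Horizontal composition of a homogeneous 2-morphism with the identity of `f` placed first. -/
noncomputable def hWhiskerLeft {a b c : K} (f : a ⟶ b) {g h : b ⟶ c} {p : ℤ}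
    (x : ShiftedHom g h p) : ShiftedHom (f ≫ g) (f ≫ h) p := x.map (precomp c f)

/-- Horizontal composition of a homogeneous 2-morphism with the identity of `h` placed last. -/
noncomputable def hWhiskerRight {a b c : K} {f g : a ⟶ b} {p : ℤ} (x : ShiftedHom f g p)
    (h : b ⟶ c) : ShiftedHom (f ≫ h) (g ≫ h) p := x.map (postcomp a h)

/-- Conjugation of a homogeneous 2-morphism by isomorphisms. -/
noncomputable def conj {a b : K} {f f' g g' : a ⟶ b} (e : f ≅ f') (e' : g ≅ g') {p : ℤ}
    (x : ShiftedHom f g p) : ShiftedHom f' g' p := e.inv ≫ x ≫ e'.hom⟦p⟧'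

/-- `x` applied to the last two of three factors that are bracketed to the left. -/
noncomputable def hWhiskerMid {a b c d : K} (f : a ⟶ b) {g g' : b ⟶ c} {h h' : c ⟶ d} {p : ℤ}
    (x : ShiftedHom (g ≫ h) (g' ≫ h') p) : ShiftedHom ((f ≫ g) ≫ h) ((f ≫ g') ≫ h') p :=
  conj (α_ f g h).symm (α_ f g' h').symm (hWhiskerLeft f x)

end ShiftedHom₂

section

attribute [local instance] hasBinaryBiproducts_of_finite_biproducts

open ShiftedHom₂ in
/-- A strong 2-representation of `sl₂` in `K`, with parameter `r`; the object of weight `n` is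
`ob n`.  `E m n h` is the 1-morphism `E 1_m`, `ER n m h` its right adjoint. -/
structure StrongRep {k : Type t} [Field k] (r : kˣ) {K : Type u} [Bicategory.{w, v} K]
    [GradedAdditiveBicategory K] [GradedLinearBicategory k K] (ob : ℤ → K) where
  E (m n : ℤ) (h : m + 2 = n) : ob m ⟶ ob n
  ER (n m : ℤ) (h : m + 2 = n) : ob n ⟶ ob m
  rightAdjoint (m n : ℤ) (h : m + 2 = n) : Nonempty (Adjunction (E m n h) (ER n m h))
  leftAdjoint (m n : ℤ) (h : m + 2 = n) :
    ∃ EL : ob n ⟶ ob m, Nonempty (Adjunction EL (E m n h))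
  /-- the hom categories are idempotent complete -/
  idempotentComplete (m n : ℤ) : IsIdempotentComplete (ob m ⟶ ob n)
  /-- integrability: all but finitely many weights of a given string are zero objects -/
  integrable (n : ℤ) : ∃ R : ℕ, ∀ s : ℤ, (R : ℤ) ≤ |s| → IsZero (𝟙 (ob (n + 2 * s)))
  hom_neg (n l : ℤ) (hl : l < 0) (x : 𝟙 (ob n) ⟶ (𝟙 (ob n))⟦l⟧) : x = 0
  hom_zero (n : ℤ) (hn : ¬ IsZero (𝟙 (ob n))) : Module.finrank k (𝟙 (ob n) ⟶ 𝟙 (ob n)) = 1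
  finiteDimensional {m n : ℤ} (f g : ob m ⟶ ob n) : FiniteDimensional k (f ⟶ g)
  /-- `F E 1_n ≅ E F 1_n ⊕ ⨁_{[-n]} 1_n` for `n ≤ 0` -/
  commutator_nonpos (l n p : ℤ) (h : l + 2 = n) (h' : n + 2 = p) (hn : n ≤ 0) :
    Nonempty (E n p h' ≫ (ER p n h')⟦-n - 1⟧ ≅
      ((ER n l h)⟦-l - 1⟧ ≫ E l n h) ⊞
        ⨁ fun i : Fin (-n).toNat => (𝟙 (ob n))⟦-n - 1 - 2 * (i : ℤ)⟧)
  /-- `E F 1_n ≅ F E 1_n ⊕ ⨁_{[n]} 1_n` for `n ≥ 0` -/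
  commutator_nonneg (l n p : ℤ) (h : l + 2 = n) (h' : n + 2 = p) (hn : 0 ≤ n) :
    Nonempty ((ER n l h)⟦-l - 1⟧ ≫ E l n h ≅
      (E n p h' ≫ (ER p n h')⟦-n - 1⟧) ⊞
        ⨁ fun i : Fin n.toNat => (𝟙 (ob n))⟦n - 1 - 2 * (i : ℤ)⟧)
  /-- the action of the polynomial generator -/
  X (m n : ℤ) (h : m + 2 = n) : ShiftedHom (E m n h) (E m n h) (2 : ℤ)
  /-- the action of the crossing -/
  T (a b c : ℤ) (h : a + 2 = b) (h' : b + 2 = c) :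
    ShiftedHom (E a b h ≫ E b c h') (E a b h ≫ E b c h') (-2 : ℤ)
  T_sq (a b c : ℤ) (h : a + 2 = b) (h' : b + 2 = c) :
    (T a b c h h').comp (T a b c h h') (show (-2 : ℤ) + -2 = -4 by norm_num) = 0
  slide (a b c : ℤ) (h : a + 2 = b) (h' : b + 2 = c) :
    (hWhiskerLeft (E a b h) (X b c h')).comp (T a b c h h') (show (-2 : ℤ) + 2 = 0 by norm_num) -
        (T a b c h h').comp (hWhiskerRight (X a b h) (E b c h'))
          (show (2 : ℤ) + -2 = 0 by norm_num) =
      (r : k) • ShiftedHom.mk₀ (0 : ℤ) rfl (𝟙 (E a b h ≫ E b c h'))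
  slide' (a b c : ℤ) (h : a + 2 = b) (h' : b + 2 = c) :
    (T a b c h h').comp (hWhiskerLeft (E a b h) (X b c h')) (show (2 : ℤ) + -2 = 0 by norm_num) -
        (hWhiskerRight (X a b h) (E b c h')).comp (T a b c h h')
          (show (-2 : ℤ) + 2 = 0 by norm_num) =
      (r : k) • ShiftedHom.mk₀ (0 : ℤ) rfl (𝟙 (E a b h ≫ E b c h'))
  braid (a b c d : ℤ) (h : a + 2 = b) (h' : b + 2 = c) (h'' : c + 2 = d) :
    ((hWhiskerRight (T a b c h h') (E c d h'')).comp
        (hWhiskerMid (E a b h) (T b c d h' h'')) (show (-2 : ℤ) + -2 = -4 by norm_num)).comp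
        (hWhiskerRight (T a b c h h') (E c d h'')) (show (-2 : ℤ) + -4 = -6 by norm_num) =
      ((hWhiskerMid (E a b h) (T b c d h' h'')).comp
        (hWhiskerRight (T a b c h h') (E c d h'')) (show (-2 : ℤ) + -2 = -4 by norm_num)).comp
        (hWhiskerMid (E a b h) (T b c d h' h'')) (show (-2 : ℤ) + -4 = -6 by norm_num)

end

namespace StrongRep

variable {k : Type t} [Field k] {r : kˣ} {K : Type u} [Bicategory.{w, v} K]
  [GradedAdditiveBicategory K] [GradedLinearBicategory k K] {ob : ℤ → K}

/-- The 1-morphism `1_m F`, the right adjoint of `E 1_m` shifted by `-m - 1`. -/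
noncomputable def F (S : StrongRep r ob) (n m : ℤ) (h : m + 2 = n) : ob n ⟶ ob m :=
  (S.ER n m h)⟦-m - 1⟧

end StrongRep

namespace UQ

variable {k : Type t} [Field k] {r : kˣ}

/-- The 2-morphism `f ⟶ g⟦p⟧` of `UQ r` given by a diagram `f ⟶ g` of degree `p`. -/
def ofDiagram {x y : UQ r} {f g : x ⟶ y} {p : ℤ} (d : Diagram k (a := x.wt) (b := y.wt) f g p) :
    ShiftedHom f g p :=
  Hom2.mk r (d.comp (Diagram.toShift (a := x.wt) (b := y.wt) g p) (add_neg_cancel p))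

/-- The 1-morphism `E 1_m` of `UQ r`. -/
def E (r : kˣ) (m n : ℤ) (h : m + 2 = n) : (⟨m⟩ : UQ r) ⟶ ⟨n⟩ := Word.E m n h

/-- The 1-morphism `1_m F` of `UQ r`. -/
def F (r : kˣ) (n m : ℤ) (h : m + 2 = n) : (⟨n⟩ : UQ r) ⟶ ⟨m⟩ := Word.F n m h

/-- The dot on an upward strand. -/
def dotE (r : kˣ) (m n : ℤ) (h : m + 2 = n) : ShiftedHom (E r m n h) (E r m n h) (2 : ℤ) :=
  ofDiagram (Diagram.dotE m n h)

/-- The crossing of two upward strands. -/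
def crossE (r : kˣ) (a b c : ℤ) (h : a + 2 = b) (h' : b + 2 = c) :
    ShiftedHom (E r a b h ≫ E r b c h') (E r a b h ≫ E r b c h') (-2 : ℤ) :=
  ofDiagram (Diagram.crossE a b c h h')

end UQ

/-- Transport of an endomorphism of degree `p` along an equality of 1-morphisms. -/
def transport {K : Type u} [Bicategory.{w, v} K] [GradedAdditiveBicategory K] {a b : K}
    {f f' : a ⟶ b} (e : f = f') {p : ℤ} (x : ShiftedHom f f p) : ShiftedHom f' f' p := e ▸ x

/-- The 2-functor `Φ` extends the strong 2-representation `S` on the objects `Φ.obj ⟨n⟩`. -/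
structure Extends {k : Type t} [Field k] {r : kˣ} {K : Type u} [Bicategory.{w, v} K]
    [GradedAdditiveBicategory K] [GradedLinearBicategory k K]
    (Φ : GradedLinearPseudofunctor k (UQ r) K) (S : StrongRep r fun n => Φ.obj ⟨n⟩) : Prop where
  map_E (m n : ℤ) (h : m + 2 = n) : Φ.map (UQ.E r m n h) = S.E m n h
  map_F (n m : ℤ) (h : m + 2 = n) : Φ.map (UQ.F r n m h) = S.F n m h
  map_dotE (m n : ℤ) (h : m + 2 = n) :
    transport (map_E m n h) ((UQ.dotE r m n h).map (Φ.mapFunctor ⟨m⟩ ⟨n⟩)) = S.X m n h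
  map_crossE (a b c : ℤ) (h : a + 2 = b) (h' : b + 2 = c) :
    transport (congrArg₂ (· ≫ ·) (map_E a b h) (map_E b c h'))
      (ShiftedHom₂.conj (Φ.mapComp _ _) (Φ.mapComp _ _)
        ((UQ.crossE r a b c h h').map (Φ.mapFunctor ⟨a⟩ ⟨c⟩))) = S.T a b c h h'

end SL2

/-!
The idea is to construct in `K` the missing generators of `U_Q(sl₂)`, to check the relations there,
and to let the 2-functor evaluate diagrams. The dot and the crossing on upward strands are given,
and so is one adjunction, that of `E` and its right adjoint. What is missing is a second
adjunction, in which the same `F` is left adjoint to `E` (`Sys.exists_bi`); it provides the other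
cups and caps. The dot and the crossing on downward strands are mates of those on upward strands.

*Setting.* All computations take place in the bicategory `Tot k K`, whose 2-morphisms are sums of
homogeneous 2-morphisms of arbitrary degrees, with the action `SL2.StrongRep.sys`. Shifts of
1-morphisms disappear from the formulas in this way, and only degrees are left. Associators
disappear by letting 1-morphisms act on hom categories by composition (`Fn`): this is faithful on
2-morphisms (`Fn.app_ext`), and there composites of functors are strict. Reversing 1-morphisms and
2-morphisms (`Coop`) exchanges the weights `n` and `-n` and the parameters `r` and `-r`, so that it
suffices to treat the weights `n ≤ 0`.

*Small endomorphism spaces.* Integrability provides a zero object of low weight, from which one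
moves up weight by weight. If `F` is known to be left adjoint to `E` one weight below, then the
commutation of `E` and `F` expresses the endomorphisms of the next `E`, of `E E` and of `E F` through
those already known: in the lowest degree they are the multiples of the identity or of the crossing,
and below it they vanish (`Sys.end₁_step`, `Sys.end₂_step`, `Sys.end_EF`). After this, most
relations hold up to a scalar for reasons of degree.

*Non-vanishing.* That these scalars are not zero rests on one fact: `E ^ j` does not vanish on
1-morphisms of weight `n ≤ 0`, for `j ≤ -n` (`Sys.It_ne_zero`). This compares graded dimensions,
and it is the place where finite-dimensionality enters. On the other hand, if the cup `1 ⟶ F E` with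
`j` dots were a combination of those with fewer dots, the dot on `E` would be a root of a monic
polynomial of degree `j`, and iterated divided differences by the crossings would kill `E ^ (j + 1)`
(`Sys.It_eq_zero_of_monic`). Hence the cups with dots span the identities contained in `F E`
(`Sys.cupX_leading`).

*The second adjunction.* In weight `n < 0` the cap `F E ⟶ 1` is the coefficient of the cup with
`-n - 1` dots (`Sys.exists_cap`), which normalises the bubble of degree zero. With this cap, the
composite of the sideways crossings on `E F` is `-r ^ 2` (`Sys.sigma_sigma'`), and the identity of `F E`
decomposes as it should (`Sys.ident_FE`): both sides agree on the sideways crossing and on the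
dotted cups, as fake bubbles are the inverse of the series of bubbles. The decomposition in turn
gives the other cup (`Sys.exists_zig_eq_id`) and thus the adjunction in weight `n` (`Sys.low_step`).

*The remaining relations.* In weight `0` the relations between curls and crossings are equations
between four scalars, which have a unique solution (`Sys.weight_zero`). In the other weights, the
curl on the right of `E` is read off from the decomposition of `F E` (`Sys.Bi.curlR_nonpos`). The
difference of a dot on `E` and a dot on `F` slides through sideways crossings and vanishes on one pair
of cups and caps, hence on the other; this is the cyclicity of the dot (`Sys.X_cyclic`). The
crossing is then cyclic up to a scalar by degree, and the relation with the dots fixes the scalar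
(`Sys.T_cyclic`).

*The 2-functor.* The evaluation `Sys.Bi.ev₂` of diagrams in `Tot k K` respects the defining
relations (`Sys.Bi.ev₂_eq`) and the degrees. On 2-morphisms of degree zero it takes values in `K`; this
is the 2-functor, which commutes with compositions and with shifts strictly
(`SL2.StrongRep.gradedPseudofunctor`).
-/

/-! ### Bicategories whose 2-morphisms form graded vector spaces -/

/-- A bicategory with preadditive hom categories and additive whiskering. -/
class AddBicat (B : Type u) [Bicategory.{w, v} B] where
  [pre : ∀ a b : B, Preadditive (a ⟶ b)]
  whiskerLeft_add : ∀ {a b c : B} (f : a ⟶ b) {g h : b ⟶ c} (x y : g ⟶ h),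
    f ◁ (x + y) = f ◁ x + f ◁ y
  add_whiskerRight : ∀ {a b c : B} {f g : a ⟶ b} (x y : f ⟶ g) (h : b ⟶ c),
    (x + y) ▷ h = x ▷ h + y ▷ h

attribute [reducible] AddBicat.pre

attribute [instance] AddBicat.pre

/-- A `k`-linear bicategory with a distinguished subspace `homog p f g` of homogeneous 2-morphisms
`f ⟶ g` of each degree `p`.  The sum of these subspaces is not required to be direct. -/
class GrBicat (k : Type t) [Field k] (B : Type u) [Bicategory.{w, v} B] [AddBicat B] where
  [lin : ∀ a b : B, Linear k (a ⟶ b)]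
  whiskerLeft_smul : ∀ {a b c : B} (f : a ⟶ b) {g h : b ⟶ c} (z : k) (x : g ⟶ h),
    f ◁ (z • x) = z • f ◁ x
  smul_whiskerRight : ∀ {a b c : B} {f g : a ⟶ b} (z : k) (x : f ⟶ g) (h : b ⟶ c),
    (z • x) ▷ h = z • x ▷ h
  homog : ℤ → ∀ {a b : B} (f g : a ⟶ b), Submodule k (f ⟶ g)
  deg_id : ∀ {a b : B} (f : a ⟶ b), 𝟙 f ∈ homog 0 f f
  deg_comp : ∀ {p q : ℤ} {a b : B} {f g h : a ⟶ b} {x : f ⟶ g} {y : g ⟶ h},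
    x ∈ homog p f g → y ∈ homog q g h → x ≫ y ∈ homog (p + q) f h
  deg_whiskerLeft : ∀ {p : ℤ} {a b c : B} (f : a ⟶ b) {g h : b ⟶ c} {x : g ⟶ h},
    x ∈ homog p g h → f ◁ x ∈ homog p (f ≫ g) (f ≫ h)
  deg_whiskerRight : ∀ {p : ℤ} {a b c : B} {f g : a ⟶ b} {x : f ⟶ g} (h : b ⟶ c),
    x ∈ homog p f g → x ▷ h ∈ homog p (f ≫ h) (g ≫ h)
  deg_associator : ∀ {a b c d : B} (f : a ⟶ b) (g : b ⟶ c) (h : c ⟶ d),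
    (α_ f g h).hom ∈ homog 0 _ _ ∧ (α_ f g h).inv ∈ homog 0 _ _
  deg_leftUnitor : ∀ {a b : B} (f : a ⟶ b), (λ_ f).hom ∈ homog 0 _ _ ∧ (λ_ f).inv ∈ homog 0 _ _
  deg_rightUnitor : ∀ {a b : B} (f : a ⟶ b), (ρ_ f).hom ∈ homog 0 _ _ ∧ (ρ_ f).inv ∈ homog 0 _ _

attribute [reducible] GrBicat.lin

attribute [instance] GrBicat.lin

namespace GrBicat

/-- The homogeneous 2-morphisms `f ⟶ g` of degree `p`. -/
abbrev deg (k : Type t) [Field k] {B : Type u} [Bicategory.{w, v} B] [AddBicat B] [GrBicat k B] (p : ℤ)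
    {a b : B} (f g : a ⟶ b) : Submodule k (f ⟶ g) := homog p f g

variable (k : Type t) [Field k] {B : Type u} [Bicategory.{w, v} B] [AddBicat B] [GrBicat k B]

theorem deg_cast {p q : ℤ} {a b : B} {f g : a ⟶ b} {x : f ⟶ g} (hx : x ∈ deg k p f g)
    (h : p = q) : x ∈ deg k q f g := h ▸ hx

theorem deg_comp' {p q s : ℤ} {a b : B} {f g h : a ⟶ b} {x : f ⟶ g} {y : g ⟶ h}
    (hx : x ∈ deg k p f g) (hy : y ∈ deg k q g h) (e : p + q = s) : x ≫ y ∈ deg k s f h :=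
  e ▸ deg_comp hx hy

end GrBicat

/-! ### Strictification -/

/-- The objects of a bicategory `B`, as objects of a bicategory whose 1-morphisms `a ⟶ b` act on
the categories of 1-morphisms into `a` by functors that compose strictly. -/
structure Fn (k : Type t) (B : Type u) where
  /-- the underlying object -/
  as : B

namespace Fn

variable {k : Type t} [Field k] {B : Type u} [Bicategory.{w, v} B] [AddBicat B] [GrBicat k B]

/-- A 1-morphism of the strictification: a 1-morphism `hom` of `B`, together with a choice of
1-morphisms isomorphic, in degree zero, to the composites `M ≫ hom`. -/
structure Hom (a b : Fn k B) where
  /-- the underlying 1-morphism -/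
  hom : a.as ⟶ b.as
  /-- the chosen composites -/
  act {x : B} (M : x ⟶ a.as) : x ⟶ b.as
  /-- the comparison with composition in `B` -/
  iso {x : B} (M : x ⟶ a.as) : act M ≅ M ≫ hom
  deg_hom {x : B} (M : x ⟶ a.as) : (iso M).hom ∈ GrBicat.deg k 0 (act M) (M ≫ hom)
  deg_inv {x : B} (M : x ⟶ a.as) : (iso M).inv ∈ GrBicat.deg k 0 (M ≫ hom) (act M)

open GrBicat

/-- The 1-morphism of the strictification that acts by composition in `B`. -/
@[reducible] def ofHom {a b : B} (f : a ⟶ b) : Hom (⟨a⟩ : Fn k B) ⟨b⟩ where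
  hom := f
  act M := M ≫ f
  iso M := Iso.refl (M ≫ f)
  deg_hom M := deg_id (M ≫ f)
  deg_inv M := deg_id (M ≫ f)

/-- The identity. -/
@[reducible] def idHom (a : Fn k B) : Hom a a where
  hom := 𝟙 a.as
  act M := M
  iso M := (ρ_ M).symm
  deg_hom M := (deg_rightUnitor M).2
  deg_inv M := (deg_rightUnitor M).1

/-- Composition; the chosen composites compose strictly. -/
@[reducible] def compHom {a b c : Fn k B} (f : Hom a b) (g : Hom b c) : Hom a c where
  hom := f.hom ≫ g.hom
  act M := g.act (f.act M)
  iso M := g.iso (f.act M) ≪≫ whiskerRightIso (f.iso M) g.hom ≪≫ α_ M f.hom g.hom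
  deg_hom M := deg_comp' k (g.deg_hom _) (deg_comp (deg_whiskerRight _ (f.deg_hom M))
    (deg_associator _ _ _).1) (by omega)
  deg_inv M := deg_comp' k (deg_comp (deg_associator _ _ _).2
    (deg_whiskerRight _ (f.deg_inv M))) (g.deg_inv _) (by omega)

instance (a b : Fn k B) : Category.{w} (Hom a b) where
  Hom f g := f.hom ⟶ g.hom
  id f := 𝟙 f.hom
  comp x y := x ≫ y

instance : Bicategory.{w} (Fn k B) where
  Hom := Hom
  id := idHom
  comp := compHom
  whiskerLeft f _ _ x := f.hom ◁ x
  whiskerRight x h := x ▷ h.hom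
  associator f g h := ⟨(α_ f.hom g.hom h.hom).hom, (α_ f.hom g.hom h.hom).inv,
    (α_ f.hom g.hom h.hom).hom_inv_id, (α_ f.hom g.hom h.hom).inv_hom_id⟩
  leftUnitor f := ⟨(λ_ f.hom).hom, (λ_ f.hom).inv, (λ_ f.hom).hom_inv_id, (λ_ f.hom).inv_hom_id⟩
  rightUnitor f := ⟨(ρ_ f.hom).hom, (ρ_ f.hom).inv, (ρ_ f.hom).hom_inv_id, (ρ_ f.hom).inv_hom_id⟩
  whiskerLeft_id f g := Bicategory.whiskerLeft_id f.hom g.hom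
  whiskerLeft_comp f _ _ _ x y := Bicategory.whiskerLeft_comp (B := B) f.hom x y
  id_whiskerLeft x := Bicategory.id_whiskerLeft (B := B) x
  comp_whiskerLeft f g _ _ x := Bicategory.comp_whiskerLeft (B := B) f.hom g.hom x
  id_whiskerRight f g := Bicategory.id_whiskerRight f.hom g.hom
  comp_whiskerRight x y h := Bicategory.comp_whiskerRight (B := B) x y h.hom
  whiskerRight_id x := Bicategory.whiskerRight_id (B := B) x
  whiskerRight_comp x g h := Bicategory.whiskerRight_comp (B := B) x g.hom h.hom
  whisker_assoc f _ _ x h := Bicategory.whisker_assoc (B := B) f.hom x h.hom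
  whisker_exchange x y := Bicategory.whisker_exchange (B := B) x y
  pentagon f g h i := Bicategory.pentagon f.hom g.hom h.hom i.hom
  triangle f g := Bicategory.triangle f.hom g.hom

instance : AddBicat (Fn k B) where
  pre a b :=
    { homGroup f g := inferInstanceAs (AddCommGroup (Hom.hom f ⟶ Hom.hom g))
      add_comp _ _ _ f f' g := Preadditive.add_comp (C := a.as ⟶ b.as) _ _ _ f f' g
      comp_add _ _ _ f g g' := Preadditive.comp_add (C := a.as ⟶ b.as) _ _ _ f g g' }
  whiskerLeft_add f _ _ x y := AddBicat.whiskerLeft_add (B := B) (Hom.hom f) x y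
  add_whiskerRight x y f := AddBicat.add_whiskerRight (B := B) x y (Hom.hom f)

instance : GrBicat k (Fn k B) where
  lin a b :=
    { homModule f g := inferInstanceAs (Module k (Hom.hom f ⟶ Hom.hom g))
      smul_comp _ _ _ c f g := Linear.smul_comp (C := a.as ⟶ b.as) _ _ _ c f g
      comp_smul _ _ _ f c g := Linear.comp_smul (C := a.as ⟶ b.as) _ _ _ f c g }
  whiskerLeft_smul f _ _ z x := GrBicat.whiskerLeft_smul (B := B) (Hom.hom f) z x
  smul_whiskerRight z x f := GrBicat.smul_whiskerRight (B := B) z x (Hom.hom f)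
  homog p _ _ f g := (GrBicat.deg k p (Hom.hom f) (Hom.hom g) : Submodule k _)
  deg_id f := GrBicat.deg_id (Hom.hom f)
  deg_comp hx hy := GrBicat.deg_comp (B := B) hx hy
  deg_whiskerLeft f _ _ _ hx := GrBicat.deg_whiskerLeft (B := B) (Hom.hom f) hx
  deg_whiskerRight f hx := GrBicat.deg_whiskerRight (B := B) (Hom.hom f) hx
  deg_associator f g h := GrBicat.deg_associator (Hom.hom f) (Hom.hom g) (Hom.hom h)
  deg_leftUnitor f := GrBicat.deg_leftUnitor (Hom.hom f)
  deg_rightUnitor f := GrBicat.deg_rightUnitor (Hom.hom f)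

section app

variable {a b c d : Fn k B}

/-- The underlying 1-morphism of `B`. -/
abbrev under (f : a ⟶ b) : a.as ⟶ b.as := Hom.hom f

/-- The underlying 2-morphism of `B`. -/
abbrev under₂ {f g : a ⟶ b} (t : f ⟶ g) : under f ⟶ under g := t

/-- The value of a 1-morphism. -/
abbrev obj (f : a ⟶ b) {x : B} (M : x ⟶ a.as) : x ⟶ b.as := Hom.act f M

/-- The comparison of the value of a 1-morphism with composition in `B`. -/
def iso (f : a ⟶ b) {x : B} (M : x ⟶ a.as) : obj f M ≅ M ≫ under f := Hom.iso f M

/-- The value of a 1-morphism on a 2-morphism. -/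
def map (f : a ⟶ b) {x : B} {M N : x ⟶ a.as} (m : M ⟶ N) : obj f M ⟶ obj f N :=
  (iso f M).hom ≫ m ▷ under f ≫ (iso f N).inv

/-- The component at `M` of a 2-morphism, as a natural transformation. -/
def app {f g : a ⟶ b} (t : f ⟶ g) {x : B} (M : x ⟶ a.as) : obj f M ⟶ obj g M :=
  (iso f M).hom ≫ M ◁ under₂ t ≫ (iso g M).inv

@[simp] theorem obj_id {x : B} (M : x ⟶ a.as) : obj (𝟙 a) M = M := rfl

@[simp] theorem obj_comp (f : a ⟶ b) (g : b ⟶ c) {x : B} (M : x ⟶ a.as) :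
    obj (f ≫ g) M = obj g (obj f M) := rfl

@[simp] theorem map_id (f : a ⟶ b) {x : B} (M : x ⟶ a.as) : map f (𝟙 M) = 𝟙 _ := by
  simp [map]

@[simp] theorem map_comp (f : a ⟶ b) {x : B} {M N P : x ⟶ a.as} (m : M ⟶ N) (n : N ⟶ P) :
    map f (m ≫ n) = map f m ≫ map f n := by
  simp [map]

@[simp] theorem id_map {x : B} {M N : x ⟶ a.as} (m : M ⟶ N) : map (𝟙 a) m = m := by
  change (ρ_ M).inv ≫ m ▷ 𝟙 a.as ≫ (ρ_ N).hom = m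
  simp

theorem iso_comp (f : a ⟶ b) (g : b ⟶ c) {x : B} (M : x ⟶ a.as) : iso (f ≫ g) M =
    iso g (obj f M) ≪≫ whiskerRightIso (iso f M) (under g) ≪≫ α_ M (under f) (under g) := rfl

@[simp] theorem comp_map (f : a ⟶ b) (g : b ⟶ c) {x : B} {M N : x ⟶ a.as} (m : M ⟶ N) :
    map (f ≫ g) m = map g (map f m) := by
  simp only [map, iso_comp]
  change _ ≫ m ▷ (under f ≫ under g) ≫ _ = _
  simp

variable (k) in
theorem deg_iso_hom (f : a ⟶ b) {x : B} (M : x ⟶ a.as) : (iso f M).hom ∈ deg k 0 _ _ :=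
  Hom.deg_hom f M

variable (k) in
theorem deg_iso_inv (f : a ⟶ b) {x : B} (M : x ⟶ a.as) : (iso f M).inv ∈ deg k 0 _ _ :=
  Hom.deg_inv f M

theorem deg_map (f : a ⟶ b) {x : B} {M N : x ⟶ a.as} {m : M ⟶ N} {p : ℤ}
    (hm : m ∈ deg k p M N) : map f m ∈ deg k p _ _ :=
  deg_comp' k (deg_iso_hom k f M) (deg_comp (deg_whiskerRight _ hm) (deg_iso_inv k f N)) (by omega)

theorem deg_app {f g : a ⟶ b} {t : f ⟶ g} {p : ℤ} (ht : t ∈ deg k p f g) {x : B} (M : x ⟶ a.as) :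
    app t M ∈ deg k p (obj f M) (obj g M) :=
  deg_comp' k (deg_iso_hom k f M) (deg_comp (deg_whiskerLeft _
    (show under₂ t ∈ deg k p (under f) (under g) from ht)) (deg_iso_inv k g M)) (by omega)

theorem app_naturality {f g : a ⟶ b} (t : f ⟶ g) {x : B} {M N : x ⟶ a.as} (m : M ⟶ N) :
    map f m ≫ app t N = app t M ≫ map g m := by
  simp [map, app, Bicategory.whisker_exchange_assoc]

theorem app_naturality_assoc {f g : a ⟶ b} (t : f ⟶ g) {x : B} {M N : x ⟶ a.as} (m : M ⟶ N)
    {Z : x ⟶ b.as} (z : obj g N ⟶ Z) :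
    map f m ≫ app t N ≫ z = app t M ≫ map g m ≫ z := by
  rw [← Category.assoc, app_naturality, Category.assoc]

@[simp] theorem app_id (f : a ⟶ b) {x : B} (M : x ⟶ a.as) : app (𝟙 f) M = 𝟙 _ := by
  change _ ≫ M ◁ 𝟙 (under f) ≫ _ = 𝟙 _
  simp

@[simp] theorem app_comp {f g h : a ⟶ b} (s : f ⟶ g) (t : g ⟶ h) {x : B} (M : x ⟶ a.as) :
    app (s ≫ t) M = app s M ≫ app t M := by
  change _ ≫ M ◁ (under₂ s ≫ under₂ t) ≫ _ = _
  simp [app]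

@[simp] theorem app_whiskerLeft (f : a ⟶ b) {g h : b ⟶ c} (t : g ⟶ h) {x : B} (M : x ⟶ a.as) :
    app (f ◁ t) M = app t (obj f M) := by
  change _ ≫ M ◁ (under f ◁ under₂ t) ≫ _ = _
  simp only [app, iso_comp, Iso.trans_hom, Iso.trans_inv, Category.assoc, whiskerRightIso_hom,
    whiskerRightIso_inv]
  rw [← Bicategory.comp_whiskerLeft_assoc, ← Bicategory.whisker_exchange_assoc]
  simp

@[simp] theorem app_whiskerRight {f g : a ⟶ b} (t : f ⟶ g) (h : b ⟶ c) {x : B} (M : x ⟶ a.as) :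
    app (t ▷ h) M = map h (app t M) := by
  change _ ≫ M ◁ (under₂ t ▷ under h) ≫ _ = _
  simp [app, iso_comp, map]

@[simp] theorem app_associator_hom (f : a ⟶ b) (g : b ⟶ c) (h : c ⟶ d) {x : B} (M : x ⟶ a.as) :
    app (α_ f g h).hom M = 𝟙 _ := by
  change ((iso h _).hom ≫ ((iso g _).hom ≫ (iso f M).hom ▷ _ ≫ (α_ M (under f) (under g)).hom) ▷
    _ ≫ (α_ M (under f ≫ under g) _).hom) ≫ M ◁ (α_ (under f) (under g) (under h)).hom ≫
    ((α_ M (under f) (under g ≫ under h)).inv ≫ (iso f M).inv ▷ (under g ≫ under h)) ≫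
    ((α_ _ (under g) (under h)).inv ≫ (iso g _).inv ▷ _) ≫ (iso h _).inv = 𝟙 _
  simp

@[simp] theorem app_associator_inv (f : a ⟶ b) (g : b ⟶ c) (h : c ⟶ d) {x : B} (M : x ⟶ a.as) :
    app (α_ f g h).inv M = 𝟙 _ := by
  have := app_comp (α_ f g h).hom (α_ f g h).inv M
  rw [Iso.hom_inv_id, app_id, app_associator_hom] at this
  exact ((this.trans (Category.id_comp _))).symm

@[simp] theorem app_leftUnitor_hom (f : a ⟶ b) {x : B} (M : x ⟶ a.as) :
    app (λ_ f).hom M = 𝟙 _ := by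
  change ((iso f M).hom ≫ (ρ_ M).inv ▷ _ ≫ (α_ _ _ _).hom) ≫ M ◁ (λ_ (under f)).hom ≫ _ = 𝟙 _
  simp

@[simp] theorem app_leftUnitor_inv (f : a ⟶ b) {x : B} (M : x ⟶ a.as) :
    app (λ_ f).inv M = 𝟙 _ := by
  have := app_comp (λ_ f).hom (λ_ f).inv M
  rw [Iso.hom_inv_id, app_id, app_leftUnitor_hom] at this
  exact (this.trans (Category.id_comp _)).symm

@[simp] theorem app_rightUnitor_hom (f : a ⟶ b) {x : B} (M : x ⟶ a.as) :
    app (ρ_ f).hom M = 𝟙 _ := by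
  change ((ρ_ _).inv ≫ (iso f M).hom ▷ _ ≫ (α_ _ _ _).hom) ≫ M ◁ (ρ_ (under f)).hom ≫ _ = 𝟙 _
  simp

@[simp] theorem app_rightUnitor_inv (f : a ⟶ b) {x : B} (M : x ⟶ a.as) :
    app (ρ_ f).inv M = 𝟙 _ := by
  have := app_comp (ρ_ f).hom (ρ_ f).inv M
  rw [Iso.hom_inv_id, app_id, app_rightUnitor_hom] at this
  exact (this.trans (Category.id_comp _)).symm

/-- A 2-morphism is determined by its component at the identity. -/
theorem app_injective {f g : a ⟶ b} {s t : f ⟶ g} (h : app s (𝟙 a.as) = app t (𝟙 a.as)) :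
    s = t := by
  simp only [app] at h
  rw [cancel_epi, ← cancel_mono (iso g (𝟙 a.as)).hom] at h
  simpa using h

theorem app_ext {f g : a ⟶ b} {s t : f ⟶ g} (h : ∀ {x : B} (M : x ⟶ a.as), app s M = app t M) :
    s = t := app_injective (h _)

@[simp] theorem app_add {f g : a ⟶ b} (s t : f ⟶ g) {x : B} (M : x ⟶ a.as) :
    app (s + t) M = app s M + app t M := by
  change _ ≫ M ◁ (under₂ s + under₂ t) ≫ _ = _
  rw [AddBicat.whiskerLeft_add]
  simp [app]

@[simp] theorem app_smul (z : k) {f g : a ⟶ b} (s : f ⟶ g) {x : B} (M : x ⟶ a.as) :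
    app (z • s) M = z • app s M := by
  change _ ≫ M ◁ (z • under₂ s) ≫ _ = _
  rw [GrBicat.whiskerLeft_smul]
  simp [app]

@[simp] theorem map_add (f : a ⟶ b) {x : B} {M N : x ⟶ a.as} (m n : M ⟶ N) :
    map f (m + n) = map f m + map f n := by
  simp [map, AddBicat.add_whiskerRight]

@[simp] theorem map_smul (f : a ⟶ b) {x : B} {M N : x ⟶ a.as} (z : k) (m : M ⟶ N) :
    map f (z • m) = z • map f m := by
  simp [map, GrBicat.smul_whiskerRight]

/-- Application at `M` as a linear map. -/
def appL {f g : a ⟶ b} {x : B} (M : x ⟶ a.as) : (f ⟶ g) →ₗ[k] (obj f M ⟶ obj g M) where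
  toFun t := app t M
  map_add' := by simp
  map_smul' := by simp

/-- The action of a 1-morphism on 2-morphisms as a linear map. -/
def mapL (f : a ⟶ b) {x : B} {M N : x ⟶ a.as} : (M ⟶ N) →ₗ[k] (obj f M ⟶ obj f N) where
  toFun m := map f m
  map_add' := by simp
  map_smul' := by simp

@[simp] theorem app_zero {f g : a ⟶ b} {x : B} (M : x ⟶ a.as) : app (0 : f ⟶ g) M = 0 :=
  (appL M).map_zero

@[simp] theorem app_sub {f g : a ⟶ b} (s t : f ⟶ g) {x : B} (M : x ⟶ a.as) :
    app (s - t) M = app s M - app t M := (appL M).map_sub s t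

@[simp] theorem app_sum {ι : Type*} (I : Finset ι) {f g : a ⟶ b} (s : ι → (f ⟶ g)) {x : B}
    (M : x ⟶ a.as) : app (∑ i ∈ I, s i) M = ∑ i ∈ I, app (s i) M := _root_.map_sum (appL M) s I

@[simp] theorem map_zero (f : a ⟶ b) {x : B} {M N : x ⟶ a.as} : map f (0 : M ⟶ N) = 0 :=
  (mapL f).map_zero

@[simp] theorem map_neg (f : a ⟶ b) {x : B} {M N : x ⟶ a.as} (m : M ⟶ N) :
    map f (-m) = - map f m := (mapL f).map_neg m

@[simp] theorem map_sub (f : a ⟶ b) {x : B} {M N : x ⟶ a.as} (m n : M ⟶ N) :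
    map f (m - n) = map f m - map f n := (mapL f).map_sub m n

@[simp] theorem map_sum {ι : Type*} (I : Finset ι) (f : a ⟶ b) {x : B} {M N : x ⟶ a.as}
    (m : ι → (M ⟶ N)) : map f (∑ i ∈ I, m i) = ∑ i ∈ I, map f (m i) :=
  _root_.map_sum (mapL f) m I

end app

end Fn

theorem leftZigzag_eq {B : Type u} [Bicategory.{w, v} B] {a b : B} {f : a ⟶ b} {g : b ⟶ a}
    (x : 𝟙 a ⟶ f ≫ g) (y : g ≫ f ⟶ 𝟙 b) :
    leftZigzag x y = x ▷ f ≫ (α_ f g f).hom ≫ f ◁ y := by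
  simp [leftZigzag, bicategoricalComp]

theorem rightZigzag_eq {B : Type u} [Bicategory.{w, v} B] {a b : B} {f : a ⟶ b} {g : b ⟶ a}
    (x : 𝟙 a ⟶ f ≫ g) (y : g ≫ f ⟶ 𝟙 b) :
    rightZigzag x y = g ◁ x ≫ (α_ g f g).inv ≫ y ▷ g := by
  simp [rightZigzag, bicategoricalComp]

/-! ### The dual that reverses 1-morphisms and 2-morphisms -/

/-- The bicategory obtained from `B` by reversing both the 1-morphisms and the 2-morphisms. -/
structure Coop (B : Type u) where
  /-- the underlying object -/
  as : B

namespace Coop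

variable {B : Type u} [Bicategory.{w, v} B]

/-- The 1-morphisms of the dual. -/
@[reducible] def Hom (a b : Coop B) : Type v := b.as ⟶ a.as

/-- The 2-morphisms of the dual. -/
@[reducible] def homCat (a b : Coop B) : Category.{w} (Hom a b) where
  Hom f g := g ⟶ f
  id f := 𝟙 f
  comp x y := y ≫ x

theorem eq_of_conj {C : Type*} [Category* C] {f g h i : C} {x : f ⟶ g} {a : f ≅ h} {b : g ≅ i}
    {y : h ⟶ i} (H : x = a.hom ≫ y ≫ b.inv) : y = (a.inv ≫ x) ≫ b.hom := by
  simp [H]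

instance : Bicategory.{w, v} (Coop B) where
  Hom := Hom
  id a := 𝟙 a.as
  comp f g := (g ≫ f : _ ⟶ _)
  homCategory := homCat
  whiskerLeft f _ _ x := x ▷ f
  whiskerRight x h := h ◁ x
  associator f g h := @Iso.mk _ (homCat _ _) _ _ (α_ h g f).hom (α_ h g f).inv
    (α_ h g f).inv_hom_id (α_ h g f).hom_inv_id
  leftUnitor f := @Iso.mk _ (homCat _ _) _ _ (ρ_ f).inv (ρ_ f).hom
    (ρ_ f).hom_inv_id (ρ_ f).inv_hom_id
  rightUnitor f := @Iso.mk _ (homCat _ _) _ _ (λ_ f).inv (λ_ f).hom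
    (λ_ f).hom_inv_id (λ_ f).inv_hom_id
  whiskerLeft_id f g := Bicategory.id_whiskerRight g f
  whiskerLeft_comp f _ _ _ x y := Bicategory.comp_whiskerRight y x f
  id_whiskerLeft x := (Bicategory.whiskerRight_id x).trans (Category.assoc _ _ _).symm
  comp_whiskerLeft f g _ _ x :=
    (Bicategory.whiskerRight_comp x g f).trans (Category.assoc _ _ _).symm
  id_whiskerRight f g := Bicategory.whiskerLeft_id g f
  comp_whiskerRight x y h := Bicategory.whiskerLeft_comp h y x
  whiskerRight_id x := (Bicategory.id_whiskerLeft x).trans (Category.assoc _ _ _).symm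
  whiskerRight_comp x g h := (Bicategory.comp_whiskerLeft h g x).trans (Category.assoc _ _ _).symm
  whisker_assoc f _ _ x h := eq_of_conj (Bicategory.whisker_assoc h x f)
  whisker_exchange x y := Bicategory.whisker_exchange y x
  pentagon f g h i := (Category.assoc _ _ _).trans (Bicategory.pentagon i h g f)
  triangle f g := Bicategory.triangle_assoc_comp_right_inv g f

instance [AddBicat B] : AddBicat (Coop B) where
  pre a b :=
    { homGroup f g := inferInstanceAs (AddCommGroup ((show b.as ⟶ a.as from g) ⟶ f))
      add_comp _ _ _ f f' g := Preadditive.comp_add (C := b.as ⟶ a.as) _ _ _ g f f'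
      comp_add _ _ _ f g g' := Preadditive.add_comp (C := b.as ⟶ a.as) _ _ _ g g' f }
  whiskerLeft_add f _ _ x y := AddBicat.add_whiskerRight (B := B) x y f
  add_whiskerRight x y f := AddBicat.whiskerLeft_add (B := B) f x y

instance {k : Type t} [Field k] [AddBicat B] [GrBicat k B] : GrBicat k (Coop B) where
  lin a b :=
    { homModule f g := inferInstanceAs (Module k ((show b.as ⟶ a.as from g) ⟶ f))
      smul_comp _ _ _ c f g := Linear.comp_smul (C := b.as ⟶ a.as) _ _ _ g c f
      comp_smul _ _ _ f c g := Linear.smul_comp (C := b.as ⟶ a.as) _ _ _ c g f }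
  whiskerLeft_smul f _ _ z x := GrBicat.smul_whiskerRight (B := B) z x f
  smul_whiskerRight z x f := GrBicat.whiskerLeft_smul (B := B) f z x
  homog p _ _ f g := GrBicat.deg k (B := B) p g f
  deg_id f := GrBicat.deg_id (B := B) f
  deg_comp {p q} _ _ _ _ _ _ _ hx hy := GrBicat.deg_comp' k (B := B) hy hx (add_comm q p)
  deg_whiskerLeft f _ _ _ hx := GrBicat.deg_whiskerRight (B := B) f hx
  deg_whiskerRight f hx := GrBicat.deg_whiskerLeft (B := B) f hx
  deg_associator f g h := GrBicat.deg_associator (B := B) h g f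
  deg_leftUnitor f := (GrBicat.deg_rightUnitor (B := B) f).symm
  deg_rightUnitor f := (GrBicat.deg_leftUnitor (B := B) f).symm

end Coop

/-! ### Actions of `sl₂` on a graded bicategory -/

section

variable (k : Type t) [Field k] {B : Type u} [Bicategory.{w, v} B] [AddBicat B] [GrBicat k B]

open GrBicat

/-- A decomposition of the 1-morphism `V` as the direct sum of `W` and of `N` identities, the
`j`-th of which is included by a 2-morphism of degree `δ j`. -/
structure Decomp {a : B} (V W : a ⟶ a) (N : ℕ) (δ : ℕ → ℤ) where
  u : W ⟶ V
  v : V ⟶ W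
  i : ℕ → (𝟙 a ⟶ V)
  q : ℕ → (V ⟶ 𝟙 a)
  deg_u : u ∈ deg k 0 W V
  deg_v : v ∈ deg k 0 V W
  deg_i : ∀ j, j < N → i j ∈ deg k (δ j) _ _
  deg_q : ∀ j, j < N → q j ∈ deg k (-δ j) _ _
  u_v : u ≫ v = 𝟙 W
  u_q : ∀ j, j < N → u ≫ q j = 0
  i_v : ∀ j, j < N → i j ≫ v = 0
  i_q : ∀ j, j < N → ∀ l, l < N → i j ≫ q l = if j = l then 𝟙 _ else 0
  total : v ≫ u + ∑ j ∈ Finset.range N, q j ≫ i j = 𝟙 V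

/-- An action of `sl₂`: 1-morphisms `E` with right adjoints `F` between objects `o n`, an action of
the nilHecke algebras with parameter `r` on the powers of `E`, the `sl₂` commutator relations, and
the finiteness conditions of a strong 2-representation. -/
structure Sys (r : kˣ) (B : Type u) [Bicategory.{w, v} B] [AddBicat B] [GrBicat k B] where
  o : ℤ → B
  E (m n : ℤ) (h : m + 2 = n) : o m ⟶ o n
  F (n m : ℤ) (h : m + 2 = n) : o n ⟶ o m
  adj (m n : ℤ) (h : m + 2 = n) : E m n h ⊣ F n m h
  deg_unit (m n : ℤ) (h : m + 2 = n) : (adj m n h).unit ∈ deg k (m + 1) _ _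
  deg_counit (m n : ℤ) (h : m + 2 = n) : (adj m n h).counit ∈ deg k (-(m + 1)) _ _
  X (m n : ℤ) (h : m + 2 = n) : E m n h ⟶ E m n h
  T (a b c : ℤ) (h : a + 2 = b) (h' : b + 2 = c) : E a b h ≫ E b c h' ⟶ E a b h ≫ E b c h'
  deg_X (m n : ℤ) (h : m + 2 = n) : X m n h ∈ deg k 2 _ _
  deg_T (a b c : ℤ) (h : a + 2 = b) (h' : b + 2 = c) : T a b c h h' ∈ deg k (-2) _ _
  T_sq (a b c : ℤ) (h : a + 2 = b) (h' : b + 2 = c) : T a b c h h' ≫ T a b c h h' = 0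
  slide (a b c : ℤ) (h : a + 2 = b) (h' : b + 2 = c) :
    E a b h ◁ X b c h' ≫ T a b c h h' - T a b c h h' ≫ X a b h ▷ E b c h' = (r : k) • 𝟙 _
  slide' (a b c : ℤ) (h : a + 2 = b) (h' : b + 2 = c) :
    T a b c h h' ≫ E a b h ◁ X b c h' - X a b h ▷ E b c h' ≫ T a b c h h' = (r : k) • 𝟙 _
  braid (a b c d : ℤ) (h : a + 2 = b) (h' : b + 2 = c) (h'' : c + 2 = d) :
    (T a b c h h' ▷ E c d h'') ≫ ((α_ _ _ _).hom ≫ E a b h ◁ T b c d h' h'' ≫ (α_ _ _ _).inv) ≫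
      (T a b c h h' ▷ E c d h'') =
    ((α_ _ _ _).hom ≫ E a b h ◁ T b c d h' h'' ≫ (α_ _ _ _).inv) ≫ (T a b c h h' ▷ E c d h'') ≫
      ((α_ _ _ _).hom ≫ E a b h ◁ T b c d h' h'' ≫ (α_ _ _ _).inv)
  one_neg (n p : ℤ) (hp : p < 0) (x : 𝟙 (o n) ⟶ 𝟙 (o n)) (hx : x ∈ deg k p _ _) : x = 0
  one_zero (n : ℤ) (x : 𝟙 (o n) ⟶ 𝟙 (o n)) (hx : x ∈ deg k 0 _ _) : ∃ c : k, x = c • 𝟙 _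
  fin (m n p : ℤ) (f g : o m ⟶ o n) : FiniteDimensional k (deg k p f g)
  integrable (n : ℤ) : ∃ R : ℕ, ∀ s : ℤ, (R : ℤ) ≤ |s| → 𝟙 (𝟙 (o (n + 2 * s))) = 0
  comm_nonpos (l n p : ℤ) (h : l + 2 = n) (h' : n + 2 = p) (hn : n ≤ 0) :
    Nonempty (Decomp k (E n p h' ≫ F p n h') (F n l h ≫ E l n h) (-n).toNat
      (fun j => n + 1 + 2 * j))
  comm_nonneg (l n p : ℤ) (h : l + 2 = n) (h' : n + 2 = p) (hn : 0 ≤ n) :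
    Nonempty (Decomp k (F n l h ≫ E l n h) (E n p h' ≫ F p n h') n.toNat
      (fun j => n - 1 - 2 * j))

variable {k}

/-- A decomposition in the strictification. -/
def Decomp.fn {a : Fn k B} {V W : a ⟶ a} {N : ℕ} {δ : ℕ → ℤ}
    (D : Decomp k (Fn.under V) (Fn.under W) N δ) : Decomp k V W N δ where
  u := D.u
  v := D.v
  i := D.i
  q := D.q
  deg_u := D.deg_u
  deg_v := D.deg_v
  deg_i := D.deg_i
  deg_q := D.deg_q
  u_v := D.u_v
  u_q := D.u_q
  i_v := D.i_v
  i_q := D.i_q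
  total := D.total

/-- The dual of a decomposition. -/
def Decomp.coop {a : B} {V W : a ⟶ a} {N : ℕ} {δ δ' : ℕ → ℤ} (D : Decomp k V W N δ)
    (h : ∀ j, -δ j = δ' j) :
    Decomp k (B := Coop B) (a := ⟨a⟩) (show (⟨a⟩ : Coop B) ⟶ ⟨a⟩ from V)
      (show (⟨a⟩ : Coop B) ⟶ ⟨a⟩ from W) N δ' where
  u := D.v
  v := D.u
  i := D.q
  q := D.i
  deg_u := D.deg_v
  deg_v := D.deg_u
  deg_i j hj := by rw [← h]; exact D.deg_q j hj
  deg_q j hj := by rw [← h, neg_neg]; exact D.deg_i j hj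
  u_v := D.u_v
  u_q := D.i_v
  i_v := D.u_q
  i_q j hj l hl := (D.i_q l hl j hj).trans (by simp only [eq_comm]; rfl)
  total := D.total

variable {r : kˣ}

namespace Sys

/-- The action on the strictification. -/
def fn (S : Sys k r B) : Sys k r (Fn k B) where
  o n := ⟨S.o n⟩
  E m n h := Fn.ofHom (S.E m n h)
  F m n h := Fn.ofHom (S.F m n h)
  adj m n h :=
    { unit := (S.adj m n h).unit
      counit := (S.adj m n h).counit
      left_triangle := (S.adj m n h).left_triangle
      right_triangle := (S.adj m n h).right_triangle }
  deg_unit := S.deg_unit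
  deg_counit := S.deg_counit
  X := S.X
  T := S.T
  deg_X := S.deg_X
  deg_T := S.deg_T
  T_sq := S.T_sq
  slide := S.slide
  slide' := S.slide'
  braid := S.braid
  one_neg := S.one_neg
  one_zero := S.one_zero
  fin m n p f g := S.fin m n p (Fn.under f) (Fn.under g)
  integrable := S.integrable
  comm_nonpos l n p h h' hn := (S.comm_nonpos l n p h h' hn).map Decomp.fn
  comm_nonneg l n p h h' hn := (S.comm_nonneg l n p h h' hn).map Decomp.fn

theorem coop_braid_aux {C : Type*} [Category* C] {V W : C} {α : V ≅ W} {t : V ⟶ V} {s : W ⟶ W}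
    (H : t ≫ (α.hom ≫ s ≫ α.inv) ≫ t = (α.hom ≫ s ≫ α.inv) ≫ t ≫ α.hom ≫ s ≫ α.inv) :
    (s ≫ ((α.inv ≫ t) ≫ α.hom)) ≫ s =
      (((α.inv ≫ t) ≫ α.hom) ≫ s) ≫ ((α.inv ≫ t) ≫ α.hom) := by
  have := congrArg (fun z => α.inv ≫ z ≫ α.hom) H
  simp only [Category.assoc, Iso.inv_hom_id, Iso.inv_hom_id_assoc, Category.comp_id] at this ⊢
  exact this.symm

/-- The dual action; it exchanges the weights `n` and `-n`. -/
def coop (S : Sys k r B) : Sys k (-r) (Coop B) where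
  o n := ⟨S.o (-n)⟩
  E m n h := S.E (-n) (-m) (by omega)
  F n m h := S.F (-m) (-n) (by omega)
  adj m n h :=
    { unit := (S.adj (-n) (-m) (by omega)).counit
      counit := (S.adj (-n) (-m) (by omega)).unit
      left_triangle := by
        rw [leftZigzag_eq]
        exact (Category.assoc _ _ _).trans ((leftZigzag_eq _ _).symm.trans
          (S.adj (-n) (-m) (by omega)).left_triangle)
      right_triangle := by
        rw [rightZigzag_eq]
        exact (Category.assoc _ _ _).trans ((rightZigzag_eq _ _).symm.trans
          (S.adj (-n) (-m) (by omega)).right_triangle) }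
  deg_unit m n h := deg_cast k (B := B) (S.deg_counit (-n) (-m) (by omega)) (by omega)
  deg_counit m n h := deg_cast k (B := B) (S.deg_unit (-n) (-m) (by omega)) (by omega)
  X m n h := S.X (-n) (-m) (by omega)
  T a b c h h' := S.T (-c) (-b) (-a) (by omega) (by omega)
  deg_X m n h := S.deg_X (-n) (-m) (by omega)
  deg_T a b c h h' := S.deg_T (-c) (-b) (-a) (by omega) (by omega)
  T_sq a b c h h' := S.T_sq (-c) (-b) (-a) (by omega) (by omega)
  slide a b c h h' := by
    have := congrArg Neg.neg (S.slide (-c) (-b) (-a) (by omega) (by omega))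
    rw [neg_sub, ← neg_smul] at this
    exact this
  slide' a b c h h' := by
    have := congrArg Neg.neg (S.slide' (-c) (-b) (-a) (by omega) (by omega))
    rw [neg_sub, ← neg_smul] at this
    exact this
  braid a b c d h h' h'' := by
    have := S.braid (-d) (-c) (-b) (-a) (by omega) (by omega) (by omega)
    exact coop_braid_aux this
  one_neg n p hp x hx := S.one_neg (-n) p hp x hx
  one_zero n x hx := S.one_zero (-n) x hx
  fin m n p f g := S.fin (-n) (-m) p g f
  integrable n := by
    obtain ⟨R, hR⟩ := S.integrable (-n)
    refine ⟨R, fun s hs => ?_⟩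
    have := hR (-s) (by simpa using hs)
    rw [show -n + 2 * -s = -(n + 2 * s) by ring] at this
    exact this
  comm_nonpos l n p h h' hn := (S.comm_nonneg (-p) (-n) (-l) (by omega) (by omega) (by omega)).map
    fun D => D.coop (fun j => by ring)
  comm_nonneg l n p h h' hn := (S.comm_nonpos (-p) (-n) (-l) (by omega) (by omega) (by omega)).map
    fun D => by
      rw [neg_neg] at D
      exact D.coop (fun j => by ring)

end Sys

end

section

variable {k : Type t} [Field k] {B : Type u} [Bicategory.{w, v} B] [AddBicat B] [GrBicat k B]

open GrBicat

/-! ### Adjunctions and degrees -/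

namespace Fn

variable {a b c : Fn k B} {l : a ⟶ b} {s : b ⟶ a} (A : l ⊣ s)

@[simp]
theorem adj_left {x : B} (M : x ⟶ a.as) :
    map l (app A.unit M) ≫ app A.counit (obj l M) = 𝟙 _ := by
  have := congrArg (fun t => app t M) A.left_triangle
  simpa [leftZigzag_eq] using this

@[simp]
theorem adj_right {x : B} (M : x ⟶ b.as) :
    app A.unit (obj s M) ≫ map s (app A.counit M) = 𝟙 _ := by
  have := congrArg (fun t => app t M) A.right_triangle
  simpa [rightZigzag_eq] using this

@[simp]
theorem adj_left_assoc {x : B} (M : x ⟶ a.as) {Z : x ⟶ b.as} (z : obj l M ⟶ Z) :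
    map l (app A.unit M) ≫ app A.counit (obj l M) ≫ z = z := by
  rw [← Category.assoc, adj_left, Category.id_comp]

@[simp]
theorem adj_right_assoc {x : B} (M : x ⟶ b.as) {Z : x ⟶ a.as} (z : obj s M ⟶ Z) :
    app A.unit (obj s M) ≫ map s (app A.counit M) ≫ z = z := by
  rw [← Category.assoc, adj_right, Category.id_comp]

theorem app_homEquiv₂ {g : c ⟶ a} {h : c ⟶ b} (y : g ≫ l ⟶ h) {x : B} (M : x ⟶ c.as) :
    app (A.homEquiv₂ y) M = app A.unit (obj g M) ≫ map s (app y M) := by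
  simp [Adjunction.homEquiv₂_apply]

/-- The 2-morphisms into or out of a 1-morphism that starts at a zero object vanish. -/
theorem eq_zero_of_source {f g : a ⟶ b} (ha : 𝟙 (𝟙 a) = 0) (x : f ⟶ g) : x = 0 := by
  refine app_ext fun {y} M => ?_
  have h : 𝟙 M = 0 := by simpa using congrArg (fun t => app t M) ha
  rw [← Category.id_comp (app x M), ← map_id, h]
  simp

theorem eq_zero_of_target {f g : a ⟶ b} (hb : 𝟙 (𝟙 b) = 0) (x : f ⟶ g) : x = 0 := by
  refine app_ext fun {y} M => ?_
  have h : 𝟙 (obj f M) = 0 := by simpa using congrArg (fun t => app t (obj f M)) hb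
  rw [← Category.id_comp (app x M), h]
  simp

end Fn

section

variable {a b c : B} {l : a ⟶ b} {s : b ⟶ a} {A : l ⊣ s}

theorem deg_homEquiv₁ {d e e' : ℤ} (hA : A.counit ∈ deg k e _ _) {g : a ⟶ c} {h : b ⟶ c}
    {y : g ⟶ l ≫ h} (hy : y ∈ deg k d _ _) (H : d + e = e') : A.homEquiv₁ y ∈ deg k e' _ _ := by
  rw [Adjunction.homEquiv₁_apply]
  exact deg_cast k (deg_comp (deg_whiskerLeft _ hy) (deg_comp (deg_associator _ _ _).2
    (deg_comp (deg_whiskerRight _ hA) (deg_leftUnitor _).1))) (by omega)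

theorem deg_homEquiv₁_symm {d e e' : ℤ} (hA : A.unit ∈ deg k e _ _) {g : a ⟶ c} {h : b ⟶ c}
    {y : s ≫ g ⟶ h} (hy : y ∈ deg k d _ _) (H : d + e = e') :
    A.homEquiv₁.symm y ∈ deg k e' _ _ := by
  rw [Adjunction.homEquiv₁_symm_apply]
  exact deg_cast k (deg_comp (deg_leftUnitor _).2 (deg_comp (deg_whiskerRight _ hA)
    (deg_comp (deg_associator _ _ _).1 (deg_whiskerLeft _ hy)))) (by omega)

theorem deg_homEquiv₂ {d e e' : ℤ} (hA : A.unit ∈ deg k e _ _) {g : c ⟶ a} {h : c ⟶ b}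
    {y : g ≫ l ⟶ h} (hy : y ∈ deg k d _ _) (H : d + e = e') : A.homEquiv₂ y ∈ deg k e' _ _ := by
  rw [Adjunction.homEquiv₂_apply]
  exact deg_cast k (deg_comp (deg_rightUnitor _).2 (deg_comp (deg_whiskerLeft _ hA)
    (deg_comp (deg_associator _ _ _).2 (deg_whiskerRight _ hy)))) (by omega)

/-- Whiskering on the left as a linear map. -/
def whiskerLeftL (f : a ⟶ b) (g h : b ⟶ c) : (g ⟶ h) →ₗ[k] (f ≫ g ⟶ f ≫ h) where
  toFun x := f ◁ x
  map_add' := AddBicat.whiskerLeft_add f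
  map_smul' := GrBicat.whiskerLeft_smul f

/-- Whiskering on the right as a linear map. -/
def whiskerRightL (f g : a ⟶ b) (h : b ⟶ c) : (f ⟶ g) →ₗ[k] (f ≫ h ⟶ g ≫ h) where
  toFun x := x ▷ h
  map_add' x y := AddBicat.add_whiskerRight x y h
  map_smul' c x := GrBicat.smul_whiskerRight c x h

namespace Decomp

variable {a : B} {V W : a ⟶ a} {N : ℕ} {δ : ℕ → ℤ} (D : Decomp k V W N δ)

include D

theorem expand {g : a ⟶ a} (y : g ⟶ V) :
    y = (y ≫ D.v) ≫ D.u + ∑ j ∈ Finset.range N, (y ≫ D.q j) ≫ D.i j := by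
  conv_lhs => rw [← Category.comp_id y, ← D.total]
  simp [Preadditive.comp_add, Preadditive.comp_sum]

theorem expand_right {g f : a ⟶ b} (y : g ⟶ V ≫ f) :
    y = (y ≫ D.v ▷ f) ≫ D.u ▷ f + ∑ j ∈ Finset.range N, (y ≫ D.q j ▷ f) ≫ D.i j ▷ f := by
  have h := congrArg (whiskerRightL (k := k) V V f) D.total
  rw [_root_.map_add, _root_.map_sum] at h
  conv_lhs => rw [← Category.comp_id y, ← Bicategory.id_whiskerRight]
  change y ≫ whiskerRightL (k := k) V V f (𝟙 V) = _
  rw [← h]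
  simp [Preadditive.comp_add, Preadditive.comp_sum, whiskerRightL]

theorem expand_left {g f : b ⟶ a} (y : g ⟶ f ≫ V) :
    y = (y ≫ f ◁ D.v) ≫ f ◁ D.u + ∑ j ∈ Finset.range N, (y ≫ f ◁ D.q j) ≫ f ◁ D.i j := by
  have h := congrArg (whiskerLeftL (k := k) f V V) D.total
  rw [_root_.map_add, _root_.map_sum] at h
  conv_lhs => rw [← Category.comp_id y, ← Bicategory.whiskerLeft_id]
  change y ≫ whiskerLeftL (k := k) f V V (𝟙 V) = _
  rw [← h]
  simp [Preadditive.comp_add, Preadditive.comp_sum, whiskerLeftL]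

end Decomp

end

namespace Sys

variable {r : kˣ}

/-! ### Notions for a single action -/

section

variable (S : Sys k r B)

/-- The endomorphisms of `E` vanish in negative degrees and are scalars in degree zero. -/
def End₁ (m n : ℤ) (h : m + 2 = n) : Prop :=
  (∀ d < 0, ∀ x ∈ deg k d (S.E m n h) (S.E m n h), x = 0) ∧
    ∀ x ∈ deg k 0 (S.E m n h) (S.E m n h), ∃ c : k, x = c • 𝟙 _

/-- The endomorphisms of `E E` vanish below degree `-2` and are multiples of the crossing in degree
`-2`. -/
def End₂ (a b c : ℤ) (h : a + 2 = b) (h' : b + 2 = c) : Prop :=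
  (∀ d < -2, ∀ x ∈ deg k d (S.E a b h ≫ S.E b c h') (S.E a b h ≫ S.E b c h'), x = 0) ∧
    ∀ x ∈ deg k (-2) (S.E a b h ≫ S.E b c h') (S.E a b h ≫ S.E b c h'), ∃ z : k, x = z • S.T a b c h h'

/-- A left adjunction `F ⊣ E`, homogeneous of the degrees required in `U_Q(sl₂)`. -/
structure LAdj (m n : ℤ) (h : m + 2 = n) where
  adj : S.F n m h ⊣ S.E m n h
  deg_unit : adj.unit ∈ deg k (-(m + 1)) _ _
  deg_counit : adj.counit ∈ deg k (m + 1) _ _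

/-- The powers of `X`. -/
def Xp (m n : ℤ) (h : m + 2 = n) : ℕ → (S.E m n h ⟶ S.E m n h)
  | 0 => 𝟙 _
  | i + 1 => Xp m n h i ≫ S.X m n h

theorem deg_Xp (m n : ℤ) (h : m + 2 = n) (i : ℕ) : S.Xp m n h i ∈ deg k (2 * i) _ _ := by
  induction i with
  | zero => exact deg_cast k (deg_id _) (by simp)
  | succ i ih => exact deg_cast k (deg_comp ih (S.deg_X m n h)) (by push_cast; ring)

/-- The sideways crossing `E F ⟶ F E`. -/
def sigma (l n p : ℤ) (h : l + 2 = n) (h' : n + 2 = p) :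
    S.F n l h ≫ S.E l n h ⟶ S.E n p h' ≫ S.F p n h' :=
  (ρ_ _).inv ≫ _ ◁ (S.adj n p h').unit ≫ (α_ _ _ _).hom ≫
    _ ◁ ((α_ _ _ _).inv ≫ S.T l n p h h' ▷ _ ≫ (α_ _ _ _).hom) ≫
      (α_ _ _ _).inv ≫ (S.adj l n h).counit ▷ _ ≫ (λ_ _).hom

theorem deg_sigma (l n p : ℤ) (h : l + 2 = n) (h' : n + 2 = p) :
    S.sigma l n p h h' ∈ deg k 0 _ _ :=
  deg_cast k (deg_comp (deg_rightUnitor _).2 (deg_comp (deg_whiskerLeft _ (S.deg_unit n p h'))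
    (deg_comp (deg_associator _ _ _).1 (deg_comp (deg_whiskerLeft _ (deg_comp
      (deg_associator _ _ _).2 (deg_comp (deg_whiskerRight _ (S.deg_T l n p h h'))
        (deg_associator _ _ _).1))) (deg_comp (deg_associator _ _ _).2 (deg_comp
          (deg_whiskerRight _ (S.deg_counit l n h)) (deg_leftUnitor _).1)))))) (by omega)

end

section

open Fn

variable (S : Sys k r (Fn k B))

theorem slide_app (a b c : ℤ) (h : a + 2 = b) (h' : b + 2 = c) {x : B} (M : x ⟶ (S.o a).as) :
    app (S.X b c h') (obj (S.E a b h) M) ≫ app (S.T a b c h h') M =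
      app (S.T a b c h h') M ≫ map (S.E b c h') (app (S.X a b h) M) + (r : k) • 𝟙 _ := by
  have := congrArg (fun t => app t M) (S.slide a b c h h')
  simp only [app_sub, app_comp, app_whiskerLeft, app_whiskerRight, app_smul, app_id] at this
  exact sub_eq_iff_eq_add'.1 this

theorem slide'_app (a b c : ℤ) (h : a + 2 = b) (h' : b + 2 = c) {x : B} (M : x ⟶ (S.o a).as) :
    app (S.T a b c h h') M ≫ app (S.X b c h') (obj (S.E a b h) M) =
      map (S.E b c h') (app (S.X a b h) M) ≫ app (S.T a b c h h') M + (r : k) • 𝟙 _ := by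
  have := congrArg (fun t => app t M) (S.slide' a b c h h')
  simp only [app_sub, app_comp, app_whiskerLeft, app_whiskerRight, app_smul, app_id] at this
  exact sub_eq_iff_eq_add'.1 this

theorem T_sq_app (a b c : ℤ) (h : a + 2 = b) (h' : b + 2 = c) {x : B} (M : x ⟶ (S.o a).as) :
    app (S.T a b c h h') M ≫ app (S.T a b c h h') M = 0 := by
  rw [← app_comp, T_sq, app_zero]

theorem app_sigma (l n p : ℤ) (h : l + 2 = n) (h' : n + 2 = p) {x : B} (M : x ⟶ (S.o n).as) :
    app (S.sigma l n p h h') M = app (S.adj n p h').unit (obj (S.E l n h) (obj (S.F n l h) M)) ≫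
      map (S.F p n h') (app (S.T l n p h h') (obj (S.F n l h) M) ≫
        map (S.E n p h') (app (S.adj l n h).counit M)) := by
  simp [sigma]

theorem app_Xp_succ (m n : ℤ) (h : m + 2 = n) (i : ℕ) {x : B} (M : x ⟶ (S.o m).as) :
    app (S.Xp m n h (i + 1)) M = app (S.Xp m n h i) M ≫ app (S.X m n h) M := app_comp _ _ _

@[simp]
theorem app_Xp_zero (m n : ℤ) (h : m + 2 = n) {x : B} (M : x ⟶ (S.o m).as) :
    app (S.Xp m n h 0) M = 𝟙 _ := app_id _ _

/-- If `F ⊣ E` is homogeneous, then 2-morphisms `1 ⟶ E F` are adjoint to endomorphisms of `E`. -/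
theorem hom_one_eq_zero {l n : ℤ} {h : l + 2 = n} (L : S.LAdj l n h) (H : S.End₁ l n h) {d : ℤ}
    (hd : d + n - 1 < 0) {y : 𝟙 _ ⟶ S.F n l h ≫ S.E l n h} (hy : y ∈ deg k d _ _) : y = 0 := by
  have h1 := deg_homEquiv₁ L.deg_counit hy rfl
  have h2 := H.1 _ (by omega) _ (deg_comp (deg_rightUnitor _).2 h1)
  have h3 : L.adj.homEquiv₁ y = 0 := by
    rw [← Iso.hom_inv_id_assoc (ρ_ _) (L.adj.homEquiv₁ y), h2, Limits.comp_zero]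
  apply L.adj.homEquiv₁.injective
  rw [h3, Adjunction.homEquiv₁_apply]
  exact (app_ext fun M => by simp)

/-- The inductive step for the vanishing of endomorphisms of `E` of negative degree. -/
theorem end₁_step {l n p : ℤ} (h : l + 2 = n) (h' : n + 2 = p) (hn : n ≤ -1) (L : S.LAdj l n h)
    (H : S.End₁ l n h) : S.End₁ n p h' := by
  obtain ⟨D⟩ := S.comm_nonpos l n p h h' (by omega)
  have key : ∀ d ≤ 0, ∀ x ∈ deg k d (S.E n p h') (S.E n p h'), ∃ c : k,
      (S.adj n p h').homEquiv₂ ((λ_ _).hom ≫ x) = c • D.i 0 ∧ (d < 0 → c = 0) := by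
    intro d hd x hx
    have hy : (S.adj n p h').homEquiv₂ ((λ_ _).hom ≫ x) ∈ deg k (d + n + 1) _ _ :=
      deg_homEquiv₂ (S.deg_unit n p h') (deg_comp (deg_leftUnitor _).1 hx) (by ring)
    generalize (S.adj n p h').homEquiv₂ ((λ_ _).hom ≫ x) = y at hy ⊢
    -- Expand the mate `1 ⟶ F E` of `x` along `D`: the component in `E F` vanishes by degree, and so
    -- do all the components in `1`, except the one with index `0` when `d = 0`.
    have hv : y ≫ D.v = 0 := S.hom_one_eq_zero L H (d := d + n + 1) (by omega)
      (deg_cast k (deg_comp hy D.deg_v) (by ring))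
    have hq : ∀ j, j < (-n).toNat → y ≫ D.q j ∈ deg k (d - 2 * j) _ _ := fun j hj =>
      deg_cast k (deg_comp hy (D.deg_q j hj)) (by ring)
    have hq' : ∀ j, j < (-n).toNat → j ≠ 0 → y ≫ D.q j = 0 := fun j hj hj0 =>
      S.one_neg n _ (by omega) _ (hq j hj)
    have hN : (-n).toNat ≠ 0 := by omega
    have e := D.expand y
    rw [hv, Limits.zero_comp, zero_add, Finset.sum_eq_single 0 (fun j hj hj0 => by
      rw [hq' j (Finset.mem_range.1 hj) hj0, Limits.zero_comp]) (fun h0 => absurd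
        (Finset.mem_range.2 (Nat.pos_of_ne_zero hN)) h0)] at e
    rcases hd.lt_or_eq with hd | rfl
    · refine ⟨0, ?_, fun _ => rfl⟩
      rw [e, S.one_neg n _ (by push_cast; omega) _ (hq 0 (by omega))]; simp
    · obtain ⟨c, hc⟩ := S.one_zero n _ (deg_cast k (hq 0 (by omega)) (by simp))
      refine ⟨c, ?_, fun h => absurd h (lt_irrefl _)⟩
      rw [e, hc]; simp
  have inj : ∀ x y : S.E n p h' ⟶ S.E n p h', (S.adj n p h').homEquiv₂ ((λ_ _).hom ≫ x) =
      (S.adj n p h').homEquiv₂ ((λ_ _).hom ≫ y) → x = y := fun x y hxy => by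
    simpa using (S.adj n p h').homEquiv₂.injective hxy
  have smul : ∀ (c : k) (x : S.E n p h' ⟶ S.E n p h'),
      (S.adj n p h').homEquiv₂ ((λ_ _).hom ≫ (c • x)) =
        c • (S.adj n p h').homEquiv₂ ((λ_ _).hom ≫ x) := fun c x =>
    app_ext fun M => by simp [app_homEquiv₂]
  refine ⟨fun d hd x hx => ?_, fun x hx => ?_⟩
  · obtain ⟨c, hc, hc'⟩ := key d hd.le x hx
    refine inj _ _ ?_
    rw [hc, hc' hd, ← zero_smul k x, smul]
    simp
  · obtain ⟨c, hc, -⟩ := key 0 le_rfl x hx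
    obtain ⟨c', hc', -⟩ := key 0 le_rfl (𝟙 _) (deg_id _)
    -- The identity lies on the same line, so it spans it unless it is zero.
    by_cases h0 : c' = 0
    · refine ⟨0, ?_⟩
      have : 𝟙 (S.E n p h') = 0 := inj _ _ (by
        rw [hc', h0, ← zero_smul k (𝟙 (S.E n p h')), smul]; simp)
      rw [← Category.comp_id x, this]; simp
    · refine ⟨c / c', inj _ _ ?_⟩
      rw [smul, hc, hc', smul_smul, div_mul_cancel₀ _ h0]

end

end Sys

end

section

variable {k : Type t} [Field k] {B : Type u} [Bicategory.{w, v} B] [AddBicat B] [GrBicat k B]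

open GrBicat

/-- If an injective homogeneous map sends `x` and `y` to the same line and `x` is non-zero unless
`y` is zero, then `y` is a multiple of `x`. -/
theorem exists_smul_of_line {V W : Type*} [AddCommGroup V] [Module k V] [AddCommGroup W]
    [Module k W] (f : V → W) (hf : Function.Injective f) (hs : ∀ (c : k) x, f (c • x) = c • f x)
    (w₀ : W) {x y : V} (hx : ∃ c : k, f x = c • w₀) (hy : ∃ c : k, f y = c • w₀)
    (h : x = 0 → y = 0) : ∃ c : k, y = c • x := by
  obtain ⟨c, hc⟩ := hx
  obtain ⟨d, hd⟩ := hy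
  by_cases h0 : c = 0
  · refine ⟨0, ?_⟩
    have h1 : f 0 = 0 := by simpa using hs 0 0
    rw [zero_smul, h (hf (by rw [hc, h0, zero_smul, h1]))]
  · exact ⟨d / c, hf (by rw [hs, hc, hd, smul_smul, div_mul_cancel₀ _ h0])⟩

section

variable {a b c : B} {l : a ⟶ b} {s : b ⟶ a} (A : l ⊣ s)

theorem homEquiv₁_symm_smul {g : a ⟶ c} {h : b ⟶ c} (z : k) (y : s ≫ g ⟶ h) :
    A.homEquiv₁.symm (z • y) = z • A.homEquiv₁.symm y := by
  simp [Adjunction.homEquiv₁_symm_apply, GrBicat.whiskerLeft_smul]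

theorem homEquiv₂_smul {g : c ⟶ a} {h : c ⟶ b} (z : k) (y : g ≫ l ⟶ h) :
    A.homEquiv₂ (z • y) = z • A.homEquiv₂ y := by
  simp [Adjunction.homEquiv₂_apply, GrBicat.smul_whiskerRight]

@[simp] theorem AddBicat.whiskerLeft_zero {d : B} (f : a ⟶ b) (g h : b ⟶ d) :
    f ◁ (0 : g ⟶ h) = 0 := by
  simpa using AddBicat.whiskerLeft_add f (0 : g ⟶ h) 0

@[simp] theorem AddBicat.zero_whiskerRight {d : B} (f g : a ⟶ b) (h : b ⟶ d) :
    (0 : f ⟶ g) ▷ h = 0 := by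
  simpa using AddBicat.add_whiskerRight (0 : f ⟶ g) 0 h

theorem homEquiv₁_zero {g : a ⟶ c} {h : b ⟶ c} : A.homEquiv₁ (0 : g ⟶ l ≫ h) = 0 := by
  simp [Adjunction.homEquiv₁_apply]

theorem homEquiv₁_symm_zero {g : a ⟶ c} {h : b ⟶ c} :
    A.homEquiv₁.symm (0 : s ≫ g ⟶ h) = 0 := by
  simp [Adjunction.homEquiv₁_symm_apply]

end

namespace Sys

variable {r : kˣ} (S : Sys k r B)

/-! ### Endomorphisms of `E E` and of `E F` -/

/-- If `T` vanishes, so does the identity of `E E`. -/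
theorem id_eq_zero_of_T {a b c : ℤ} {h : a + 2 = b} {h' : b + 2 = c} (H : S.T a b c h h' = 0) :
    𝟙 (S.E a b h ≫ S.E b c h') = 0 := by
  have := S.slide a b c h h'
  rw [H] at this
  simp only [Limits.comp_zero, Limits.zero_comp, sub_zero] at this
  rw [← one_smul k (𝟙 _), ← r.inv_mul, mul_smul, ← this, smul_zero]

/-- The 2-morphisms `E ⟶ E F E` of the lowest possible degree form a line. -/
theorem triple {l n m : ℤ} {h : l + 2 = n} {h' : n + 2 = m} (hn : n ≤ -2) {L : S.LAdj l n h}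
    (H₁ : S.End₁ n m h') (H₂ : S.End₂ l n m h h')
    (D : Decomp k (S.E n m h' ≫ S.F m n h') (S.F n l h ≫ S.E l n h) (-n).toNat
      (fun j => n + 1 + 2 * j)) {d : ℤ} (hd : d ≤ n + 1)
    {y : S.E n m h' ⟶ (S.E n m h' ≫ S.F m n h') ≫ S.E n m h'} (hy : y ∈ deg k d _ _) :
    ∃ c : k, y = c • ((λ_ _).inv ≫ D.i 0 ▷ _) ∧ (d < n + 1 → c = 0) := by
  -- The component in `E E F` is adjoint to an endomorphism of `E E` of degree below `-2`.
  have hv : y ≫ D.v ▷ _ = 0 := by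
    have h1 : L.adj.homEquiv₁ ((y ≫ D.v ▷ _) ≫ (α_ _ _ _).hom) = 0 :=
      H₂.1 _ (by omega) _ (deg_homEquiv₁ L.deg_counit (deg_comp (deg_comp hy
        (deg_whiskerRight _ D.deg_v)) (deg_associator _ _ _).1) rfl)
    rw [← homEquiv₁_zero, L.adj.homEquiv₁.injective.eq_iff] at h1
    rw [← cancel_mono (α_ _ _ _).hom, h1, Limits.zero_comp]
  -- The components in `E` are endomorphisms of `E` of non-positive degree.
  have hq : ∀ j, j < (-n).toNat → (y ≫ D.q j ▷ _) ≫ (λ_ _).hom ∈ deg k (d - (n + 1) - 2 * j) _ _ :=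
    fun j hj => deg_cast k (deg_comp (deg_comp hy (deg_whiskerRight _ (D.deg_q j hj)))
      (deg_leftUnitor _).1) (by ring)
  have hq' : ∀ j, j < (-n).toNat → d - (n + 1) - 2 * j < 0 → y ≫ D.q j ▷ _ = 0 := by
    intro j hj h0
    rw [← cancel_mono (λ_ _).hom, H₁.1 _ h0 _ (hq j hj), Limits.zero_comp]
  have hN : 0 < (-n).toNat := by omega
  have e := D.expand_right y
  rw [hv, Limits.zero_comp, zero_add, Finset.sum_eq_single 0 (fun j hj hj0 => by
    rw [hq' j (Finset.mem_range.1 hj) (by omega), Limits.zero_comp]) (fun h0 => absurd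
      (Finset.mem_range.2 hN) h0)] at e
  rcases hd.lt_or_eq with hd | rfl
  · refine ⟨0, ?_, fun _ => rfl⟩
    rw [e, hq' 0 hN (by push_cast; omega)]; simp
  · obtain ⟨c, hc⟩ := H₁.2 _ (deg_cast k (hq 0 hN) (by simp))
    refine ⟨c, ?_, fun h => absurd h (lt_irrefl _)⟩
    rw [← Iso.eq_comp_inv] at hc
    rw [e, hc]; simp

/-- The inductive step for the determination of the endomorphisms of `E E` of degree at most
`-2`. -/
theorem end₂_step {l n m p : ℤ} {h : l + 2 = n} {h' : n + 2 = m} (h'' : m + 2 = p) (hn : n ≤ -2)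
    (L : S.LAdj l n h) (H₁ : S.End₁ n m h') (H₂ : S.End₂ l n m h h') : S.End₂ n m p h' h'' := by
  obtain ⟨D⟩ := S.comm_nonpos l n m h h' (by omega)
  obtain ⟨D'⟩ := S.comm_nonpos n m p h' h'' (by omega)
  -- the mate `E ⟶ F E E` of `z`; commuting `F` and `E` turns it into a 2-morphism `E ⟶ E F E`
  let f (z : S.E n m h' ≫ S.E m p h'' ⟶ S.E n m h' ≫ S.E m p h'') :=
    (S.adj m p h'').homEquiv₂ z ≫ (α_ _ _ _).hom
  have hf : Function.Injective f := fun x y hxy => by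
    simpa [f] using hxy
  have hs : ∀ (c : k) x, f (c • x) = c • f x := fun c x => by
    simp [f, homEquiv₂_smul]
  have key : ∀ d ≤ -2, ∀ z ∈ deg k d _ _, ∃ c : k,
      f z = c • (((λ_ _).inv ≫ D.i 0 ▷ _) ≫ (α_ _ _ _).hom ≫ _ ◁ D'.u) ∧ (d < -2 → c = 0) := by
    intro d hd z hz
    have hy : f z ∈ deg k (d + m + 1) _ _ := deg_cast k (deg_comp (deg_homEquiv₂
      (S.deg_unit m p h'') hz rfl) (deg_associator _ _ _).1) (by ring)
    generalize f z = y at hy ⊢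
    have hq : ∀ j, j < (-m).toNat → y ≫ _ ◁ D'.q j = 0 := fun j hj => by
      have := H₁.1 _ (by omega) _ (deg_comp (deg_comp hy (deg_whiskerLeft _ (D'.deg_q j hj)))
        (deg_rightUnitor _).1)
      rw [← cancel_mono (ρ_ _).hom, this, Limits.zero_comp]
    have e := D'.expand_left y
    rw [Finset.sum_eq_zero (fun j hj => by
      rw [hq j (Finset.mem_range.1 hj), Limits.zero_comp]), add_zero] at e
    obtain ⟨c, hc, hc'⟩ := S.triple hn (L := L) H₁ H₂ D (d := d + m + 1) (by omega)
      (y := (y ≫ _ ◁ D'.v) ≫ (α_ _ _ _).inv)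
      (deg_cast k (deg_comp (deg_comp hy (deg_whiskerLeft _ D'.deg_v)) (deg_associator _ _ _).2)
        (by ring))
    refine ⟨c, ?_, fun h => hc' (by omega)⟩
    rw [Iso.comp_inv_eq] at hc
    rw [e, hc]; simp
  refine ⟨fun d hd z hz => ?_, fun z hz => ?_⟩
  · obtain ⟨c, hc, hc'⟩ := key d hd.le z hz
    refine hf ?_
    rw [hc, hc' hd, ← zero_smul k z, hs, zero_smul, zero_smul]
  · obtain ⟨c, hc, -⟩ := key _ le_rfl z hz
    -- The crossing lies on the same line; if it is zero, then so is the identity of `E E`.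
    obtain ⟨c', hc', -⟩ := key _ le_rfl _ (S.deg_T n m p h' h'')
    refine exists_smul_of_line f hf hs _ ⟨c', hc'⟩ ⟨c, hc⟩ fun h0 => ?_
    rw [← Category.comp_id z, S.id_eq_zero_of_T h0, Limits.comp_zero]

/-- The endomorphisms of `E F` of degree zero are scalars, in weights below `1`. -/
theorem end_EF {l n m : ℤ} {h : l + 2 = n} {h' : n + 2 = m} (hn : n ≤ -2) (L : S.LAdj l n h)
    (H₁ : S.End₁ n m h') (H₂ : S.End₂ l n m h h') (z : S.F m n h' ≫ S.E n m h' ⟶ _)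
    (hz : z ∈ deg k 0 _ (S.F m n h' ≫ S.E n m h')) : ∃ c : k, z = c • 𝟙 _ := by
  obtain ⟨D⟩ := S.comm_nonpos l n m h h' (by omega)
  let f (z : S.F m n h' ≫ S.E n m h' ⟶ S.F m n h' ≫ S.E n m h') :=
    (S.adj n m h').homEquiv₁.symm z ≫ (α_ _ _ _).inv
  have hf : Function.Injective f := fun x y hxy => by
    simpa [f] using hxy
  have hs : ∀ (c : k) x, f (c • x) = c • f x := fun c x => by
    simp [f, homEquiv₁_symm_smul]
  have key : ∀ z ∈ deg k 0 _ _, ∃ c : k, f z = c • ((λ_ _).inv ≫ D.i 0 ▷ _) := by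
    intro z hz
    obtain ⟨c, hc, -⟩ := S.triple hn (L := L) H₁ H₂ D le_rfl (y := f z)
      (deg_cast k (deg_comp (deg_homEquiv₁_symm (S.deg_unit n m h') hz rfl)
        (deg_associator _ _ _).2) (by ring))
    exact ⟨c, hc⟩
  refine exists_smul_of_line f hf hs _ (key _ (deg_id _)) (key z hz) fun h0 => ?_
  rw [← Category.comp_id z, h0, Limits.comp_zero]

end Sys

end

section

variable {k : Type t} [Field k] {B : Type u} [Bicategory.{w, v} B] [AddBicat B] [GrBicat k B]

open GrBicat

/-! ### Polynomial identities in nilHecke algebras -/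

section

variable {A : Type*} [Ring A] [Algebra k A] {x y s : A} {z : k}

theorem pow_mul_crossing (h : x * s = s * y + z • 1) (j : ℕ) :
    x ^ j * s = s * y ^ j + z • ∑ a ∈ Finset.range j, x ^ a * y ^ (j - 1 - a) := by
  induction j with
  | zero => simp
  | succ j ih =>
    have e : ∑ a ∈ Finset.range (j + 1), x ^ a * y ^ (j + 1 - 1 - a) =
        (∑ a ∈ Finset.range j, x ^ a * y ^ (j - 1 - a)) * y + x ^ j := by
      rw [Finset.sum_range_succ, Finset.sum_mul]
      congr 1
      · refine Finset.sum_congr rfl fun a ha => ?_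
        have := Finset.mem_range.1 ha
        rw [mul_assoc, ← pow_succ, show j - 1 - a + 1 = j + 1 - 1 - a by omega]
      · simp
    rw [e, pow_succ, mul_assoc, h, mul_add, ← mul_assoc, ih, add_mul, smul_add, pow_succ, add_assoc]
    simp [mul_assoc]

theorem crossing_mul_pow (hxy : Commute x y) (h : s * x = y * s + z • 1) (j : ℕ) :
    s * x ^ j = y ^ j * s + z • ∑ a ∈ Finset.range j, x ^ a * y ^ (j - 1 - a) := by
  induction j with
  | zero => simp
  | succ j ih =>
    have e : ∑ a ∈ Finset.range (j + 1), x ^ a * y ^ (j + 1 - 1 - a) =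
        (∑ a ∈ Finset.range j, x ^ a * y ^ (j - 1 - a)) * x + y ^ j := by
      rw [Finset.sum_range_succ', Finset.sum_mul]
      congr 1
      · refine Finset.sum_congr rfl fun a ha => ?_
        rw [mul_assoc, ← (hxy.pow_right _).eq, ← mul_assoc, ← pow_succ,
          show j - 1 - a = j + 1 - 1 - (a + 1) by omega]
      · simp
    rw [e, pow_succ, ← mul_assoc, ih, add_mul, mul_assoc, h, mul_add, ← mul_assoc, ← pow_succ,
      smul_add, add_assoc]
    simp [add_comm]

/-- If `y` is a root of a polynomial, then `x` is a root of its divided difference in `x` and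
`y`. -/
theorem divided_difference_eq_zero {c : kˣ} (h : x * s = s * y + (c : k) • 1)
    (h' : s * x = y * s + (c : k) • 1) (hs : s * s = 0) (hxy : Commute x y) (m : ℕ) (f : ℕ → A)
    (hfx : ∀ j, Commute (f j) x) (hfs : ∀ j, Commute (f j) s)
    (H : ∑ j ∈ Finset.range (m + 2), y ^ j * f j = 0) :
    ∑ a ∈ Finset.range (m + 1), x ^ a * ∑ j ∈ Finset.Ico (a + 1) (m + 2), y ^ (j - 1 - a) * f j =
      0 := by
  -- Let `P` be the polynomial evaluated at `x`, and let `Q` be the divided difference. As the value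
  -- at `y` vanishes, `P s = c Q = s P`; hence `s Q = Q s = 0`, and `Q` commutes with `x`, so that
  -- `c Q = Q (x s - s y) = 0`.
  set Q := ∑ a ∈ Finset.range (m + 1),
    x ^ a * ∑ j ∈ Finset.Ico (a + 1) (m + 2), y ^ (j - 1 - a) * f j with hQ
  have eQ : Q = ∑ j ∈ Finset.range (m + 2),
      (∑ a ∈ Finset.range j, x ^ a * y ^ (j - 1 - a)) * f j := by
    simp only [hQ, Finset.mul_sum, Finset.sum_mul]
    rw [Finset.sum_comm' (t' := Finset.range (m + 2)) (s' := fun j => Finset.range j)]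
    · simp only [mul_assoc]
    · intro a j
      simp only [Finset.mem_range, Finset.mem_Ico]
      omega
  set P := ∑ j ∈ Finset.range (m + 2), x ^ j * f j with hP
  have h1 : P * s = (c : k) • Q := by
    have : P * s = s * (∑ j ∈ Finset.range (m + 2), y ^ j * f j) + (c : k) • Q := by
      rw [hP, eQ, Finset.sum_mul, Finset.mul_sum, Finset.smul_sum, ← Finset.sum_add_distrib]
      refine Finset.sum_congr rfl fun j _ => ?_
      rw [mul_assoc, (hfs j).eq, ← mul_assoc, pow_mul_crossing h, add_mul, mul_assoc,
        smul_mul_assoc]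
    rw [this, H, mul_zero, zero_add]
  have h2 : s * P = (c : k) • Q := by
    have : s * P = (∑ j ∈ Finset.range (m + 2), y ^ j * f j) * s + (c : k) • Q := by
      rw [hP, eQ, Finset.sum_mul, Finset.mul_sum, Finset.smul_sum, ← Finset.sum_add_distrib]
      refine Finset.sum_congr rfl fun j _ => ?_
      rw [mul_assoc, (hfs j).eq, ← mul_assoc, crossing_mul_pow hxy h', add_mul, mul_assoc,
        smul_mul_assoc]
    rw [this, H, zero_mul, zero_add]
  have inj : ∀ q : A, (c : k) • q = 0 → q = 0 := fun q hq => by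
    rw [← one_smul k q, ← c.inv_mul, mul_smul, hq, smul_zero]
  have h3 : s * Q = 0 := inj _ (by rw [← mul_smul_comm, ← h2, ← mul_assoc, hs, zero_mul])
  have h4 : Q * s = 0 := inj _ (by rw [← smul_mul_assoc, ← h1, mul_assoc, hs, mul_zero])
  have hx : x * Q = Q * x := by
    rw [eQ]
    refine (Commute.sum_right _ _ _ fun j _ => Commute.mul_right (Commute.sum_right _ _ _
      fun a _ => Commute.mul_right ?_ (hxy.pow_right _)) (hfx j).symm)
    exact (Commute.refl x).pow_right a
  refine inj _ ?_
  calc (c : k) • Q = Q * ((c : k) • 1) := by simp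
    _ = Q * (x * s - s * y) := by rw [h]; simp
    _ = 0 := by rw [mul_sub, ← mul_assoc, ← hx, mul_assoc, h4, ← mul_assoc, h4]; simp

end

namespace Sys

open Fn

variable {r : kˣ} (S : Sys k r (Fn k B))

/-! ### Powers of `E` -/

/-- The weight `n + 2 * j`, defined so that the powers of `E` compose strictly. -/
def tgt : ℕ → ℤ → ℤ
  | 0, n => n
  | j + 1, n => tgt j (n + 2)

theorem tgt_add_two (j : ℕ) (n : ℤ) : tgt j n + 2 = tgt j (n + 2) := by
  induction j generalizing n with
  | zero => rfl
  | succ j ih => exact ih (n + 2)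

/-- The `j`-th power of `E`. -/
def It : (j : ℕ) → (n : ℤ) → (S.o n ⟶ S.o (tgt j n))
  | 0, n => 𝟙 (S.o n)
  | j + 1, n => S.E n (n + 2) rfl ≫ It j (n + 2)

theorem of_app_pow (m n : ℤ) (h : m + 2 = n) {x : B} (M : x ⟶ (S.o m).as) (j : ℕ) :
    End.of (app (S.X m n h) M) ^ j = End.of (app (S.Xp m n h j) M) := by
  induction j with
  | zero => rw [app_Xp_zero]; rfl
  | succ j ih => rw [app_Xp_succ, pow_succ', ih]; rfl

theorem of_map_pow (m n : ℤ) (h : m + 2 = n) {x : B} (M : x ⟶ (S.o m).as) {c : Fn k B}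
    (f : S.o n ⟶ c) (j : ℕ) :
    End.of (map f (app (S.X m n h) M)) ^ j = End.of (map f (app (S.Xp m n h j) M)) := by
  induction j with
  | zero => rw [app_Xp_zero, map_id]; rfl
  | succ j ih => rw [app_Xp_succ, pow_succ', map_comp, ih]; rfl

/-- If the dot on `E M` is a root of a monic polynomial of degree `m`, with coefficients that come from
`M`, then the power `m + 1` of `E` vanishes on `M`. -/
theorem It_eq_zero_of_monic (m : ℕ) (n : ℤ) {x : B} (M : x ⟶ (S.o n).as) (f : ℕ → (M ⟶ M))
    (hf : f m = 𝟙 M)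
    (H : ∑ j ∈ Finset.range (m + 1),
      map (S.E n (n + 2) rfl) (f j) ≫ app (S.Xp n (n + 2) rfl j) M = 0) :
    𝟙 (obj (S.It (m + 1) n) M) = 0 := by
  induction m generalizing n M with
  | zero =>
    rw [zero_add, Finset.sum_range_one, hf, map_id, app_Xp_zero, Category.comp_id] at H
    exact H
  -- The divided difference is a monic polynomial of degree `m` in the dot on the outer strand
  -- of `E E M`, with coefficients that come from `E M`.
  | succ m ih =>
    let E' := S.E (n + 2) (n + 2 + 2) rfl
    let E₀ := S.E n (n + 2) rfl
    refine ih (n + 2) (obj E₀ M) (fun a => ∑ j ∈ Finset.Ico (a + 1) (m + 2),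
      map E₀ (f j) ≫ app (S.Xp n (n + 2) rfl (j - 1 - a)) M) ?_ ?_
    · simp [hf]
      rfl
    · have key := divided_difference_eq_zero (A := End (obj E' (obj E₀ M)))
        (x := End.of (app (S.X (n + 2) (n + 2 + 2) rfl) (obj E₀ M)))
        (y := End.of (map E' (app (S.X n (n + 2) rfl) M)))
        (s := End.of (app (S.T n (n + 2) (n + 2 + 2) rfl rfl) M))
        (c := r) (S.slide'_app _ _ _ _ _ M) (S.slide_app _ _ _ _ _ M) (S.T_sq_app _ _ _ _ _ M)
        (app_naturality _ _) m (fun j => End.of (map E' (map E₀ (f j))))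
        (fun j => (app_naturality _ _).symm) (fun j => by
          have := app_naturality (S.T n (n + 2) (n + 2 + 2) rfl rfl) (f j)
          simp only [Fn.comp_map] at this
          exact this.symm) ?_
      · refine Eq.trans (Finset.sum_congr rfl fun a _ => ?_) key
        rw [of_app_pow, Fn.map_sum, End.mul_def, Preadditive.sum_comp, End.of]
        refine Eq.trans (Finset.sum_congr rfl fun j _ => ?_) (Preadditive.sum_comp _ _ _).symm
        rw [of_map_pow, map_comp]
        rfl
      · have := congrArg (map E') H
        rw [Fn.map_sum, Fn.map_zero] at this
        refine Eq.trans (Finset.sum_congr rfl fun a _ => ?_) this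
        rw [of_map_pow, map_comp]
        rfl

end Sys

end

section

variable {k : Type t} [Field k] {B : Type u} [Bicategory.{w, v} B] [AddBicat B] [GrBicat k B]

open GrBicat

/-! ### Graded dimensions -/

variable (k) in
/-- The graded dimension of the space of 2-morphisms `L ⟶ V`. -/
noncomputable def gdim {x y : B} (L V : x ⟶ y) (p : ℤ) : ℤ := Module.finrank k (deg k p L V)

/-- Multiplication of a graded dimension by the quantum integer `[v]`. -/
def qmul (v : ℤ) (f : ℤ → ℤ) (p : ℤ) : ℤ :=
  ∑ i ∈ Finset.range v.toNat, f (p - (v - 1 - 2 * i)) -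
    ∑ i ∈ Finset.range (-v).toNat, f (p - (v + 1 + 2 * i))

theorem qmul_neg (v : ℤ) (f : ℤ → ℤ) (p : ℤ) : qmul (-v) f p = - qmul v f p := by
  have key : ∀ w : ℤ, ∑ i ∈ Finset.range w.toNat, f (p - (w - 1 - 2 * i)) =
      ∑ i ∈ Finset.range w.toNat, f (p - (-w + 1 + 2 * i)) := fun w => by
    rw [← Finset.sum_range_reflect]
    refine Finset.sum_congr rfl fun i hi => ?_
    have := Finset.mem_range.1 hi
    congr 2
    omega
  have h1 := key v
  have h2 := key (-v)
  simp only [neg_neg] at h2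
  simp only [qmul, neg_neg]
  rw [← h1, h2]
  ring

theorem qmul_nonneg {v : ℤ} (hv : 0 ≤ v) {f : ℤ → ℤ} (hf : ∀ p, 0 ≤ f p) (p : ℤ) :
    0 ≤ qmul v f p := by
  rw [qmul, show (-v).toNat = 0 by omega]
  simpa using Finset.sum_nonneg fun i _ => hf _

/-- The quantum integers `[n + 2 * i]`, for `0 ≤ i ≤ j < -n`, add up to something negative. -/
theorem exists_sum_qmul_neg {n : ℤ} {j : ℕ} (hj : (j : ℤ) < -n) {f : ℤ → ℤ} (hf : ∀ p, 0 ≤ f p)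
    (h0 : 0 < f 0) : ∃ p, ∑ i ∈ Finset.range (j + 1), qmul (n + 2 * i) f p < 0 := by
  -- At `p = -n - 1` the quantum integer `[-n]` picks up the value `f 0`.
  have pos : 0 < qmul (-n) f (-n - 1) := by
    rw [qmul, show (- -n).toNat = 0 by omega, Finset.range_zero, Finset.sum_empty, sub_zero]
    refine Finset.sum_pos' (fun i _ => hf _) ⟨0, Finset.mem_range.2 (by omega), ?_⟩
    simpa using h0
  refine ⟨-n - 1, ?_⟩
  -- If no positive quantum integer occurs, all the terms are non-positive and the first one is
  -- negative. Otherwise, the terms with `i` and `-n - i` cancel in the sum over all `i ≤ -n`, and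
  -- the terms that are missing here are non-negative, the last one being positive.
  by_cases hj' : n + 2 * j ≤ 0
  · rw [Finset.sum_range_succ']
    have : ∑ i ∈ Finset.range j, qmul (n + 2 * ((i + 1 : ℕ) : ℤ)) f (-n - 1) ≤ 0 := by
      refine Finset.sum_nonpos fun i hi => ?_
      have := Finset.mem_range.1 hi
      rw [← neg_neg (n + _), qmul_neg]
      exact neg_nonpos.2 (qmul_nonneg (by push_cast; omega) hf _)
    rw [qmul_neg] at pos
    simp only [Nat.cast_zero, mul_zero, add_zero]
    omega
  · obtain ⟨N, rfl⟩ : ∃ N : ℕ, n = -N := ⟨(-n).toNat, by omega⟩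
    have hz : ∑ i ∈ Finset.range (N + 1), qmul (-N + 2 * i) f (- -N - 1) = 0 := by
      have h1 := Finset.sum_range_reflect (fun i : ℕ => qmul (-N + 2 * i) f (- -N - 1)) (N + 1)
      have h2 : ∑ i ∈ Finset.range (N + 1), qmul (-N + 2 * ((N + 1 - 1 - i : ℕ) : ℤ)) f (- -N - 1) =
          - ∑ i ∈ Finset.range (N + 1), qmul (-N + 2 * i) f (- -N - 1) := by
        rw [← Finset.sum_neg_distrib]
        refine Finset.sum_congr rfl fun i hi => ?_
        have := Finset.mem_range.1 hi
        rw [← qmul_neg]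
        congr 1
        omega
      omega
    have hsplit := Finset.sum_range_add_sum_Ico
      (fun i : ℕ => qmul (-N + 2 * i) f (- -N - 1)) (show j + 1 ≤ N + 1 by omega)
    have : 0 < ∑ i ∈ Finset.Ico (j + 1) (N + 1), qmul (-N + 2 * i) f (- -N - 1) := by
      refine Finset.sum_pos' (fun i hi => ?_) ⟨N, Finset.mem_Ico.2 ⟨by omega, by omega⟩, ?_⟩
      · have := Finset.mem_Ico.1 hi
        exact qmul_nonneg (by omega) hf _
      · rw [show -(N : ℤ) + 2 * N = - -N by ring]
        exact pos
    omega

open Fn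

theorem id_obj_eq_zero {a b : Fn k B} (f : a ⟶ b) {x : B} {M : x ⟶ a.as} (h : 𝟙 M = 0) :
    𝟙 (obj f M) = 0 := by
  rw [← Fn.map_id, h, Fn.map_zero]

/-- The graded dimensions attached to the parts of a decomposition. -/
theorem Decomp.gdim_eq {a b : Fn k B} {V W : a ⟶ a} {N : ℕ} {δ : ℕ → ℤ} (D : Decomp k V W N δ)
    (G : a ⟶ b) {x : B} (M : x ⟶ a.as) (L : x ⟶ b.as)
    (fin : ∀ p (M : x ⟶ b.as), FiniteDimensional k (deg k p L M)) (p : ℤ) :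
    gdim k L (obj G (obj V M)) p = gdim k L (obj G (obj W M)) p +
      ∑ j ∈ Finset.range N, gdim k L (obj G M) (p - δ j) := by
  have e : deg k p L (obj G (obj V M)) ≃ₗ[k] deg k p L (obj G (obj W M)) ×
      ((j : Fin N) → deg k (p - δ j) L (obj G M)) :=
    { toFun z := (⟨z.1 ≫ map G (app D.v M),
          deg_cast k (deg_comp z.2 (deg_map G (deg_app D.deg_v M))) (by ring)⟩,
        fun j => ⟨z.1 ≫ map G (app (D.q j) M),
          deg_cast k (deg_comp z.2 (deg_map G (deg_app (D.deg_q j j.2) M))) (by ring)⟩)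
      invFun z := ⟨z.1.1 ≫ map G (app D.u M) + ∑ j : Fin N, (z.2 j).1 ≫ map G (app (D.i j) M),
        Submodule.add_mem _ (deg_cast k (deg_comp z.1.2 (deg_map G (deg_app D.deg_u M)))
          (by ring)) (Submodule.sum_mem _ fun j _ => deg_cast k (deg_comp (z.2 j).2
            (deg_map G (deg_app (D.deg_i j j.2) M))) (by ring))⟩
      map_add' z z' := by
        refine Prod.ext (Subtype.ext ?_) (funext fun j => Subtype.ext ?_) <;> simp
      map_smul' c z := by
        refine Prod.ext (Subtype.ext ?_) (funext fun j => Subtype.ext ?_) <;> simp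
      left_inv z := by
        refine Subtype.ext ?_
        have := congrArg (fun t => z.1 ≫ map G (app t M)) D.total
        simp only [app_add, app_comp, app_sum, Fn.map_add, Fn.map_comp, Fn.map_sum, app_id,
          Fn.map_id, Category.comp_id, Preadditive.comp_add, Preadditive.comp_sum] at this
        rw [← Fin.sum_univ_eq_sum_range
          (fun j => z.1 ≫ map G (app (D.q j) M) ≫ map G (app (D.i j) M))] at this
        simpa using this
      right_inv z := by
        have huv := congrArg (fun t => map G (app t M)) D.u_v
        have huq := fun (j : Fin N) => congrArg (fun t => map G (app t M)) (D.u_q j j.2)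
        have hiv := fun (j : Fin N) => congrArg (fun t => map G (app t M)) (D.i_v j j.2)
        have hiq := fun (j l : Fin N) =>
          congrArg (fun t => map G (app t M)) (D.i_q j j.2 l l.2)
        simp only [app_comp, Fn.map_comp, app_id, Fn.map_id, app_zero, Fn.map_zero,
          Fin.val_inj] at huv huq hiv hiq
        refine Prod.ext (Subtype.ext ?_) (funext fun j => Subtype.ext ?_)
        · simp [Preadditive.sum_comp, huv, hiv]
        · have : ∀ l : Fin N, (z.2 l).1 ≫ map G (app (D.i l) M) ≫ map G (app (D.q j) M) =
              if l = j then (z.2 j).1 else 0 := fun l => by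
            rw [hiq]
            split
            · next h => subst h; simp
            · simp
          simp [Preadditive.sum_comp, huq, this] }
  have := fin
  rw [gdim, e.finrank_eq, Module.finrank_prod, Module.finrank_pi_fintype, Nat.cast_add,
    Nat.cast_sum, ← Fin.sum_univ_eq_sum_range (fun j => gdim k L (obj G M) (p - δ j))]
  rfl

namespace Sys

variable {r : kˣ} (S : Sys k r (Fn k B))

theorem finiteDimensional_deg {m n : ℤ} (p : ℤ) (L V : (S.o m).as ⟶ (S.o n).as) :
    FiniteDimensional k (deg k p L V) :=
  S.fin m n p (ofHom L) (ofHom V)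

/-- The commutation of `E` and `F` on graded dimensions. -/
theorem gdim_commutator {l n p : ℤ} (h : l + 2 = n) (h' : n + 2 = p) {m : ℤ} {b : ℤ}
    (G : S.o n ⟶ S.o b) (M : (S.o m).as ⟶ (S.o n).as) (L : (S.o m).as ⟶ (S.o b).as) (d : ℤ) :
    gdim k L (obj G (obj (S.E l n h) (obj (S.F n l h) M))) d =
      gdim k L (obj G (obj (S.F p n h') (obj (S.E n p h') M))) d +
        qmul n (gdim k L (obj G M)) d := by
  rcases le_total n 0 with hn | hn
  · obtain ⟨D⟩ := S.comm_nonpos l n p h h' hn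
    have := D.gdim_eq G M L (fun p M => S.finiteDimensional_deg p _ _) d
    rw [obj_comp, obj_comp] at this
    rw [this, qmul, show n.toNat = 0 by omega]
    simp
  · obtain ⟨D⟩ := S.comm_nonneg l n p h h' hn
    have := D.gdim_eq G M L (fun p M => S.finiteDimensional_deg p _ _) d
    rw [obj_comp, obj_comp] at this
    rw [this, qmul, show (-n).toNat = 0 by omega]
    simp

/-- Moving an `F` through a power of `E` changes the graded dimension by quantum integers. -/
theorem gdim_It (j : ℕ) {l n : ℤ} (h : l + 2 = n) {m : ℤ} (M : (S.o m).as ⟶ (S.o n).as)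
    (L : (S.o m).as ⟶ (S.o (tgt j n)).as) (d : ℤ) :
    gdim k L (obj (S.It j n) (obj (S.E l n h) (obj (S.F n l h) M))) d =
      gdim k L (obj (S.F _ _ (tgt_add_two j n)) (obj (S.It (j + 1) n) M)) d +
        ∑ i ∈ Finset.range (j + 1), qmul (n + 2 * i) (gdim k L (obj (S.It j n) M)) d := by
  induction j generalizing l n with
  | zero =>
    have := S.gdim_commutator h rfl (𝟙 _) M L d
    rw [Finset.sum_range_one, Nat.cast_zero, mul_zero, add_zero]
    exact this
  | succ j ih =>
    have h1 := S.gdim_commutator h rfl (S.It (j + 1) n) M L d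
    have h2 := ih (l := n) rfl (obj (S.E n (n + 2) rfl) M) L
    rw [Finset.sum_range_succ']
    refine h1.trans ?_
    refine (congrArg (· + qmul n _ d) h2).trans ?_
    rw [add_assoc]
    simp only [Nat.cast_zero, mul_zero, add_zero]
    congr 2
    refine Finset.sum_congr rfl fun i _ => ?_
    rw [show n + 2 + 2 * (i : ℤ) = n + 2 * ((i + 1 : ℕ) : ℤ) by push_cast; ring]
    rfl

/-- The powers `E ^ j` do not vanish on non-zero 1-morphisms of weight `n`, for `j ≤ -n`. -/
theorem It_ne_zero {m n : ℤ} (M : (S.o m).as ⟶ (S.o n).as) (hM : 𝟙 M ≠ 0) (j : ℕ)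
    (hj : (j : ℤ) ≤ -n) : 𝟙 (obj (S.It j n) M) ≠ 0 := by
  induction j with
  | zero => exact hM
  | succ j ih =>
    intro h0
    have h1 := ih (by omega)
    set L := obj (S.It j n) M
    have fin := fun p (V : (S.o m).as ⟶ (S.o (tgt j n)).as) => S.finiteDimensional_deg p L V
    have hpos : 0 < gdim k L L 0 := by
      have : Nontrivial (deg k 0 L L) := ⟨⟨⟨𝟙 L, deg_id L⟩, 0, fun h => h1 (congrArg Subtype.val h)⟩⟩
      have := Module.finrank_pos (R := k) (M := deg k 0 L L)
      rw [gdim]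
      omega
    -- Apply `gdim_It` to `L = E ^ j M`. If `E ^ (j + 1) M` vanished, a sum with a negative
    -- coefficient would be a graded dimension.
    obtain ⟨p, hp⟩ := exists_sum_qmul_neg (n := n) (j := j) (by omega)
      (f := gdim k L L) (fun p => Int.natCast_nonneg _) hpos
    have h2 := S.gdim_It j (sub_add_cancel n 2) M L p
    have h3 : gdim k L (obj (S.F _ _ (tgt_add_two j n)) (obj (S.It (j + 1) n) M)) p = 0 := by
      have : Subsingleton (deg k p L (obj (S.F _ _ (tgt_add_two j n))
          (obj (S.It (j + 1) n) M))) := by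
        refine ⟨fun y z => Subtype.ext ?_⟩
        have e := id_obj_eq_zero (S.F _ _ (tgt_add_two j n)) h0
        exact ((Category.comp_id y.1).symm.trans (congrArg (y.1 ≫ ·) e)).trans
          ((Limits.comp_zero.trans Limits.comp_zero.symm).trans
            ((congrArg (z.1 ≫ ·) e).symm.trans (Category.comp_id z.1)))
      rw [gdim, Module.finrank_zero_of_subsingleton]
      rfl
    rw [h3, zero_add] at h2
    exact absurd hp (not_lt.2 ((Int.natCast_nonneg _).trans_eq h2))

end Sys

end

section

variable {k : Type t} [Field k] {B : Type u} [Bicategory.{w, v} B] [AddBicat B] [GrBicat k B]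

open GrBicat

namespace Fn

variable {a b : Fn k B} {l : a ⟶ b} {s : b ⟶ a} (A : l ⊣ s)

theorem counit_naturality {x : B} {M N : x ⟶ b.as} (m : M ⟶ N) :
    map l (map s m) ≫ app A.counit N = app A.counit M ≫ m := by
  simpa using app_naturality A.counit m

end Fn

namespace Sys

variable {r : kˣ}

/-! ### Cups with dots -/

section

variable (S : Sys k r B)

/-- The cup `1 ⟶ F E` with `j` dots. -/
def cupX (m n : ℤ) (h : m + 2 = n) (j : ℕ) : 𝟙 _ ⟶ S.E m n h ≫ S.F n m h :=
  (S.adj m n h).unit ≫ S.Xp m n h j ▷ S.F n m h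

theorem deg_cupX (m n : ℤ) (h : m + 2 = n) (j : ℕ) :
    S.cupX m n h j ∈ deg k (m + 1 + 2 * j) _ _ :=
  deg_comp (S.deg_unit m n h) (deg_whiskerRight _ (S.deg_Xp m n h j))

end

open Fn

variable (S : Sys k r (Fn k B))

theorem app_cupX (m n : ℤ) (h : m + 2 = n) (j : ℕ) {x : B} (M : x ⟶ (S.o m).as) :
    app (S.cupX m n h j) M = app (S.adj m n h).unit M ≫ map (S.F n m h) (app (S.Xp m n h j) M) := by
  simp [cupX]

theorem map_cupX_counit (m n : ℤ) (h : m + 2 = n) (j : ℕ) {x : B} (M : x ⟶ (S.o m).as) :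
    map (S.E m n h) (app (S.cupX m n h j) M) ≫ app (S.adj m n h).counit (obj (S.E m n h) M) =
      app (S.Xp m n h j) M := by
  rw [app_cupX, Fn.map_comp, Category.assoc, counit_naturality, adj_left_assoc]

theorem It_succ_eq_zero (j : ℕ) (n : ℤ) {x : B} (M : x ⟶ (S.o n).as)
    (h : 𝟙 (obj (S.It j n) M) = 0) : 𝟙 (obj (S.It (j + 1) n) M) = 0 := by
  induction j generalizing n M with
  | zero => exact id_obj_eq_zero (S.E n (n + 2) rfl) h
  | succ j ih => exact ih (n + 2) (obj (S.E n (n + 2) rfl) M) h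

theorem It_eq_zero_of_le {i j : ℕ} (hij : i ≤ j) (n : ℤ) {x : B} (M : x ⟶ (S.o n).as)
    (h : 𝟙 (obj (S.It i n) M) = 0) : 𝟙 (obj (S.It j n) M) = 0 := by
  induction j, hij using Nat.le_induction with
  | base => exact h
  | succ j _ ih => exact S.It_succ_eq_zero j n M ih

/-- If the cup with `j` dots, on `M`, is a combination of the cups with fewer dots, then
`E ^ (j + 1)` vanishes on `M`. -/
theorem It_eq_zero_of_cupX (n : ℤ) (j : ℕ) {x : B} (M : x ⟶ (S.o n).as) (z : ℕ → (M ⟶ M))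
    (H : app (S.cupX n (n + 2) rfl j) M =
      ∑ i ∈ Finset.range j, z i ≫ app (S.cupX n (n + 2) rfl i) M) :
    𝟙 (obj (S.It (j + 1) n) M) = 0 := by
  refine S.It_eq_zero_of_monic j n M (fun i => if i = j then 𝟙 M else - z i) (if_pos rfl) ?_
  have := congrArg (fun t => map (S.E n (n + 2) rfl) t ≫
    app (S.adj n (n + 2) rfl).counit (obj (S.E n (n + 2) rfl) M)) H
  simp only [Fn.map_sum, Preadditive.sum_comp, Fn.map_comp, Category.assoc, map_cupX_counit] at this
  rw [Finset.sum_range_succ, if_pos rfl, Fn.map_id, Category.id_comp, this,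
    ← Finset.sum_add_distrib]
  refine Finset.sum_eq_zero fun i hi => ?_
  rw [if_neg (Finset.mem_range.1 hi).ne]
  simp

/-- The leading coefficients of the cups with dots, in a decomposition of `F E`, do not vanish as
long as the components in `E F` of these cups vanish and enough powers of `E` do not. -/
theorem cupX_leading {l n p : ℤ} {h : l + 2 = n} {h' : n + 2 = p}
    (D : Decomp k (S.E n p h' ≫ S.F p n h') (S.F n l h ≫ S.E l n h) (-n).toNat
      (fun j => n + 1 + 2 * j)) {J : ℕ} {x : B} (M : x ⟶ (S.o n).as)
    (hv : ∀ j ≤ J, app (S.cupX n p h' j ≫ D.v) M = 0)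
    (hM : 𝟙 (obj (S.It (J + 1) n) M) ≠ 0) (j : ℕ) (hj : j ≤ J) :
    j < (-n).toNat ∧ ∃ c : k, c ≠ 0 ∧ S.cupX n p h' j ≫ D.q j = c • 𝟙 _ := by
  subst h'
  -- the combinations of the cups with fewer than `j` dots
  let Sp (j : ℕ) (t : M ⟶ obj (S.F (n + 2) n rfl) (obj (S.E n (n + 2) rfl) M)) : Prop :=
    ∃ z : ℕ → (M ⟶ M), t = ∑ i ∈ Finset.range j, z i ≫ app (S.cupX n (n + 2) rfl i) M
  have Sp_mono : ∀ j t, Sp j t → Sp (j + 1) t := by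
    rintro j t ⟨z, rfl⟩
    refine ⟨fun i => if i < j then z i else 0, ?_⟩
    beta_reduce
    rw [Finset.sum_range_succ, if_neg (lt_irrefl j), Limits.zero_comp, add_zero]
    exact Finset.sum_congr rfl fun i hi => by rw [if_pos (Finset.mem_range.1 hi)]
  have Sp_sum : ∀ (j : ℕ) (I : Finset ℕ) (y : ℕ → (M ⟶ M))
      (t : ℕ → (M ⟶ obj (S.F (n + 2) n rfl) (obj (S.E n (n + 2) rfl) M))),
      (∀ i ∈ I, Sp j (t i)) → Sp j (∑ i ∈ I, y i ≫ t i) := by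
    intro j I y t ht
    choose! z hz using ht
    refine ⟨fun a => ∑ i ∈ I, y i ≫ z i a, ?_⟩
    simp only [Preadditive.sum_comp]
    rw [Finset.sum_comm]
    refine Finset.sum_congr rfl fun i hi => ?_
    rw [hz i hi, Preadditive.comp_sum]
    simp
  have deg_q : ∀ j i : ℕ, i < (-n).toNat → S.cupX n (n + 2) rfl j ≫ D.q i ∈
      deg k (2 * (j - i)) _ _ := fun j i hi =>
    deg_cast k (deg_comp (S.deg_cupX _ _ _ j) (D.deg_q i hi)) (by ring)
  have expand : ∀ j ≤ J, app (S.cupX n (n + 2) rfl j) M =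
      ∑ i ∈ Finset.range (-n).toNat, app (S.cupX n (n + 2) rfl j ≫ D.q i) M ≫ app (D.i i) M := by
    intro j hj
    have := congrArg (fun t => app t M) (D.expand (S.cupX n (n + 2) rfl j))
    simp only [app_add, app_sum, app_comp _ D.u, hv j hj, Limits.zero_comp, zero_add] at this
    refine this.trans (Finset.sum_congr rfl fun i _ => app_comp _ _ _)
  suffices key : ∀ j ≤ J + 1, ∀ i < j, (i < (-n).toNat ∧
      ∃ c : k, c ≠ 0 ∧ S.cupX n (n + 2) rfl i ≫ D.q i = c • 𝟙 _) ∧ Sp j (app (D.i i) M) from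
    (key (j + 1) (by omega) j (by omega)).1
  intro j
  induction j with
  | zero => intro _ i hi; omega
  | succ j ih =>
    intro hj i hi
    have ih := ih (by omega)
    have lower : ∀ m, m ≤ j → m ≤ (-n).toNat → Sp j (∑ i ∈ Finset.range m,
        app (S.cupX n (n + 2) rfl j ≫ D.q i) M ≫ app (D.i i) M) := fun m hm _ =>
      Sp_sum j _ _ _ fun i hi => (ih i (by have := Finset.mem_range.1 hi; omega)).2
    -- Otherwise, the dot on `E M` would be a root of a monic polynomial of degree `j`.
    have not_Sp : ¬ Sp j (app (S.cupX n (n + 2) rfl j) M) := by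
      rintro ⟨z, hz⟩
      exact hM (S.It_eq_zero_of_le (by omega) n M (S.It_eq_zero_of_cupX n j M z hz))
    have hjN : j < (-n).toNat := by
      by_contra hjN
      refine not_Sp ?_
      rw [expand j (by omega)]
      exact lower _ (by omega) le_rfl
    have e : app (S.cupX n (n + 2) rfl j) M = (∑ i ∈ Finset.range j,
        app (S.cupX n (n + 2) rfl j ≫ D.q i) M ≫ app (D.i i) M) +
          app (S.cupX n (n + 2) rfl j ≫ D.q j) M ≫ app (D.i j) M := by
      rw [expand j (by omega), ← Finset.sum_range_succ]
      refine (Finset.sum_subset (Finset.range_mono (by omega)) fun i hi hi' => ?_).symm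
      rw [Finset.mem_range] at hi hi'
      rw [S.one_neg n _ (by omega) _ (deg_q j i hi), app_zero, Limits.zero_comp]
    obtain ⟨c, hc⟩ := S.one_zero n _ (deg_cast k (deg_q j j hjN) (by ring))
    rw [hc] at e
    -- The leading coefficient does not vanish, since otherwise the cup with `j` dots would be a
    -- combination of the cups with fewer dots.
    have hc0 : c ≠ 0 := by
      rintro rfl
      refine not_Sp ?_
      rw [e, zero_smul, app_zero, Limits.zero_comp, add_zero]
      exact lower j le_rfl (by omega)
    rcases Nat.lt_succ_iff_lt_or_eq.1 hi with hi | rfl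
    · exact ⟨(ih i hi).1, Sp_mono _ _ (ih i hi).2⟩
    · refine ⟨⟨hjN, c, hc0, hc⟩, ?_⟩
      obtain ⟨z, hz⟩ := lower i le_rfl (by omega)
      rw [hz, app_smul, app_id, Linear.smul_comp, Category.id_comp] at e
      refine ⟨fun a => if a = i then c⁻¹ • 𝟙 M else - (c⁻¹ • z a), ?_⟩
      beta_reduce
      rw [Finset.sum_range_succ, if_pos rfl, e]
      simp only [Linear.smul_comp, Category.id_comp, smul_add, smul_smul, inv_mul_cancel₀ hc0,
        one_smul]
      rw [Finset.smul_sum, ← add_assoc, ← Finset.sum_add_distrib, Finset.sum_eq_zero, zero_add]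
      intro a ha
      rw [if_neg (Finset.mem_range.1 ha).ne]
      simp

/-- In negative weights, the cups with dots span the identities in a decomposition of `F E`. -/
theorem cupX_leading_one {l n p : ℤ} {h : l + 2 = n} {h' : n + 2 = p} {N : ℕ}
    (hN : n = -(N + 1 : ℕ)) (L : S.LAdj l n h) (H : S.End₁ l n h)
    (D : Decomp k (S.E n p h' ≫ S.F p n h') (S.F n l h ≫ S.E l n h) (-n).toNat
      (fun j => n + 1 + 2 * j)) (j : ℕ) (hj : j ≤ N) :
    S.cupX n p h' j ≫ D.v = 0 ∧ ∃ c : k, c ≠ 0 ∧ S.cupX n p h' j ≫ D.q j = c • 𝟙 _ := by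
  have hv : ∀ j ≤ N, S.cupX n p h' j ≫ D.v = 0 := fun j hj =>
    S.hom_one_eq_zero L H (d := n + 1 + 2 * j) (by omega)
      (deg_cast k (deg_comp (S.deg_cupX _ _ _ j) D.deg_v) (by ring))
  refine ⟨hv j hj, ?_⟩
  by_cases h0 : 𝟙 (𝟙 (S.o n)) = 0
  · exact ⟨1, one_ne_zero, (eq_zero_of_source h0 _).trans (eq_zero_of_source h0 _).symm⟩
  · refine (S.cupX_leading D (J := N) (𝟙 _) (fun j hj => ?_) ?_ j hj).2
    · rw [hv j hj, app_zero]
    · exact S.It_ne_zero (𝟙 _) h0 _ (by omega)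

/-- A 2-morphism out of `F E` is determined by its values on `E F` and on the cups with dots. -/
theorem hom_FE_eq_zero {l n p : ℤ} {h : l + 2 = n} {h' : n + 2 = p} {N : ℕ}
    (hN : n = -(N + 1 : ℕ)) (L : S.LAdj l n h) (H : S.End₁ l n h)
    (D : Decomp k (S.E n p h' ≫ S.F p n h') (S.F n l h ≫ S.E l n h) (-n).toNat
      (fun j => n + 1 + 2 * j)) {Z : S.o n ⟶ S.o n} (y : S.E n p h' ≫ S.F p n h' ⟶ Z)
    (hu : D.u ≫ y = 0) (hy : ∀ j ≤ N, S.cupX n p h' j ≫ y = 0) : y = 0 := by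
  have hi : ∀ j ≤ N, D.i j ≫ y = 0 := by
    intro j
    induction j using Nat.strong_induction_on with
    | _ j ih =>
      intro hj
      obtain ⟨hv, c, hc, hq⟩ := S.cupX_leading_one hN L H D j hj
      -- The cup with `j` dots is a non-zero multiple of `D.i j`, up to terms with lower index;
      -- those with higher index vanish by degree.
      have e := D.expand (S.cupX n p h' j)
      rw [hv, Limits.zero_comp, zero_add, ← Finset.sum_erase_add _ _
        (Finset.mem_range.2 (show j < (-n).toNat by omega)), hq] at e
      have e' := congrArg (· ≫ y) e
      simp only [hy j hj, Preadditive.add_comp, Preadditive.sum_comp, Linear.smul_comp,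
        Category.id_comp, Category.assoc] at e'
      rw [Finset.sum_eq_zero, zero_add] at e'
      · exact (smul_eq_zero.1 e'.symm).resolve_left hc
      · intro i hi
        simp only [Finset.mem_erase, Finset.mem_range] at hi
        rcases lt_or_gt_of_ne hi.1 with hij | hij
        · rw [ih i hij (by omega), Limits.comp_zero, Limits.comp_zero]
        · rw [← Category.assoc, S.one_neg n (2 * (j - i)) (by omega) (S.cupX n p h' j ≫ D.q i)
            (deg_cast k (deg_comp (S.deg_cupX _ _ _ j) (D.deg_q i hi.2)) (by ring)),
            Limits.zero_comp]
  rw [← Category.id_comp y, ← D.total]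
  simp only [Preadditive.add_comp, Preadditive.sum_comp, Category.assoc, hu, Limits.comp_zero,
    zero_add]
  refine Finset.sum_eq_zero fun j hj => ?_
  rw [hi j (by have := Finset.mem_range.1 hj; omega), Limits.comp_zero]

/-- The cap `F E ⟶ 1`, in negative weights. -/
theorem exists_cap {l n p : ℤ} (h : l + 2 = n) (h' : n + 2 = p) {N : ℕ}
    (hN : n = -(N + 1 : ℕ)) (L : S.LAdj l n h) (H : S.End₁ l n h) :
    ∃ c : S.E n p h' ≫ S.F p n h' ⟶ 𝟙 _, c ∈ deg k (n + 1) _ _ ∧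
      (∀ j < N, S.cupX n p h' j ≫ c = 0) ∧ S.cupX n p h' N ≫ c = 𝟙 _ := by
  obtain ⟨D⟩ := S.comm_nonpos l n p h h' (by omega)
  obtain ⟨-, z, hz, hq⟩ := S.cupX_leading_one hN L H D N le_rfl
  refine ⟨z⁻¹ • D.q N, Submodule.smul_mem _ _ (deg_cast k (D.deg_q N (by omega)) (by
    push_cast at hN; omega)), fun j hj => ?_, ?_⟩
  · rw [Linear.comp_smul, S.one_neg n (2 * (j - N)) (by omega) (S.cupX n p h' j ≫ D.q N)
      (deg_cast k (deg_comp (S.deg_cupX _ _ _ j) (D.deg_q N (by omega))) (by ring)), smul_zero]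
  · rw [Linear.comp_smul, hq, smul_smul, inv_mul_cancel₀ hz, one_smul]

end Sys

end

/-! ### Components of 2-morphisms between composites -/

section

variable {k : Type t} [Field k] {B : Type u} [Bicategory.{w, v} B] [AddBicat B] [GrBicat k B]

open GrBicat

namespace Fn

variable {a b c d : Fn k B} {f : a ⟶ b} {g : b ⟶ c} {f' : a ⟶ d} {g' : d ⟶ c}

section

variable {g : b ⟶ a}

/-- The component at `M` of a 2-morphism `𝟙 ⟶ 𝟙`. -/
def app₀ (t : 𝟙 a ⟶ 𝟙 a) {x : B} (M : x ⟶ a.as) : M ⟶ M := app t M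

/-- The component at `M` of a 2-morphism `𝟙 ⟶ f ≫ g`. -/
def cup (t : 𝟙 a ⟶ f ≫ g) {x : B} (M : x ⟶ a.as) : M ⟶ obj g (obj f M) := app t M

/-- The component at `M` of a 2-morphism `f ≫ g ⟶ 𝟙`. -/
def cap (t : f ≫ g ⟶ 𝟙 a) {x : B} (M : x ⟶ a.as) : obj g (obj f M) ⟶ M := app t M

theorem cup_nat (t : 𝟙 a ⟶ f ≫ g) {x : B} {M N : x ⟶ a.as} (m : M ⟶ N) :
    m ≫ cup t N = cup t M ≫ map g (map f m) := by
  have h := app_naturality t m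
  simp only [Fn.comp_map, Fn.id_map] at h
  exact h

theorem cap_nat (t : f ≫ g ⟶ 𝟙 a) {x : B} {M N : x ⟶ a.as} (m : M ⟶ N) :
    map g (map f m) ≫ cap t N = cap t M ≫ m := by
  have h := app_naturality t m
  simp only [Fn.comp_map, Fn.id_map] at h
  exact h

theorem cup_nat_assoc (t : 𝟙 a ⟶ f ≫ g) {x : B} {M N : x ⟶ a.as} (m : M ⟶ N) {Z : x ⟶ a.as}
    (z : obj g (obj f N) ⟶ Z) : m ≫ cup t N ≫ z = cup t M ≫ map g (map f m) ≫ z := by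
  rw [← Category.assoc, cup_nat, Category.assoc]

theorem cap_nat_assoc (t : f ≫ g ⟶ 𝟙 a) {x : B} {M N : x ⟶ a.as} (m : M ⟶ N) {Z : x ⟶ a.as}
    (z : N ⟶ Z) : map g (map f m) ≫ cap t N ≫ z = cap t M ≫ m ≫ z := by
  rw [← Category.assoc, cap_nat, Category.assoc]

end

/-- The component at `M` of a 2-morphism `f ≫ g ⟶ f' ≫ g'`. -/
def app₂ (t : f ≫ g ⟶ f' ≫ g') {x : B} (M : x ⟶ a.as) :
    obj g (obj f M) ⟶ obj g' (obj f' M) := app t M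

theorem app₂_nat (t : f ≫ g ⟶ f' ≫ g') {x : B} {M N : x ⟶ a.as} (m : M ⟶ N) :
    map g (map f m) ≫ app₂ t N = app₂ t M ≫ map g' (map f' m) := by
  have h := app_naturality t m
  simp only [Fn.comp_map] at h
  exact h

theorem app₂_nat_assoc (t : f ≫ g ⟶ f' ≫ g') {x : B} {M N : x ⟶ a.as} (m : M ⟶ N)
    {Z : x ⟶ c.as} (z : obj g' (obj f' N) ⟶ Z) :
    map g (map f m) ≫ app₂ t N ≫ z = app₂ t M ≫ map g' (map f' m) ≫ z := by
  rw [← Category.assoc, app₂_nat, Category.assoc]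

@[simp] theorem app₂_whiskerLeft (f : a ⟶ b) {g h : b ⟶ c} (t : g ⟶ h) {x : B} (M : x ⟶ a.as) :
    app₂ (f ◁ t) M = app t (obj f M) := app_whiskerLeft f t M

@[simp] theorem app₂_whiskerRight {f g : a ⟶ b} (t : f ⟶ g) (h : b ⟶ c) {x : B} (M : x ⟶ a.as) :
    app₂ (t ▷ h) M = map h (app t M) := app_whiskerRight t h M

@[simp] theorem app₀_id {x : B} (M : x ⟶ a.as) : app₀ (𝟙 (𝟙 a)) M = 𝟙 M := app_id _ M

@[simp] theorem app₂_id (f : a ⟶ b) (g : b ⟶ c) {x : B} (M : x ⟶ a.as) :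
    app₂ (𝟙 (f ≫ g)) M = 𝟙 _ := app_id _ M

section

variable {e : Fn k B} {g : b ⟶ a} {g' : d ⟶ a} {f'' : a ⟶ e} {g'' : e ⟶ a} {x : B} (M : x ⟶ a.as)

@[simp] theorem cup_comp₀ (s : 𝟙 a ⟶ 𝟙 a) (t : 𝟙 a ⟶ f'' ≫ g'') :
    cup (s ≫ t) M = app₀ s M ≫ cup t M := app_comp _ _ _

@[simp] theorem app₀_comp₂ (s : 𝟙 a ⟶ f' ≫ g') (t : f' ≫ g' ⟶ 𝟙 a) :
    app₀ (s ≫ t) M = cup s M ≫ cap t M := app_comp _ _ _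

@[simp] theorem cup_comp₂ (s : 𝟙 a ⟶ f' ≫ g') (t : f' ≫ g' ⟶ f'' ≫ g'') :
    cup (s ≫ t) M = cup s M ≫ app₂ t M := app_comp _ _ _

@[simp] theorem app₂_comp₀ (s : f ≫ g ⟶ 𝟙 a) (t : 𝟙 a ⟶ f'' ≫ g'') :
    app₂ (s ≫ t) M = cap s M ≫ cup t M := app_comp _ _ _

@[simp] theorem cap_comp₂ (s : f ≫ g ⟶ f' ≫ g') (t : f' ≫ g' ⟶ 𝟙 a) :
    cap (s ≫ t) M = app₂ s M ≫ cap t M := app_comp _ _ _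

@[simp] theorem app₂_comp₂ (s : f ≫ g ⟶ f' ≫ g') (t : f' ≫ g' ⟶ f'' ≫ g'') :
    app₂ (s ≫ t) M = app₂ s M ≫ app₂ t M := app_comp _ _ _

@[simp] theorem app₀_zero : app₀ (0 : 𝟙 a ⟶ 𝟙 a) M = 0 := app_zero _

@[simp] theorem app₀_smul (z : k) (s : 𝟙 a ⟶ 𝟙 a) : app₀ (z • s) M = z • app₀ s M := app_smul _ _ _

@[simp] theorem cup_zero : cup (0 : 𝟙 a ⟶ f ≫ g) M = 0 := app_zero _

@[simp] theorem cup_sub (s t : 𝟙 a ⟶ f ≫ g) : cup (s - t) M = cup s M - cup t M := app_sub _ _ _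

@[simp] theorem cup_smul (z : k) (s : 𝟙 a ⟶ f ≫ g) : cup (z • s) M = z • cup s M := app_smul _ _ _

@[simp] theorem cup_sum {ι : Type*} (I : Finset ι) (s : ι → (𝟙 a ⟶ f ≫ g)) :
    cup (∑ i ∈ I, s i) M = ∑ i ∈ I, cup (s i) M := app_sum _ _ _

theorem cup_ext {s t : 𝟙 a ⟶ f ≫ g} (h : ∀ {x : B} (M : x ⟶ a.as), cup s M = cup t M) : s = t :=
  app_ext h

theorem cap_ext {s t : f ≫ g ⟶ 𝟙 a} (h : ∀ {x : B} (M : x ⟶ a.as), cap s M = cap t M) : s = t :=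
  app_ext h

@[simp] theorem app₂_zero : app₂ (0 : f ≫ g ⟶ f' ≫ g') M = 0 := app_zero _

@[simp] theorem app₂_add (s t : f ≫ g ⟶ f' ≫ g') : app₂ (s + t) M = app₂ s M + app₂ t M := app_add _ _ _

@[simp] theorem app₂_sub (s t : f ≫ g ⟶ f' ≫ g') : app₂ (s - t) M = app₂ s M - app₂ t M := app_sub _ _ _

@[simp] theorem app₂_smul (z : k) (s : f ≫ g ⟶ f' ≫ g') : app₂ (z • s) M = z • app₂ s M := app_smul _ _ _

@[simp] theorem app₂_sum {ι : Type*} (I : Finset ι) (s : ι → (f ≫ g ⟶ f' ≫ g')) :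
    app₂ (∑ i ∈ I, s i) M = ∑ i ∈ I, app₂ (s i) M := app_sum _ _ _

theorem app₂_ext {s t : f ≫ g ⟶ f' ≫ g'} (h : ∀ {x : B} (M : x ⟶ a.as), app₂ s M = app₂ t M) : s = t :=
  app_ext h

end

section

variable {l : a ⟶ b} {s : b ⟶ a} (A : l ⊣ s)

@[simp]
theorem cup_cap_left {x : B} (M : x ⟶ a.as) :
    map l (cup A.unit M) ≫ cap A.counit (obj l M) = 𝟙 _ := adj_left A M

@[simp]
theorem cup_cap_right {x : B} (M : x ⟶ b.as) :
    cup A.unit (obj s M) ≫ map s (cap A.counit M) = 𝟙 _ := adj_right A M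

@[simp]
theorem cup_cap_left_assoc {x : B} (M : x ⟶ a.as) {Z : x ⟶ b.as} (z : obj l M ⟶ Z) :
    map l (cup A.unit M) ≫ cap A.counit (obj l M) ≫ z = z := adj_left_assoc A M z

@[simp]
theorem cup_cap_right_assoc {x : B} (M : x ⟶ b.as) {Z : x ⟶ a.as} (z : obj s M ⟶ Z) :
    cup A.unit (obj s M) ≫ map s (cap A.counit M) ≫ z = z := adj_right_assoc A M z

theorem map_comp_assoc (f : a ⟶ b) {x : B} {M N P : x ⟶ a.as} (m : M ⟶ N) (n : N ⟶ P)
    {Z : x ⟶ b.as} (z : obj f P ⟶ Z) : map f (m ≫ n) ≫ z = map f m ≫ map f n ≫ z := by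
  rw [Fn.map_comp, Category.assoc]

end

end Fn

end

section

variable {k : Type t} [Field k] {B : Type u} [Bicategory.{w, v} B] [AddBicat B] [GrBicat k B]

open GrBicat

/-! ### Fake bubbles -/

/-- The inverse of the power series with constant term `1` and coefficients `b 1`, `b 2`, … -/
def fakes {C : Type*} [Category* C] [Preadditive C] {A : C} (b : ℕ → (A ⟶ A)) : ℕ → (A ⟶ A)
  | 0 => 𝟙 A
  | j + 1 => - ∑ i : Fin (j + 1), b (j + 1 - i) ≫ fakes b i

theorem sum_fakes {C : Type*} [Category* C] [Preadditive C] {A : C} {b : ℕ → (A ⟶ A)}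
    (hb : b 0 = 𝟙 A) (j : ℕ) :
    ∑ i ∈ Finset.range (j + 1), b (j - i) ≫ fakes b i = if j = 0 then 𝟙 A else 0 := by
  cases j with
  | zero => simp [fakes, hb]
  | succ j =>
    rw [Finset.sum_range_succ, if_neg (Nat.succ_ne_zero j), Nat.sub_self, hb, Category.id_comp,
      fakes, ← Fin.sum_univ_eq_sum_range (fun i => b (j + 1 - i) ≫ fakes b i) (j + 1)]
    simp

namespace Sys

variable {r : kˣ}

/-! ### Sideways crossings in negative weights -/

section

variable (S : Sys k r B)

/-- The sideways crossing `F E ⟶ E F` built from a left adjunction and a cap `c`. -/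
def sigma' {l n p : ℤ} {h : l + 2 = n} (h' : n + 2 = p) (L : S.LAdj l n h)
    (c : S.E n p h' ≫ S.F p n h' ⟶ 𝟙 _) : S.E n p h' ≫ S.F p n h' ⟶ S.F n l h ≫ S.E l n h :=
  (λ_ _).inv ≫ L.adj.unit ▷ _ ≫ (α_ _ _ _).hom ≫
    _ ◁ ((α_ _ _ _).inv ≫ S.T l n p h h' ▷ _ ≫ (α_ _ _ _).hom) ≫
      (α_ _ _ _).inv ≫ _ ◁ c ≫ (ρ_ _).hom

/-- The left curl with `j` dots inside. -/
def curlL {l n p : ℤ} (h : l + 2 = n) (h' : n + 2 = p) (c : S.E n p h' ≫ S.F p n h' ⟶ 𝟙 _)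
    (j : ℕ) : S.E l n h ⟶ S.E l n h :=
  (ρ_ _).inv ≫ _ ◁ (S.adj n p h').unit ≫ (α_ _ _ _).inv ≫
    (_ ◁ S.Xp n p h' j ≫ S.T l n p h h') ▷ _ ≫ (α_ _ _ _).hom ≫ _ ◁ c ≫ (ρ_ _).hom

theorem deg_sigma' {l n p : ℤ} {h : l + 2 = n} (h' : n + 2 = p) (L : S.LAdj l n h)
    {c : S.E n p h' ≫ S.F p n h' ⟶ 𝟙 _} (hc : c ∈ deg k (n + 1) _ _) :
    S.sigma' h' L c ∈ deg k 0 _ _ :=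
  deg_cast k (deg_comp (deg_leftUnitor _).2 (deg_comp (deg_whiskerRight _ L.deg_unit)
    (deg_comp (deg_associator _ _ _).1 (deg_comp (deg_whiskerLeft _ (deg_comp
      (deg_associator _ _ _).2 (deg_comp (deg_whiskerRight _ (S.deg_T l n p h h'))
        (deg_associator _ _ _).1))) (deg_comp (deg_associator _ _ _).2 (deg_comp
          (deg_whiskerLeft _ hc) (deg_rightUnitor _).1)))))) (by omega)

theorem deg_curlL {l n p : ℤ} (h : l + 2 = n) (h' : n + 2 = p)
    {c : S.E n p h' ≫ S.F p n h' ⟶ 𝟙 _} (hc : c ∈ deg k (n + 1) _ _) (j : ℕ) :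
    S.curlL h h' c j ∈ deg k (2 * (n + j)) _ _ :=
  deg_cast k (deg_comp (deg_rightUnitor _).2 (deg_comp (deg_whiskerLeft _ (S.deg_unit n p h'))
    (deg_comp (deg_associator _ _ _).2 (deg_comp (deg_whiskerRight _ (deg_comp
      (deg_whiskerLeft _ (S.deg_Xp n p h' j)) (S.deg_T l n p h h')))
        (deg_comp (deg_associator _ _ _).1 (deg_comp
          (deg_whiskerLeft _ hc) (deg_rightUnitor _).1)))))) (by ring)

end

open Fn

variable (S : Sys k r (Fn k B))

theorem cup_cupX (m n : ℤ) (h : m + 2 = n) (j : ℕ) {x : B} (M : x ⟶ (S.o m).as) :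
    cup (S.cupX m n h j) M = cup (S.adj m n h).unit M ≫ map (S.F n m h) (app (S.Xp m n h j) M) := by
  simp [cupX]

theorem app₂_sigma (l n p : ℤ) (h : l + 2 = n) (h' : n + 2 = p) {x : B} (M : x ⟶ (S.o n).as) :
    app₂ (S.sigma l n p h h') M = cup (S.adj n p h').unit (obj (S.E l n h) (obj (S.F n l h) M)) ≫
      map (S.F p n h') (app₂ (S.T l n p h h') (obj (S.F n l h) M)) ≫
        map (S.F p n h') (map (S.E n p h') (cap (S.adj l n h).counit M)) := by
  rw [← Fn.map_comp]
  exact S.app_sigma l n p h h' M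

theorem app₂_sigma' {l n p : ℤ} {h : l + 2 = n} (h' : n + 2 = p) (L : S.LAdj l n h)
    (c : S.E n p h' ≫ S.F p n h' ⟶ 𝟙 _) {x : B} (M : x ⟶ (S.o n).as) :
    app₂ (S.sigma' h' L c) M = map (S.F p n h') (map (S.E n p h') (cup L.adj.unit M)) ≫
      map (S.F p n h') (app₂ (S.T l n p h h') (obj (S.F n l h) M)) ≫
        cap c (obj (S.E l n h) (obj (S.F n l h) M)) := by
  change app (S.sigma' h' L c) M = _
  simp [sigma']
  rfl

theorem app_curlL {l n p : ℤ} (h : l + 2 = n) (h' : n + 2 = p)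
    (c : S.E n p h' ≫ S.F p n h' ⟶ 𝟙 _) (j : ℕ) {x : B} (M : x ⟶ (S.o l).as) :
    app (S.curlL h h' c j) M = cup (S.adj n p h').unit (obj (S.E l n h) M) ≫
      map (S.F p n h') (app (S.Xp n p h' j) (obj (S.E l n h) M)) ≫
        map (S.F p n h') (app₂ (S.T l n p h h') M) ≫ cap c (obj (S.E l n h) M) := by
  simp [curlL]
  rfl

/-- Moving dots through a crossing. -/
theorem Xp_T (a b c : ℤ) (h : a + 2 = b) (h' : b + 2 = c) (j : ℕ) {x : B} (M : x ⟶ (S.o a).as) :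
    app (S.Xp b c h' j) (obj (S.E a b h) M) ≫ app₂ (S.T a b c h h') M =
      app₂ (S.T a b c h h') M ≫ map (S.E b c h') (app (S.Xp a b h j) M) +
        (r : k) • ∑ i ∈ Finset.range j, app (S.Xp b c h' i) (obj (S.E a b h) M) ≫
          map (S.E b c h') (app (S.Xp a b h (j - 1 - i)) M) := by
  have key := crossing_mul_pow (A := End (obj (S.E b c h') (obj (S.E a b h) M)))
    (x := End.of (app (S.X b c h') (obj (S.E a b h) M)))
    (y := End.of (map (S.E b c h') (app (S.X a b h) M))) (s := End.of (app (S.T a b c h h') M))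
    (z := (r : k)) (app_naturality _ _) (S.slide_app _ _ _ _ _ M) j
  rw [of_app_pow, of_map_pow] at key
  refine Eq.trans key (congrArg (_ + (r : k) • ·) (Finset.sum_congr rfl fun i _ => ?_))
  rw [of_app_pow, of_map_pow]
  exact app_naturality _ _

theorem T_T (a b c : ℤ) (h : a + 2 = b) (h' : b + 2 = c) {x : B} (M : x ⟶ (S.o a).as) :
    app₂ (S.T a b c h h') M ≫ app₂ (S.T a b c h h') M = 0 :=
  S.T_sq_app a b c h h' M

/-- The sideways crossing on `E`, after a cup. -/
theorem cup_sigma {l n p : ℤ} (h : l + 2 = n) (h' : n + 2 = p) {x : B} (M : x ⟶ (S.o l).as) :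
    map (S.E l n h) (cup (S.adj l n h).unit M) ≫ app₂ (S.sigma l n p h h') (obj (S.E l n h) M) =
      cup (S.adj n p h').unit (obj (S.E l n h) M) ≫ map (S.F p n h') (app₂ (S.T l n p h h') M) := by
  rw [app₂_sigma, cup_nat_assoc, ← Fn.map_comp, ← Fn.map_comp, app₂_nat_assoc, ← Fn.map_comp,
    cup_cap_left, Fn.map_id, Category.comp_id]

/-- The sideways crossing on `E`, before a cap. -/
theorem sigma'_cap {l n p : ℤ} (h : l + 2 = n) (h' : n + 2 = p) (L : S.LAdj l n h)
    (c : S.E n p h' ≫ S.F p n h' ⟶ 𝟙 _) {x : B} (M : x ⟶ (S.o l).as) :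
    app₂ (S.sigma' h' L c) (obj (S.E l n h) M) ≫ map (S.E l n h) (cap L.adj.counit M) =
      map (S.F p n h') (app₂ (S.T l n p h h') M) ≫ cap c (obj (S.E l n h) M) := by
  rw [app₂_sigma', Category.assoc, Category.assoc, ← cap_nat, ← Fn.map_comp_assoc,
    ← Fn.map_comp_assoc, Category.assoc, ← app₂_nat, ← Category.assoc (map (S.E n p h') _),
    ← Fn.map_comp (S.E n p h'), cup_cap_right, Fn.map_id, Category.id_comp]

theorem cupX_sigma' {l n p : ℤ} (h : l + 2 = n) (h' : n + 2 = p) (L : S.LAdj l n h)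
    (c : S.E n p h' ≫ S.F p n h' ⟶ 𝟙 _) (j : ℕ) :
    S.cupX n p h' j ≫ S.sigma' h' L c = L.adj.unit ≫ S.F n l h ◁ S.curlL h h' c j := by
  refine cup_ext fun M => ?_
  rw [cup_comp₂, cup_comp₂, cup_cupX, app₂_sigma', app₂_whiskerLeft, app_curlL, cup_nat_assoc,
    Category.assoc, ← Fn.map_comp_assoc, ← app_naturality, Fn.map_comp_assoc]

/-- The left curl with dots, in terms of the left curl without dots and of bubbles. -/
theorem app_curlL_expand {l n p : ℤ} (h : l + 2 = n) (h' : n + 2 = p)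
    (c : S.E n p h' ≫ S.F p n h' ⟶ 𝟙 _) (j : ℕ) {x : B} (M : x ⟶ (S.o l).as) :
    app (S.curlL h h' c j) M = app (S.curlL h h' c 0) M ≫ app (S.Xp l n h j) M +
      (r : k) • ∑ i ∈ Finset.range j, app₀ (S.cupX n p h' i ≫ c) (obj (S.E l n h) M) ≫
        app (S.Xp l n h (j - 1 - i)) M := by
  rw [app_curlL, ← Fn.map_comp_assoc, Xp_T, app_curlL, app_Xp_zero, Fn.map_id, Category.id_comp,
    Fn.map_add, Preadditive.add_comp, Preadditive.comp_add, Fn.map_comp_assoc, cap_nat,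
    Category.assoc, Category.assoc, Fn.map_smul, Linear.smul_comp, Linear.comp_smul, Fn.map_sum,
    Preadditive.sum_comp, Preadditive.comp_sum]
  refine congrArg (_ + (r : k) • ·) (Finset.sum_congr rfl fun i _ => ?_)
  rw [Fn.map_comp_assoc, cap_nat, app₀_comp₂, cup_cupX]
  simp only [Category.assoc]

/-- The composite of the two sideways crossings, with a cup, a cap and dots, in terms of left
curls. -/
theorem cup_sigma_sigma'_cap {l n p : ℤ} (h : l + 2 = n) (h' : n + 2 = p) (L : S.LAdj l n h)
    (c : S.E n p h' ≫ S.F p n h' ⟶ 𝟙 _) (j : ℕ) {x : B} (M : x ⟶ (S.o l).as) :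
    map (S.E l n h) (cup (S.adj l n h).unit M) ≫
      app₂ (S.sigma l n p h h' ≫ S.sigma' h' L c) (obj (S.E l n h) M) ≫
        map (S.E l n h) (map (S.F n l h) (app (S.Xp l n h j) M) ≫ cap L.adj.counit M) =
      - ((r : k) • ∑ i ∈ Finset.range j,
        app (S.Xp l n h (j - 1 - i)) M ≫ app (S.curlL h h' c i) M) := by
  have e : app₂ (S.T l n p h h') M ≫ map (S.E n p h') (app (S.Xp l n h j) M) =
      app (S.Xp n p h' j) (obj (S.E l n h) M) ≫ app₂ (S.T l n p h h') M -
        (r : k) • ∑ i ∈ Finset.range j, app (S.Xp n p h' i) (obj (S.E l n h) M) ≫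
          map (S.E n p h') (app (S.Xp l n h (j - 1 - i)) M) :=
    eq_sub_of_add_eq (S.Xp_T l n p h h' j M).symm
  rw [app₂_comp₂, Category.assoc, ← Category.assoc (Fn.map _ _), cup_sigma, Fn.map_comp,
    ← app₂_nat_assoc, sigma'_cap, Category.assoc, ← Fn.map_comp_assoc, ← Fn.map_comp_assoc, e,
    Preadditive.sub_comp, Category.assoc, T_T, Limits.comp_zero, zero_sub, Fn.map_neg,
    Preadditive.neg_comp, Preadditive.comp_neg, Linear.smul_comp, Fn.map_smul, Linear.smul_comp,
    Linear.comp_smul, Preadditive.sum_comp, Fn.map_sum, Preadditive.sum_comp, Preadditive.comp_sum]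
  refine congrArg (fun t => - ((r : k) • t)) (Finset.sum_congr rfl fun i _ => ?_)
  rw [← app_naturality, Category.assoc, Fn.map_comp_assoc, ← cup_nat_assoc, app_curlL,
    Fn.map_comp_assoc]

section

variable {l n p : ℤ} {h : l + 2 = n} {h' : n + 2 = p} {N : ℕ} (hN : n = -(N + 1 : ℕ))
  (L : S.LAdj l n h) (H : S.End₁ l n h)
  {c : S.E n p h' ≫ S.F p n h' ⟶ 𝟙 _} (hc : c ∈ deg k (n + 1) _ _)

include hN H hc

theorem curlL_eq_zero (j : ℕ) (hj : j ≤ N) : S.curlL h h' c j = 0 :=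
  H.1 _ (by omega) _ (S.deg_curlL h h' hc j)

variable (hc0 : ∀ j < N, S.cupX n p h' j ≫ c = 0) (hc1 : S.cupX n p h' N ≫ c = 𝟙 _)

include hc0 hc1

/-- The left curl with the least number of dots for which it does not vanish by degree. -/
theorem curlL_eq_smul : S.curlL h h' c (N + 1) = (r : k) • 𝟙 _ := by
  refine app_ext fun M => ?_
  rw [app_curlL_expand, S.curlL_eq_zero hN H hc 0 (Nat.zero_le _), app_zero, Limits.zero_comp,
    zero_add, app_smul, Finset.sum_range_succ, Finset.sum_eq_zero, zero_add, hc1, app₀_id]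
  · simp
  · intro i hi
    rw [hc0 i (Finset.mem_range.1 hi), app₀_zero, Limits.zero_comp]

/-- The composite of the two sideways crossings, on `E F`. -/
theorem sigma_sigma' (K : ∀ z ∈ deg k 0 (S.F n l h ≫ S.E l n h) (S.F n l h ≫ S.E l n h),
      ∃ c : k, z = c • 𝟙 _)
    (hL : S.cupX l n h (N + 2) ≫ L.adj.counit = 𝟙 _) :
    S.sigma l n p h h' ≫ S.sigma' h' L c = - ((r : k) ^ 2) • 𝟙 _ := by
  -- The composite is a scalar by degree. Closing it with a cup, a cap and `N + 2` dots gives the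
  -- scalar on one side, and on the other side a sum of left curls, of which only the last one is
  -- non-zero.
  obtain ⟨z, hz⟩ := K _ (deg_cast k (deg_comp (S.deg_sigma l n p h h') (S.deg_sigma' h' L hc))
    (add_zero 0))
  have key : z • 𝟙 (S.E l n h) = - ((r : k) ^ 2) • 𝟙 _ := by
    refine app_ext fun M => ?_
    have := S.cup_sigma_sigma'_cap h h' L c (N + 2) M
    have hL' := congrArg (fun t => app₀ t M) hL
    rw [hz, Finset.sum_range_succ, Finset.sum_eq_zero (fun i hi => by
      rw [S.curlL_eq_zero hN H hc i (by have := Finset.mem_range.1 hi; omega), app_zero,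
        Limits.comp_zero]), S.curlL_eq_smul hN H hc hc0 hc1] at this
    simp only [app₀_comp₂, cup_cupX, Category.assoc, app₀_id] at hL'
    simp only [app₂_smul, app₂_id, Linear.smul_comp, Linear.comp_smul, Category.id_comp,
      ← Fn.map_comp, hL', Fn.map_id, zero_add, app_smul, app_id, Category.comp_id,
      smul_smul, show N + 2 - 1 - (N + 1) = 0 by omega,
      app_Xp_zero] at this
    rw [app_smul, app_smul, app_id, this, pow_two, neg_smul]
  rw [hz]
  by_cases h0 : 𝟙 (S.E l n h) = 0
  · have : 𝟙 (S.F n l h ≫ S.E l n h) = 0 := by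
      rw [← Bicategory.whiskerLeft_id, h0, AddBicat.whiskerLeft_zero]
    rw [this, smul_zero, smul_zero]
  · rw [← sub_eq_zero, ← sub_smul, smul_eq_zero, or_iff_left h0, sub_eq_zero] at key
    rw [key]

end

end Sys

end

section

variable {k : Type t} [Field k] {B : Type u} [Bicategory.{w, v} B] [AddBicat B] [GrBicat k B]

open GrBicat

namespace Sys

variable {r : kˣ}

/-! ### The identity of `F E` in negative weights -/

/-- Since `E ⊣ F`, 2-morphisms `E F ⟶ 1` are adjoint to endomorphisms of `E`. -/
theorem hom_EF_one_eq_zero (S : Sys k r B) {l n : ℤ} {h : l + 2 = n} (H : S.End₁ l n h) {d : ℤ}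
    (hd : d + l + 1 < 0) {y : S.F n l h ≫ S.E l n h ⟶ 𝟙 _} (hy : y ∈ deg k d _ _) : y = 0 := by
  have h1 := deg_homEquiv₁_symm (S.deg_unit l n h) hy rfl
  have h2 := H.1 _ (by omega) _ (deg_comp h1 (deg_rightUnitor _).1)
  have h3 : (S.adj l n h).homEquiv₁.symm y = 0 := by
    rw [← cancel_mono (ρ_ _).hom, h2, Limits.zero_comp]
  rw [← homEquiv₁_symm_zero] at h3
  exact (S.adj l n h).homEquiv₁.symm.injective h3

open Fn

variable (S : Sys k r (Fn k B))

theorem Xp_add (m n : ℤ) (h : m + 2 = n) (i j : ℕ) :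
    S.Xp m n h (i + j) = S.Xp m n h i ≫ S.Xp m n h j := by
  induction j with
  | zero => exact (Category.comp_id _).symm
  | succ j ih => rw [← add_assoc, Xp, ih, Xp, Category.assoc]

theorem cupX_Xp (m n : ℤ) (h : m + 2 = n) (i j : ℕ) :
    S.cupX m n h i ≫ S.Xp m n h j ▷ S.F n m h = S.cupX m n h (i + j) := by
  rw [cupX, cupX, Category.assoc, Xp_add, comp_whiskerRight]

section

variable {l n p : ℤ} {h : l + 2 = n} {h' : n + 2 = p} {N : ℕ} (hN : n = -(N + 1 : ℕ))
  (L : S.LAdj l n h) (H : S.End₁ l n h)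

/-- A 2-morphism out of `F E` is determined by its values on the sideways crossing and on the cups
with dots, if the sideways crossing has a left inverse up to a scalar. -/
theorem hom_FE_eq_zero_of_sigma (hN : n = -(N + 1 : ℕ)) (L : S.LAdj l n h) (H : S.End₁ l n h)
    (K : ∀ z ∈ deg k 0 (S.F n l h ≫ S.E l n h) (S.F n l h ≫ S.E l n h), ∃ c : k, z = c • 𝟙 _)
    {s' : S.E n p h' ≫ S.F p n h' ⟶ S.F n l h ≫ S.E l n h} {b : kˣ}
    (hs : S.sigma l n p h h' ≫ s' = (b : k) • 𝟙 _) {Z : S.o n ⟶ S.o n}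
    (y : S.E n p h' ≫ S.F p n h' ⟶ Z)
    (hu : S.sigma l n p h h' ≫ y = 0) (hy : ∀ j ≤ N, S.cupX n p h' j ≫ y = 0) : y = 0 := by
  obtain ⟨D⟩ := S.comm_nonpos l n p h h' (by omega)
  refine S.hom_FE_eq_zero hN L H D y ?_ hy
  -- By degree, the sideways crossing is a multiple of the inclusion of `E F` that is part of `D`.
  obtain ⟨z, hz⟩ := K _ (deg_cast k (deg_comp (S.deg_sigma l n p h h') D.deg_v) (add_zero 0))
  have e := D.expand (S.sigma l n p h h')
  rw [hz, Finset.sum_eq_zero, add_zero, Linear.smul_comp, Category.id_comp] at e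
  · by_cases h0 : z = 0
    · rw [h0, zero_smul] at e
      rw [e, Limits.zero_comp] at hs
      have h1 : 𝟙 (S.F n l h ≫ S.E l n h) = 0 :=
        (smul_eq_zero.1 hs.symm).resolve_left b.ne_zero
      rw [← Category.id_comp D.u, h1, Limits.zero_comp, Limits.zero_comp]
    · rw [e, Linear.smul_comp] at hu
      exact (smul_eq_zero.1 hu).resolve_left h0
  · intro j hj
    rw [S.hom_EF_one_eq_zero H (d := -(n + 1 + 2 * j)) (by omega) (deg_cast k
      (deg_comp (S.deg_sigma l n p h h') (D.deg_q j (Finset.mem_range.1 hj))) (by ring)),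
      Limits.zero_comp]

variable {c : S.E n p h' ≫ S.F p n h' ⟶ 𝟙 _}

/-- The part of the identity of `F E` that factors through identities. -/
def cupCap (c : S.E n p h' ≫ S.F p n h' ⟶ 𝟙 _) (N : ℕ) (f : ℕ → (𝟙 (S.o n) ⟶ 𝟙 (S.o n))) :
    S.E n p h' ≫ S.F p n h' ⟶ S.E n p h' ≫ S.F p n h' :=
  ∑ i ∈ Finset.range N, ∑ j ∈ Finset.range (N - i),
    (S.Xp n p h' (N - 1 - i - j) ▷ S.F p n h' ≫ c) ≫ f j ≫ S.cupX n p h' i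

/-- The decomposition of the identity of `F E` in negative weights. The two sides agree after the
sideways crossing by `sigma_sigma'`, and on the cups with dots since the fake bubbles are inverse to
the bubbles. -/
theorem ident_FE (hN : n = -(N + 1 : ℕ)) (L : S.LAdj l n h) (H : S.End₁ l n h)
    (hc : c ∈ deg k (n + 1) _ _) (hc0 : ∀ j < N, S.cupX n p h' j ≫ c = 0)
    (hc1 : S.cupX n p h' N ≫ c = 𝟙 _)
    (K : ∀ z ∈ deg k 0 (S.F n l h ≫ S.E l n h) (S.F n l h ≫ S.E l n h), ∃ c : k, z = c • 𝟙 _)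
    (hL : S.cupX l n h (N + 2) ≫ L.adj.counit = 𝟙 _) :
    𝟙 (S.E n p h' ≫ S.F p n h') =
      (-((r⁻¹ : kˣ) : k) ^ 2) • (S.sigma' h' L c ≫ S.sigma l n p h h') +
        S.cupCap c (N + 1) (fakes fun t => S.cupX n p h' (N + t) ≫ c) := by
  have hs := S.sigma_sigma' hN L H hc hc0 hc1 K hL
  set b : ℕ → (𝟙 (S.o n) ⟶ 𝟙 (S.o n)) := fun t => S.cupX n p h' (N + t) ≫ c with hb
  rw [← sub_eq_zero]
  refine S.hom_FE_eq_zero_of_sigma hN L H K (b := - r ^ 2) (s' := S.sigma' h' L c)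
    (by rw [hs]; simp) _ ?_ fun t ht => ?_
  -- After the sideways crossing, the terms through identities vanish by degree.
  · rw [Preadditive.comp_sub, Preadditive.comp_add, Linear.comp_smul, reassoc_of% hs, cupCap,
      Preadditive.comp_sum, Finset.sum_eq_zero]
    · simp [Linear.smul_comp, smul_smul]
    · intro i hi
      rw [Preadditive.comp_sum]
      refine Finset.sum_eq_zero fun j hj => ?_
      rw [Finset.mem_range] at hi hj
      rw [← Category.assoc, S.hom_EF_one_eq_zero H (d := n + 1 + 2 * (N - i - j : ℕ)) (by omega)
        (deg_cast k (deg_comp (S.deg_sigma l n p h h') (deg_comp (deg_whiskerRight _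
          (S.deg_Xp n p h' (N + 1 - 1 - i - j))) hc)) (by
            rw [Nat.add_sub_cancel]; ring)), Limits.zero_comp]
  -- On the cup with `t` dots, the term with the crossings contains a left curl of negative degree.
  · rw [Preadditive.comp_sub, Preadditive.comp_add, Linear.comp_smul, ← Category.assoc _ _
      (S.sigma l n p h h'), cupX_sigma', S.curlL_eq_zero hN H hc t ht, AddBicat.whiskerLeft_zero,
      Limits.comp_zero, Limits.zero_comp, smul_zero, zero_add, Category.comp_id, cupCap,
      Preadditive.comp_sum, sub_eq_zero]
    -- The term with index `i` contains the sum of the products of bubbles and fake bubbles of total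
    -- degree `t - i`, which vanishes for `i ≠ t`.
    have e1 : ∀ i < N + 1, S.cupX n p h' t ≫ (∑ j ∈ Finset.range (N + 1 - i),
        (S.Xp n p h' (N + 1 - 1 - i - j) ▷ S.F p n h' ≫ c) ≫ fakes b j ≫ S.cupX n p h' i) =
          if i = t then S.cupX n p h' t else 0 := by
      intro i hi
      have e2 : ∀ j < N + 1 - i, S.cupX n p h' t ≫
          (S.Xp n p h' (N + 1 - 1 - i - j) ▷ S.F p n h' ≫ c) ≫ fakes b j ≫ S.cupX n p h' i =
          if i + j ≤ t then (b (t - i - j) ≫ fakes b j) ≫ S.cupX n p h' i else 0 := by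
        intro j hj
        rw [← Category.assoc, ← Category.assoc _ _ c, cupX_Xp]
        split_ifs with hij
        · rw [show t + (N + 1 - 1 - i - j) = N + (t - i - j) by omega]
          simp only [hb, Category.assoc]
        · rw [hc0 _ (by omega), Limits.zero_comp]
      rw [Preadditive.comp_sum, Finset.sum_congr rfl fun j hj => e2 j (Finset.mem_range.1 hj)]
      by_cases hit : i ≤ t
      · rw [← Finset.sum_subset (s₁ := Finset.range (t - i + 1)) (Finset.range_mono (by omega))
          (fun j hj hj' => if_neg (by rw [Finset.mem_range] at hj'; omega)),
          Finset.sum_congr rfl fun j hj => if_pos (by rw [Finset.mem_range] at hj; omega),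
          ← Preadditive.sum_comp, sum_fakes (by rw [hb]; exact hc1)]
        by_cases hit' : i = t
        · rw [if_pos (by omega), if_pos hit', hit', Category.id_comp]
        · rw [if_neg (by omega), if_neg hit', Limits.zero_comp]
      · rw [if_neg (by omega)]
        exact Finset.sum_eq_zero fun j _ => if_neg (by omega)
    rw [Finset.sum_congr rfl fun i hi => e1 i (Finset.mem_range.1 hi), Finset.sum_ite_eq',
      if_pos (Finset.mem_range.2 (by omega))]

end

end Sys

end

section

variable {k : Type t} [Field k] {B : Type u} [Bicategory.{w, v} B] [AddBicat B] [GrBicat k B]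

open GrBicat

/-! ### The left adjunction -/

namespace Fn

variable {a b : Fn k B} {f : a ⟶ b} {g : b ⟶ a}

/-- The composite of a cup on the right of `f` with a cap on its left. -/
def zig (x : 𝟙 b ⟶ g ≫ f) (c : f ≫ g ⟶ 𝟙 a) : f ⟶ f :=
  (ρ_ _).inv ≫ f ◁ x ≫ (α_ _ _ _).inv ≫ c ▷ f ≫ (λ_ _).hom

/-- The composite of a cup on the left of `g` with a cap on its right. -/
def zag (x : 𝟙 b ⟶ g ≫ f) (c : f ≫ g ⟶ 𝟙 a) : g ⟶ g :=
  (λ_ _).inv ≫ x ▷ g ≫ (α_ _ _ _).hom ≫ g ◁ c ≫ (ρ_ _).hom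

theorem app_zig (x : 𝟙 b ⟶ g ≫ f) (c : f ≫ g ⟶ 𝟙 a) {y : B} (M : y ⟶ a.as) :
    app (zig x c) M = cup x (obj f M) ≫ map f (cap c M) := by
  simp [zig]
  rfl

theorem app_zag (x : 𝟙 b ⟶ g ≫ f) (c : f ≫ g ⟶ 𝟙 a) {y : B} (M : y ⟶ b.as) :
    app (zag x c) M = map g (cup x M) ≫ cap c (obj g M) := by
  simp [zag]
  rfl

theorem deg_zig {p q s : ℤ} {x : 𝟙 b ⟶ g ≫ f} {c : f ≫ g ⟶ 𝟙 a} (hx : x ∈ deg k p _ _)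
    (hc : c ∈ deg k q _ _) (hs : p + q = s) : zig x c ∈ deg k s _ _ :=
  deg_cast k (deg_comp (deg_rightUnitor _).2 (deg_comp (deg_whiskerLeft _ hx)
    (deg_comp (deg_associator _ _ _).2 (deg_comp (deg_whiskerRight _ hc)
      (deg_leftUnitor _).1)))) (by omega)

theorem deg_zag {p q s : ℤ} {x : 𝟙 b ⟶ g ≫ f} {c : f ≫ g ⟶ 𝟙 a} (hx : x ∈ deg k p _ _)
    (hc : c ∈ deg k q _ _) (hs : p + q = s) : zag x c ∈ deg k s _ _ :=
  deg_cast k (deg_comp (deg_leftUnitor _).2 (deg_comp (deg_whiskerRight _ hx)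
    (deg_comp (deg_associator _ _ _).1 (deg_comp (deg_whiskerLeft _ hc)
      (deg_rightUnitor _).1)))) (by omega)

/-- If one of the triangle identities holds and the other composite is a scalar, then the latter is
the identity. -/
theorem zag_eq_id {x : 𝟙 b ⟶ g ≫ f} {c : f ≫ g ⟶ 𝟙 a} (hx : zig x c = 𝟙 _) {z : k}
    (hz : zag x c = z • 𝟙 _) (hfg : 𝟙 f = 0 → 𝟙 g = 0) : zag x c = 𝟙 _ := by
  have key : 𝟙 f = z • 𝟙 f := by
    refine app_ext fun M => ?_
    have h1 := congrArg (fun t => app t M) hx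
    have h2 := congrArg (fun t => app t (obj f M)) hz
    simp only [app_zig, app_id, app_zag, app_smul] at h1 h2
    have h3 : cup x (obj f M) ≫ map f (map g (cup x (obj f M)) ≫ cap c (obj g (obj f M))) ≫
        map f (cap c M) = 𝟙 _ := by
      rw [Fn.map_comp, Category.assoc, ← Fn.map_comp f (cap c (obj g (obj f M))), ← cap_nat,
        Fn.map_comp, ← cup_nat_assoc, ← cup_nat_assoc, reassoc_of% h1, h1]
    rw [h2, Fn.map_smul, Fn.map_id, Linear.smul_comp, Linear.comp_smul, Category.id_comp, h1] at h3
    rw [app_smul, app_id, h3]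
  by_cases h0 : 𝟙 f = 0
  · rw [← Category.comp_id (zag x c), hfg h0, Limits.comp_zero]
  · rw [hz]
    have : (1 - z) • 𝟙 f = 0 := by rw [sub_smul, one_smul, ← key, sub_self]
    rw [← sub_eq_zero.1 ((smul_eq_zero.1 this).resolve_right h0), one_smul]

/-- If the endomorphisms of a left adjoint of a given degree are scalars, so are those of the right
adjoint. -/
theorem end_scalar_of_adj (A : f ⊣ g) {d d' : ℤ} (hu : A.unit ∈ deg k d _ _)
    (hc : A.counit ∈ deg k d' _ _) (hd : d + d' = 0)
    (H : ∀ x ∈ deg k 0 f f, ∃ z : k, x = z • 𝟙 f) (y : g ⟶ g) (hy : y ∈ deg k 0 g g) :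
    ∃ z : k, y = z • 𝟙 g := by
  obtain ⟨z, hz⟩ := H ((λ_ _).inv ≫ A.unit ▷ f ≫ (α_ _ _ _).hom ≫ f ◁ (y ▷ f ≫ A.counit) ≫
    (ρ_ _).hom) (deg_cast k (deg_comp (deg_leftUnitor _).2 (deg_comp (deg_whiskerRight _ hu)
      (deg_comp (deg_associator _ _ _).1 (deg_comp (deg_whiskerLeft _ (deg_comp
        (deg_whiskerRight _ hy) hc)) (deg_rightUnitor _).1)))) (by omega))
  refine ⟨z, app_ext fun M => ?_⟩
  have h1 : map f (cup A.unit (obj g M)) ≫ map f (app y (obj f (obj g M))) ≫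
      cap A.counit (obj f (obj g M)) = z • 𝟙 _ := by
    have := congrArg (fun t => app t (obj g M)) hz
    simp at this
    exact this
  have h2 := congrArg (fun t => cup A.unit (obj g M) ≫ map g (t ≫ cap A.counit M)) h1
  simp only [Linear.smul_comp, Linear.comp_smul, Category.id_comp, Fn.map_smul, cup_cap_right,
    Category.assoc, ← cap_nat, Fn.map_comp] at h2
  rw [app_smul, app_id, ← h2, ← cup_nat_assoc, ← cup_nat_assoc, ← cup_nat_assoc, cup_cap_right,
    Category.comp_id, ← app_naturality, cup_cap_right_assoc]

end Fn

end

section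

variable {k : Type t} [Field k] {B : Type u} [Bicategory.{w, v} B] [AddBicat B] [GrBicat k B]

open GrBicat

namespace Sys

variable {r : kˣ}

open Fn

variable (S : Sys k r (Fn k B))

section

variable {l n p : ℤ} {h : l + 2 = n} {h' : n + 2 = p} {N : ℕ} {c : S.E n p h' ≫ S.F p n h' ⟶ 𝟙 _}

/-- A cup that composes to zero with `c` vanishes on the image of `E`. -/
theorem cup_eq_zero_of_zig (L : S.LAdj l n h) {z : k} {f : ℕ → (𝟙 (S.o n) ⟶ 𝟙 (S.o n))}
    (hid : 𝟙 (S.E n p h' ≫ S.F p n h') = z • (S.sigma' h' L c ≫ S.sigma l n p h h') +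
      S.cupCap c (N + 1) f)
    (x : 𝟙 (S.o p) ⟶ S.F p n h' ≫ S.E n p h') (hx : zig x c = 0) {y : B} (M : y ⟶ (S.o n).as) :
    cup x (obj (S.E n p h') M) = 0 := by
  have h0 : ∀ {y : B} (M : y ⟶ (S.o n).as), cup x (obj (S.E n p h') M) ≫
      map (S.E n p h') (cap c M) = 0 := fun M => by
    rw [← app_zig, hx, app_zero]
  have h1 : cup x (obj (S.E n p h') M) ≫ map (S.E n p h') (app₂ (S.sigma' h' L c) M) = 0 := by
    rw [app₂_sigma', ← Fn.map_comp_assoc, Fn.map_comp (S.E n p h') (Fn.map (S.F p n h') _),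
      ← cup_nat_assoc, h0, Limits.comp_zero]
  have h2 : ∀ j, cup x (obj (S.E n p h') M) ≫
      map (S.E n p h') (cap (S.Xp n p h' j ▷ S.F p n h' ≫ c) M) = 0 := fun j => by
    rw [cap_comp₂, app₂_whiskerRight, Fn.map_comp, ← cup_nat_assoc, h0, Limits.comp_zero]
  rw [← Category.comp_id (cup x _), ← Fn.map_id, ← app₂_id (S.E n p h') (S.F p n h') M, hid,
    app₂_add, app₂_smul, app₂_comp₂, Fn.map_add, Fn.map_smul, Fn.map_comp, Preadditive.comp_add,
    Linear.comp_smul, reassoc_of% h1, Limits.zero_comp, smul_zero, zero_add, cupCap, app₂_sum,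
    Fn.map_sum, Preadditive.comp_sum, Finset.sum_eq_zero]
  intro i _
  rw [app₂_sum, Fn.map_sum, Preadditive.comp_sum, Finset.sum_eq_zero]
  intro j _
  rw [app₂_comp₀, Fn.map_comp, reassoc_of% h2, Limits.zero_comp]

/-- In negative weights there is a homogeneous cup `1 ⟶ E F` that satisfies a triangle identity
with `c`. By degree, it suffices to find one that does not compose to zero with `c`. -/
theorem exists_zig_eq_id (hN : n = -(N + 1 : ℕ)) (h0 : 𝟙 (𝟙 (S.o n)) ≠ 0)
    (L : S.LAdj l n h) (H : S.End₁ n p h') (hc : c ∈ deg k (n + 1) _ _)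
    {z : k} {f : ℕ → (𝟙 (S.o n) ⟶ 𝟙 (S.o n))}
    (hid : 𝟙 (S.E n p h' ≫ S.F p n h') = z • (S.sigma' h' L c ≫ S.sigma l n p h h') +
      S.cupCap c (N + 1) f) :
    ∃ x : 𝟙 (S.o p) ⟶ S.F p n h' ≫ S.E n p h', x ∈ deg k (-(n + 1)) _ _ ∧ zig x c = 𝟙 _ := by
  suffices ∃ x : 𝟙 (S.o p) ⟶ S.F p n h' ≫ S.E n p h', x ∈ deg k (-(n + 1)) _ _ ∧ zig x c ≠ 0 by
    obtain ⟨x, hx, hx0⟩ := this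
    obtain ⟨y, hy⟩ := H.2 _ (deg_zig hx hc (by omega))
    have hy0 : y ≠ 0 := by
      rintro rfl
      exact hx0 (by rw [hy, zero_smul])
    refine ⟨y⁻¹ • x, Submodule.smul_mem _ _ hx, app_ext fun M => ?_⟩
    have := congrArg (fun t => app t M) hy
    simp only [app_zig, app_smul, app_id] at this
    rw [app_zig, cup_smul, Linear.smul_comp, this, smul_smul, inv_mul_cancel₀ hy0, one_smul, app_id]
  -- Suppose that all such cups give zero. Then the cups that come from a decomposition in weight
  -- `n + 2` vanish on `E`, which contradicts the fact that suitable powers of `E` do not vanish.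
  have hE : ∀ j : ℕ, j ≤ N → 𝟙 (obj (S.It (j + 1) n) (𝟙 (S.o n).as)) ≠ 0 := fun j hj =>
    S.It_ne_zero (m := n) _ h0 _ (by omega)
  by_contra! hall
  subst h'
  obtain _ | N := N
  · obtain rfl : n = -1 := by simpa using hN
    -- In weight `-1`, the inclusion of the summand `1` of `E F` is such a cup.
    obtain ⟨D⟩ := S.comm_nonneg (-1) (-1 + 2) (-1 + 2 + 2) rfl rfl (by norm_num)
    have h1 := S.cup_eq_zero_of_zig L hid (D.i 0) (hall _ (deg_cast k (D.deg_i 0 (by norm_num))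
      (by norm_num))) (𝟙 _)
    have h2 := congrArg (fun t => app₀ t (obj (S.E (-1) _ rfl) (𝟙 _)))
      (D.i_q 0 (by norm_num) 0 (by norm_num))
    rw [if_pos rfl, app₀_comp₂, h1, Limits.zero_comp, app₀_id] at h2
    exact hE 0 le_rfl h2.symm
  -- In lower weights, consider the components in `E F` of the cups `1 ⟶ F E` with dots. If they
  -- vanish on `E`, then `cupX_leading` bounds their number by that of the summands `1`.
  · obtain ⟨D⟩ := S.comm_nonpos n (n + 2) (n + 2 + 2) rfl rfl (by omega)
    have h1 : ∀ j ≤ N, zig (S.cupX (n + 2) (n + 2 + 2) rfl j ≫ D.v) c = 0 := by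
      intro j hj
      have hd := deg_comp (S.deg_cupX (n + 2) _ rfl j) D.deg_v
      rcases hj.lt_or_eq with hj | rfl
      · exact H.1 _ (by omega) _ (deg_zig hd hc rfl)
      · exact hall _ (deg_cast k hd (by omega))
    have h2 := (S.cupX_leading D (J := N) (obj (S.E n _ rfl) (𝟙 (S.o n).as)) (fun j hj =>
      S.cup_eq_zero_of_zig L hid _ (h1 j hj) (𝟙 _)) (hE (N + 1) le_rfl) N le_rfl).1
    omega

end

end Sys

end

section

variable {k : Type t} [Field k] {B : Type u} [Bicategory.{w, v} B] [AddBicat B] [GrBicat k B]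

open GrBicat

namespace Sys

variable {r : kˣ}

section

variable (S : Sys k r B)

/-- The left adjunction is normalised so that the counterclockwise bubble of degree zero is the
identity, in negative weights. -/
def LowNormal {m n : ℤ} {h : m + 2 = n} (L : S.LAdj m n h) : Prop :=
  ∀ j : ℕ, m = -(j + 1 : ℕ) → S.cupX m n h j ≫ L.adj.counit = 𝟙 _

/-- The left adjunction is normalised so that the clockwise bubble of degree zero is the identity,
in positive weights. -/
def HighNormal {m n : ℤ} {h : m + 2 = n} (L : S.LAdj m n h) : Prop :=
  ∀ j : ℕ, n = (j + 1 : ℕ) → L.adj.unit ≫ S.F n m h ◁ S.Xp m n h j ≫ (S.adj m n h).counit = 𝟙 _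

/-- The data constructed by induction over the negative weights. -/
def Low (n p : ℤ) (h : n + 2 = p) : Prop :=
  (∃ L : S.LAdj n p h, S.LowNormal L) ∧ S.End₁ n p h ∧ (n ≤ -2 →
    (∀ q h', S.End₂ n p q h h') ∧
      ∀ z ∈ deg k 0 (S.F p n h ≫ S.E n p h) (S.F p n h ≫ S.E n p h), ∃ c : k, z = c • 𝟙 _)

end

open Fn

variable (S : Sys k r (Fn k B))

/-- The base of the induction is a zero object. -/
theorem low_of_zero {n p : ℤ} (h : n + 2 = p) (h0 : 𝟙 (𝟙 (S.o n)) = 0) : S.Low n p h := by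
  refine ⟨⟨⟨⟨0, 0, ?_, ?_⟩, Submodule.zero_mem _, Submodule.zero_mem _⟩, fun j _ => ?_⟩,
    ⟨fun d _ x _ => eq_zero_of_source h0 x, fun x _ => ⟨0, ?_⟩⟩, fun _ => ⟨fun q h' =>
      ⟨fun d _ x _ => eq_zero_of_source h0 x, fun x _ => ⟨0, ?_⟩⟩, fun z _ => ⟨0, ?_⟩⟩⟩
  · exact (eq_zero_of_target h0 _).trans (eq_zero_of_target h0 _).symm
  · exact (eq_zero_of_source h0 _).trans (eq_zero_of_source h0 _).symm
  · rw [h0, Limits.comp_zero]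
  · exact (eq_zero_of_source h0 _).trans (eq_zero_of_source h0 _).symm
  · exact (eq_zero_of_source h0 _).trans (eq_zero_of_source h0 _).symm
  · rw [← Category.id_comp z, ← id_whiskerRight, eq_zero_of_target h0 (𝟙 (S.F p n h)),
      AddBicat.zero_whiskerRight, Limits.zero_comp, zero_smul]

/-- The inductive step, from the weight `l` to the weight `n = l + 2`: the cap is that of
`exists_cap`, the cup that of `exists_zig_eq_id`. -/
theorem low_step {l n p : ℤ} (h : l + 2 = n) (h' : n + 2 = p) (hn : n ≤ -1) (HL : S.Low l n h) :
    S.Low n p h' := by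
  by_cases h0 : 𝟙 (𝟙 (S.o n)) = 0
  · exact S.low_of_zero h' h0
  obtain ⟨⟨L, hL⟩, H, H2⟩ := HL
  obtain ⟨H2, K⟩ := H2 (by omega)
  obtain ⟨N, hN⟩ : ∃ N : ℕ, n = -(N + 1 : ℕ) := ⟨(-n - 1).toNat, by omega⟩
  obtain ⟨c, hc, hc0, hc1⟩ := S.exists_cap h h' hN L H
  have H' := S.end₁_step h h' hn L H
  obtain ⟨x, hx, hzig⟩ := S.exists_zig_eq_id hN h0 L H' hc
    (S.ident_FE hN L H hc hc0 hc1 K (hL (N + 2) (by push_cast at hN ⊢; omega)))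
  obtain ⟨z, hz⟩ := end_scalar_of_adj (S.adj n p h') (S.deg_unit n p h') (S.deg_counit n p h')
    (by omega) H'.2 (zag x c) (deg_zag hx hc (by omega))
  have hzag := zag_eq_id hzig hz (fun hE => app_ext fun M => by
    have h1 : 𝟙 (obj (S.E n p h') (obj (S.F p n h') M)) = 0 := by
      rw [← app_id, hE, app_zero]
    have h2 := cup_cap_right (S.adj n p h') M
    rw [← Category.comp_id (cup _ _), ← Fn.map_id (S.F p n h'), h1, Fn.map_zero, Limits.comp_zero,
      Limits.zero_comp] at h2
    rw [app_id, ← h2, app_zero])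
  refine ⟨⟨⟨⟨x, c, ?_, ?_⟩, hx, hc⟩, fun j hj => ?_⟩, H', fun hn' => ⟨fun q h'' =>
    S.end₂_step h'' hn' L H' (H2 p h'), S.end_EF hn' L H' (H2 p h')⟩⟩
  · rw [leftZigzag_eq, ← cancel_epi (λ_ _).inv, ← cancel_mono (ρ_ _).hom]
    simpa [zag] using hzag
  · rw [rightZigzag_eq, ← cancel_epi (ρ_ _).inv, ← cancel_mono (λ_ _).hom]
    simpa [zig] using hzig
  · obtain rfl : j = N := by push_cast at hj hN; omega
    exact hc1

/-- Integrability provides a zero object to start from. -/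
theorem low_of_le {n p : ℤ} (h : n + 2 = p) (hn : n ≤ -1) : S.Low n p h := by
  suffices ∀ j : ℕ, ∀ n p (h : n + 2 = p), n ≤ -1 → 𝟙 (𝟙 (S.o (n - 2 * j))) = 0 → S.Low n p h by
    obtain ⟨R, hR⟩ := S.integrable n
    refine this R n p h hn ?_
    have := hR (-R) (by simp)
    rwa [show n + 2 * -(R : ℤ) = n - 2 * R by ring] at this
  clear hn h n p
  intro j
  induction j with
  | zero =>
    intro n p h _ h0
    rw [Nat.cast_zero, mul_zero, sub_zero] at h0
    exact S.low_of_zero h h0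
  | succ j ih =>
    intro n p h hn h0
    refine S.low_step (sub_add_cancel n 2) h hn (ih _ _ _ (by omega) ?_)
    rwa [show n - 2 * ((j + 1 : ℕ) : ℤ) = n - 2 - 2 * j by push_cast; ring] at h0

/-- The sideways crossing on `F`, after a cup on the left of `E`. -/
theorem cup_sigma' {l n p : ℤ} {h : l + 2 = n} {h' : n + 2 = p} (L : S.LAdj l n h)
    (L' : S.LAdj n p h') {x : B} (M : x ⟶ (S.o n).as) :
    cup L'.adj.unit (obj (S.E n p h') M) ≫
      map (S.E n p h') (app₂ (S.sigma' h' L L'.adj.counit) M) =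
        map (S.E n p h') (cup L.adj.unit M) ≫ app₂ (S.T l n p h h') (obj (S.F n l h) M) := by
  rw [app₂_sigma', ← Fn.map_comp_assoc, Fn.map_comp (S.E n p h') (Fn.map (S.F p n h') _),
    ← cup_nat_assoc, cup_cap_right, Category.comp_id]

/-- The sideways crossing on `F`, before a cap on the left of `E`. -/
theorem sigma_cap {l n p : ℤ} (h : l + 2 = n) (h' : n + 2 = p) {x : B} (M : x ⟶ (S.o n).as) :
    map (S.E n p h') (app₂ (S.sigma l n p h h') M) ≫
      cap (S.adj n p h').counit (obj (S.E n p h') M) = app₂ (S.T l n p h h') (obj (S.F n l h) M) ≫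
        map (S.E n p h') (cap (S.adj l n h).counit M) := by
  rw [app₂_sigma, ← Fn.map_comp (S.F p n h'), Fn.map_comp, Category.assoc, cap_nat,
    cup_cap_left_assoc]

/-- Closing the composite of the sideways crossings on the right produces the square of the
crossing, which vanishes. -/
theorem cup_sigma'_sigma_cap {l n p : ℤ} {h : l + 2 = n} {h' : n + 2 = p} (L : S.LAdj l n h)
    (L' : S.LAdj n p h') {x : B} (M : x ⟶ (S.o n).as) :
    cup L'.adj.unit (obj (S.E n p h') M) ≫
      map (S.E n p h') (app₂ (S.sigma' h' L L'.adj.counit) M ≫ app₂ (S.sigma l n p h h') M) ≫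
        cap (S.adj n p h').counit (obj (S.E n p h') M) = 0 := by
  rw [Fn.map_comp, Category.assoc, sigma_cap, ← Category.assoc, cup_sigma', Category.assoc,
    ← Category.assoc (app₂ _ _), T_T, Limits.zero_comp, Limits.comp_zero]

/-- In the middle weight, the two normalisations agree. -/
theorem highNormal_of_lowNormal {n p : ℤ} {h' : n + 2 = p} (hn : n = -1) (L' : S.LAdj n p h')
    (hL' : S.LowNormal L') : S.HighNormal L' := by
  intro j hj
  obtain rfl : j = 0 := by omega
  have hN : n = -((0 + 1 : ℕ) : ℤ) := by simpa using hn
  obtain ⟨⟨L, hL⟩, H, H2⟩ := S.low_of_le (sub_add_cancel n 2) (by omega)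
  have hid := S.ident_FE hN L H L'.deg_counit (by simp) (hL' 0 hN) (H2 (by omega)).2
    (hL 2 (by push_cast; omega))
  obtain ⟨z, hz⟩ := S.one_zero p (L'.adj.unit ≫ (S.adj n p h').counit)
    (deg_cast k (deg_comp L'.deg_unit (S.deg_counit n p h')) (by omega))
  -- Insert the decomposition of the identity of `F E` between the cup and the cap: the crossings
  -- cancel, and what remains is the identity.
  have key : (1 - z) • 𝟙 (S.E n p h') = 0 := by
    refine app_ext fun M => ?_
    have h1 := congrArg (fun t => app₀ t (obj (S.E n p h') M)) hz
    simp only [app₀_comp₂, app₀_smul, app₀_id] at h1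
    have h2 : cup L'.adj.unit (obj (S.E n p h') M) ≫ cap (S.adj n p h').counit _ = 𝟙 _ := by
      rw [← Category.id_comp (cap _ _), ← Fn.map_id, ← app₂_id (S.E n p h') (S.F p n h') M, hid,
        app₂_add, Fn.map_add, Preadditive.add_comp, Preadditive.comp_add, app₂_smul, Fn.map_smul,
        Linear.smul_comp, Linear.comp_smul, app₂_comp₂, cup_sigma'_sigma_cap, smul_zero, zero_add]
      simp [cupCap, fakes, cupX]
    rw [app_smul, sub_smul, one_smul, app_id, ← h1, h2, sub_self, app_zero]
  have hXp : S.F p n h' ◁ S.Xp n p h' 0 = 𝟙 _ := Bicategory.whiskerLeft_id _ _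
  rw [hXp, Category.id_comp, hz]
  rcases smul_eq_zero.1 key with h1 | h1
  · rw [← sub_eq_zero.1 h1, one_smul]
  -- If `E` vanishes, so does the identity of the object, which is a summand of `E F`.
  · obtain ⟨D⟩ := S.comm_nonneg n p (p + 2) h' rfl (by omega)
    have h2 : 𝟙 (𝟙 (S.o p)) = 0 := by
      rw [← (D.i_q 0 (by omega) 0 (by omega)).trans (if_pos rfl), ← Category.comp_id (D.i 0),
        ← Bicategory.whiskerLeft_id, h1, AddBicat.whiskerLeft_zero, Limits.comp_zero,
        Limits.zero_comp]
    rw [h2, smul_zero]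

end Sys

end

section

variable {k : Type t} [Field k] {B : Type u} [Bicategory.{w, v} B] [AddBicat B] [GrBicat k B]

open GrBicat

namespace Coop

/-- Adjunctions in `B` are adjunctions in the dual, with the unit and the counit exchanged. -/
def adj {a b : B} {f : a ⟶ b} {g : b ⟶ a} (A : f ⊣ g) :
    Bicategory.Adjunction (B := Coop B) (a := ⟨b⟩) (b := ⟨a⟩) f g where
  unit := A.counit
  counit := A.unit
  left_triangle := (leftZigzag_eq (B := Coop B) (a := ⟨b⟩) (b := ⟨a⟩) (f := f) (g := g)
    A.counit A.unit).trans ((Category.assoc (A.unit ▷ f) (α_ f g f).hom (f ◁ A.counit)).trans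
      ((leftZigzag_eq A.unit A.counit).symm.trans A.left_triangle))
  right_triangle := (rightZigzag_eq (B := Coop B) (a := ⟨b⟩) (b := ⟨a⟩) (f := f) (g := g)
    A.counit A.unit).trans ((Category.assoc (g ◁ A.unit) (α_ g f g).inv (A.counit ▷ g)).trans
      ((rightZigzag_eq A.unit A.counit).symm.trans A.right_triangle))

/-- Adjunctions in the dual are adjunctions in `B`, with the unit and the counit exchanged. -/
def ofAdj {a b : B} {f : a ⟶ b} {g : b ⟶ a}
    (A : Bicategory.Adjunction (B := Coop B) (a := ⟨b⟩) (b := ⟨a⟩) f g) : f ⊣ g where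
  unit := A.counit
  counit := A.unit
  left_triangle := (leftZigzag_eq (B := B) (f := f) (g := g) A.counit A.unit).trans
    ((Category.assoc (obj := a ⟶ b) _ _ _).symm.trans ((leftZigzag_eq (B := Coop B) (a := ⟨b⟩)
      (b := ⟨a⟩) (f := f) (g := g) A.unit A.counit).symm.trans A.left_triangle))
  right_triangle := (rightZigzag_eq (B := B) (f := f) (g := g) A.counit A.unit).trans
    ((Category.assoc (obj := b ⟶ a) _ _ _).symm.trans ((rightZigzag_eq (B := Coop B) (a := ⟨b⟩)
      (b := ⟨a⟩) (f := f) (g := g) A.unit A.counit).symm.trans A.right_triangle))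

end Coop

namespace Sys

variable {r : kˣ}

variable (S : Sys k r B)

/-! ### Biadjoint actions -/

theorem Xp_succ' (m n : ℤ) (h : m + 2 = n) (j : ℕ) :
    S.Xp m n h (j + 1) = S.X m n h ≫ S.Xp m n h j := by
  induction j with
  | zero => exact (Category.id_comp _).trans (Category.comp_id _).symm
  | succ j ih => exact (congrArg (· ≫ S.X m n h) ih).trans (Category.assoc _ _ _)

theorem fn_Xp (m n : ℤ) (h : m + 2 = n) (j : ℕ) :
    Fn.under₂ (S.fn.Xp m n h j) = S.Xp m n h j := by
  induction j with
  | zero => rfl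
  | succ j ih => exact congrArg (· ≫ S.X m n h) ih

theorem coop_Xp (m n : ℤ) (h : m + 2 = n) (j : ℕ) :
    S.coop.Xp m n h j = S.Xp (-n) (-m) (by omega) j := by
  induction j with
  | zero => rfl
  | succ j ih =>
    rw [Xp_succ', ih]
    rfl

/-- A choice of normalised left adjunctions. -/
structure Bi where
  lad (m n : ℤ) (h : m + 2 = n) : S.LAdj m n h
  low (m n : ℤ) (h : m + 2 = n) : S.LowNormal (lad m n h)
  high (m n : ℤ) (h : m + 2 = n) : S.HighNormal (lad m n h)

variable {S}

/-- A left adjunction for the strictification is one for the original action. -/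
def LAdj.ofFn {m n : ℤ} {h : m + 2 = n} (L : S.fn.LAdj m n h) : S.LAdj m n h where
  adj :=
    { unit := L.adj.unit
      counit := L.adj.counit
      left_triangle := L.adj.left_triangle
      right_triangle := L.adj.right_triangle }
  deg_unit := L.deg_unit
  deg_counit := L.deg_counit

/-- A left adjunction gives one for the strictification. -/
def LAdj.fn {m n : ℤ} {h : m + 2 = n} (L : S.LAdj m n h) : S.fn.LAdj m n h where
  adj :=
    { unit := L.adj.unit
      counit := L.adj.counit
      left_triangle := L.adj.left_triangle
      right_triangle := L.adj.right_triangle }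
  deg_unit := L.deg_unit
  deg_counit := L.deg_counit

/-- A left adjunction for the dual action gives one for the original action. -/
def LAdj.ofCoop {m n : ℤ} {h : m + 2 = n} (L : S.coop.LAdj m n h) :
    S.LAdj (-n) (-m) (by omega) where
  adj := Coop.ofAdj L.adj
  deg_unit := deg_cast k (B := B) L.deg_counit (by omega)
  deg_counit := deg_cast k (B := B) L.deg_unit (by omega)

/-- A left adjunction gives one for the dual action. -/
def LAdj.coop {m n : ℤ} {h : m + 2 = n} (L : S.LAdj (-n) (-m) (by omega)) :
    S.coop.LAdj m n h where
  adj := Coop.adj L.adj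
  deg_unit := deg_cast k (B := B) L.deg_counit (by omega)
  deg_counit := deg_cast k (B := B) L.deg_unit (by omega)

theorem fn_cupX (m n : ℤ) (h : m + 2 = n) (j : ℕ) :
    Fn.under₂ (S.fn.cupX m n h j) = S.cupX m n h j :=
  congrArg (fun t => (S.adj m n h).unit ≫ t ▷ S.F n m h) (S.fn_Xp m n h j)

theorem lowNormal_ofFn {m n : ℤ} {h : m + 2 = n} {L : S.fn.LAdj m n h} (hL : S.fn.LowNormal L) :
    S.LowNormal L.ofFn := fun j hj =>
  (congrArg (· ≫ L.ofFn.adj.counit) (fn_cupX m n h j)).symm.trans (hL j hj)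

theorem highNormal_ofFn {m n : ℤ} {h : m + 2 = n} {L : S.fn.LAdj m n h} (hL : S.fn.HighNormal L) :
    S.HighNormal L.ofFn := fun j hj =>
  (congrArg (fun t => L.ofFn.adj.unit ≫ S.F n m h ◁ t ≫ (S.adj m n h).counit)
    (S.fn_Xp m n h j)).symm.trans (hL j hj)

/-- Normalised left adjunctions for the strictification. -/
def Bi.fn (b : Bi S) : Bi S.fn where
  lad m n h := (b.lad m n h).fn
  low m n h j hj := Eq.trans (congrArg (· ≫ (b.lad m n h).adj.counit) (fn_cupX m n h j))
    (b.low m n h j hj)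
  high m n h j hj := Eq.trans (congrArg
    (fun t => (b.lad m n h).adj.unit ≫ S.F n m h ◁ t ≫ (S.adj m n h).counit) (S.fn_Xp m n h j))
      (b.high m n h j hj)

theorem highNormal_ofCoop {m n : ℤ} {h : m + 2 = n} {L : S.coop.LAdj m n h}
    (hL : S.coop.LowNormal L) : S.HighNormal L.ofCoop := fun j hj =>
  (congrArg (fun t => L.ofCoop.adj.unit ≫ S.F (-m) (-n) (by omega) ◁ t ≫
    (S.adj (-n) (-m) (by omega)).counit) (S.coop_Xp m n h j)).symm.trans (hL j (by omega))

/-- Normalised left adjunctions for the dual action. -/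
def Bi.coop (b : Bi S) : Bi S.coop where
  lad m n h := (b.lad (-n) (-m) (by omega)).coop
  low m n h j hj := Eq.trans (congrArg (fun t => (b.lad (-n) (-m) (by omega)).adj.unit ≫
    S.F (-m) (-n) (by omega) ◁ t ≫ (S.adj (-n) (-m) (by omega)).counit) (S.coop_Xp m n h j))
      (b.high (-n) (-m) (by omega) j (by omega))
  high m n h j hj := Eq.trans (congrArg (fun t => ((S.adj (-n) (-m) (by omega)).unit ≫
    t ▷ S.F (-m) (-n) (by omega)) ≫ (b.lad (-n) (-m) (by omega)).adj.counit) (S.coop_Xp m n h j))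
      (b.low (-n) (-m) (by omega) j (by omega))

/-- The right adjoints of the 1-morphisms `E` are also left adjoints. -/
theorem exists_bi (S : Sys k r B) : Nonempty (Bi S) := by
  have key : ∀ m n h, ∃ L : S.LAdj m n h, S.LowNormal L ∧ S.HighNormal L := by
    intro m n h
    rcases le_or_gt m (-1) with hm | hm
    · obtain ⟨⟨L, hL⟩, -⟩ := S.fn.low_of_le h hm
      refine ⟨L.ofFn, lowNormal_ofFn hL, ?_⟩
      rcases hm.lt_or_eq with hm' | rfl
      · exact fun j hj => by omega
      · exact highNormal_ofFn (S.fn.highNormal_of_lowNormal rfl L hL)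
    · obtain ⟨m', rfl⟩ : ∃ m', m = -m' := ⟨-m, (neg_neg m).symm⟩
      obtain ⟨n', rfl⟩ : ∃ n', n = -n' := ⟨-n, (neg_neg n).symm⟩
      obtain ⟨⟨L, hL⟩, -⟩ := S.coop.fn.low_of_le (show n' + 2 = m' by omega) (by omega)
      exact ⟨L.ofFn.ofCoop, fun j hj => by omega, highNormal_ofCoop (lowNormal_ofFn hL)⟩
  choose L hL using key
  exact ⟨⟨L, fun m n h => (hL m n h).1, fun m n h => (hL m n h).2⟩⟩

end Sys

end

section

variable {k : Type t} [Field k] {B : Type u} [Bicategory.{w, v} B] [AddBicat B] [GrBicat k B]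

open GrBicat

namespace Sys

variable {r : kˣ}

/-! ### Curls and sideways crossings in non-positive weights -/

/-- The curl on the right of `E`. -/
def curlR (S : Sys k r B) {l n p : ℤ} {h : l + 2 = n} (h' : n + 2 = p) (L : S.LAdj l n h) :
    S.E n p h' ⟶ S.E n p h' :=
  (λ_ _).inv ≫ L.adj.unit ▷ _ ≫ (α_ _ _ _).hom ≫ _ ◁ S.T l n p h h' ≫ (α_ _ _ _).inv ≫
    (S.adj l n h).counit ▷ _ ≫ (λ_ _).hom

theorem deg_curlR (S : Sys k r B) {l n p : ℤ} {h : l + 2 = n} (h' : n + 2 = p) (L : S.LAdj l n h) :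
    S.curlR h' L ∈ deg k (-(2 * n)) _ _ :=
  deg_cast k (deg_comp (deg_leftUnitor _).2 (deg_comp (deg_whiskerRight _ L.deg_unit)
    (deg_comp (deg_associator _ _ _).1 (deg_comp (deg_whiskerLeft _ (S.deg_T l n p h h'))
        (deg_comp (deg_associator _ _ _).2 (deg_comp
          (deg_whiskerRight _ (S.deg_counit l n h)) (deg_leftUnitor _).1)))))) (by omega)

/-- The endomorphisms of `E` of negative degree vanish, and those of degree zero are scalars. In
weights `m ≥ 0` this is the statement for the dual action. -/
theorem end₁ (S : Sys k r B) (m n : ℤ) (h : m + 2 = n) : S.End₁ m n h := by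
  rcases le_or_gt m (-1) with hm | hm
  · exact (S.fn.low_of_le h hm).2.1
  · obtain ⟨m, rfl⟩ : ∃ m', m = -m' := ⟨-m, (neg_neg m).symm⟩
    obtain ⟨n, rfl⟩ : ∃ n', n = -n' := ⟨-n, (neg_neg n).symm⟩
    exact (S.coop.fn.low_of_le (show n + 2 = m by omega) (by omega)).2.1

/-- The crossing spans the endomorphisms of `E E` of degree `-2`. -/
theorem end₂ (S : Sys k r B) (a b c : ℤ) (h : a + 2 = b) (h' : b + 2 = c) : S.End₂ a b c h h' := by
  rcases le_or_gt a (-2) with ha | ha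
  · exact ((S.fn.low_of_le h (by omega)).2.2 ha).1 c h'
  · obtain ⟨a, rfl⟩ : ∃ m', a = -m' := ⟨-a, (neg_neg a).symm⟩
    obtain ⟨b, rfl⟩ : ∃ n', b = -n' := ⟨-b, (neg_neg b).symm⟩
    obtain ⟨c, rfl⟩ : ∃ n', c = -n' := ⟨-c, (neg_neg c).symm⟩
    exact ((S.coop.fn.low_of_le (show c + 2 = b by omega) (by omega)).2.2 (by omega)).1 a (by omega)

open Fn

variable (S : Sys k r (Fn k B))

section

variable {l n p : ℤ} {h : l + 2 = n} {h' : n + 2 = p} (L : S.LAdj l n h) (L' : S.LAdj n p h')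

theorem app_curlR {x : B} (M : x ⟶ (S.o n).as) :
    app (S.curlR h' L) M = map (S.E n p h') (cup L.adj.unit M) ≫
      app₂ (S.T l n p h h') (obj (S.F n l h) M) ≫ map (S.E n p h') (cap (S.adj l n h).counit M) := by
  simp [curlR]
  rfl

/-- Composing a cup with a sideways crossing produces a curl. -/
theorem unit_sigma : L.adj.unit ≫ S.sigma l n p h h' =
    (S.adj n p h').unit ≫ S.curlR h' L ▷ S.F p n h' := by
  refine cup_ext (k := k) (B := B) fun M => ?_
  rw [cup_comp₂, cup_comp₂, app₂_sigma, app₂_whiskerRight, app_curlR, cup_nat_assoc,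
    Fn.map_comp, Fn.map_comp]

theorem T_eq_zero_of_sigma (hs : S.sigma l n p h h' = 0) : S.T l n p h h' = 0 := by
  refine app_ext fun M => ?_
  have h1 := S.cup_sigma h h' M
  rw [hs, app₂_zero, Limits.comp_zero] at h1
  have h2 := congrArg (fun t => map (S.E n p h') t ≫ cap (S.adj n p h').counit _) h1
  simp only [Fn.map_zero, Limits.zero_comp, Fn.map_comp, Category.assoc] at h2
  rw [cap_nat, cup_cap_left_assoc] at h2
  rw [app_zero]
  exact h2.symm

theorem T_eq_zero_of_sigma' (hs : S.sigma' h' L L'.adj.counit = 0) : S.T l n p h h' = 0 := by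
  refine app_ext fun M => ?_
  have h1 := S.sigma'_cap h h' L L'.adj.counit M
  rw [hs, app₂_zero, Limits.zero_comp] at h1
  have h2 := congrArg (fun t => cup L'.adj.unit _ ≫ map (S.E n p h') t) h1
  simp only [Fn.map_zero, Limits.comp_zero, Fn.map_comp] at h2
  rw [← cup_nat_assoc, cup_cap_right, Category.comp_id] at h2
  rw [app_zero]
  exact h2.symm

/-- Closing the composite of the sideways crossings on the right, with a dot, produces a curl. -/
theorem cup_X_sigma'_sigma_cap {x : B} (M : x ⟶ (S.o n).as) :
    cup L'.adj.unit (obj (S.E n p h') M) ≫ app (S.X n p h') (obj (S.F p n h') (obj (S.E n p h') M)) ≫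
      map (S.E n p h') (app₂ (S.sigma' h' L L'.adj.counit) M ≫ app₂ (S.sigma l n p h h') M) ≫
        cap (S.adj n p h').counit (obj (S.E n p h') M) = (r : k) • app (S.curlR h' L) M := by
  have h1 := S.slide'_app l n p h h' (obj (S.F n l h) M)
  change app₂ (S.T l n p h h') (obj (S.F n l h) M) ≫ _ =
    _ ≫ app₂ (S.T l n p h h') (obj (S.F n l h) M) + _ at h1
  rw [Fn.map_comp, Category.assoc, sigma_cap, ← app_naturality_assoc, reassoc_of% S.cup_sigma' L L' M,
    reassoc_of% h1, Preadditive.add_comp, Category.assoc, ← Category.assoc (app₂ _ _), T_T,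
    Limits.zero_comp, Limits.comp_zero, zero_add, Linear.smul_comp, Category.id_comp,
    Linear.comp_smul, app_curlR]

end

/-- The endomorphisms of `E F` of degree zero are scalars, in non-positive weights. -/
theorem end_EF_scalar {l n : ℤ} (h : l + 2 = n) (hn : n ≤ 0) (z : S.F n l h ≫ S.E l n h ⟶ _)
    (hz : z ∈ deg k 0 _ (S.F n l h ≫ S.E l n h)) : ∃ c : k, z = c • 𝟙 _ :=
  ((S.low_of_le h (by omega)).2.2 (by omega)).2 z hz

/-- The endomorphisms of `F E` of degree zero are scalars, in non-negative weights. -/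
theorem end_FE_scalar {n p : ℤ} (h : n + 2 = p) (hn : 0 ≤ n) (z : S.E n p h ≫ S.F p n h ⟶ _)
    (hz : z ∈ deg k 0 _ (S.E n p h ≫ S.F p n h)) : ∃ c : k, z = c • 𝟙 _ := by
  obtain ⟨n, rfl⟩ : ∃ n', n = -n' := ⟨-n, (neg_neg n).symm⟩
  obtain ⟨p, rfl⟩ : ∃ n', p = -n' := ⟨-p, (neg_neg p).symm⟩
  exact ((S.coop.fn.low_of_le (show p + 2 = n by omega) (by omega)).2.2 (by omega)).2 z hz

/-- In weight zero, the sideways crossings are mutually inverse up to a scalar, and the curls are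
scalars. -/
theorem weight_zero {l p : ℤ} {h : l + 2 = 0} {h' : 0 + 2 = p} (L : S.LAdj l 0 h)
    (hL : S.LowNormal L) (L' : S.LAdj 0 p h') (hL' : S.HighNormal L') :
    S.sigma l 0 p h h' ≫ S.sigma' h' L L'.adj.counit = - ((r : k) ^ 2) • 𝟙 _ ∧
      S.sigma' h' L L'.adj.counit ≫ S.sigma l 0 p h h' = - ((r : k) ^ 2) • 𝟙 _ ∧
        L.adj.unit ≫ S.sigma l 0 p h h' = -(r : k) • (S.adj 0 p h').unit := by
  obtain ⟨D⟩ := S.comm_nonpos l 0 p h h' le_rfl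
  have hD : D.v ≫ D.u = 𝟙 _ := by simpa using D.total
  by_cases h0 : 𝟙 (𝟙 (S.o l)) = 0
  · -- in this case everything vanishes
    have hu : D.u = 0 := by
      rw [← Category.id_comp D.u, ← id_whiskerRight, eq_zero_of_target h0 (𝟙 (S.F 0 l h)),
        AddBicat.zero_whiskerRight, Limits.zero_comp]
    have hFE : 𝟙 (S.E 0 p h' ≫ S.F p 0 h') = 0 := by rw [← hD, hu, Limits.comp_zero]
    have hEF : 𝟙 (S.F 0 l h ≫ S.E l 0 h) = 0 := by rw [← D.u_v, hu, Limits.zero_comp]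
    refine ⟨?_, ?_, ?_⟩
    · rw [← Category.id_comp (S.sigma l 0 p h h'), hEF, Limits.zero_comp, Limits.zero_comp, smul_zero]
    · rw [← Category.id_comp (S.sigma' h' L _), hFE, Limits.zero_comp, Limits.zero_comp, smul_zero]
    · rw [← Category.comp_id (S.sigma l 0 p h h'), ← Category.comp_id (S.adj 0 p h').unit, hFE,
        Limits.comp_zero, Limits.comp_zero, Limits.comp_zero, smul_zero]
  have hEE : 𝟙 (S.E l 0 h ≫ S.E 0 p h') ≠ 0 := by
    intro hE
    obtain rfl : p = 2 := by omega
    obtain rfl : l = -2 := by omega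
    have h1 := app₂_id (S.E (-2) 0 h) (S.E 0 2 h') (𝟙 (S.o (-2)).as)
    rw [hE] at h1
    replace h1 := (app_zero _).symm.trans h1
    exact S.It_ne_zero (𝟙 (S.o (-2)).as) h0 2 (by norm_num) h1.symm
  have hT : S.T l 0 p h h' ≠ 0 := fun hT => hEE (S.id_eq_zero_of_T hT)
  -- None of the 2-morphisms used below vanishes, so that scalars may be compared.
  have hE : 𝟙 (S.E l 0 h) ≠ 0 := fun hE => hEE (by
    rw [← id_whiskerRight, hE, AddBicat.zero_whiskerRight])
  have hE' : 𝟙 (S.E 0 p h') ≠ 0 := fun hE => hEE (by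
    rw [← Bicategory.whiskerLeft_id, hE, AddBicat.whiskerLeft_zero])
  have hσ : S.sigma l 0 p h h' ≠ 0 := fun hs => hT (S.T_eq_zero_of_sigma hs)
  have hσ' : S.sigma' h' L L'.adj.counit ≠ 0 := fun hs => hT (S.T_eq_zero_of_sigma' L L' hs)
  have hun : (S.adj 0 p h').unit ≠ 0 := by
    intro hu
    refine hE' (app_ext fun M => ?_)
    rw [app_id, ← cup_cap_left (S.adj 0 p h') M, hu, cup_zero, Fn.map_zero, Limits.zero_comp,
      app_zero]
  have d1 := S.deg_sigma l 0 p h h'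
  have d2 := S.deg_sigma' h' L L'.deg_counit
  -- the scalars by which the composites of the crossings and the curls act
  obtain ⟨c, hc⟩ := S.end_EF_scalar h le_rfl _ (deg_cast k (deg_comp d1 d2) (add_zero 0))
  obtain ⟨c', hc'⟩ := S.end_FE_scalar h' le_rfl _ (deg_cast k (deg_comp d2 d1) (add_zero 0))
  obtain ⟨s, hs⟩ := (S.end₁ l 0 h).2 _ (deg_cast k (S.deg_curlL h h' L'.deg_counit 0) (by simp))
  obtain ⟨q, hq⟩ := (S.end₁ 0 p h').2 _ (deg_cast k (S.deg_curlR h' L) (by simp))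
  obtain ⟨z, hz⟩ := S.end_EF_scalar h le_rfl _ (deg_cast k (deg_comp d1 D.deg_v) (add_zero 0))
  have smul_inj : ∀ {a b : Fn k B} {f g : a ⟶ b} {x : f ⟶ g} {y z : k}, x ≠ 0 → y • x = z • x →
      y = z := fun hx H => by
    rw [← sub_eq_zero, ← sub_smul] at H
    exact sub_eq_zero.1 ((smul_eq_zero.1 H).resolve_right hx)
  -- The composites of the crossings act by `c` and `c'`, the left curl by `s` and the right curl by
  -- `q`. The relations are `c = c' = s q` (pull a curl through the cups), `c = -r s` and `c' = r q`
  -- (close the composites with dots); as `c ≠ 0`, it follows that `s = r`, `q = -r` and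
  -- `c = -r ^ 2`.
  have e1 : c = c' := by
    refine smul_inj hσ ?_
    have := congrArg (fun t => t ≫ S.sigma l 0 p h h') hc
    rw [Category.assoc, hc'] at this
    simpa using this.symm
  have u1 : L.adj.unit ≫ S.sigma l 0 p h h' = q • (S.adj 0 p h').unit := by
    rw [unit_sigma, hq, GrBicat.smul_whiskerRight, id_whiskerRight, Linear.comp_smul,
      Category.comp_id]
  have u2 : (S.adj 0 p h').unit ≫ S.sigma' h' L L'.adj.counit = s • L.adj.unit := by
    have := S.cupX_sigma' h h' L L'.adj.counit 0
    rw [hs, GrBicat.whiskerLeft_smul, Bicategory.whiskerLeft_id, Linear.comp_smul,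
      Category.comp_id] at this
    rw [← this]
    simp [cupX, Xp]
  have e2 : c' = s * q := by
    refine smul_inj hun ?_
    have := congrArg (fun t => t ≫ S.sigma l 0 p h h') u2
    rw [Category.assoc, hc', Linear.smul_comp, u1, Linear.comp_smul, Category.comp_id,
      smul_smul] at this
    exact this
  have e3 : c = - (r * s) := by
    refine smul_inj hE (app_ext fun M => ?_)
    have h1 := S.cup_sigma_sigma'_cap h h' L L'.adj.counit 1 M
    have h2 := congrArg (fun t => app₀ t M) (hL 1 (by omega))
    simp only [app₀_comp₂, cup_cupX, Category.assoc, app₀_id] at h2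
    rw [hc, app₂_smul, app₂_id, Linear.smul_comp, Linear.comp_smul, Category.id_comp,
      ← Fn.map_comp, h2, Fn.map_id, Finset.sum_range_one, hs, Nat.sub_self,
      app_Xp_zero, Category.id_comp, app_smul, app_id, smul_smul, ← neg_smul] at h1
    rw [app_smul, app_smul, app_id, h1]
  have e4 : c' = r * q := by
    refine smul_inj hE' (app_ext fun M => ?_)
    have h1 := S.cup_X_sigma'_sigma_cap L L' M
    have h2 := congrArg (fun t => app₀ t (obj (S.E 0 p h') M)) (hL' 1 (by push_cast; omega))
    rw [app₀_comp₂, cap_comp₂, app₂_whiskerLeft, app_Xp_succ, app_Xp_zero, Category.id_comp,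
      app₀_id] at h2
    rw [← app₂_comp₂, hc', app₂_smul, app₂_id, Fn.map_smul, Fn.map_id, Linear.smul_comp,
      Category.id_comp, Linear.comp_smul, Linear.comp_smul, h2, hq, app_smul, app_id,
      smul_smul] at h1
    rw [app_smul, app_smul, app_id, h1]
  -- By degree, the crossing is a multiple of the isomorphism `D.u`, so it is invertible.
  have e5 : c ≠ 0 := by
    rintro rfl
    have e := D.expand (S.sigma l 0 p h h')
    rw [hz] at e
    simp only [neg_zero, Int.toNat_zero, Finset.range_zero, Finset.sum_empty, add_zero,
      Linear.smul_comp, Category.id_comp] at e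
    have hz0 : z ≠ 0 := by
      rintro rfl
      exact hσ (by rw [e, zero_smul])
    rw [e, zero_smul, Linear.smul_comp] at hc
    refine hσ' ?_
    rw [← Category.id_comp (S.sigma' h' L _), ← hD, Category.assoc,
      (smul_eq_zero.1 hc).resolve_left hz0, Limits.comp_zero]
  have hs0 : s ≠ 0 := by
    rintro rfl
    exact e5 (by rw [e3, mul_zero, neg_zero])
  have e6 : q = -s := mul_left_cancel₀ r.ne_zero (by rw [← e4, ← e1, e3, mul_neg])
  have e7 : s = r := by
    refine mul_right_cancel₀ hs0 ?_
    rw [e1, e2, e6, mul_neg] at e3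
    exact neg_injective e3
  refine ⟨?_, ?_, ?_⟩
  · rw [hc, e3, e7, pow_two]
  · rw [hc', ← e1, e3, e7, pow_two]
  · rw [u1, e6, e7]

end Sys

end

section

/-! ### Coherence for sideways crossings and curls -/

theorem crossing_coherence {B : Type u} [Bicategory.{w, v} B] {a b c : B} {f : a ⟶ b} {e : b ⟶ a}
    {e' : a ⟶ c} {g : c ⟶ a} (x : 𝟙 a ⟶ e' ≫ g) (t : e ≫ e' ⟶ e ≫ e') (y : f ≫ e ⟶ 𝟙 a) :
    ((((((ρ_ (f ≫ e)).inv ≫ (f ≫ e) ◁ x) ≫ (α_ (f ≫ e) e' g).inv) ≫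
      (((α_ f e e').hom ≫ f ◁ t) ≫ (α_ f e e').inv) ▷ g) ≫ (α_ (f ≫ e) e' g).hom) ≫
        y ▷ (e' ≫ g)) ≫ (λ_ _).hom =
    (ρ_ _).inv ≫ _ ◁ x ≫ (α_ _ _ _).hom ≫ f ◁ ((α_ _ _ _).inv ≫ t ▷ _ ≫ (α_ _ _ _).hom) ≫
      (α_ _ _ _).inv ≫ y ▷ _ ≫ (λ_ _).hom := by
  simp

theorem crossing_coherence' {B : Type u} [Bicategory.{w, v} B] {a b c : B} {f : a ⟶ b} {e : b ⟶ a}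
    {e' : a ⟶ c} {g : c ⟶ a} (x : 𝟙 a ⟶ f ≫ e) (t : e ≫ e' ⟶ e ≫ e') (y : e' ≫ g ⟶ 𝟙 a) :
    ((((((λ_ (e' ≫ g)).inv ≫ x ▷ (e' ≫ g)) ≫ (α_ (f ≫ e) e' g).inv) ≫
      (((α_ f e e').hom ≫ f ◁ t) ≫ (α_ f e e').inv) ▷ g) ≫ (α_ (f ≫ e) e' g).hom) ≫
        (f ≫ e) ◁ y) ≫ (ρ_ _).hom =
    (λ_ _).inv ≫ x ▷ _ ≫ (α_ _ _ _).hom ≫ f ◁ ((α_ _ _ _).inv ≫ t ▷ _ ≫ (α_ _ _ _).hom) ≫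
      (α_ _ _ _).inv ≫ _ ◁ y ≫ (ρ_ _).hom := by
  simp

/-- The 2-endomorphisms of an identity commute. -/
theorem end_one_comm {B : Type u} [Bicategory.{w, v} B] {a : B} (s t : 𝟙 a ⟶ 𝟙 a) : s ≫ t = t ≫ s := by
  have h1 := Bicategory.whisker_exchange s t
  simpa using h1.symm

theorem whiskerLeft_one_comm {B : Type u} [Bicategory.{w, v} B] {a b : B} {f : a ⟶ b} (x : f ⟶ f)
    (s : 𝟙 b ⟶ 𝟙 b) : (((ρ_ f).inv ≫ f ◁ s) ≫ (ρ_ f).hom) ≫ x =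
      x ≫ (ρ_ f).inv ≫ f ◁ s ≫ (ρ_ f).hom := by
  rw [rightUnitor_inv_naturality_assoc, ← Bicategory.whisker_exchange_assoc, Category.assoc,
    Category.assoc, rightUnitor_naturality]

variable {k : Type t} [Field k] {B : Type u} [Bicategory.{w, v} B] [AddBicat B] [GrBicat k B]

open GrBicat

namespace Sys

variable {r : kˣ} (S : Sys k r B)

theorem coop_sigma (l n p : ℤ) (h : l + 2 = n) (h' : n + 2 = p) :
    S.coop.sigma l n p h h' = S.sigma (-p) (-n) (-l) (by omega) (by omega) :=
  crossing_coherence _ _ _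

variable {S} (b : Bi S)

namespace Bi

/-- The sideways crossing `F E ⟶ E F`. -/
def sigma' (l n p : ℤ) (h : l + 2 = n) (h' : n + 2 = p) :
    S.E n p h' ≫ S.F p n h' ⟶ S.F n l h ≫ S.E l n h :=
  S.sigma' h' (b.lad l n h) (b.lad n p h').adj.counit

/-- The curl on the right of `E`. -/
def curlR (l n p : ℤ) (h : l + 2 = n) (h' : n + 2 = p) : S.E n p h' ⟶ S.E n p h' :=
  S.curlR h' (b.lad l n h)

/-- The curl on the left of `E`. -/
def curlL (l n p : ℤ) (h : l + 2 = n) (h' : n + 2 = p) : S.E l n h ⟶ S.E l n h :=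
  (ρ_ _).inv ≫ _ ◁ (S.adj n p h').unit ≫ (α_ _ _ _).inv ≫
    S.T l n p h h' ▷ _ ≫ (α_ _ _ _).hom ≫ _ ◁ (b.lad n p h').adj.counit ≫ (ρ_ _).hom

/-- The counterclockwise bubble with `j` dots. -/
def ccw (m n : ℤ) (h : m + 2 = n) (j : ℕ) : 𝟙 (S.o m) ⟶ 𝟙 (S.o m) :=
  S.cupX m n h j ≫ (b.lad m n h).adj.counit

/-- The clockwise bubble with `j` dots. -/
def cw (m n : ℤ) (h : m + 2 = n) (j : ℕ) : 𝟙 (S.o n) ⟶ 𝟙 (S.o n) :=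
  (b.lad m n h).adj.unit ≫ S.F n m h ◁ S.Xp m n h j ≫ (S.adj m n h).counit

/-- The counterclockwise bubble of degree `2 * j` in weight `-N`; it has `N - 1 + j` dots. For
`j = 0` it is the identity by definition, which for `N = 0` is the convention for fake bubbles. -/
def ccwB (N : ℕ) (n p : ℤ) (h' : n + 2 = p) : ℕ → (𝟙 (S.o n) ⟶ 𝟙 (S.o n))
  | 0 => 𝟙 _
  | j + 1 => b.ccw n p h' (N + j)

/-- The clockwise bubble of degree `2 * j` in weight `N`; it has `N - 1 + j` dots. For `j = 0` it
is the identity by definition, which for `N = 0` is the convention for fake bubbles. -/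
def cwB (N : ℕ) (l n : ℤ) (h : l + 2 = n) : ℕ → (𝟙 (S.o n) ⟶ 𝟙 (S.o n))
  | 0 => 𝟙 _
  | j + 1 => b.cw l n h (N + j)

theorem coop_sigma' (l n p : ℤ) (h : l + 2 = n) (h' : n + 2 = p) :
    b.coop.sigma' l n p h h' = b.sigma' (-p) (-n) (-l) (by omega) (by omega) :=
  crossing_coherence' _ _ _

theorem coop_curlR (l n p : ℤ) (h : l + 2 = n) (h' : n + 2 = p) :
    b.coop.curlR l n p h h' = b.curlL (-p) (-n) (-l) (by omega) (by omega) := by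
  refine Eq.trans ?_ (?_ : ((((((ρ_ _).inv ≫ _ ◁ (S.adj (-n) (-l) (by omega)).unit) ≫ (α_ _ _ _).inv) ≫
    S.T (-p) (-n) (-l) (by omega) (by omega) ▷ _) ≫ (α_ _ _ _).hom) ≫
      _ ◁ (b.lad (-n) (-l) (by omega)).adj.counit) ≫ (ρ_ _).hom = _)
  · rfl
  · simp only [curlL, Category.assoc]

theorem coop_ccw (m n : ℤ) (h : m + 2 = n) (j : ℕ) :
    b.coop.ccw m n h j = b.cw (-n) (-m) (by omega) j :=
  congrArg (fun t => (b.lad (-n) (-m) (by omega)).adj.unit ≫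
    S.F (-m) (-n) (by omega) ◁ t ≫ (S.adj (-n) (-m) (by omega)).counit) (S.coop_Xp m n h j)

theorem fn_ccw (m n : ℤ) (h : m + 2 = n) (j : ℕ) :
    Fn.under₂ (b.fn.ccw m n h j) = b.ccw m n h j :=
  congrArg (· ≫ (b.lad m n h).adj.counit) (fn_cupX m n h j)

end Bi

end Sys

theorem fn_fakes {a : B} {f : ℕ → ((𝟙 (⟨a⟩ : Fn k B)) ⟶ 𝟙 (⟨a⟩ : Fn k B))} {g : ℕ → (𝟙 a ⟶ 𝟙 a)}
    (hfg : ∀ j, Fn.under₂ (f j) = g j) (j : ℕ) : Fn.under₂ (fakes f j) = fakes g j := by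
  induction j using Nat.strong_induction_on with
  | _ j ih =>
    cases j with
    | zero => rw [fakes, fakes]; rfl
    | succ j =>
      rw [fakes, fakes]
      refine congrArg Neg.neg (Finset.sum_congr rfl fun i _ => ?_)
      rw [← hfg, ← ih _ i.2]
      rfl

theorem coop_fakes {a : B} {f : ℕ → ((𝟙 (⟨a⟩ : Coop B)) ⟶ 𝟙 (⟨a⟩ : Coop B))} {g : ℕ → (𝟙 a ⟶ 𝟙 a)}
    (hfg : ∀ j, f j = g j) (j : ℕ) : fakes f j = fakes g j := by
  induction j using Nat.strong_induction_on with
  | _ j ih =>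
    cases j with
    | zero => rw [fakes, fakes]; rfl
    | succ j =>
      rw [fakes, fakes]
      refine congrArg Neg.neg (Finset.sum_congr rfl fun i _ => ?_)
      rw [end_one_comm, ← hfg, ← ih _ i.2]
      rfl

namespace Sys

variable {r : kˣ}

namespace Bi

section

open Fn

variable {S : Sys k r (Fn k B)} (b : Bi S) (N : ℕ) {l n p : ℤ} (h : l + 2 = n) (h' : n + 2 = p)
  (hn : n = -N)

include hn

/-- The relations for sideways crossings in non-positive weights: `weight_zero` in weight `0`, and
`ident_FE` in negative weights. The last one follows by composing the decomposition of the identity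
of `F E` with the cup with `-n` dots. -/
theorem nonpos_fn : S.sigma l n p h h' ≫ b.sigma' l n p h h' = - ((r : k) ^ 2) • 𝟙 _ ∧
    𝟙 (S.E n p h' ≫ S.F p n h') =
      (-((r⁻¹ : kˣ) : k) ^ 2) • (b.sigma' l n p h h' ≫ S.sigma l n p h h') +
        S.cupCap (b.lad n p h').adj.counit N (fakes (b.ccwB N n p h')) ∧
    (b.lad l n h).adj.unit ≫ S.sigma l n p h h' = -(r : k) •
      ∑ i ∈ Finset.range (N + 1), fakes (b.ccwB N n p h') (N - i) ≫ S.cupX n p h' i := by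
  cases N with
  | zero =>
    obtain rfl : n = 0 := by simpa using hn
    obtain ⟨h1, h2, h3⟩ := S.weight_zero (b.lad l 0 h) (b.low _ _ _) (b.lad 0 p h') (b.high _ _ _)
    refine ⟨h1, ?_, ?_⟩
    · rw [Bi.sigma', h2, cupCap, Finset.sum_range_zero, add_zero, smul_smul]
      simp
    · rw [h3, Finset.sum_range_one, fakes, Category.id_comp, cupX, Xp, id_whiskerRight,
        Category.comp_id]
  | succ M =>
    have H := S.end₁ l n h
    have hc := (b.lad n p h').deg_counit
    have hc1 : S.cupX n p h' M ≫ (b.lad n p h').adj.counit = 𝟙 _ := b.low n p h' M hn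
    have hc0 : ∀ j < M, S.cupX n p h' j ≫ (b.lad n p h').adj.counit = 0 := fun j hj =>
      S.one_neg _ _ (by omega) _ (deg_comp (S.deg_cupX n p h' j) hc)
    have hL := b.low l n h (M + 2) (by omega)
    have K := S.end_EF_scalar h (by omega)
    -- The bubble of degree zero is the identity, by the normalisation of the left adjunction.
    have hb : (fun t => S.cupX n p h' (M + t) ≫ (b.lad n p h').adj.counit) =
        b.ccwB (M + 1) n p h' := by
      funext t
      cases t with
      | zero => exact hc1
      | succ t => rw [ccwB, ccw, Nat.add_right_comm, ← Nat.add_assoc]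
    have I := S.ident_FE hn (b.lad l n h) H hc hc0 hc1 K hL
    rw [hb] at I
    refine ⟨S.sigma_sigma' hn (b.lad l n h) H hc hc0 hc1 K hL, I, ?_⟩
    -- On the cup with `-n` dots, `σ'` gives the left curl, which is `r` times the identity.
    have e1 := S.cupX_sigma' h h' (b.lad l n h) (b.lad n p h').adj.counit (M + 1)
    rw [S.curlL_eq_smul hn H hc hc0 hc1, GrBicat.whiskerLeft_smul, Bicategory.whiskerLeft_id,
      Linear.comp_smul, Category.comp_id] at e1
    have e2 := congrArg (fun t => S.cupX n p h' (M + 1) ≫ t) I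
    simp only [Preadditive.comp_add, Linear.comp_smul, Category.comp_id] at e2
    rw [← Category.assoc _ _ (S.sigma l n p h h'), e1, Linear.smul_comp, smul_smul] at e2
    have e3 : (b.lad l n h).adj.unit ≫ S.sigma l n p h h' = -(r : k) •
        (S.cupX n p h' (M + 1) - S.cupX n p h' (M + 1) ≫
          S.cupCap (b.lad n p h').adj.counit (M + 1) (fakes (b.ccwB (M + 1) n p h'))) := by
      rw [eq_comm, ← eq_sub_iff_add_eq] at e2
      rw [← e2, smul_smul]
      simp [pow_two]
    rw [e3, Finset.sum_range_succ, Nat.sub_self, fakes, Category.id_comp, add_comm (Finset.sum _ _),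
      sub_eq_add_neg, cupCap, Preadditive.comp_sum, ← Finset.sum_neg_distrib]
    -- What remains are the inductive definitions of the fake bubbles.
    refine congrArg (fun t => -(r : k) • (_ + t)) (Finset.sum_congr rfl fun i hi => ?_)
    rw [Finset.mem_range] at hi
    rw [show M + 1 - i = (M - i) + 1 by omega, fakes, Preadditive.neg_comp, Preadditive.sum_comp,
      Preadditive.comp_sum, Finset.sum_range]
    refine congrArg Neg.neg (Finset.sum_congr rfl fun j _ => ?_)
    have := j.2
    rw [← Category.assoc, ← Category.assoc _ _ (b.lad n p h').adj.counit, cupX_Xp, ← hb]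
    rw [show M + 1 + (M + 1 - 1 - i - j) = M + (M - i + 1 - j) by omega]
    simp only [Category.assoc]

/-- The curl is obtained by bending the strand `F` in the last part of `nonpos_fn`. -/
theorem curlR_nonpos_fn : b.curlR l n p h h' = -(r : k) • ∑ i ∈ Finset.range (N + 1),
    S.Xp n p h' i ≫ (λ_ _).inv ≫ fakes (b.ccwB N n p h') (N - i) ▷ _ ≫ (λ_ _).hom := by
  obtain ⟨-, -, H⟩ := b.nonpos_fn N h h' hn
  rw [unit_sigma] at H
  refine app_ext fun M => ?_
  have H1 := congrArg (fun t => map (S.E n p h') (cup t M) ≫ cap (S.adj n p h').counit _) H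
  simp only [cup_comp₂, app₂_whiskerRight, cup_smul, cup_sum, cup_comp₀, Fn.map_smul, Fn.map_sum,
    Linear.smul_comp, Preadditive.sum_comp, Fn.map_comp, Category.assoc, cup_cupX] at H1
  rw [cap_nat, cup_cap_left_assoc] at H1
  rw [Bi.curlR, H1, app_smul, app_sum]
  refine congrArg (_ • ·) (Finset.sum_congr rfl fun i _ => ?_)
  rw [cap_nat, cup_cap_left_assoc, app_comp, app_comp, app_comp, app_leftUnitor_hom,
    app_leftUnitor_inv, app_whiskerRight, app_naturality]
  exact congrArg (_ ≫ ·) ((Category.comp_id _).symm.trans (Category.id_comp _).symm)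

end


section

variable {S : Sys k r B} (b : Bi S) (N : ℕ) {l n p : ℤ} (h : l + 2 = n) (h' : n + 2 = p)

theorem congr_arg₃ {A C D Z : Sort*} (f : A → C → D → Z) {a a' : A} {c c' : C} {d d' : D}
    (h : a = a') (h' : c = c') (h'' : d = d') : f a c d = f a' c' d' := by
  rw [h, h', h'']

theorem fn_ccwB (j : ℕ) : Fn.under₂ (b.fn.ccwB N n p h' j) = b.ccwB N n p h' j := by
  cases j with
  | zero => rfl
  | succ j => exact b.fn_ccw _ _ _ _

theorem coop_ccwB {l n : ℤ} (h : -l + 2 = -n) (h' : n + 2 = l) (j : ℕ) :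
    b.coop.ccwB N n l h' j = b.cwB N (-l) (-n) h j := by
  cases j with
  | zero => rfl
  | succ j => exact b.coop_ccw _ _ _ _

/-- The sideways crossings compose to a scalar on `E F`, in non-positive weights. -/
theorem sigma_sigma' (hn : n ≤ 0) :
    S.sigma l n p h h' ≫ b.sigma' l n p h h' = - ((r : k) ^ 2) • 𝟙 _ :=
  (b.fn.nonpos_fn (-n).toNat h h' (by omega)).1

/-- The decomposition of the identity of `F E`, in non-positive weights. -/
theorem ident_FE (hn : n = -N) : 𝟙 (S.E n p h' ≫ S.F p n h') =
    (-((r⁻¹ : kˣ) : k) ^ 2) • (b.sigma' l n p h h' ≫ S.sigma l n p h h') +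
      ∑ i ∈ Finset.range N, ∑ j ∈ Finset.range (N - i),
        (S.Xp n p h' (N - 1 - i - j) ▷ S.F p n h' ≫ (b.lad n p h').adj.counit) ≫
          fakes (b.ccwB N n p h') j ≫ S.cupX n p h' i := by
  refine (b.fn.nonpos_fn N h h' hn).2.1.trans (congrArg ((-((r⁻¹ : kˣ) : k) ^ 2) •
    (b.sigma' l n p h h' ≫ S.sigma l n p h h') + ·)
    (Finset.sum_congr rfl fun i _ => Finset.sum_congr rfl fun j _ => ?_))
  exact congr_arg₃ (fun x f y => (x ▷ S.F p n h' ≫ (b.lad n p h').adj.counit) ≫ f ≫ y)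
    (S.fn_Xp _ _ _ _) (fn_fakes (b.fn_ccwB N h') j) (fn_cupX _ _ _ _)

/-- The curl on the right of `E`, in non-positive weights. -/
theorem curlR_nonpos (hn : n = -N) : b.curlR l n p h h' = -(r : k) • ∑ i ∈ Finset.range (N + 1),
    S.Xp n p h' i ≫ (λ_ _).inv ≫ fakes (b.ccwB N n p h') (N - i) ▷ _ ≫ (λ_ _).hom := by
  refine (b.fn.curlR_nonpos_fn N h h' hn).trans (congrArg (-(r : k) • ·)
    (Finset.sum_congr rfl fun i _ => ?_))
  rw [← S.fn_Xp, ← fn_fakes (b.fn_ccwB N h')]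
  rfl

/-- The sideways crossings compose to a scalar on `F E`, in non-negative weights. -/
theorem sigma'_sigma (hn : 0 ≤ n) :
    b.sigma' l n p h h' ≫ S.sigma l n p h h' = - ((r : k) ^ 2) • 𝟙 _ := by
  obtain ⟨l, rfl⟩ : ∃ m', l = -m' := ⟨-l, (neg_neg l).symm⟩
  obtain ⟨n, rfl⟩ : ∃ m', n = -m' := ⟨-n, (neg_neg n).symm⟩
  obtain ⟨p, rfl⟩ : ∃ m', p = -m' := ⟨-p, (neg_neg p).symm⟩
  have H := b.coop.sigma_sigma' (show p + 2 = n by omega) (show n + 2 = l by omega) (by omega)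
  rw [coop_sigma, coop_sigma', Units.val_neg, neg_sq] at H
  exact H

/-- The sum over the triples of natural numbers with sum `N - 1`, with the first and the third entry
exchanged. -/
theorem sum_triangle_reflect {A : Type*} [AddCommMonoid A] (N : ℕ) (g : ℕ → ℕ → ℕ → A) :
    ∑ i ∈ Finset.range N, ∑ j ∈ Finset.range (N - i), g i j (N - 1 - i - j) =
      ∑ i ∈ Finset.range N, ∑ j ∈ Finset.range (N - i), g (N - 1 - i - j) j i := by
  rw [Finset.sum_sigma', Finset.sum_sigma']
  refine Finset.sum_nbij' (fun x => ⟨N - 1 - x.1 - x.2, x.2⟩) (fun x => ⟨N - 1 - x.1 - x.2, x.2⟩)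
    ?_ ?_ ?_ ?_ ?_
  · rintro ⟨i, j⟩ hx
    simp only [Finset.mem_sigma, Finset.mem_range] at hx ⊢
    omega
  · rintro ⟨i, j⟩ hx
    simp only [Finset.mem_sigma, Finset.mem_range] at hx ⊢
    omega
  · rintro ⟨i, j⟩ hx
    simp only [Finset.mem_sigma, Finset.mem_range] at hx
    simp only [Sigma.mk.injEq, heq_eq_eq, and_true]
    omega
  · rintro ⟨i, j⟩ hx
    simp only [Finset.mem_sigma, Finset.mem_range] at hx
    simp only [Sigma.mk.injEq, heq_eq_eq, and_true]
    omega
  · rintro ⟨i, j⟩ hx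
    simp only [Finset.mem_sigma, Finset.mem_range] at hx
    rw [show N - 1 - (N - 1 - i - j) - j = i by omega]

/-- The decomposition of the identity of `E F`, in non-negative weights. -/
theorem ident_EF (hn : n = N) : 𝟙 (S.F n l h ≫ S.E l n h) =
    (-((r⁻¹ : kˣ) : k) ^ 2) • (S.sigma l n p h h' ≫ b.sigma' l n p h h') +
      ∑ i ∈ Finset.range N, ∑ j ∈ Finset.range (N - i),
        (S.F n l h ◁ S.Xp l n h (N - 1 - i - j) ≫ (S.adj l n h).counit) ≫
          fakes (b.cwB N l n h) j ≫ (b.lad l n h).adj.unit ≫ S.F n l h ◁ S.Xp l n h i := by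
  obtain ⟨l, rfl⟩ : ∃ m', l = -m' := ⟨-l, (neg_neg l).symm⟩
  obtain ⟨n, rfl⟩ : ∃ m', n = -m' := ⟨-n, (neg_neg n).symm⟩
  obtain ⟨p, rfl⟩ : ∃ m', p = -m' := ⟨-p, (neg_neg p).symm⟩
  have H := b.coop.ident_FE N (show p + 2 = n by omega) (show n + 2 = l by omega) (by omega)
  rw [coop_sigma, coop_sigma', inv_neg, Units.val_neg, neg_sq] at H
  rw [sum_triangle_reflect N fun i j i' => (S.F (-n) (-l) h ◁ S.Xp (-l) (-n) h i' ≫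
    (S.adj (-l) (-n) h).counit) ≫ fakes (b.cwB N (-l) (-n) h) j ≫
      (b.lad (-l) (-n) h).adj.unit ≫ S.F (-n) (-l) h ◁ S.Xp (-l) (-n) h i]
  refine H.trans (congrArg ((-((r⁻¹ : kˣ) : k) ^ 2) •
    (S.sigma (-l) (-n) (-p) h h' ≫ b.sigma' (-l) (-n) (-p) h h') + ·)
    (Finset.sum_congr rfl fun i _ => Finset.sum_congr rfl fun j _ => ?_))
  exact (congr_arg₃ (fun x f y => ((S.F (-n) (-l) h ◁ x ≫ (S.adj (-l) (-n) h).counit) ≫ f) ≫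
    (b.lad (-l) (-n) h).adj.unit ≫ S.F (-n) (-l) h ◁ y) (S.coop_Xp _ _ _ _)
      (coop_fakes (b.coop_ccwB N h (by omega)) j) (S.coop_Xp _ _ _ _)).trans (Category.assoc _ _ _)

/-- The curl on the left of `E`, in non-negative weights. -/
theorem curlL_nonneg (hn : n = N) : b.curlL l n p h h' = (r : k) • ∑ i ∈ Finset.range (N + 1),
    S.Xp l n h i ≫ (ρ_ _).inv ≫ _ ◁ fakes (b.cwB N l n h) (N - i) ≫ (ρ_ _).hom := by
  obtain ⟨l, rfl⟩ : ∃ m', l = -m' := ⟨-l, (neg_neg l).symm⟩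
  obtain ⟨n, rfl⟩ : ∃ m', n = -m' := ⟨-n, (neg_neg n).symm⟩
  obtain ⟨p, rfl⟩ : ∃ m', p = -m' := ⟨-p, (neg_neg p).symm⟩
  have H := b.coop.curlR_nonpos N (show p + 2 = n by omega) (show n + 2 = l by omega) (by omega)
  rw [coop_curlR, Units.val_neg, neg_neg] at H
  refine H.trans (congrArg ((r : k) • ·) (Finset.sum_congr rfl fun i _ => ?_))
  exact (congrArg₂ (fun x f =>
    (((ρ_ (S.E (-l) (-n) h)).inv ≫ S.E (-l) (-n) h ◁ f) ≫ (ρ_ _).hom) ≫ x)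
      (S.coop_Xp n l (by omega) i) (coop_fakes (b.coop_ccwB N h (by omega)) (N - i))).trans
        (whiskerLeft_one_comm _ _)

/-- The degree of the curl is `-2 n`. -/
theorem curlR_pos (hn : 0 < n) : b.curlR l n p h h' = 0 :=
  (S.end₁ n p h').1 _ (by omega) _ (S.deg_curlR h' (b.lad l n h))

theorem curlL_eq : b.curlL l n p h h' = S.curlL h h' (b.lad n p h').adj.counit 0 := by
  rw [curlL, Sys.curlL, Xp, Bicategory.whiskerLeft_id, Category.id_comp]

/-- The degree of the curl is `2 n`. -/
theorem curlL_neg (hn : n < 0) : b.curlL l n p h h' = 0 := by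
  rw [curlL_eq]
  exact (S.end₁ l n h).1 _ (by omega) _ (S.deg_curlL h h' (b.lad n p h').deg_counit 0)

theorem deg_ccw (m n : ℤ) (h : m + 2 = n) (j : ℕ) : b.ccw m n h j ∈ deg k (2 * (1 + m + j)) _ _ :=
  deg_cast k (deg_comp (S.deg_cupX m n h j) (b.lad m n h).deg_counit) (by ring)

theorem deg_cw (m n : ℤ) (h : m + 2 = n) (j : ℕ) : b.cw m n h j ∈ deg k (2 * (1 - n + j)) _ _ :=
  deg_cast k (deg_comp (b.lad m n h).deg_unit (deg_comp (deg_whiskerLeft _ (S.deg_Xp m n h j))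
    (S.deg_counit m n h))) (by omega)

theorem ccw_eq_zero (m n : ℤ) (h : m + 2 = n) (j : ℕ) (hj : (j : ℤ) < -m - 1) :
    b.ccw m n h j = 0 :=
  S.one_neg _ _ (by omega) _ (b.deg_ccw m n h j)

theorem cw_eq_zero (m n : ℤ) (h : m + 2 = n) (j : ℕ) (hj : (j : ℤ) < n - 1) :
    b.cw m n h j = 0 :=
  S.one_neg _ _ (by omega) _ (b.deg_cw m n h j)

end

end Bi

end Sys

end

section

/-! ### Mates -/

/-- The mate of `x` under the adjunction `A`, as an endomorphism of the right adjoint. -/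
def mateR {B : Type u} [Bicategory.{w, v} B] {a b : B} {f : a ⟶ b} {g : b ⟶ a} (A : f ⊣ g)
    (x : f ⟶ f) : g ⟶ g :=
  (ρ_ _).inv ≫ g ◁ A.unit ≫ g ◁ x ▷ g ≫ (α_ _ _ _).inv ≫ A.counit ▷ g ≫ (λ_ _).hom

/-- The mate of `x` under the adjunction `A`, as an endomorphism of the left adjoint. -/
def mateL {B : Type u} [Bicategory.{w, v} B] {a b : B} {f : a ⟶ b} {g : b ⟶ a} (A : f ⊣ g)
    (x : g ⟶ g) : f ⟶ f :=
  (λ_ _).inv ≫ A.unit ▷ f ≫ (f ◁ x) ▷ f ≫ (α_ _ _ _).hom ≫ f ◁ A.counit ≫ (ρ_ _).hom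

section

variable {B : Type u} [Bicategory.{w, v} B] {a b c d : B} {f : a ⟶ b} {g : b ⟶ a} (A : f ⊣ g)

theorem mateR_eq (x : f ⟶ f) : mateR A x = conjugateEquiv A A x :=
  (Bicategory.conjugateEquiv_apply' A A x).symm

theorem mateL_eq (x : g ⟶ g) : mateL A x = (conjugateEquiv A A).symm x := by
  rw [Bicategory.conjugateEquiv_symm_apply', mateL, whisker_assoc_symm_assoc]
  simp

@[simp] theorem mateL_mateR (x : f ⟶ f) : mateL A (mateR A x) = x := by
  rw [mateR_eq, mateL_eq, Equiv.symm_apply_apply]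

@[simp] theorem mateR_mateL (x : g ⟶ g) : mateR A (mateL A x) = x := by
  rw [mateR_eq, mateL_eq, Equiv.apply_symm_apply]

theorem mateR_id : mateR A (𝟙 f) = 𝟙 g := by
  rw [mateR_eq, Bicategory.conjugateEquiv_id]

theorem mateR_comp (x y : f ⟶ f) : mateR A (x ≫ y) = mateR A y ≫ mateR A x := by
  rw [mateR_eq, mateR_eq, mateR_eq, Bicategory.conjugateEquiv_comp]

variable {f' : b ⟶ c} {g' : c ⟶ b} (A' : f' ⊣ g') {f'' : c ⟶ d} {g'' : d ⟶ c} (A'' : f'' ⊣ g'')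

theorem mateR_whiskerLeft (x : f' ⟶ f') : mateR (A.comp A') (f ◁ x) = mateR A' x ▷ g := by
  rw [mateR_eq, mateR_eq, Bicategory.conjugateEquiv_whiskerLeft]

theorem mateR_whiskerRight (x : f ⟶ f) : mateR (A.comp A') (x ▷ f') = g' ◁ mateR A x := by
  rw [mateR_eq, mateR_eq, Bicategory.conjugateEquiv_whiskerRight]

theorem mateR_assoc (x : f ≫ f' ≫ f'' ⟶ f ≫ f' ≫ f'') :
    mateR ((A.comp A').comp A'') ((α_ _ _ _).hom ≫ x ≫ (α_ _ _ _).inv) =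
      (α_ _ _ _).inv ≫ mateR (A.comp (A'.comp A'')) x ≫ (α_ _ _ _).hom := by
  rw [mateR_eq, ← Bicategory.conjugateEquiv_comp _ (A.comp (A'.comp A'')),
    ← Bicategory.conjugateEquiv_comp _ (A.comp (A'.comp A'')), Bicategory.conjugateEquiv_associator_hom, mateR_eq,
    Category.assoc]
  congr 1
  rw [← cancel_epi (α_ g'' g' g).hom, Iso.hom_inv_id, ← Bicategory.conjugateEquiv_associator_hom A A' A'',
    Bicategory.conjugateEquiv_comp, Iso.inv_hom_id, Bicategory.conjugateEquiv_id]

theorem comp_unit : (A.comp A').unit = A.unit ≫ f ◁ ((λ_ _).inv ≫ A'.unit ▷ g ≫ (α_ _ _ _).hom) ≫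
    (α_ _ _ _).inv := by
  simp [Bicategory.Adjunction.comp, Bicategory.Adjunction.compUnit, bicategoricalComp]

theorem comp_counit : (A.comp A').counit = (α_ _ _ _).hom ≫ g' ◁ ((α_ _ _ _).inv ≫ A.counit ▷ f' ≫
    (λ_ _).hom) ≫ A'.counit := by
  simp [Bicategory.Adjunction.comp, Bicategory.Adjunction.compCounit, bicategoricalComp]

end

variable {k : Type t} [Field k] {B : Type u} [Bicategory.{w, v} B] [AddBicat B] [GrBicat k B]

open GrBicat

section

variable {a b : B} {f : a ⟶ b} {g : b ⟶ a} (A : f ⊣ g)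

theorem mateR_smul (z : k) (x : f ⟶ f) : mateR A (z • x) = z • mateR A x := by
  simp [mateR, GrBicat.smul_whiskerRight, GrBicat.whiskerLeft_smul]

theorem mateR_sub (x y : f ⟶ f) : mateR A (x - y) = mateR A x - mateR A y := by
  rw [eq_sub_iff_add_eq]
  conv_rhs => rw [← sub_add_cancel x y]
  simp only [mateR, AddBicat.add_whiskerRight, AddBicat.whiskerLeft_add, Preadditive.add_comp,
    Preadditive.comp_add]

theorem mateR_zero : mateR A (0 : f ⟶ f) = 0 := by
  simp [mateR]

theorem deg_mateR {p q s : ℤ} (hu : A.unit ∈ deg k p _ _) (hc : A.counit ∈ deg k q _ _)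
    {x : f ⟶ f} (hx : x ∈ deg k s _ _) : mateR A x ∈ deg k (p + s + q) _ _ :=
  deg_cast k (deg_comp (deg_rightUnitor _).2 (deg_comp (deg_whiskerLeft _ hu) (deg_comp
    (deg_whiskerLeft _ (deg_whiskerRight _ hx)) (deg_comp (deg_associator _ _ _).2 (deg_comp
      (deg_whiskerRight _ hc) (deg_leftUnitor _).1))))) (by ring)

theorem deg_comp_unit {c : B} {f' : b ⟶ c} {g' : c ⟶ b} (A' : f' ⊣ g') {p q : ℤ}
    (hu : A.unit ∈ deg k p _ _) (hu' : A'.unit ∈ deg k q _ _) :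
    (A.comp A').unit ∈ deg k (p + q) _ _ := by
  rw [comp_unit]
  exact deg_cast k (deg_comp hu (deg_comp (deg_whiskerLeft _ (deg_comp (deg_leftUnitor _).2
    (deg_comp (deg_whiskerRight _ hu') (deg_associator _ _ _).1))) (deg_associator _ _ _).2))
      (by ring)

theorem deg_comp_counit {c : B} {f' : b ⟶ c} {g' : c ⟶ b} (A' : f' ⊣ g') {p q : ℤ}
    (hu : A.counit ∈ deg k p _ _) (hu' : A'.counit ∈ deg k q _ _) :
    (A.comp A').counit ∈ deg k (p + q) _ _ := by
  rw [comp_counit]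
  exact deg_cast k (deg_comp (deg_associator _ _ _).1 (deg_comp (deg_whiskerLeft _ (deg_comp
    (deg_associator _ _ _).2 (deg_comp (deg_whiskerRight _ hu) (deg_leftUnitor _).1))) hu'))
      (by ring)

end

namespace Fn

variable {a b : Fn k B} {f : a ⟶ b} {g : b ⟶ a} (A : f ⊣ g)

theorem app_mateR (x : f ⟶ f) {y : B} (M : y ⟶ b.as) : app (mateR A x) M =
    cup A.unit (obj g M) ≫ map g (app x (obj g M)) ≫ map g (cap A.counit M) := by
  simp [mateR]
  rfl

theorem app_mateL (x : g ⟶ g) {y : B} (M : y ⟶ a.as) : app (mateL A x) M =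
    map f (cup A.unit M) ≫ map f (app x (obj f M)) ≫ cap A.counit (obj f M) := by
  simp [mateL]
  rfl

theorem mateR_cap (x : f ⟶ f) {y : B} (M : y ⟶ b.as) :
    map f (app (mateR A x) M) ≫ cap A.counit M = app x (obj g M) ≫ cap A.counit M := by
  rw [app_mateR, Fn.map_comp_assoc, Fn.map_comp_assoc, cap_nat, cap_nat_assoc, cup_cap_left_assoc]

theorem cup_mateR (x : f ⟶ f) {y : B} (M : y ⟶ a.as) :
    cup A.unit M ≫ map g (app x M) = cup A.unit M ≫ app (mateR A x) (obj f M) := by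
  rw [app_mateR, cup_nat_assoc, ← Fn.map_comp, ← Fn.map_comp, app_naturality_assoc, cup_cap_left,
    Category.comp_id]

end Fn

namespace Sys

variable {r : kˣ}

/-! ### Cyclicity -/

section

open Fn

variable (S : Sys k r (Fn k B)) {l n p : ℤ} (h : l + 2 = n) (h' : n + 2 = p)

/-- The difference between a dot on `E` and a dot on `F` slides through a sideways crossing. -/
theorem dots_sigma :
    (S.F n l h ◁ S.X l n h - mateR (S.adj l n h) (S.X l n h) ▷ S.E l n h) ≫ S.sigma l n p h h' =
      S.sigma l n p h h' ≫
        (S.X n p h' ▷ S.F p n h' - S.E n p h' ◁ mateR (S.adj n p h') (S.X n p h')) := by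
  refine app₂_ext fun M => ?_
  have h1 : map (S.E n p h') (app (S.X l n h) (obj (S.F n l h) M)) ≫
      app₂ (S.T l n p h h') (obj (S.F n l h) M) = app₂ (S.T l n p h h') (obj (S.F n l h) M) ≫
        app (S.X n p h') (obj (S.E l n h) (obj (S.F n l h) M)) - (r : k) • 𝟙 _ :=
    eq_sub_of_add_eq (S.slide'_app l n p h h' (obj (S.F n l h) M)).symm
  have h2 : app₂ (S.T l n p h h') (obj (S.F n l h) M) ≫
      map (S.E n p h') (app (S.X l n h) (obj (S.F n l h) M)) =
        app (S.X n p h') (obj (S.E l n h) (obj (S.F n l h) M)) ≫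
          app₂ (S.T l n p h h') (obj (S.F n l h) M) - (r : k) • 𝟙 _ :=
    eq_sub_of_add_eq (S.slide_app l n p h h' (obj (S.F n l h) M)).symm
  -- Sliding either dot through the crossing produces the same correction term, a cap followed by a
  -- cup.
  have e1 : app (S.X l n h) (obj (S.F n l h) M) ≫ app₂ (S.sigma l n p h h') M =
      app₂ (S.sigma l n p h h') M ≫ map (S.F p n h') (app (S.X n p h') M) -
        (r : k) • cup (S.adj n p h').unit (obj (S.E l n h) (obj (S.F n l h) M)) ≫
          map (S.F p n h') (map (S.E n p h') (cap (S.adj l n h).counit M)) := by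
    rw [app₂_sigma, cup_nat_assoc, ← Fn.map_comp_assoc, h1, Fn.map_sub, Fn.map_comp,
      Preadditive.sub_comp, Preadditive.comp_sub, Category.assoc, Category.assoc, Category.assoc,
      ← Fn.map_comp (S.F p n h') (app (S.X n p h') _), ← app_naturality, Fn.map_comp,
      Fn.map_smul, Fn.map_id, Linear.smul_comp, Category.id_comp, Linear.comp_smul]
  have e2 : map (S.E l n h) (app (mateR (S.adj l n h) (S.X l n h)) M) ≫
      app₂ (S.sigma l n p h h') M =
      app₂ (S.sigma l n p h h') M ≫ app (mateR (S.adj n p h') (S.X n p h')) (obj (S.E n p h') M) -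
        (r : k) • cup (S.adj n p h').unit (obj (S.E l n h) (obj (S.F n l h) M)) ≫
          map (S.F p n h') (map (S.E n p h') (cap (S.adj l n h).counit M)) := by
    rw [app₂_sigma, cup_nat_assoc, ← Fn.map_comp_assoc, app₂_nat, Fn.map_comp, Category.assoc,
      ← Fn.map_comp (S.F p n h') (map (S.E n p h') _), ← Fn.map_comp (S.E n p h'), mateR_cap,
      Fn.map_comp (S.E n p h'), Fn.map_comp (S.F p n h'), ← Fn.map_comp_assoc, h2, Fn.map_sub,
      Fn.map_comp, Preadditive.sub_comp, Preadditive.comp_sub, Category.assoc, ← Category.assoc,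
      cup_mateR, Category.assoc, ← app_naturality_assoc, ← app_naturality,
      Fn.map_smul, Fn.map_id, Linear.smul_comp, Category.id_comp, Linear.comp_smul]
    simp only [Category.assoc]
  rw [app₂_comp₂, app₂_comp₂, app₂_sub, app₂_sub, app₂_whiskerLeft, app₂_whiskerRight,
    app₂_whiskerLeft, app₂_whiskerRight, Preadditive.sub_comp, e1, e2, Preadditive.comp_sub,
    sub_sub_sub_cancel_right]

/-- The two dots agree on a cap. -/
theorem dots_Xp_counit (j : ℕ) :
    (S.F n l h ◁ S.X l n h - mateR (S.adj l n h) (S.X l n h) ▷ S.E l n h) ≫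
      S.F n l h ◁ S.Xp l n h j ≫ (S.adj l n h).counit = 0 := by
  rw [Preadditive.sub_comp, ← whisker_exchange_assoc, ← Bicategory.whiskerLeft_comp_assoc,
    ← Xp_succ', Xp, sub_eq_zero, Bicategory.whiskerLeft_comp_assoc]
  congr 1
  refine cap_ext (k := k) (B := B) fun M => ?_
  rw [cap_comp₂, cap_comp₂, app₂_whiskerLeft, app₂_whiskerRight, mateR_cap]

/-- The two dots agree on a cup. -/
theorem cupX_dots (j : ℕ) : S.cupX n p h' j ≫
    (S.X n p h' ▷ S.F p n h' - S.E n p h' ◁ mateR (S.adj n p h') (S.X n p h')) = 0 := by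
  rw [cupX, Preadditive.comp_sub, Category.assoc, Category.assoc, ← comp_whiskerRight, ← Xp,
    Xp_succ', ← Bicategory.whisker_exchange, comp_whiskerRight, sub_eq_zero, ← Category.assoc,
    ← Category.assoc]
  congr 1
  refine cup_ext (k := k) (B := B) fun M => ?_
  rw [cup_comp₂, cup_comp₂, app₂_whiskerLeft, app₂_whiskerRight, cup_mateR]

variable {S} (b : Bi S)

include h' in
/-- The two dots agree on the cup of the other adjunction. -/
theorem unit_dots : (b.lad l n h).adj.unit ≫
    (S.F n l h ◁ S.X l n h - mateR (S.adj l n h) (S.X l n h) ▷ S.E l n h) = 0 := by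
  rcases le_or_gt n 0 with hn | hn
  · -- the sideways crossing is a split monomorphism
    obtain ⟨N, rfl⟩ : ∃ N : ℕ, n = -N := ⟨(-n).toNat, by omega⟩
    obtain ⟨h1, -, h3⟩ := b.nonpos_fn N h h' rfl
    have h4 := congrArg (· ≫ b.sigma' l _ p h h')
      (congrArg ((b.lad l _ h).adj.unit ≫ ·) (S.dots_sigma h h'))
    simp only [← Category.assoc] at h4
    rw [h3, Linear.smul_comp, Preadditive.sum_comp, Finset.sum_eq_zero, smul_zero, Limits.zero_comp,
      Category.assoc, h1, Linear.comp_smul, Category.comp_id] at h4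
    · exact (smul_eq_zero.1 h4).resolve_left (by simp)
    · intro i _
      rw [Category.assoc, cupX_dots, Limits.comp_zero]
  -- Insert the decomposition of the identity of `E F`: the term with the crossings contains a right
  -- curl, which vanishes, and in the other terms the dots meet a cap.
  · obtain ⟨N, rfl⟩ : ∃ N : ℕ, n = N := ⟨n.toNat, by omega⟩
    rw [← Category.comp_id (_ ≫ _), b.ident_EF N h h' rfl, Preadditive.comp_add, Linear.comp_smul,
      Category.assoc, reassoc_of% S.dots_sigma h h', ← Category.assoc (b.lad l _ h).adj.unit,
      unit_sigma]
    have h5 : S.curlR h' (b.lad l N h) = 0 := b.curlR_pos h h' hn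
    rw [h5, AddBicat.zero_whiskerRight, Limits.comp_zero, Limits.zero_comp, smul_zero, zero_add,
      Preadditive.comp_sum]
    refine Finset.sum_eq_zero fun i _ => ?_
    rw [Preadditive.comp_sum]
    refine Finset.sum_eq_zero fun j _ => ?_
    simp only [Category.assoc]
    rw [reassoc_of% S.dots_Xp_counit h, Limits.zero_comp, Limits.comp_zero]

/-- The dot is cyclic, as `unit_dots` says that both mates agree on a cup. -/
theorem X_cyclic_fn : mateL (b.lad l n h).adj (S.X l n h) = mateR (S.adj l n h) (S.X l n h) := by
  refine app_ext fun M => ?_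
  have h1 := congrArg (fun t => cup t M) (unit_dots h rfl b)
  rw [Preadditive.comp_sub, cup_sub, cup_comp₂, cup_comp₂, app₂_whiskerLeft, app₂_whiskerRight,
    cup_zero, sub_eq_zero] at h1
  rw [app_mateL, ← Fn.map_comp_assoc, h1, Fn.map_comp_assoc, cap_nat, cup_cap_left_assoc]

end

/-! ### The nilHecke action on the powers of `F` -/

section

variable (S : Sys k r B)

/-- The dot on a downward strand. -/
def xF (n m : ℤ) (h : m + 2 = n) : S.F n m h ⟶ S.F n m h := mateR (S.adj m n h) (S.X m n h)

/-- The crossing of two downward strands. -/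
def tF (c b a : ℤ) (h' : b + 2 = c) (h : a + 2 = b) :
    S.F c b h' ≫ S.F b a h ⟶ S.F c b h' ≫ S.F b a h :=
  mateR ((S.adj a b h).comp (S.adj b c h')) (S.T a b c h h')

theorem deg_xF (n m : ℤ) (h : m + 2 = n) : S.xF n m h ∈ deg k 2 _ _ :=
  deg_cast k (deg_mateR (S.adj m n h) (S.deg_unit m n h) (S.deg_counit m n h) (S.deg_X m n h))
    (by ring)

theorem deg_tF (c b a : ℤ) (h' : b + 2 = c) (h : a + 2 = b) : S.tF c b a h' h ∈ deg k (-2) _ _ :=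
  deg_cast k (deg_mateR _ (deg_comp_unit _ _ (S.deg_unit a b h) (S.deg_unit b c h'))
    (deg_comp_counit _ _ (S.deg_counit a b h) (S.deg_counit b c h')) (S.deg_T a b c h h')) (by ring)

theorem tF_sq (c b a : ℤ) (h' : b + 2 = c) (h : a + 2 = b) :
    S.tF c b a h' h ≫ S.tF c b a h' h = 0 := by
  rw [tF, ← mateR_comp, S.T_sq, mateR_zero]

theorem xF_slide (c b a : ℤ) (h' : b + 2 = c) (h : a + 2 = b) :
    S.F c b h' ◁ S.xF b a h ≫ S.tF c b a h' h - S.tF c b a h' h ≫ S.xF c b h' ▷ S.F b a h =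
      -(r : k) • 𝟙 _ := by
  have H := congrArg (mateR ((S.adj a b h).comp (S.adj b c h'))) (S.slide a b c h h')
  rw [mateR_sub, mateR_comp, mateR_comp, mateR_whiskerLeft, mateR_whiskerRight, mateR_smul,
    mateR_id] at H
  rw [neg_smul, ← H, neg_sub]
  rfl

theorem xF_slide' (c b a : ℤ) (h' : b + 2 = c) (h : a + 2 = b) :
    S.tF c b a h' h ≫ S.F c b h' ◁ S.xF b a h - S.xF c b h' ▷ S.F b a h ≫ S.tF c b a h' h =
      -(r : k) • 𝟙 _ := by
  have H := congrArg (mateR ((S.adj a b h).comp (S.adj b c h'))) (S.slide' a b c h h')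
  rw [mateR_sub, mateR_comp, mateR_comp, mateR_whiskerLeft, mateR_whiskerRight, mateR_smul,
    mateR_id] at H
  rw [neg_smul, ← H, neg_sub]
  rfl

/-- The braid relation for downward strands is the mate of the one for upward strands. -/
theorem tF_braid (d c b a : ℤ) (h'' : c + 2 = d) (h' : b + 2 = c) (h : a + 2 = b) :
    S.tF d c b h'' h' ▷ S.F b a h ≫
        ((α_ _ _ _).hom ≫ S.F d c h'' ◁ S.tF c b a h' h ≫ (α_ _ _ _).inv) ≫
          S.tF d c b h'' h' ▷ S.F b a h =
      ((α_ _ _ _).hom ≫ S.F d c h'' ◁ S.tF c b a h' h ≫ (α_ _ _ _).inv) ≫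
        S.tF d c b h'' h' ▷ S.F b a h ≫
          ((α_ _ _ _).hom ≫ S.F d c h'' ◁ S.tF c b a h' h ≫ (α_ _ _ _).inv) := by
  have H := congrArg (mateR (((S.adj a b h).comp (S.adj b c h')).comp (S.adj c d h'')))
    (S.braid a b c d h h' h'')
  rw [mateR_comp, mateR_comp, mateR_comp, mateR_comp, mateR_assoc, mateR_whiskerLeft,
    mateR_whiskerRight] at H
  have H' := congrArg (fun t => (α_ (S.F d c h'') (S.F c b h') (S.F b a h)).hom ≫ t ≫
    (α_ _ _ _).inv) H
  simp only [Category.assoc, Iso.hom_inv_id_assoc, Iso.hom_inv_id, Category.comp_id] at H' ⊢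
  exact H'.symm

end

section

variable {S : Sys k r B} (b : Bi S)

/-- The dot on a downward strand is also the left mate of the dot on an upward strand. -/
theorem X_cyclic (m n : ℤ) (h : m + 2 = n) : mateL (b.lad m n h).adj (S.X m n h) = S.xF n m h :=
  X_cyclic_fn h b.fn

/-- The crossing of downward strands is also the left mate of the crossing of upward strands. -/
theorem T_cyclic (l m n : ℤ) (h : l + 2 = m) (h' : m + 2 = n) :
    mateL ((b.lad m n h').adj.comp (b.lad l m h).adj) (S.T l m n h h') = S.tF n m l h' h := by
  set A := (b.lad m n h').adj.comp (b.lad l m h).adj with hA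
  set t := mateL A (S.T l m n h h') with ht
  have hT : mateR A t = S.T l m n h h' := mateR_mateL A _
  -- by degree reasons, the two mates of the crossing agree up to a scalar
  obtain ⟨z, hz⟩ := (S.end₂ l m n h h').2 _ (deg_cast k (deg_mateR A
    (deg_comp_unit _ _ (b.lad m n h').deg_unit (b.lad l m h).deg_unit)
    (deg_comp_counit _ _ (b.lad m n h').deg_counit (b.lad l m h).deg_counit)
    (S.deg_tF n m l h' h)) (by ring))
  have hz' : S.tF n m l h' h = z • t := by
    rw [← mateL_mateR A (S.tF n m l h' h), hz, ← hT, ← mateR_smul, mateL_mateR]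
  have e1 : mateR A (S.F n m h' ◁ S.xF m l h) = S.X l m h ▷ S.E m n h' := by
    rw [← X_cyclic b, hA, mateR_whiskerLeft, mateR_mateL]
  have e2 : mateR A (S.xF n m h' ▷ S.F m l h) = S.E l m h ◁ S.X m n h' := by
    rw [← X_cyclic b, hA, mateR_whiskerRight, mateR_mateL]
  -- the slide relation shows that this scalar is one
  have e3 : S.F n m h' ◁ S.xF m l h ≫ t - t ≫ S.xF n m h' ▷ S.F m l h = -(r : k) • 𝟙 _ := by
    rw [← mateL_mateR A (_ - _), mateR_sub, mateR_comp, mateR_comp, hT, e1, e2, ← neg_sub,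
      S.slide, ← neg_smul, ← mateR_id A, ← mateR_smul, mateL_mateR]
  have e4 := S.xF_slide n m l h' h
  rw [hz', Linear.comp_smul, Linear.smul_comp, ← smul_sub, e3, smul_smul, ← sub_eq_zero,
    ← sub_smul, smul_eq_zero, show z * -(r : k) - -(r : k) = (1 - z) * r by ring, mul_eq_zero,
    or_iff_left r.ne_zero] at e4
  rcases e4 with e4 | e4
  · rw [hz', ← sub_eq_zero.1 e4, one_smul]
  · rw [← Category.id_comp t, ← Category.id_comp (S.tF n m l h' h), e4, Limits.zero_comp,
      Limits.zero_comp]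

end

end Sys

end

/-! ### The bicategory of 2-morphisms of all degrees -/

open DirectSum in
/-- The morphisms `f ⟶ g` of all degrees: sums of homogeneous ones. -/
abbrev GHom {C : Type v} [Category.{w} C] [HasShift C ℤ] [Preadditive C] (f g : C) : Type w :=
  ⨁ p : ℤ, ShiftedHom f g p

namespace GHom

variable {k : Type t} [Field k] {C : Type v} [Category.{w} C] [HasShift C ℤ] [Preadditive C]
  [Linear k C]

variable (k) in
/-- A homogeneous morphism. -/
def hm {f g : C} (p : ℤ) : ShiftedHom f g p →ₗ[k] GHom f g :=
  DirectSum.lof k ℤ (fun p => ShiftedHom f g p) p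

variable (k) in
@[elab_as_elim]
theorem ind {f g : C} {P : GHom f g → Prop} (h : ∀ p x, P (hm k p x))
    (h' : ∀ x y, P x → P y → P (x + y)) (x : GHom f g) : P x := by
  induction x using DirectSum.induction_on with
  | zero => simpa using h 0 0
  | of p x => exact h p x
  | add x y hx hy => exact h' x y hx hy

theorem hm_injective {f g : C} (p : ℤ) : Function.Injective (hm k (f := f) (g := g) p) :=
  DirectSum.of_injective p

variable (k) in
/-- The homogeneous morphisms of degree `p`. -/
def homog (f g : C) (p : ℤ) : Submodule k (GHom f g) := LinearMap.range (hm k p)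

theorem finite_homog (f g : C) (p : ℤ) [FiniteDimensional k (ShiftedHom f g p)] :
    FiniteDimensional k (homog k f g p) :=
  (inferInstance : FiniteDimensional k (LinearMap.range (hm k p)))

variable (k) in
/-- A morphism, regarded as a homogeneous one of degree zero. -/
noncomputable def mk {f g : C} (x : f ⟶ g) : GHom f g := hm k 0 (ShiftedHom.mk₀ 0 rfl x)

theorem mk_injective {f g : C} {x y : f ⟶ g} (h : mk k x = mk k y) : x = y :=
  (ShiftedHom.homEquiv (0 : ℤ) rfl).injective (hm_injective 0 h)

variable [∀ n : ℤ, (shiftFunctor C n).Additive] [∀ n : ℤ, (shiftFunctor C n).Linear k]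

variable (k) in
/-- Composition of homogeneous morphisms is bilinear. -/
noncomputable def comp₀ {f g h : C} (p q : ℤ) :
    ShiftedHom f g p →ₗ[k] ShiftedHom g h q →ₗ[k] GHom f h :=
  LinearMap.mk₂ k (fun x y => hm k (p + q) (x.comp y (add_comm q p)))
    (fun x x' y => by simp) (fun c x y => by simp) (fun x y y' => by simp) (fun c x y => by simp)

variable (k) in
/-- Composition, as a bilinear map. -/
noncomputable def comp {f g h : C} : GHom f g →ₗ[k] GHom g h →ₗ[k] GHom f h :=
  DirectSum.toModule k ℤ _ fun p => LinearMap.flip (DirectSum.toModule k ℤ _ fun q =>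
    LinearMap.flip (comp₀ k p q))

theorem comp_hm {f g h : C} {p q s : ℤ} (x : ShiftedHom f g p) (y : ShiftedHom g h q)
    (e : q + p = s) : comp k (hm k p x) (hm k q y) = hm k s (x.comp y e) := by
  obtain rfl : p + q = s := by omega
  simp only [comp, hm, DirectSum.toModule_lof, LinearMap.flip_apply]
  rfl

theorem mk_comp_hm {f g h : C} {p : ℤ} (x : f ⟶ g) (y : ShiftedHom g h p) :
    comp k (mk k x) (hm k p y) = hm k p (x ≫ y) := by
  rw [mk, comp_hm _ _ (add_zero p), ShiftedHom.mk₀_comp]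

theorem hm_comp_mk {f g h : C} {p : ℤ} (x : ShiftedHom f g p) (y : g ⟶ h) :
    comp k (hm k p x) (mk k y) = hm k p (x ≫ y⟦p⟧') := by
  rw [mk, comp_hm _ _ (zero_add p), ShiftedHom.comp_mk₀]

theorem mk_comp_mk {f g h : C} (x : f ⟶ g) (y : g ⟶ h) :
    comp k (mk k x) (mk k y) = mk k (x ≫ y) := by
  rw [mk, mk, comp_hm _ _ (add_zero 0), ShiftedHom.mk₀_comp_mk₀]
  rfl

variable (k C) in
/-- The category with the morphisms of all degrees. -/
@[reducible] noncomputable def cat : Category.{w} C where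
  Hom f g := GHom f g
  id f := mk k (𝟙 f)
  comp x y := comp k x y
  id_comp x := by
    refine ind k (fun p x => ?_) (fun x y hx hy => ?_) x
    · rw [mk_comp_hm, Category.id_comp]
    · rw [map_add, hx, hy]
  comp_id x := by
    refine ind k (fun p x => ?_) (fun x y hx hy => ?_) x
    · rw [hm_comp_mk, CategoryTheory.Functor.map_id, Category.comp_id]
    · rw [map_add, LinearMap.add_apply, hx, hy]
  assoc x y z := by
    refine ind k (fun p x => ?_) (fun x x' hx hx' => ?_) x
    · refine ind k (fun q y => ?_) (fun y y' hy hy' => ?_) y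
      · refine ind k (fun s z => ?_) (fun z z' hz hz' => ?_) z
        · rw [comp_hm x y rfl, comp_hm _ _ rfl, comp_hm y z rfl,
            comp_hm _ _ (add_assoc s q p), ShiftedHom.comp_assoc _ _ _ rfl rfl (add_assoc s q p)]
        · rw [map_add, hz, hz', map_add, map_add]
      · simp only [map_add, LinearMap.add_apply, hy, hy']
    · simp only [map_add, LinearMap.add_apply, hx, hx']

variable (k) in
theorem add_comp {f g h : C} (x x' : GHom f g) (y : GHom g h) :
    comp k (x + x') y = comp k x y + comp k x' y := LinearMap.map_add₂ _ x x' y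

variable (k) in
theorem comp_add {f g h : C} (x : GHom f g) (y y' : GHom g h) :
    comp k x (y + y') = comp k x y + comp k x y' := LinearMap.map_add _ y y'

variable (k) in
theorem smul_comp {f g h : C} (c : k) (x : GHom f g) (y : GHom g h) :
    comp k (c • x) y = c • comp k x y := LinearMap.map_smul₂ _ c x y

variable (k) in
theorem comp_smul {f g h : C} (x : GHom f g) (c : k) (y : GHom g h) :
    comp k x (c • y) = c • comp k x y := LinearMap.map_smul _ c y

variable (k C) in
/-- The sum of morphisms. -/
@[reducible] noncomputable def preadditive : @Preadditive C (cat k C) :=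
  @Preadditive.mk C (cat k C) (fun f g => (inferInstance : AddCommGroup (GHom f g)))
    (fun _ _ _ x x' y => add_comp k x x' y) (fun _ _ _ x y y' => comp_add k x y y')

variable (k C) in
/-- Scalar multiples of morphisms. -/
@[reducible] noncomputable def linear : @Linear k _ C (cat k C) (preadditive k C) :=
  @Linear.mk k _ C (cat k C) (preadditive k C) (fun f g => (inferInstance : Module k (GHom f g)))
    (fun _ _ _ c x y => smul_comp k c x y) (fun _ _ _ x c y => comp_smul k x c y)

variable (k) in
/-- An isomorphism, regarded as a homogeneous one of degree zero. -/
noncomputable def mkIso {f g : C} (e : f ≅ g) : @Iso _ (cat k C) f g :=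
  @Iso.mk _ (cat k C) f g (mk k e.hom) (mk k e.inv)
    ((mk_comp_mk _ _).trans (congrArg _ e.hom_inv_id))
    ((mk_comp_mk _ _).trans (congrArg _ e.inv_hom_id))

variable {D : Type v'} [Category.{w'} D] [HasShift D ℤ] [Preadditive D] [Linear k D]
  (F : C ⥤ D) [F.CommShift ℤ] [F.Additive] [F.Linear k]

variable (k) in
/-- The action of a functor that commutes with the shifts. -/
noncomputable def map {f g : C} : GHom f g →ₗ[k] GHom (F.obj f) (F.obj g) :=
  DirectSum.toModule k ℤ _ fun p => (hm k p).comp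
    ({ toFun := fun x => ShiftedHom.map x F
       map_add' := fun x y => ShiftedHom.map_add x y F
       map_smul' := fun c x => ShiftedHom.map_smul c x F } :
      ShiftedHom f g p →ₗ[k] ShiftedHom (F.obj f) (F.obj g) p)

omit [∀ n : ℤ, (shiftFunctor C n).Additive] [∀ n : ℤ, (shiftFunctor C n).Linear k] in
theorem map_hm {f g : C} {p : ℤ} (x : ShiftedHom f g p) :
    map k F (hm k p x) = hm k p (x.map F) := by
  simp only [map, hm, DirectSum.toModule_lof]
  rfl

omit [∀ n : ℤ, (shiftFunctor C n).Additive] [∀ n : ℤ, (shiftFunctor C n).Linear k] in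
theorem map_mk {f g : C} (x : f ⟶ g) : map k F (mk k x) = mk k (F.map x) := by
  rw [mk, map_hm, ShiftedHom.map_mk₀]; rfl

variable [∀ n : ℤ, (shiftFunctor D n).Additive] [∀ n : ℤ, (shiftFunctor D n).Linear k]

theorem map_comp {f g h : C} (x : GHom f g) (y : GHom g h) :
    map k F (comp k x y) = comp k (map k F x) (map k F y) := by
  refine ind k (fun p x => ?_) (fun x x' hx hx' => ?_) x
  · refine ind k (fun q y => ?_) (fun y y' hy hy' => ?_) y
    · rw [comp_hm _ _ rfl, map_hm, map_hm, map_hm, comp_hm _ _ rfl, ShiftedHom.map_comp]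
    · simp only [_root_.map_add, hy, hy']
  · simp only [_root_.map_add, LinearMap.add_apply, hx, hx']

end GHom

namespace GHom

section whisker

open GradedAdditiveBicategory

variable (k : Type t) [Field k] {K : Type u} [Bicategory.{w, v} K]
  [GradedAdditiveBicategory K] [GradedLinearBicategory k K] {a b c d : K}

/-- Left whiskering. -/
noncomputable abbrev wL (f : a ⟶ b) {g h : b ⟶ c} : GHom g h →ₗ[k] GHom (f ≫ g) (f ≫ h) :=
  map k (precomp c f)

/-- Right whiskering. -/
noncomputable abbrev wR {f g : a ⟶ b} (h : b ⟶ c) : GHom f g →ₗ[k] GHom (f ≫ h) (g ≫ h) :=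
  map k (postcomp a h)

/-- The isomorphism `f ≫ g⟦n⟧ ≅ (f ≫ g)⟦n⟧`. -/
def cL (f : a ⟶ b) (g : b ⟶ c) (n : ℤ) : f ≫ g⟦n⟧ ⟶ (f ≫ g)⟦n⟧ :=
  ((precomp c f).commShiftIso n).hom.app g

/-- The isomorphism `f⟦n⟧ ≫ g ≅ (f ≫ g)⟦n⟧`. -/
def cR (f : a ⟶ b) (g : b ⟶ c) (n : ℤ) : f⟦n⟧ ≫ g ⟶ (f ≫ g)⟦n⟧ :=
  ((postcomp a g).commShiftIso n).hom.app f

theorem cL_whiskerRight {f f' : a ⟶ b} (x : f ⟶ f') (g : b ⟶ c) (n : ℤ) :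
    x ▷ (g⟦n⟧) ≫ cL f' g n = cL f g n ≫ (x ▷ g)⟦n⟧' := precomp_natural c x g n

theorem cR_whiskerLeft (f : a ⟶ b) {g g' : b ⟶ c} (x : g ⟶ g') (n : ℤ) :
    (f⟦n⟧) ◁ x ≫ cR f g' n = cR f g n ≫ (f ◁ x)⟦n⟧' := postcomp_natural a f x n

theorem cL_cR (f : a ⟶ b) (g : b ⟶ c) (m n : ℤ) :
    cL (f⟦m⟧) g n ≫ (cR f g m)⟦n⟧' =
      cR f (g⟦n⟧) m ≫ (cL f g n)⟦m⟧' ≫ (shiftFunctorComm (a ⟶ c) n m).hom.app (f ≫ g) :=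
  shift_exchange f g m n

theorem cL_leftUnitor (f : a ⟶ b) (n : ℤ) : cL (𝟙 a) f n ≫ ((λ_ f).hom)⟦n⟧' = (λ_ (f⟦n⟧)).hom :=
  leftUnitor_shift f n

theorem cR_rightUnitor (f : a ⟶ b) (n : ℤ) : cR f (𝟙 b) n ≫ ((ρ_ f).hom)⟦n⟧' = (ρ_ (f⟦n⟧)).hom :=
  rightUnitor_shift f n

theorem cL_associator (f : a ⟶ b) (g : b ⟶ c) (h : c ⟶ d) (n : ℤ) :
    cL (f ≫ g) h n ≫ ((α_ f g h).hom)⟦n⟧' = (α_ f g (h⟦n⟧)).hom ≫ f ◁ cL g h n ≫ cL f (g ≫ h) n :=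
  (associator_shift_right f g h n).symm

theorem cR_associator (f : a ⟶ b) (g : b ⟶ c) (h : c ⟶ d) (n : ℤ) :
    cR f g n ▷ h ≫ cR (f ≫ g) h n ≫ ((α_ f g h).hom)⟦n⟧' = (α_ (f⟦n⟧) g h).hom ≫ cR f (g ≫ h) n :=
  (associator_shift_left f g h n).symm

theorem cL_cR_associator (f : a ⟶ b) (g : b ⟶ c) (h : c ⟶ d) (n : ℤ) :
    cL f g n ▷ h ≫ cR (f ≫ g) h n ≫ ((α_ f g h).hom)⟦n⟧' =
      (α_ f (g⟦n⟧) h).hom ≫ f ◁ cR g h n ≫ cL f (g ≫ h) n :=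
  (associator_shift_middle f g h n).symm

theorem wL_hm (f : a ⟶ b) {g h : b ⟶ c} {p : ℤ} (x : ShiftedHom g h p) :
    wL k f (hm k p x) = hm k p (f ◁ x ≫ cL f h p) := map_hm _ x

theorem wR_hm {f g : a ⟶ b} {p : ℤ} (x : ShiftedHom f g p) (h : b ⟶ c) :
    wR k h (hm k p x) = hm k p (x ▷ h ≫ cR g h p) := map_hm _ x

theorem wL_mk (f : a ⟶ b) {g h : b ⟶ c} (x : g ⟶ h) : wL k f (mk k x) = mk k (f ◁ x) :=
  map_mk _ x

theorem wR_mk {f g : a ⟶ b} (x : f ⟶ g) (h : b ⟶ c) : wR k h (mk k x) = mk k (x ▷ h) :=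
  map_mk _ x

theorem wL_add (f : a ⟶ b) {g h : b ⟶ c} (x y : GHom g h) :
    wL k f (x + y) = wL k f x + wL k f y := LinearMap.map_add _ x y

theorem wR_add {f g : a ⟶ b} (x y : GHom f g) (h : b ⟶ c) :
    wR k h (x + y) = wR k h x + wR k h y := LinearMap.map_add _ x y

theorem wL_smul (f : a ⟶ b) {g h : b ⟶ c} (z : k) (x : GHom g h) :
    wL k f (z • x) = z • wL k f x := LinearMap.map_smul _ z x

theorem wR_smul {f g : a ⟶ b} (z : k) (x : GHom f g) (h : b ⟶ c) :
    wR k h (z • x) = z • wR k h x := LinearMap.map_smul _ z x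

theorem leftUnitor_naturality {f g : a ⟶ b} (x : GHom f g) :
    comp k (wL k (𝟙 a) x) (mk k (λ_ g).hom) = comp k (mk k (λ_ f).hom) x := by
  refine ind k (fun p x => ?_) (fun x y hx hy => ?_) x
  · rw [wL_hm, hm_comp_mk, mk_comp_hm, Category.assoc, cL_leftUnitor,
      Bicategory.leftUnitor_naturality]
  · simp only [_root_.map_add, LinearMap.add_apply, hx, hy]

theorem rightUnitor_naturality {f g : a ⟶ b} (x : GHom f g) :
    comp k (wR k (𝟙 b) x) (mk k (ρ_ g).hom) = comp k (mk k (ρ_ f).hom) x := by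
  refine ind k (fun p x => ?_) (fun x y hx hy => ?_) x
  · rw [wR_hm, hm_comp_mk, mk_comp_hm, Category.assoc, cR_rightUnitor,
      Bicategory.rightUnitor_naturality]
  · simp only [_root_.map_add, LinearMap.add_apply, hx, hy]

theorem associator_naturality_right (f : a ⟶ b) (g : b ⟶ c) {h h' : c ⟶ d} (x : GHom h h') :
    comp k (wL k (f ≫ g) x) (mk k (α_ f g h').hom) =
      comp k (mk k (α_ f g h).hom) (wL k f (wL k g x)) := by
  refine ind k (fun p x => ?_) (fun x y hx hy => ?_) x
  · rw [wL_hm, wL_hm, wL_hm, hm_comp_mk, mk_comp_hm, Category.assoc, cL_associator]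
    simp
  · simp only [_root_.map_add, LinearMap.add_apply, hx, hy]

theorem associator_naturality_left {f f' : a ⟶ b} (x : GHom f f') (g : b ⟶ c) (h : c ⟶ d) :
    comp k (wR k h (wR k g x)) (mk k (α_ f' g h).hom) =
      comp k (mk k (α_ f g h).hom) (wR k (g ≫ h) x) := by
  refine ind k (fun p x => ?_) (fun x y hx hy => ?_) x
  · rw [wR_hm, wR_hm, wR_hm, hm_comp_mk, mk_comp_hm, comp_whiskerRight, Category.assoc,
      Category.assoc, cR_associator]
    simp
  · simp only [_root_.map_add, LinearMap.add_apply, hx, hy]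

theorem associator_naturality_middle (f : a ⟶ b) {g g' : b ⟶ c} (x : GHom g g') (h : c ⟶ d) :
    comp k (wR k h (wL k f x)) (mk k (α_ f g' h).hom) =
      comp k (mk k (α_ f g h).hom) (wL k f (wR k h x)) := by
  refine ind k (fun p x => ?_) (fun x y hx hy => ?_) x
  · rw [wL_hm, wR_hm, wR_hm, wL_hm, hm_comp_mk, mk_comp_hm, comp_whiskerRight, Category.assoc,
      Category.assoc, cL_cR_associator]
    simp
  · simp only [_root_.map_add, LinearMap.add_apply, hx, hy]

/-- The interchange law for homogeneous 2-morphisms. No sign occurs when shifts are exchanged. -/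
theorem whisker_exchange_hm {f g : a ⟶ b} {h i : b ⟶ c} {p q s : ℤ} (x : ShiftedHom f g p)
    (y : ShiftedHom h i q) (e : p + q = s) (e' : q + p = s) :
    ShiftedHom.comp (f ◁ y ≫ cL f i q) (x ▷ i ≫ cR g i p) e =
      ShiftedHom.comp (x ▷ h ≫ cR g h p) (g ◁ y ≫ cL g i q) e' := by
  have h1 := cL_whiskerRight x i q
  have h2 := cR_whiskerLeft g y p
  have h3 := cL_cR g i p q
  simp only [ShiftedHom.comp, Functor.map_comp, Category.assoc]
  rw [← reassoc_of% h1, reassoc_of% h3, ← reassoc_of% h2, shiftFunctorComm_eq _ _ _ s e',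
    ← whisker_exchange_assoc]
  simp

theorem whisker_exchange {f g : a ⟶ b} {h i : b ⟶ c} (x : GHom f g) (y : GHom h i) :
    comp k (wL k f y) (wR k i x) = comp k (wR k h x) (wL k g y) := by
  refine ind k (fun p x => ?_) (fun x x' hx hx' => ?_) x
  · refine ind k (fun q y => ?_) (fun y y' hy hy' => ?_) y
    · rw [wL_hm, wR_hm, wR_hm, wL_hm, comp_hm _ _ (add_comm p q), comp_hm _ _ rfl,
        whisker_exchange_hm]
    · simp only [_root_.map_add, LinearMap.add_apply, hy, hy']
  · simp only [_root_.map_add, LinearMap.add_apply, hx, hx']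

end whisker

end GHom

/-- The objects of `K`, as objects of the bicategory with the same 1-morphisms, in which the
2-morphisms are the sums of homogeneous 2-morphisms of `K` of arbitrary degrees. -/
structure Tot (k : Type t) (K : Type u) where
  /-- the underlying object -/
  as : K

namespace Tot

variable {k : Type t} [Field k] {K : Type u} [Bicategory.{w, v} K]
  [GradedAdditiveBicategory K] [GradedLinearBicategory k K]

noncomputable instance : Bicategory.{w, v} (Tot k K) where
  Hom a b := a.as ⟶ b.as
  id a := 𝟙 a.as
  comp f g := (f ≫ g : _ ⟶ _)
  homCategory a b := GHom.cat k (a.as ⟶ b.as)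
  whiskerLeft f _ _ x := GHom.wL k f x
  whiskerRight x h := GHom.wR k h x
  associator f g h := GHom.mkIso k (α_ f g h)
  leftUnitor f := GHom.mkIso k (λ_ f)
  rightUnitor f := GHom.mkIso k (ρ_ f)
  whiskerLeft_id f g := (GHom.wL_mk k f (𝟙 g)).trans (congrArg _ (Bicategory.whiskerLeft_id f g))
  whiskerLeft_comp f _ _ _ x y := GHom.map_comp _ x y
  id_whiskerLeft x := @SL2.Graded.eq_conj _ (GHom.cat k _) _ _ _ _ _ _ _ _
    (GHom.leftUnitor_naturality k x)
  comp_whiskerLeft f g _ _ x := @SL2.Graded.eq_conj _ (GHom.cat k _) _ _ _ _ _ _ _ _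
    (GHom.associator_naturality_right k f g x)
  id_whiskerRight f g := (GHom.wR_mk k (𝟙 f) g).trans (congrArg _ (Bicategory.id_whiskerRight f g))
  comp_whiskerRight x y _ := GHom.map_comp _ x y
  whiskerRight_id x := @SL2.Graded.eq_conj _ (GHom.cat k _) _ _ _ _ _ _ _ _
    (GHom.rightUnitor_naturality k x)
  whiskerRight_comp x g h := @SL2.Graded.eq_conj' _ (GHom.cat k _) _ _ _ _ _ _ _ _
    (GHom.associator_naturality_left k x g h)
  whisker_assoc f _ _ x h := @SL2.Graded.eq_conj _ (GHom.cat k _) _ _ _ _ _ _ _ _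
    (GHom.associator_naturality_middle k f x h)
  whisker_exchange x y := GHom.whisker_exchange k x y
  pentagon f g h i := by
    change GHom.comp k (GHom.wR k i (GHom.mk k (α_ _ _ _).hom)) (GHom.comp k (GHom.mk k
      (α_ _ _ _).hom) (GHom.wL k f (GHom.mk k (α_ _ _ _).hom))) =
      GHom.comp k (GHom.mk k (α_ _ _ _).hom) (GHom.mk k (α_ _ _ _).hom)
    rw [GHom.wR_mk, GHom.wL_mk, GHom.mk_comp_mk, GHom.mk_comp_mk, GHom.mk_comp_mk,
      Bicategory.pentagon]
  triangle f g := by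
    change GHom.comp k (GHom.mk k (α_ _ _ _).hom) (GHom.wL k f (GHom.mk k (λ_ _).hom)) =
      GHom.wR k g (GHom.mk k (ρ_ _).hom)
    rw [GHom.wR_mk, GHom.wL_mk, GHom.mk_comp_mk, Bicategory.triangle]

noncomputable instance : AddBicat (Tot k K) where
  pre a b := GHom.preadditive k (a.as ⟶ b.as)
  whiskerLeft_add {a b c} f _ _ x y := @GHom.wL_add k _ K _ _ _ a.as b.as c.as f _ _ x y
  add_whiskerRight {a b c} _ _ x y f := @GHom.wR_add k _ K _ _ _ a.as b.as c.as _ _ x y f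

noncomputable instance : GrBicat k (Tot k K) where
  lin a b := GHom.linear k (a.as ⟶ b.as)
  whiskerLeft_smul {a b c} f _ _ z x := @GHom.wL_smul k _ K _ _ _ a.as b.as c.as f _ _ z x
  smul_whiskerRight {a b c} _ _ z x f := @GHom.wR_smul k _ K _ _ _ a.as b.as c.as _ _ z x f
  homog p a b f g := GHom.homog k (C := a.as ⟶ b.as) f g p
  deg_id f := ⟨_, rfl⟩
  deg_comp := by
    rintro p q a b f g h _ _ ⟨x, rfl⟩ ⟨y, rfl⟩
    exact ⟨_, (GHom.comp_hm x y (add_comm q p)).symm⟩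
  deg_whiskerLeft := by
    rintro p a b c f g h _ ⟨x, rfl⟩
    exact ⟨_, (@GHom.wL_hm k _ K _ _ _ a.as b.as c.as f _ _ _ x).symm⟩
  deg_whiskerRight := by
    rintro p a b c f g _ h ⟨x, rfl⟩
    exact ⟨_, (@GHom.wR_hm k _ K _ _ _ a.as b.as c.as _ _ _ x h).symm⟩
  deg_associator f g h := ⟨⟨_, rfl⟩, ⟨_, rfl⟩⟩
  deg_leftUnitor f := ⟨⟨_, rfl⟩, ⟨_, rfl⟩⟩
  deg_rightUnitor f := ⟨⟨_, rfl⟩, ⟨_, rfl⟩⟩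

end Tot

/-- Transport of an adjunction along an isomorphism of right adjoints. -/
def adjOfIso {B : Type u} [Bicategory.{w, v} B] {a b : B} {f : a ⟶ b} {g g' : b ⟶ a} (A : f ⊣ g)
    (e : g' ≅ g) : f ⊣ g' where
  unit := A.unit ≫ f ◁ e.inv
  counit := e.hom ▷ f ≫ A.counit
  left_triangle := by
    have h := A.left_triangle
    rw [leftZigzag_eq] at h ⊢
    rw [← h]
    simp [← Bicategory.whiskerLeft_comp_assoc]
  right_triangle := by
    have h := A.right_triangle
    rw [rightZigzag_eq] at h ⊢
    have h1 : (e.hom ▷ f ≫ A.counit) ▷ g' ≫ 𝟙 b ◁ e.hom =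
        (g' ≫ f) ◁ e.hom ≫ (e.hom ▷ f ≫ A.counit) ▷ g := (whisker_exchange _ _).symm
    have h2 : g' ◁ A.unit ≫ (α_ g' f g).inv ≫ e.hom ▷ f ▷ g =
        e.hom ▷ 𝟙 a ≫ g ◁ A.unit ≫ (α_ g f g).inv := by
      rw [← whisker_exchange_assoc, whiskerRight_comp]
      simp
    rw [← cancel_mono (𝟙 b ◁ e.hom), Category.assoc, Category.assoc, h1, comp_whiskerLeft]
    simp only [Bicategory.whiskerLeft_comp, comp_whiskerRight, Category.assoc, Iso.inv_hom_id_assoc]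
    have h3 : g' ◁ f ◁ e.inv ≫ g' ◁ f ◁ e.hom = 𝟙 _ := by
      simp [← Bicategory.whiskerLeft_comp]
    rw [reassoc_of% h3, reassoc_of% h2, h, rightUnitor_naturality_assoc, leftUnitor_inv_naturality]

namespace Tot

open GrBicat

section

variable {k : Type t} [Field k] {K : Type u} [Bicategory.{w, v} K] {a b c d : K}

variable (k) in
/-- A 1-morphism of `K`, as a 1-morphism of the total bicategory. -/
abbrev of₁ [GradedAdditiveBicategory K] [GradedLinearBicategory k K] (f : a ⟶ b) :
    (⟨a⟩ : Tot k K) ⟶ ⟨b⟩ := f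

variable [GradedAdditiveBicategory K] [GradedLinearBicategory k K]

variable (k) in
/-- A homogeneous 2-morphism of `K`, as a 2-morphism of the total bicategory. -/
def of₂ {f g : a ⟶ b} {p : ℤ} (x : ShiftedHom f g p) : of₁ k f ⟶ of₁ k g := GHom.hm k p x

variable (k) in
/-- A 2-morphism of `K`, as a 2-morphism of degree zero of the total bicategory. -/
noncomputable def of₀ {f g : a ⟶ b} (x : f ⟶ g) : of₁ k f ⟶ of₁ k g := GHom.mk k x

variable {f g h : a ⟶ b} {p q s : ℤ}

theorem of₂_injective {x y : ShiftedHom f g p} (h : of₂ k x = of₂ k y) : x = y :=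
  GHom.hm_injective p h

theorem of₀_injective {x y : f ⟶ g} (h : of₀ k x = of₀ k y) : x = y :=
  GHom.mk_injective h

theorem deg_of₂ (x : ShiftedHom f g p) : of₂ k x ∈ deg k p (of₁ k f) (of₁ k g) := ⟨x, rfl⟩

theorem deg_of₀ (x : f ⟶ g) : of₀ k x ∈ deg k 0 (of₁ k f) (of₁ k g) := ⟨_, rfl⟩

theorem exists_of₂ {x : of₁ k f ⟶ of₁ k g} (hx : x ∈ deg k p (of₁ k f) (of₁ k g)) :
    ∃ y : ShiftedHom f g p, of₂ k y = x := hx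

theorem exists_of₀ {x : of₁ k f ⟶ of₁ k g} (hx : x ∈ deg k 0 (of₁ k f) (of₁ k g)) :
    ∃ y : f ⟶ g, of₀ k y = x := by
  obtain ⟨y, rfl⟩ := exists_of₂ hx
  obtain ⟨z, rfl⟩ := (ShiftedHom.homEquiv (0 : ℤ) rfl).surjective y
  exact ⟨z, rfl⟩

theorem of₂_add (x y : ShiftedHom f g p) : of₂ k (x + y) = of₂ k x + of₂ k y := map_add _ x y

theorem of₂_sub (x y : ShiftedHom f g p) : of₂ k (x - y) = of₂ k x - of₂ k y := map_sub _ x y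

theorem of₂_smul (c : k) (x : ShiftedHom f g p) : of₂ k (c • x) = c • of₂ k x := map_smul _ c x

theorem of₂_zero : of₂ k (0 : ShiftedHom f g p) = 0 := map_zero _

theorem of₂_mk₀ (x : f ⟶ g) : of₂ k (ShiftedHom.mk₀ (0 : ℤ) rfl x) = of₀ k x := rfl

theorem of₂_comp (x : ShiftedHom f g p) (y : ShiftedHom g h q) (e : q + p = s) :
    of₂ k (x.comp y e) = of₂ k x ≫ of₂ k y := (GHom.comp_hm x y e).symm

theorem of₀_add (x y : f ⟶ g) : of₀ k (x + y) = of₀ k x + of₀ k y := by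
  rw [← of₂_mk₀, ShiftedHom.mk₀_add, of₂_add]; rfl

theorem of₀_smul (c : k) (x : f ⟶ g) : of₀ k (c • x) = c • of₀ k x := by
  rw [← of₂_mk₀, ShiftedHom.mk₀_smul, of₂_smul]; rfl

theorem of₀_zero : of₀ k (0 : f ⟶ g) = 0 := by
  rw [← of₂_mk₀, ShiftedHom.mk₀_zero, of₂_zero]

theorem of₀_sum {ι : Type*} (t : Finset ι) (x : ι → (f ⟶ g)) :
    of₀ k (∑ i ∈ t, x i) = ∑ i ∈ t, of₀ k (x i) :=
  map_sum (AddMonoidHom.mk' (of₀ k) of₀_add) x t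

theorem of₀_id (f : a ⟶ b) : of₀ k (𝟙 f) = 𝟙 (of₁ k f) := rfl

theorem of₀_comp (x : f ⟶ g) (y : g ⟶ h) : of₀ k (x ≫ y) = of₀ k x ≫ of₀ k y :=
  (GHom.mk_comp_mk x y).symm

theorem of₀_whiskerLeft (f : a ⟶ b) {g h : b ⟶ c} (x : g ⟶ h) :
    of₀ k (f ◁ x) = of₁ k f ◁ of₀ k x := (GHom.wL_mk k f x).symm

theorem of₀_whiskerRight (x : f ⟶ g) (h : b ⟶ c) :
    of₀ k (x ▷ h) = of₀ k x ▷ of₁ k h := (GHom.wR_mk k x h).symm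

theorem of₂_whiskerLeft (f : a ⟶ b) {g h : b ⟶ c} (x : ShiftedHom g h p) :
    of₂ k (SL2.ShiftedHom₂.hWhiskerLeft f x) = of₁ k f ◁ of₂ k x := (GHom.map_hm _ x).symm

theorem of₂_whiskerRight (x : ShiftedHom f g p) (h : b ⟶ c) :
    of₂ k (SL2.ShiftedHom₂.hWhiskerRight x h) = of₂ k x ▷ of₁ k h := (GHom.map_hm _ x).symm

theorem of₂_whiskerMid (f : a ⟶ b) {g g' : b ⟶ c} {h h' : c ⟶ d}
    (x : ShiftedHom (g ≫ h) (g' ≫ h') p) : of₂ k (SL2.ShiftedHom₂.hWhiskerMid f x) =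
      (α_ (of₁ k f) (of₁ k g) (of₁ k h)).hom ≫ of₁ k f ◁ of₂ k x ≫
        (α_ (of₁ k f) (of₁ k g') (of₁ k h')).inv := by
  rw [← of₂_whiskerLeft]
  refine Eq.trans ?_ (congrArg (of₀ k (α_ f g h).hom ≫ ·) (GHom.hm_comp_mk
    (SL2.ShiftedHom₂.hWhiskerLeft f x) (α_ f g' h').inv).symm)
  exact (GHom.mk_comp_hm (α_ f g h).hom _).symm

variable (k) in
/-- The isomorphism of degree `l` from `f⟦l⟧` to `f`. -/
noncomputable def un (f : a ⟶ b) (l : ℤ) : of₁ k (f⟦l⟧) ≅ of₁ k f where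
  hom := of₂ k (p := l) (𝟙 (f⟦l⟧))
  inv := of₂ k (p := -l) ((shiftFunctorCompIsoId _ l (-l) (add_neg_cancel l)).inv.app f)
  hom_inv_id := by
    rw [← of₂_comp _ _ (neg_add_cancel l), ← of₀_id, ← of₂_mk₀]
    rw [ShiftedHom.comp, Category.id_comp, shift_shiftFunctorCompIsoId_inv_app]
    simp [ShiftedHom.mk₀, shiftFunctorCompIsoId, shiftFunctorZero']
  inv_hom_id := by
    rw [← of₂_comp _ _ (add_neg_cancel l), ← of₀_id, ← of₂_mk₀]
    simp [ShiftedHom.comp, ShiftedHom.mk₀, shiftFunctorCompIsoId, shiftFunctorZero']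

theorem deg_un (f : a ⟶ b) (l : ℤ) : (un k f l).hom ∈ deg k l _ _ := deg_of₂ _

theorem deg_un_inv (f : a ⟶ b) (l : ℤ) : (un k f l).inv ∈ deg k (-l) _ _ := deg_of₂ _

/-- A 2-morphism `f ⟶ g⟦p⟧`, regarded as homogeneous of degree `p`. -/
theorem of₂_eq (x : ShiftedHom f g p) : of₂ k x = of₀ k x ≫ (un k g p).hom := by
  refine Eq.trans ?_ (GHom.mk_comp_hm (k := k) (x : f ⟶ g⟦p⟧) (𝟙 (g⟦p⟧))).symm
  rw [Category.comp_id]; rfl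

theorem un_natural (x : f ⟶ g) (l : ℤ) :
    of₀ k (x⟦l⟧') ≫ (un k g l).hom = (un k f l).hom ≫ of₀ k x := by
  refine (GHom.mk_comp_hm (k := k) (x⟦l⟧') (𝟙 (g⟦l⟧))).trans
    (Eq.trans ?_ (GHom.hm_comp_mk (k := k) (p := l) (𝟙 (f⟦l⟧)) x).symm)
  rw [Category.comp_id, Category.id_comp]

theorem whiskerLeft_un (f : a ⟶ b) (g : b ⟶ c) (l : ℤ) :
    of₁ k f ◁ (un k g l).hom = of₀ k (GHom.cL f g l) ≫ (un k (f ≫ g) l).hom := by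
  refine (GHom.wL_hm k f (p := l) (𝟙 (g⟦l⟧))).trans
    (Eq.trans ?_ (GHom.mk_comp_hm (k := k) (GHom.cL f g l) (𝟙 ((f ≫ g)⟦l⟧))).symm)
  rw [Category.comp_id, Bicategory.whiskerLeft_id, Category.id_comp]

theorem whiskerRight_un (f : a ⟶ b) (g : b ⟶ c) (l : ℤ) :
    (un k f l).hom ▷ of₁ k g = of₀ k (GHom.cR f g l) ≫ (un k (f ≫ g) l).hom := by
  refine (GHom.wR_hm k (p := l) (𝟙 (f⟦l⟧)) g).trans
    (Eq.trans ?_ (GHom.mk_comp_hm (k := k) (GHom.cR f g l) (𝟙 ((f ≫ g)⟦l⟧))).symm)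
  rw [Category.comp_id, Bicategory.id_whiskerRight, Category.id_comp]

theorem un_add (f : a ⟶ b) (l m : ℤ) : (un k (f⟦l⟧) m).hom ≫ (un k f l).hom =
    of₀ k ((shiftFunctorAdd (a ⟶ b) l m).inv.app f) ≫ (un k f (l + m)).hom := by
  refine (GHom.comp_hm (k := k) (p := m) (q := l) (𝟙 ((f⟦l⟧)⟦m⟧)) (𝟙 (f⟦l⟧)) rfl).trans
    (Eq.trans ?_ (GHom.mk_comp_hm (k := k) _ (𝟙 (f⟦l + m⟧))).symm)
  rw [ShiftedHom.comp, CategoryTheory.Functor.map_id, Category.id_comp, Category.id_comp, Category.comp_id,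
    shiftFunctorAdd'_eq_shiftFunctorAdd]

theorem un_zero (f : a ⟶ b) :
    (un k f 0).hom = of₀ k ((shiftFunctorZero (a ⟶ b) ℤ).hom.app f) := by
  refine congrArg (GHom.hm k 0) ?_
  simp [ShiftedHom.mk₀, shiftFunctorZero']

end

end Tot

/-! ### The action given by a strong 2-representation -/

namespace Tot

open GrBicat

variable {k : Type t} [Field k] {K : Type u} [Bicategory.{w, v} K]
  [GradedAdditiveBicategory K] [GradedLinearBicategory k K]

attribute [local instance] hasBinaryBiproducts_of_finite_biproducts

/-- A direct sum decomposition of a 1-morphism of `K` into `W` and shifted identities. -/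
theorem exists_decomp {a : K} {V W : a ⟶ a} {N : ℕ} {s : Fin N → ℤ} {δ : ℕ → ℤ}
    (φ : V ≅ W ⊞ ⨁ fun i => (𝟙 a)⟦s i⟧) (τ : Fin N ≃ Fin N)
    (hδ : ∀ j (hj : j < N), δ j = -s (τ ⟨j, hj⟩)) :
    Nonempty (Decomp k (of₁ k V) (of₁ k W) N δ) := by
  -- The shifted identities, as 1-morphisms of the total bicategory, are isomorphic to the identity,
  -- by homogeneous 2-morphisms.
  let I (j : Fin N) : of₁ k (𝟙 a) ⟶ of₁ k V := (un k (𝟙 a) (s j)).inv ≫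
    of₀ k (biproduct.ι (fun i => (𝟙 a)⟦s i⟧) j ≫ biprod.inr ≫ φ.inv)
  let Q (j : Fin N) : of₁ k V ⟶ of₁ k (𝟙 a) :=
    of₀ k (φ.hom ≫ biprod.snd ≫ biproduct.π (fun i => (𝟙 a)⟦s i⟧) j) ≫ (un k (𝟙 a) (s j)).hom
  have hIQ (j l : Fin N) : I j ≫ Q l = if j = l then 𝟙 _ else 0 := by
    simp only [I, Q, Category.assoc]
    rw [← Category.assoc (of₀ k _), ← of₀_comp]
    simp only [Category.assoc, Iso.inv_hom_id_assoc, BinaryBicone.inr_snd_assoc]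
    split_ifs with h
    · subst h
      rw [biproduct.ι_π_self, of₀_id, Category.id_comp, Iso.inv_hom_id]
    · rw [biproduct.ι_π_ne _ h, of₀_zero, zero_comp, comp_zero]
  have hQI : ∑ j, Q j ≫ I j = of₀ k (φ.hom ≫ biprod.snd ≫ biprod.inr ≫ φ.inv) := by
    have h1 : ∀ j, Q j ≫ I j = of₀ k (φ.hom ≫ biprod.snd ≫
        (biproduct.π (fun i => (𝟙 a)⟦s i⟧) j ≫ biproduct.ι (fun i => (𝟙 a)⟦s i⟧) j) ≫
          biprod.inr ≫ φ.inv) := by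
      intro j
      simp only [I, Q, Category.assoc, Iso.hom_inv_id_assoc]
      rw [← of₀_comp]
      simp only [Category.assoc]
    simp only [h1]
    rw [← of₀_sum, ← Preadditive.comp_sum, ← Preadditive.comp_sum, ← Preadditive.sum_comp,
      biproduct.total, Category.id_comp]
  refine ⟨{ u := of₀ k (biprod.inl ≫ φ.inv)
            v := of₀ k (φ.hom ≫ biprod.fst)
            i := fun j => if hj : j < N then I (τ ⟨j, hj⟩) else 0
            q := fun j => if hj : j < N then Q (τ ⟨j, hj⟩) else 0
            deg_u := deg_of₀ _
            deg_v := deg_of₀ _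
            deg_i := fun j hj => ?_
            deg_q := fun j hj => ?_
            u_v := ?_
            u_q := fun j hj => ?_
            i_v := fun j hj => ?_
            i_q := fun j hj l hl => ?_
            total := ?_ }⟩
  · rw [dif_pos hj]
    exact deg_comp' k (deg_un_inv _ _) (deg_of₀ _) (by rw [hδ j hj, add_zero])
  · rw [dif_pos hj]
    exact deg_comp' k (deg_of₀ _) (deg_un _ _) (by rw [hδ j hj, neg_neg, zero_add])
  · rw [← of₀_comp, ← of₀_id]
    simp
  · rw [dif_pos hj]
    simp only [Q]
    rw [← Category.assoc, ← of₀_comp]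
    simp [of₀_zero]
  · rw [dif_pos hj]
    simp only [I, Category.assoc]
    rw [← of₀_comp]
    simp [of₀_zero]
  · rw [dif_pos hj, dif_pos hl, hIQ]
    simp [Fin.ext_iff]
    rfl
  · rw [Finset.sum_range, ← of₀_comp]
    have : ∀ j : Fin N, ((if hj : (j : ℕ) < N then Q (τ ⟨j, hj⟩) else 0) ≫
        (if hj : (j : ℕ) < N then I (τ ⟨j, hj⟩) else 0)) = Q (τ j) ≫ I (τ j) := by
      intro j
      rw [dif_pos j.2, dif_pos j.2]
    simp only [this]
    rw [Equiv.sum_comp τ (fun j => Q j ≫ I j), hQI, ← of₀_add, ← of₀_id]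
    simp only [Category.assoc, ← Preadditive.comp_add]
    rw [← Category.assoc biprod.fst, ← Category.assoc biprod.snd, ← Preadditive.add_comp,
      biprod.total, Category.id_comp, Iso.hom_inv_id]

end Tot

namespace SL2.StrongRep

open GrBicat Tot

variable {k : Type t} [Field k] {r : kˣ} {K : Type u} [Bicategory.{w, v} K]
  [GradedAdditiveBicategory K] [GradedLinearBicategory k K] {ob : ℤ → K} (S : StrongRep r ob)

/-- An adjunction between `E` and its right adjoint. -/
noncomputable def adjER (m n : ℤ) (h : m + 2 = n) :
    of₁ k (S.E m n h) ⊣ of₁ k (S.ER n m h) where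
  unit := of₀ k (S.rightAdjoint m n h).some.unit
  counit := of₀ k (S.rightAdjoint m n h).some.counit
  left_triangle := by
    have := congrArg (of₀ k) (S.rightAdjoint m n h).some.left_triangle
    rw [leftZigzag_eq, of₀_comp, of₀_comp, of₀_whiskerLeft, of₀_whiskerRight] at this
    rw [leftZigzag_eq]
    exact this.trans (of₀_comp _ _)
  right_triangle := by
    have := congrArg (of₀ k) (S.rightAdjoint m n h).some.right_triangle
    rw [rightZigzag_eq, of₀_comp, of₀_comp, of₀_whiskerLeft, of₀_whiskerRight] at this
    rw [rightZigzag_eq]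
    exact this.trans (of₀_comp _ _)

/-- The action on the total bicategory given by a strong 2-representation. -/
noncomputable def sys : Sys k r (Tot k K) where
  o n := ⟨ob n⟩
  E m n h := of₁ k (S.E m n h)
  F n m h := of₁ k (S.F n m h)
  adj m n h := adjOfIso (S.adjER m n h) (un k (S.ER n m h) (-m - 1))
  deg_unit m n h := deg_comp' k (deg_of₀ _) (deg_whiskerLeft _ (deg_un_inv _ _)) (by omega)
  deg_counit m n h := deg_comp' k (deg_whiskerRight _ (deg_un _ _)) (deg_of₀ _) (by omega)
  X m n h := of₂ k (S.X m n h)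
  T a b c h h' := of₂ k (S.T a b c h h')
  deg_X m n h := deg_of₂ _
  deg_T a b c h h' := deg_of₂ _
  T_sq a b c h h' := by
    have := congrArg (of₂ k) (S.T_sq a b c h h')
    rw [of₂_comp, of₂_zero] at this
    exact this
  slide a b c h h' := by
    have := congrArg (of₂ k) (S.slide a b c h h')
    rw [of₂_sub, of₂_comp, of₂_comp, of₂_smul, of₂_whiskerLeft, of₂_whiskerRight] at this
    exact this
  slide' a b c h h' := by
    have := congrArg (of₂ k) (S.slide' a b c h h')
    rw [of₂_sub, of₂_comp, of₂_comp, of₂_smul, of₂_whiskerLeft, of₂_whiskerRight] at this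
    exact this
  braid a b c d h h' h'' := by
    have := congrArg (of₂ k) (S.braid a b c d h h' h'')
    rw [of₂_comp, of₂_comp, of₂_comp, of₂_comp, of₂_whiskerRight, of₂_whiskerMid] at this
    exact (Category.assoc _ _ _).symm.trans (this.trans (Category.assoc _ _ _))
  one_neg n p hp x hx := by
    obtain ⟨y, rfl⟩ := exists_of₂ hx
    rw [S.hom_neg n p hp y, of₂_zero]
  one_zero n x hx := by
    obtain ⟨y, rfl⟩ := exists_of₀ hx
    by_cases hn : IsZero (𝟙 (ob n))
    · refine ⟨0, ?_⟩
      rw [hn.eq_of_src y 0, of₀_zero, zero_smul]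
    · have h1 : 𝟙 (𝟙 (ob n)) ≠ 0 := fun h => hn ((IsZero.iff_id_eq_zero _).2 h)
      obtain ⟨c, hc⟩ := (finrank_eq_one_iff_of_nonzero' _ h1).1 (S.hom_zero n hn) y
      exact ⟨c, by rw [← hc, of₀_smul]; rfl⟩
  fin m n p f g := by
    have := S.finiteDimensional (m := m) (n := n) f (g⟦p⟧)
    exact GHom.finite_homog (C := ob m ⟶ ob n) f g p
  integrable n := by
    obtain ⟨R, hR⟩ := S.integrable n
    refine ⟨R, fun s hs => ?_⟩
    have := congrArg (of₀ k) ((IsZero.iff_id_eq_zero _).1 (hR s hs))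
    rw [of₀_zero] at this
    exact this
  comm_nonpos l n p h h' hn := by
    obtain ⟨φ⟩ := S.commutator_nonpos l n p h h' hn
    exact exists_decomp φ (Equiv.refl _) (fun j hj => by simp; ring)
  comm_nonneg l n p h h' hn := by
    obtain ⟨φ⟩ := S.commutator_nonneg l n p h h' hn
    exact exists_decomp φ Fin.revPerm (fun j hj => by
      have := Int.toNat_of_nonneg hn
      simp [Fin.rev]; omega)

end SL2.StrongRep

/-! ### Evaluation of diagrams -/

section

open GrBicat SL2

/-- Shifts and finite direct sums of 1-morphisms, in a bicategory whose 2-morphisms have degrees. -/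
structure Sums (k : Type t) [Field k] (B : Type u) [Bicategory.{w, v} B] [AddBicat B]
    [GrBicat k B] where
  sh {a b : B} (f : a ⟶ b) (l : ℤ) : a ⟶ b
  un {a b : B} (f : a ⟶ b) (l : ℤ) : sh f l ≅ f
  deg_un {a b : B} (f : a ⟶ b) (l : ℤ) : (un f l).hom ∈ deg k l _ _
  deg_un_inv {a b : B} (f : a ⟶ b) (l : ℤ) : (un f l).inv ∈ deg k (-l) _ _
  zero (a b : B) : a ⟶ b
  id_zero (a b : B) : 𝟙 (zero a b) = 0
  sum {a b : B} (f g : a ⟶ b) : a ⟶ b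
  inl {a b : B} (f g : a ⟶ b) : f ⟶ sum f g
  inr {a b : B} (f g : a ⟶ b) : g ⟶ sum f g
  fst {a b : B} (f g : a ⟶ b) : sum f g ⟶ f
  snd {a b : B} (f g : a ⟶ b) : sum f g ⟶ g
  deg_inl {a b : B} (f g : a ⟶ b) : inl f g ∈ deg k 0 _ _
  deg_inr {a b : B} (f g : a ⟶ b) : inr f g ∈ deg k 0 _ _
  deg_fst {a b : B} (f g : a ⟶ b) : fst f g ∈ deg k 0 _ _
  deg_snd {a b : B} (f g : a ⟶ b) : snd f g ∈ deg k 0 _ _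
  inl_fst {a b : B} (f g : a ⟶ b) : inl f g ≫ fst f g = 𝟙 f
  inr_snd {a b : B} (f g : a ⟶ b) : inr f g ≫ snd f g = 𝟙 g
  inl_snd {a b : B} (f g : a ⟶ b) : inl f g ≫ snd f g = 0
  inr_fst {a b : B} (f g : a ⟶ b) : inr f g ≫ fst f g = 0
  total {a b : B} (f g : a ⟶ b) : fst f g ≫ inl f g + snd f g ≫ inr f g = 𝟙 (sum f g)

namespace Sys.Bi

variable {k : Type t} [Field k] {B : Type u} [Bicategory.{w, v} B] [AddBicat B] [GrBicat k B]
  {r : kˣ} {S : Sys k r B} (β : Bi S) (Z : Sums k B)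

/-- The 1-morphism given by a word. -/
def ev (S : Sys k r B) (Z : Sums k B) : {a b : ℤ} → Word a b → (S.o a ⟶ S.o b)
  | _, _, .one n => 𝟙 (S.o n)
  | _, _, .E m n h => S.E m n h
  | _, _, .F n m h => S.F n m h
  | _, _, .comp f g => ev S Z f ≫ ev S Z g
  | _, _, .shift f l => Z.sh (ev S Z f) l
  | _, _, .zero a b => Z.zero (S.o a) (S.o b)
  | _, _, .sum f g => Z.sum (ev S Z f) (ev S Z g)

/-- The 2-morphism given by a diagram. -/
def ev₂ : {a b : ℤ} → {f g : Word a b} → {p : ℤ} → Diagram k f g p → (ev S Z f ⟶ ev S Z g)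
  | _, _, _, _, _, .ident f => 𝟙 (ev S Z f)
  | _, _, _, _, _, .comp x y _ => ev₂ x ≫ ev₂ y
  | _, _, _, _, _, .whiskerLeft f x => ev S Z f ◁ ev₂ x
  | _, _, _, _, _, .whiskerRight x h => ev₂ x ▷ ev S Z h
  | _, _, _, _, _, .assoc f g h => (α_ (ev S Z f) (ev S Z g) (ev S Z h)).hom
  | _, _, _, _, _, .assocInv f g h => (α_ (ev S Z f) (ev S Z g) (ev S Z h)).inv
  | _, _, _, _, _, .leftUnit f => (λ_ (ev S Z f)).hom
  | _, _, _, _, _, .leftUnitInv f => (λ_ (ev S Z f)).inv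
  | _, _, _, _, _, .rightUnit f => (ρ_ (ev S Z f)).hom
  | _, _, _, _, _, .rightUnitInv f => (ρ_ (ev S Z f)).inv
  | _, _, _, _, _, .unshift f l => (Z.un (ev S Z f) l).hom
  | _, _, _, _, _, .toShift f l => (Z.un (ev S Z f) l).inv
  | _, _, _, _, _, .zero _ _ _ => 0
  | _, _, _, _, _, .add x y => ev₂ x + ev₂ y
  | _, _, _, _, _, .smul c x => c • ev₂ x
  | _, _, _, _, _, .inl f g => Z.inl (ev S Z f) (ev S Z g)
  | _, _, _, _, _, .inr f g => Z.inr (ev S Z f) (ev S Z g)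
  | _, _, _, _, _, .fst f g => Z.fst (ev S Z f) (ev S Z g)
  | _, _, _, _, _, .snd f g => Z.snd (ev S Z f) (ev S Z g)
  | _, _, _, _, _, .dotE m n h => S.X m n h
  | _, _, _, _, _, .dotF n m h => S.xF n m h
  | _, _, _, _, _, .crossE a b c h h' => S.T a b c h h'
  | _, _, _, _, _, .crossF c b a h' h => S.tF c b a h' h
  | _, _, _, _, _, .cupFE m n h => (S.adj m n h).unit
  | _, _, _, _, _, .capFE m n h => (β.lad m n h).adj.counit
  | _, _, _, _, _, .cupEF m n h => (β.lad m n h).adj.unit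
  | _, _, _, _, _, .capEF m n h => (S.adj m n h).counit

theorem deg_ev₂ {a b : ℤ} {f g : Word a b} {p : ℤ} (x : Diagram k f g p) :
    β.ev₂ Z x ∈ deg k p _ _ := by
  induction x with
  | ident f => exact deg_id _
  | comp x y e ihx ihy => exact deg_comp' k ihx ihy e
  | whiskerLeft f x ih => exact deg_whiskerLeft _ ih
  | whiskerRight x h ih => exact deg_whiskerRight _ ih
  | assoc f g h => exact (deg_associator _ _ _).1
  | assocInv f g h => exact (deg_associator _ _ _).2
  | leftUnit f => exact (deg_leftUnitor _).1
  | leftUnitInv f => exact (deg_leftUnitor _).2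
  | rightUnit f => exact (deg_rightUnitor _).1
  | rightUnitInv f => exact (deg_rightUnitor _).2
  | unshift f l => exact Z.deg_un _ _
  | toShift f l => exact Z.deg_un_inv _ _
  | zero f g p => exact Submodule.zero_mem _
  | add x y ihx ihy => exact Submodule.add_mem _ ihx ihy
  | smul c x ih => exact Submodule.smul_mem _ c ih
  | inl f g => exact Z.deg_inl _ _
  | inr f g => exact Z.deg_inr _ _
  | fst f g => exact Z.deg_fst _ _
  | snd f g => exact Z.deg_snd _ _
  | dotE m n h => exact S.deg_X m n h
  | dotF n m h => exact S.deg_xF n m h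
  | crossE a b c h h' => exact S.deg_T a b c h h'
  | crossF c b a h' h => exact S.deg_tF c b a h' h
  | cupFE m n h => exact deg_cast k (S.deg_unit m n h) (by ring)
  | capFE m n h => exact deg_cast k (β.lad m n h).deg_counit (by ring)
  | cupEF m n h => exact deg_cast k (β.lad m n h).deg_unit (by omega)
  | capEF m n h => exact deg_cast k (S.deg_counit m n h) (by omega)

section

variable {a b c d : ℤ} {f g h : Word a b} {p q : ℤ}

@[simp] theorem ev₂_cast (x : Diagram k f g p) (e : p = q) :
    β.ev₂ Z (x.cast e) = β.ev₂ Z x := by subst e; rfl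

@[simp] theorem ev₂_seq (x : Diagram k f g p) (y : Diagram k g h q) :
    β.ev₂ Z (x.seq y) = β.ev₂ Z x ≫ β.ev₂ Z y := rfl

theorem ev₂_sumLt (n : ℕ) (x : (i : ℕ) → i < n → Diagram k f g p)
    (y : ℕ → (ev S Z f ⟶ ev S Z g)) (hxy : ∀ i hi, β.ev₂ Z (x i hi) = y i) :
    β.ev₂ Z (Diagram.sumLt n x) = ∑ i ∈ Finset.range n, y i := by
  induction n with
  | zero => rfl
  | succ n ih =>
    rw [Finset.sum_range_succ, ← ih (fun i hi => x i (Nat.lt_succ_of_lt hi))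
      (fun i hi => hxy _ _), ← hxy n (Nat.lt_succ_self n)]
    rfl

theorem ev₂_dots (m n : ℤ) (h : m + 2 = n) (j : ℕ) :
    β.ev₂ Z (Diagram.dots m n h j) = S.Xp m n h j := by
  induction j with
  | zero => exact β.ev₂_cast Z _ _
  | succ j ih => exact (β.ev₂_cast Z _ _).trans (congrArg (· ≫ S.X m n h) ih)

theorem ev₂_mateR {W : Word a b} {V : Word b a} {p s q : ℤ}
    (cup : Diagram k (Word.one a) (W.comp V) p) (cap : Diagram k (V.comp W) (Word.one b) q)
    (x : Diagram k W W s) {A : ev S Z W ⊣ ev S Z V} (hu : β.ev₂ Z cup = A.unit)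
    (hc : β.ev₂ Z cap = A.counit) :
    β.ev₂ Z (Diagram.mateR cup cap x) = mateR A (β.ev₂ Z x) := by
  rw [mateR, ← hu, ← hc]
  refine (β.ev₂_cast Z _ _).trans ?_
  simp only [ev₂_seq, Category.assoc]
  rfl

theorem ev₂_mateL {W : Word a b} {V : Word b a} {p s q : ℤ}
    (cup : Diagram k (Word.one b) (V.comp W) p) (cap : Diagram k (W.comp V) (Word.one a) q)
    (x : Diagram k W W s) {A : ev S Z V ⊣ ev S Z W} (hu : β.ev₂ Z cup = A.unit)
    (hc : β.ev₂ Z cap = A.counit) :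
    β.ev₂ Z (Diagram.mateL cup cap x) = mateL A (β.ev₂ Z x) := by
  rw [mateL, ← hu, ← hc]
  refine (β.ev₂_cast Z _ _).trans ?_
  simp only [ev₂_seq, Category.assoc]
  rfl

theorem ev₂_nestCup {W₁ : Word a b} {V₁ : Word b a} {W₂ : Word b c} {V₂ : Word c b} {p q : ℤ}
    (x : Diagram k (Word.one a) (W₁.comp V₁) p) (y : Diagram k (Word.one b) (W₂.comp V₂) q)
    {A : ev S Z W₁ ⊣ ev S Z V₁} {A' : ev S Z W₂ ⊣ ev S Z V₂} (hx : β.ev₂ Z x = A.unit)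
    (hy : β.ev₂ Z y = A'.unit) :
    β.ev₂ Z (Diagram.nestCup x y) = (A.comp A').unit := by
  rw [comp_unit, ← hx, ← hy]
  refine (β.ev₂_cast Z _ _).trans ?_
  simp only [ev₂_seq, Category.assoc]
  exact congrArg (fun z => β.ev₂ Z x ≫ ev S Z W₁ ◁ z ≫ _) (Category.assoc _ _ _)

theorem ev₂_nestCap {W₁ : Word a b} {V₁ : Word b a} {W₂ : Word b c} {V₂ : Word c b} {p q : ℤ}
    (x : Diagram k (W₁.comp V₁) (Word.one a) p) (y : Diagram k (W₂.comp V₂) (Word.one b) q)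
    {A : ev S Z V₁ ⊣ ev S Z W₁} {A' : ev S Z V₂ ⊣ ev S Z W₂} (hx : β.ev₂ Z x = A.counit)
    (hy : β.ev₂ Z y = A'.counit) :
    β.ev₂ Z (Diagram.nestCap x y) = (A'.comp A).counit := by
  rw [comp_counit, ← hx, ← hy]
  refine (β.ev₂_cast Z _ _).trans ?_
  simp only [ev₂_seq, Category.assoc]
  exact congrArg (fun z => _ ≫ ev S Z W₁ ◁ z ≫ β.ev₂ Z x) (Category.assoc _ _ _)

end

theorem ev₂_ccw (n : ℤ) (j : ℕ) :
    β.ev₂ Z (Diagram.ccw n j) = β.ccw n (n + 2) rfl j := by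
  refine (β.ev₂_cast Z _ _).trans ?_
  simp only [ev₂_seq]
  exact congrArg (fun x => ((S.adj n (n + 2) rfl).unit ≫ x ▷ S.F (n + 2) n rfl) ≫
    (β.lad n (n + 2) rfl).adj.counit) (β.ev₂_dots Z n (n + 2) rfl j)

theorem ev₂_cw (n : ℤ) (j : ℕ) :
    β.ev₂ Z (Diagram.cw n j) = β.cw (n - 2) n (by omega) j := by
  refine (β.ev₂_cast Z _ _).trans ?_
  simp only [ev₂_seq, Category.assoc]
  have h : n - 2 + 2 = n := by omega
  exact congrArg (fun x => (β.lad (n - 2) n h).adj.unit ≫ S.F n (n - 2) h ◁ x ≫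
    (S.adj (n - 2) n h).counit) (β.ev₂_dots Z (n - 2) n h j)

theorem ev₂_fakeCW (N : ℕ) (p : ℤ) (h : (-N : ℤ) + 2 = p) (j : ℕ) :
    β.ev₂ Z (Diagram.fakeCW N j) = fakes (β.ccwB N (-N) p h) j := by
  subst h
  induction j using Nat.strong_induction_on with
  | _ j ih =>
    cases j with
    | zero =>
      rw [Diagram.fakeCW, fakes]
      exact β.ev₂_cast Z _ _
    | succ j =>
      rw [Diagram.fakeCW, fakes, Finset.sum_fin_eq_sum_range]
      refine (congrArg ((-1 : k) • ·) (β.ev₂_sumLt Z _ _ _ fun i hi => ?_)).trans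
        (neg_one_smul k _)
      refine (β.ev₂_cast Z _ _).trans (Eq.trans ?_ (dif_pos hi).symm)
      refine congrArg₂ (· ≫ ·) ((β.ev₂_ccw Z _ _).trans ?_) (ih i hi)
      rw [show j + 1 - i = (j - i) + 1 by omega]
      rfl

theorem ev₂_fakeCCW (N : ℕ) (l : ℤ) (h : l + 2 = N) (j : ℕ) :
    β.ev₂ Z (Diagram.fakeCCW N j) = fakes (β.cwB N l N h) j := by
  obtain rfl : l = (N : ℤ) - 2 := by omega
  induction j using Nat.strong_induction_on with
  | _ j ih =>
    cases j with
    | zero =>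
      rw [Diagram.fakeCCW, fakes]
      exact β.ev₂_cast Z _ _
    | succ j =>
      rw [Diagram.fakeCCW, fakes, Finset.sum_fin_eq_sum_range]
      refine (congrArg ((-1 : k) • ·) (β.ev₂_sumLt Z _ _ _ fun i hi => ?_)).trans
        (neg_one_smul k _)
      refine (β.ev₂_cast Z _ _).trans (Eq.trans ?_ (dif_pos hi).symm)
      refine congrArg₂ (· ≫ ·) ((β.ev₂_cw Z _ _).trans ?_) (ih i hi)
      rw [show j + 1 - i = (j - i) + 1 by omega]
      rfl

theorem ev₂_crossEF (l n p : ℤ) (h : l + 2 = n) (h' : n + 2 = p) :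
    β.ev₂ Z (Diagram.crossEF l n p h h') = S.sigma l n p h h' := by
  refine (β.ev₂_cast Z _ _).trans ?_
  simp only [ev₂_seq, Category.assoc]
  exact congrArg (fun z => _ ≫ _ ≫ _ ≫ S.F n l h ◁ z ≫ _) (Category.assoc _ _ _)

theorem ev₂_crossFE (l n p : ℤ) (h : l + 2 = n) (h' : n + 2 = p) :
    β.ev₂ Z (Diagram.crossFE l n p h h') = β.sigma' l n p h h' := by
  refine (β.ev₂_cast Z _ _).trans ?_
  simp only [ev₂_seq, Category.assoc]
  exact congrArg (fun z => _ ≫ _ ≫ _ ≫ S.F n l h ◁ z ≫ _) (Category.assoc _ _ _)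

theorem ev₂_curlRight (l n p : ℤ) (h : l + 2 = n) (h' : n + 2 = p) :
    β.ev₂ Z (Diagram.curlRight l n p h h') = β.curlR l n p h h' := by
  refine (β.ev₂_cast Z _ _).trans ?_
  simp only [ev₂_seq, Category.assoc]
  rfl

theorem ev₂_curlLeft (l n p : ℤ) (h : l + 2 = n) (h' : n + 2 = p) :
    β.ev₂ Z (Diagram.curlLeft l n p h h') = β.curlL l n p h h' := by
  refine (β.ev₂_cast Z _ _).trans ?_
  simp only [ev₂_seq, Category.assoc]
  rfl

theorem ev₂_whiskerMid {a b c d : ℤ} (f : Word a b) {g g' : Word b c} {h h' : Word c d} {p : ℤ}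
    (x : Diagram k (g.comp h) (g'.comp h') p) : β.ev₂ Z (Diagram.whiskerMid f x) =
      (α_ _ _ _).hom ≫ ev S Z f ◁ β.ev₂ Z x ≫ (α_ _ _ _).inv := by
  refine (β.ev₂_cast Z _ _).trans ?_
  simp only [ev₂_seq, Category.assoc]
  rfl

end Sys.Bi

end

/-! ### Evaluation respects the relations -/

section

open GrBicat SL2

namespace Sys.Bi

variable {k : Type t} [Field k] {B : Type u} [Bicategory.{w, v} B] [AddBicat B] [GrBicat k B]
  {r : kˣ} {S : Sys k r B} (β : Bi S) (Z : Sums k B)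

theorem ev₂_sum_EF (N : ℕ) (l : ℤ) (h : l + 2 = N) :
    β.ev₂ Z (Diagram.sumLt N fun i _ => Diagram.sumLt (N - i) fun j _ =>
      ((Diagram.whiskerLeft (Word.F N l h) (Diagram.dots l N h (N - 1 - i - j))).seq
        (Diagram.capEF l N h) |>.seq (Diagram.fakeCCW N j) |>.seq (Diagram.cupEF l N h) |>.seq
          (Diagram.whiskerLeft _ (Diagram.dots l N h i))).cast
            (show _ = (0 : ℤ) by omega)) =
      ∑ i ∈ Finset.range N, ∑ j ∈ Finset.range (N - i),
        (S.F N l h ◁ S.Xp l N h (N - 1 - i - j) ≫ (S.adj l N h).counit) ≫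
          fakes (β.cwB N l N h) j ≫ (β.lad l N h).adj.unit ≫ S.F N l h ◁ S.Xp l N h i := by
  refine β.ev₂_sumLt Z _ _ _ fun i hi => β.ev₂_sumLt Z _ _ _ fun j hj => ?_
  refine (β.ev₂_cast Z _ _).trans ?_
  simp only [ev₂_seq, Category.assoc]
  rw [← β.ev₂_dots Z, ← β.ev₂_dots Z, ← β.ev₂_fakeCCW Z]
  rfl

theorem ev₂_sum_FE (N : ℕ) (p : ℤ) (h : (-N : ℤ) + 2 = p) :
    β.ev₂ Z (Diagram.sumLt N fun i _ => Diagram.sumLt (N - i) fun j _ =>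
      ((Diagram.whiskerRight (Diagram.dots (-N) p h (N - 1 - i - j)) (Word.F p (-N) h)).seq
        (Diagram.capFE (-N) p h) |>.seq (Diagram.fakeCW N j) |>.seq (Diagram.cupFE (-N) p h) |>.seq
          (Diagram.whiskerRight (Diagram.dots (-N) p h i) _)).cast
            (show _ = (0 : ℤ) by omega)) =
      ∑ i ∈ Finset.range N, ∑ j ∈ Finset.range (N - i),
        (S.Xp (-N) p h (N - 1 - i - j) ▷ S.F p (-N) h ≫ (β.lad (-N) p h).adj.counit) ≫
          fakes (β.ccwB N (-N) p h) j ≫ S.cupX (-N) p h i := by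
  refine β.ev₂_sumLt Z _ _ _ fun i hi => β.ev₂_sumLt Z _ _ _ fun j hj => ?_
  refine (β.ev₂_cast Z _ _).trans ?_
  simp only [ev₂_seq, Category.assoc]
  rw [cupX, ← β.ev₂_dots Z, ← β.ev₂_dots Z, ← β.ev₂_fakeCW Z]
  rfl

theorem ev₂_sum_curlLeft (N : ℕ) (l : ℤ) (h : l + 2 = N) :
    β.ev₂ Z (Diagram.sumLt (N + 1) fun i hi =>
      ((Diagram.dots l N h i).seq (Diagram.rightUnitInv _) |>.seq
        (Diagram.whiskerLeft _ (Diagram.fakeCCW N (N - i))) |>.seq (Diagram.rightUnit _)).cast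
          (show _ = (2 * N : ℤ) by omega)) =
      ∑ i ∈ Finset.range (N + 1), S.Xp l N h i ≫ (ρ_ _).inv ≫
        S.E l N h ◁ fakes (β.cwB N l N h) (N - i) ≫ (ρ_ _).hom := by
  refine β.ev₂_sumLt Z _ _ _ fun i hi => ?_
  refine (β.ev₂_cast Z _ _).trans ?_
  simp only [ev₂_seq, Category.assoc]
  rw [← β.ev₂_dots Z, ← β.ev₂_fakeCCW Z]
  rfl

theorem ev₂_sum_curlRight (N : ℕ) (p : ℤ) (h : (-N : ℤ) + 2 = p) :
    β.ev₂ Z (Diagram.sumLt (N + 1) fun i hi =>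
      ((Diagram.dots (-N) p h i).seq (Diagram.leftUnitInv _) |>.seq
        (Diagram.whiskerRight (Diagram.fakeCW N (N - i)) _) |>.seq (Diagram.leftUnit _)).cast
          (show _ = (-(2 * -N) : ℤ) by omega)) =
      ∑ i ∈ Finset.range (N + 1), S.Xp (-N) p h i ≫ (λ_ _).inv ≫
        fakes (β.ccwB N (-N) p h) (N - i) ▷ S.E (-N) p h ≫ (λ_ _).hom := by
  refine β.ev₂_sumLt Z _ _ _ fun i hi => ?_
  refine (β.ev₂_cast Z _ _).trans ?_
  simp only [ev₂_seq, Category.assoc]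
  rw [← β.ev₂_dots Z, ← β.ev₂_fakeCW Z]
  rfl

theorem adj_left_triangle {B : Type u} [Bicategory.{w, v} B] {a b : B} {f : a ⟶ b} {g : b ⟶ a}
    (A : f ⊣ g) : ((((λ_ f).inv ≫ A.unit ▷ f) ≫ (α_ f g f).hom) ≫ f ◁ A.counit) ≫ (ρ_ f).hom =
      𝟙 f := by
  have h := A.left_triangle
  rw [leftZigzag_eq] at h
  simp only [Category.assoc]
  rw [reassoc_of% h]
  simp

theorem adj_right_triangle {B : Type u} [Bicategory.{w, v} B] {a b : B} {f : a ⟶ b} {g : b ⟶ a}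
    (A : f ⊣ g) : ((((ρ_ g).inv ≫ g ◁ A.unit) ≫ (α_ g f g).inv) ≫ A.counit ▷ g) ≫ (λ_ g).hom =
      𝟙 g := by
  have h := A.right_triangle
  rw [rightZigzag_eq] at h
  simp only [Category.assoc]
  rw [reassoc_of% h]
  simp

/-- If `x` acts by `-r ^ 2`, then the identity is `-r⁻² x`. -/
theorem smul_neg_sq {C : Type*} [Category* C] [Preadditive C] [Linear k C] {f : C} {x : f ⟶ f}
    (hx : x = -((r : k) ^ 2) • 𝟙 f) : 𝟙 f = (-((r⁻¹ : kˣ) : k) ^ 2) • x := by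
  rw [hx, smul_smul]
  have : -((r⁻¹ : kˣ) : k) ^ 2 * -(r : k) ^ 2 = 1 := by
    rw [neg_mul_neg, ← mul_pow, Units.inv_mul, one_pow]
  rw [this, one_smul]

/-- The evaluation of diagrams respects the defining relations of `U_Q(sl₂)`. -/
theorem ev₂_eq {a b : ℤ} {f g : Word a b} {p : ℤ} {x y : Diagram k f g p} (H : Rel r x y) :
    β.ev₂ Z x = β.ev₂ Z y := by
  induction H with
  | refl x => rfl
  | symm _ ih => exact ih.symm
  | trans _ _ ih ih' => exact ih.trans ih'
  | comp_congr e _ _ ih ih' => exact congrArg₂ (· ≫ ·) ih ih'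
  | whiskerLeft_congr f _ ih => exact congrArg (_ ◁ ·) ih
  | whiskerRight_congr h _ ih => exact congrArg (· ▷ _) ih
  | add_congr _ _ ih ih' => exact congrArg₂ (· + ·) ih ih'
  | smul_congr c _ ih => exact congrArg (c • ·) ih
  | add_assoc x y z => exact add_assoc _ _ _
  | add_comm x y => exact add_comm _ _
  | zero_add x => exact zero_add _
  | neg_add x => exact (congrArg (· + _) (neg_one_smul k _)).trans (neg_add_cancel _)
  | one_smul x => exact one_smul k _
  | mul_smul c d x => exact mul_smul c d _
  | smul_add c x y => exact smul_add c _ _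
  | add_smul c d x => exact add_smul c d _
  | comp_add x y z e => exact Preadditive.comp_add _ _ _ _ _ _
  | add_comp x y z e => exact Preadditive.add_comp _ _ _ _ _ _
  | comp_smul c x y e => exact Linear.comp_smul _ _ _ _ _ _
  | smul_comp c x y e => exact Linear.smul_comp _ _ _ _ _ _
  | whiskerLeft_add f x y => exact AddBicat.whiskerLeft_add _ _ _
  | whiskerLeft_smul f z x => exact GrBicat.whiskerLeft_smul _ _ _
  | whiskerRight_add x y h => exact AddBicat.add_whiskerRight _ _ _
  | whiskerRight_smul z x h => exact GrBicat.smul_whiskerRight _ _ _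
  | id_comp x e => exact Category.id_comp _
  | comp_id x e => exact Category.comp_id _
  | comp_assoc x y z e₁ e₂ e₃ e₄ => exact Category.assoc _ _ _
  | whiskerLeft_id f g => exact Bicategory.whiskerLeft_id _ _
  | whiskerLeft_comp f x y e => exact Bicategory.whiskerLeft_comp _ _ _
  | id_whiskerRight f g => exact Bicategory.id_whiskerRight _ _
  | comp_whiskerRight x y e i => exact Bicategory.comp_whiskerRight _ _ _
  | whisker_exchange x y e e' => exact Bicategory.whisker_exchange _ _
  | assoc_hom_inv f g h e => exact Iso.hom_inv_id _
  | assoc_inv_hom f g h e => exact Iso.inv_hom_id _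
  | leftUnit_hom_inv f e => exact Iso.hom_inv_id _
  | leftUnit_inv_hom f e => exact Iso.inv_hom_id _
  | rightUnit_hom_inv f e => exact Iso.hom_inv_id _
  | rightUnit_inv_hom f e => exact Iso.inv_hom_id _
  | assoc_natural_left x g h e e' => exact Bicategory.associator_naturality_left _ _ _
  | assoc_natural_middle f x h e e' => exact Bicategory.associator_naturality_middle _ _ _
  | assoc_natural_right f g x e e' => exact Bicategory.associator_naturality_right _ _ _
  | leftUnit_natural x e e' => exact Bicategory.leftUnitor_naturality _
  | rightUnit_natural x e e' => exact Bicategory.rightUnitor_naturality _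
  | pentagon f g h i e => exact Bicategory.pentagon _ _ _ _
  | triangle f g e => exact Bicategory.triangle _ _
  | toShift_unshift f l e => exact Iso.inv_hom_id _
  | unshift_toShift f l e => exact Iso.hom_inv_id _
  | ident_zero a b => exact Z.id_zero _ _
  | inl_fst f g e => exact Z.inl_fst _ _
  | inr_snd f g e => exact Z.inr_snd _ _
  | inl_snd f g e => exact Z.inl_snd _ _
  | inr_fst f g e => exact Z.inr_fst _ _
  | total f g e => exact Z.total _ _
  | biadjoint_E_right m n h =>
    exact (β.ev₂_cast Z _ _).trans (adj_left_triangle (S.adj m n h))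
  | biadjoint_F_left m n h =>
    exact (β.ev₂_cast Z _ _).trans (adj_right_triangle (S.adj m n h))
  | biadjoint_E_left m n h =>
    exact (β.ev₂_cast Z _ _).trans (adj_right_triangle (β.lad m n h).adj)
  | biadjoint_F_right m n h =>
    exact (β.ev₂_cast Z _ _).trans (adj_left_triangle (β.lad m n h).adj)
  | dotF_eq_mateR m n h =>
    refine Eq.symm ((β.ev₂_cast Z _ _).trans ?_)
    exact β.ev₂_mateR Z (W := Word.E m n h) (V := Word.F n m h) (Diagram.cupFE m n h)
      (Diagram.capEF m n h) (Diagram.dotE m n h) (A := S.adj m n h) rfl rfl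
  | dotF_eq_mateL m n h =>
    refine Eq.symm ((β.ev₂_cast Z _ _).trans (Eq.trans ?_ (X_cyclic β m n h)))
    exact β.ev₂_mateL Z (W := Word.E m n h) (V := Word.F n m h) (Diagram.cupEF m n h)
      (Diagram.capFE m n h) (Diagram.dotE m n h) (A := (β.lad m n h).adj) rfl rfl
  | crossF_eq_mateR a b c h h' =>
    refine Eq.symm ((β.ev₂_cast Z _ _).trans ?_)
    exact β.ev₂_mateR Z
      (W := (Word.E a b h).comp (Word.E b c h')) (V := (Word.F c b h').comp (Word.F b a h))
      _ _ (Diagram.crossE a b c h h') (A := (S.adj a b h).comp (S.adj b c h'))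
      (β.ev₂_nestCup Z (W₁ := Word.E a b h) (V₁ := Word.F b a h) (W₂ := Word.E b c h')
        (V₂ := Word.F c b h') (Diagram.cupFE a b h) (Diagram.cupFE b c h')
        (A := S.adj a b h) (A' := S.adj b c h') rfl rfl)
      (β.ev₂_nestCap Z (W₁ := Word.F c b h') (V₁ := Word.E b c h') (W₂ := Word.F b a h)
        (V₂ := Word.E a b h) (Diagram.capEF b c h') (Diagram.capEF a b h)
        (A := S.adj b c h') (A' := S.adj a b h) rfl rfl)
  | crossF_eq_mateL a b c h h' =>
    refine Eq.symm ((β.ev₂_cast Z _ _).trans (Eq.trans ?_ (T_cyclic β a b c h h')))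
    exact β.ev₂_mateL Z
      (W := (Word.E a b h).comp (Word.E b c h')) (V := (Word.F c b h').comp (Word.F b a h))
      _ _ (Diagram.crossE a b c h h') (A := (β.lad b c h').adj.comp (β.lad a b h).adj)
      (β.ev₂_nestCup Z (W₁ := Word.F c b h') (V₁ := Word.E b c h') (W₂ := Word.F b a h)
        (V₂ := Word.E a b h) (Diagram.cupEF b c h') (Diagram.cupEF a b h)
        (A := (β.lad b c h').adj) (A' := (β.lad a b h).adj) rfl rfl)
      (β.ev₂_nestCap Z (W₁ := Word.E a b h) (V₁ := Word.F b a h) (W₂ := Word.E b c h')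
        (V₂ := Word.F c b h') (Diagram.capFE a b h) (Diagram.capFE b c h')
        (A := (β.lad a b h).adj) (A' := (β.lad b c h').adj) rfl rfl)
  | crossE_sq a b c h h' => exact S.T_sq a b c h h'
  | dotE_slide a b c h h' =>
    refine (β.ev₂_cast Z _ _).trans (Eq.trans ?_ (S.slide a b c h h'))
    exact (congrArg (_ + ·) (neg_one_smul k _)).trans (sub_eq_add_neg _ _).symm
  | dotE_slide' a b c h h' =>
    refine (β.ev₂_cast Z _ _).trans (Eq.trans ?_ (S.slide' a b c h h'))
    exact (congrArg (_ + ·) (neg_one_smul k _)).trans (sub_eq_add_neg _ _).symm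
  | crossE_braid a b c d h h' h'' =>
    have hm := β.ev₂_whiskerMid Z (Word.E a b h) (Diagram.crossE (k := k) b c d h' h'')
    refine (congrArg (fun z => (S.T a b c h h' ▷ S.E c d h'' ≫ z) ≫ S.T a b c h h' ▷ S.E c d h'')
      hm).trans ((Category.assoc _ _ _).trans ((S.braid a b c d h h' h'').trans ?_))
    refine Eq.symm ((β.ev₂_cast Z _ _).trans ?_)
    exact (congrArg (fun z => (z ≫ S.T a b c h h' ▷ S.E c d h'') ≫ z) hm).trans (Category.assoc _ _ _)
  | crossF_sq a b c h h' => exact S.tF_sq c b a h' h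
  | dotF_slide a b c h h' =>
    refine (β.ev₂_cast Z _ _).trans (Eq.trans ?_ (S.xF_slide c b a h' h))
    exact (congrArg (_ + ·) (neg_one_smul k _)).trans (sub_eq_add_neg _ _).symm
  | dotF_slide' a b c h h' =>
    refine (β.ev₂_cast Z _ _).trans (Eq.trans ?_ (S.xF_slide' c b a h' h))
    exact (congrArg (_ + ·) (neg_one_smul k _)).trans (sub_eq_add_neg _ _).symm
  | crossF_braid a b c d h h' h'' =>
    have hm := β.ev₂_whiskerMid Z (Word.F d c h'') (Diagram.crossF (k := k) c b a h' h)
    refine (congrArg (fun z => (S.tF d c b h'' h' ▷ S.F b a h ≫ z) ≫ S.tF d c b h'' h' ▷ S.F b a h)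
      hm).trans ((Category.assoc _ _ _).trans ((S.tF_braid d c b a h'' h' h).trans ?_))
    refine Eq.symm ((β.ev₂_cast Z _ _).trans ?_)
    exact (congrArg (fun z => (z ≫ S.tF d c b h'' h' ▷ S.F b a h) ≫ z) hm).trans (Category.assoc _ _ _)
  | cw_eq_zero n m hm => exact (β.ev₂_cw Z n m).trans (β.cw_eq_zero _ _ _ _ hm)
  | ccw_eq_zero n m hm => exact (β.ev₂_ccw Z n m).trans (β.ccw_eq_zero _ _ _ _ hm)
  | cw_eq_ident n m hm =>
    exact (β.ev₂_cast Z _ _).trans ((β.ev₂_cw Z n m).trans (β.high _ _ _ _ (by push_cast; omega)))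
  | ccw_eq_ident n m hm =>
    exact (β.ev₂_cast Z _ _).trans ((β.ev₂_ccw Z n m).trans (β.low _ _ _ _ (by push_cast; omega)))
  | curlRight_pos l n p h h' hn =>
    exact (β.ev₂_curlRight Z l n p h h').trans (β.curlR_pos h h' hn)
  | curlLeft_neg l n p h h' hn =>
    exact (β.ev₂_curlLeft Z l n p h h').trans (β.curlL_neg h h' hn)
  | curlLeft_nonneg N l p h h' =>
    exact (β.ev₂_curlLeft Z l N p h h').trans ((β.curlL_nonneg N h h' rfl).trans
      (congrArg ((r : k) • ·) (β.ev₂_sum_curlLeft Z N l h).symm))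
  | curlRight_nonpos N l p h h' =>
    exact (β.ev₂_curlRight Z l (-N) p h h').trans ((β.curlR_nonpos N h h' rfl).trans
      (congrArg (-(r : k) • ·) (β.ev₂_sum_curlRight Z N p h').symm))
  | ident_EF_nonpos l n p h h' hn =>
    exact smul_neg_sq ((congrArg₂ (· ≫ ·) (β.ev₂_crossEF Z l n p h h')
      (β.ev₂_crossFE Z l n p h h')).trans (β.sigma_sigma' h h' hn))
  | ident_FE_nonneg l n p h h' hn =>
    exact smul_neg_sq ((congrArg₂ (· ≫ ·) (β.ev₂_crossFE Z l n p h h')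
      (β.ev₂_crossEF Z l n p h h')).trans (β.sigma'_sigma h h' hn))
  | ident_EF_nonneg N l p h h' =>
    refine (β.ident_EF N h h' rfl).trans ?_
    refine congrArg₂ (fun x y => (-((r⁻¹ : kˣ) : k) ^ 2) • x + y)
      (congrArg₂ (· ≫ ·) (β.ev₂_crossEF Z l N p h h') (β.ev₂_crossFE Z l N p h h')).symm
      (β.ev₂_sum_EF Z N l h).symm
  | ident_FE_nonpos N l p h h' =>
    refine (β.ident_FE N h h' rfl).trans ?_
    refine congrArg₂ (fun x y => (-((r⁻¹ : kˣ) : k) ^ 2) • x + y)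
      (congrArg₂ (· ≫ ·) (β.ev₂_crossFE Z l (-N) p h h') (β.ev₂_crossEF Z l (-N) p h h')).symm
      (β.ev₂_sum_FE Z N p h').symm

end Sys.Bi

end

/-! ### The 2-functor -/

section

open GrBicat SL2

namespace Sys.Bi

variable {k : Type t} [Field k] {B : Type u} [Bicategory.{w, v} B] [AddBicat B] [GrBicat k B]
  {r : kˣ} {S : Sys k r B} (β : Bi S) (Z : Sums k B)

/-- The evaluation of homogeneous 2-morphisms of `U_Q(sl₂)`. -/
def evQ {a b : ℤ} {f g : Word a b} {p : ℤ} : Hom2 r f g p → (ev S Z f ⟶ ev S Z g) :=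
  Quot.lift (β.ev₂ Z) fun _ _ H => β.ev₂_eq Z H

theorem deg_evQ {a b : ℤ} {f g : Word a b} {p : ℤ} (x : Hom2 r f g p) :
    β.evQ Z x ∈ deg k p _ _ := by
  obtain ⟨x⟩ := x
  exact β.deg_ev₂ Z x

theorem evQ_comp {a b : ℤ} {f g h : Word a b} {p q s : ℤ} (x : Hom2 r f g p) (y : Hom2 r g h q)
    (e : p + q = s) : β.evQ Z (x.comp y e) = β.evQ Z x ≫ β.evQ Z y := by
  obtain ⟨x⟩ := x
  obtain ⟨y⟩ := y
  rfl

theorem evQ_whiskerLeft {a b c : ℤ} (f : Word a b) {g h : Word b c} {p : ℤ} (x : Hom2 r g h p) :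
    β.evQ Z (x.whiskerLeft f) = ev S Z f ◁ β.evQ Z x := by
  obtain ⟨x⟩ := x
  rfl

theorem evQ_whiskerRight {a b c : ℤ} {f g : Word a b} {p : ℤ} (x : Hom2 r f g p) (h : Word b c) :
    β.evQ Z (x.whiskerRight h) = β.evQ Z x ▷ ev S Z h := by
  obtain ⟨x⟩ := x
  rfl

theorem evQ_add {a b : ℤ} {f g : Word a b} {p : ℤ} (x y : Hom2 r f g p) :
    β.evQ Z (x + y) = β.evQ Z x + β.evQ Z y := by
  obtain ⟨x⟩ := x
  obtain ⟨y⟩ := y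
  rfl

theorem evQ_smul {a b : ℤ} {f g : Word a b} {p : ℤ} (c : k) (x : Hom2 r f g p) :
    β.evQ Z (c • x) = c • β.evQ Z x := by
  obtain ⟨x⟩ := x
  rfl

end Sys.Bi

namespace Tot

variable {k : Type t} [Field k] {K : Type u} [Bicategory.{w, v} K]
  [GradedAdditiveBicategory K] [GradedLinearBicategory k K]

attribute [local instance] hasBinaryBiproducts_of_finite_biproducts

variable (k) in
/-- The inclusion of the first summand. -/
noncomputable def inl {a b : K} (f g : a ⟶ b) : of₁ k f ⟶ of₁ k (f ⊞ g) := of₀ k biprod.inl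

variable (k) in
/-- The inclusion of the second summand. -/
noncomputable def inr {a b : K} (f g : a ⟶ b) : of₁ k g ⟶ of₁ k (f ⊞ g) := of₀ k biprod.inr

variable (k) in
/-- The projection to the first summand. -/
noncomputable def fst {a b : K} (f g : a ⟶ b) : of₁ k (f ⊞ g) ⟶ of₁ k f := of₀ k biprod.fst

variable (k) in
/-- The projection to the second summand. -/
noncomputable def snd {a b : K} (f g : a ⟶ b) : of₁ k (f ⊞ g) ⟶ of₁ k g := of₀ k biprod.snd

theorem inl_fst {a b : K} (f g : a ⟶ b) : inl k f g ≫ fst k f g = 𝟙 _ :=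
  (of₀_comp _ _).symm.trans (congrArg (of₀ k) biprod.inl_fst)

theorem inr_snd {a b : K} (f g : a ⟶ b) : inr k f g ≫ snd k f g = 𝟙 _ :=
  (of₀_comp _ _).symm.trans (congrArg (of₀ k) biprod.inr_snd)

theorem inl_snd {a b : K} (f g : a ⟶ b) : inl k f g ≫ snd k f g = 0 :=
  (of₀_comp _ _).symm.trans ((congrArg (of₀ k) biprod.inl_snd).trans of₀_zero)

theorem inr_fst {a b : K} (f g : a ⟶ b) : inr k f g ≫ fst k f g = 0 :=
  (of₀_comp _ _).symm.trans ((congrArg (of₀ k) biprod.inr_fst).trans of₀_zero)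

theorem fst_inl_add_snd_inr {a b : K} (f g : a ⟶ b) :
    fst k f g ≫ inl k f g + snd k f g ≫ inr k f g = 𝟙 _ :=
  (congrArg₂ (· + ·) (of₀_comp _ _).symm (of₀_comp _ _).symm).trans
    ((of₀_add _ _).symm.trans (congrArg (of₀ k) biprod.total))

variable (K) in
/-- A zero 1-morphism of `K`. -/
noncomputable def zero₁ (a b : K) : a ⟶ b :=
  (HasZeroObject.zero' (a ⟶ b)).zero

theorem id_zero₁ (a b : K) : 𝟙 (of₁ k (zero₁ K a b)) = 0 :=
  (congrArg (of₀ k) ((IsZero.iff_id_eq_zero (zero₁ K a b)).1 (isZero_zero (a ⟶ b)))).trans of₀_zero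

variable (k K) in
/-- The shifts and direct sums of `K`. -/
noncomputable def sums : Sums k (Tot k K) where
  sh {a b} f l := of₁ k ((f : a.as ⟶ b.as)⟦l⟧)
  un {a b} f l := un k (a := a.as) (b := b.as) f l
  deg_un {a b} _ _ := deg_un (a := a.as) (b := b.as) _ _
  deg_un_inv {a b} _ _ := deg_un_inv (a := a.as) (b := b.as) _ _
  zero a b := of₁ k (zero₁ K a.as b.as)
  id_zero a b := id_zero₁ a.as b.as
  sum {a b} f g := of₁ k (biprod (C := a.as ⟶ b.as) f g)
  inl {a b} f g := inl k (a := a.as) (b := b.as) f g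
  inr {a b} f g := inr k (a := a.as) (b := b.as) f g
  fst {a b} f g := fst k (a := a.as) (b := b.as) f g
  snd {a b} f g := snd k (a := a.as) (b := b.as) f g
  deg_inl {a b} _ _ := deg_of₀ (a := a.as) (b := b.as) _
  deg_inr {a b} _ _ := deg_of₀ (a := a.as) (b := b.as) _
  deg_fst {a b} _ _ := deg_of₀ (a := a.as) (b := b.as) _
  deg_snd {a b} _ _ := deg_of₀ (a := a.as) (b := b.as) _
  inl_fst {a b} f g := inl_fst (a := a.as) (b := b.as) f g
  inr_snd {a b} f g := inr_snd (a := a.as) (b := b.as) f g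
  inl_snd {a b} f g := inl_snd (a := a.as) (b := b.as) f g
  inr_fst {a b} f g := inr_fst (a := a.as) (b := b.as) f g
  total {a b} f g := fst_inl_add_snd_inr (a := a.as) (b := b.as) f g

end Tot

end

section

open GrBicat Tot

section

variable {K : Type u} [Bicategory.{w, v} K]

theorem associator_eq_refl_comp {a b c d : K} (f : a ⟶ b) (g : b ⟶ c) (h : c ⟶ d) :
    (α_ f g h).hom = (Iso.refl ((f ≫ g) ≫ h)).hom ≫ (Iso.refl (f ≫ g)).hom ▷ h ≫ (α_ f g h).hom ≫
      f ◁ (Iso.refl (g ≫ h)).inv ≫ (Iso.refl (f ≫ g ≫ h)).inv := by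
  simp

theorem leftUnitor_eq_refl_comp {a b : K} (f : a ⟶ b) :
    (λ_ f).hom = (Iso.refl (𝟙 a ≫ f)).hom ≫ (Iso.refl (𝟙 a)).hom ▷ f ≫ (λ_ f).hom := by
  simp

theorem rightUnitor_eq_refl_comp {a b : K} (f : a ⟶ b) :
    (ρ_ f).hom = (Iso.refl (f ≫ 𝟙 b)).hom ≫ f ◁ (Iso.refl (𝟙 b)).hom ≫ (ρ_ f).hom := by
  simp

end

namespace Tot

variable {k : Type t} [Field k] {K : Type u} [Bicategory.{w, v} K]
  [GradedAdditiveBicategory K] [GradedLinearBicategory k K] {a b c : K}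

theorem of₀_shift {f g : a ⟶ b} (x : f ⟶ g) (l : ℤ) :
    of₀ k (x⟦l⟧') = (un k f l).hom ≫ of₀ k x ≫ (un k g l).inv := by
  rw [← Category.assoc, Iso.eq_comp_inv, un_natural]

theorem of₀_shiftFunctorAdd_inv (f : a ⟶ b) (l m : ℤ) :
    of₀ k ((shiftFunctorAdd (a ⟶ b) l m).inv.app f) =
      (un k (f⟦l⟧) m).hom ≫ (un k f l).hom ≫ (un k f (l + m)).inv := by
  rw [← Category.assoc, Iso.eq_comp_inv, un_add]

theorem of₀_compShift (f : a ⟶ b) (g : b ⟶ c) (l : ℤ) :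
    of₀ k (((precomp c f).commShiftIso l).hom.app g) =
      of₁ k f ◁ (un k g l).hom ≫ (un k (f ≫ g) l).inv :=
  (Iso.eq_comp_inv _).2 (whiskerLeft_un f g l).symm

theorem of₀_shiftComp (f : a ⟶ b) (g : b ⟶ c) (l : ℤ) :
    of₀ k (((postcomp a g).commShiftIso l).hom.app f) =
      (un k f l).hom ▷ of₁ k g ≫ (un k (f ≫ g) l).inv :=
  (Iso.eq_comp_inv _).2 (whiskerRight_un f g l).symm

end Tot

namespace SL2.StrongRep

variable {k : Type t} [Field k] {r : kˣ} {K : Type u} [Bicategory.{w, v} K]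
  [GradedAdditiveBicategory K] [GradedLinearBicategory k K] {ob : ℤ → K} {S : StrongRep r ob}
  (β : Sys.Bi S.sys)

variable (S) in
/-- The 2-functor on 1-morphisms. -/
noncomputable def map₁ {x y : UQ r} (f : x ⟶ y) : ob x.wt ⟶ ob y.wt :=
  Sys.Bi.ev S.sys (sums k K) f

/-- The 2-functor on 2-morphisms of arbitrary degree. -/
noncomputable def totMap {x y : UQ r} {f g : x ⟶ y} (η : UQ.tot₁ f ⟶ UQ.tot₁ g) :
    of₁ k (S.map₁ f) ⟶ of₁ k (S.map₁ g) := β.evQ (sums k K) η.2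

/-- The evaluation of a 2-morphism of degree zero has degree zero, so it is a 2-morphism of `K`. -/
theorem exists_map₂ {x y : UQ r} {f g : x ⟶ y} (η : f ⟶ g) :
    ∃ θ : S.map₁ f ⟶ S.map₁ g, of₀ k θ = totMap β (UQ.tot₂ η) :=
  exists_of₀ (β.deg_evQ (sums k K) (UQ.tot₂ η).2)

/-- The 2-functor on 2-morphisms. -/
noncomputable def map₂ {x y : UQ r} {f g : x ⟶ y} (η : f ⟶ g) : S.map₁ f ⟶ S.map₁ g :=
  (exists_map₂ β η).choose

theorem of₀_map₂ {x y : UQ r} {f g : x ⟶ y} (η : f ⟶ g) :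
    of₀ k (map₂ β η) = totMap β (UQ.tot₂ η) := (exists_map₂ β η).choose_spec

section

variable {x y z : UQ r}

theorem totMap_comp {f g h : x ⟶ y} (η : UQ.tot₁ f ⟶ UQ.tot₁ g) (θ : UQ.tot₁ g ⟶ UQ.tot₁ h) :
    totMap β (η ≫ θ) = totMap β η ≫ totMap β θ := β.evQ_comp _ _ _ _

theorem totMap_whiskerLeft (f : x ⟶ y) {g h : y ⟶ z} (η : UQ.tot₁ g ⟶ UQ.tot₁ h) :
    totMap β (f := f ≫ g) (g := f ≫ h) (UQ.tot₁ f ◁ η) = of₁ k (S.map₁ f) ◁ totMap β η :=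
  β.evQ_whiskerLeft _ _ _

theorem totMap_whiskerRight {f g : x ⟶ y} (η : UQ.tot₁ f ⟶ UQ.tot₁ g) (h : y ⟶ z) :
    totMap β (f := f ≫ h) (g := g ≫ h) (η ▷ UQ.tot₁ h) = totMap β η ▷ of₁ k (S.map₁ h) :=
  β.evQ_whiskerRight _ _ _

theorem map₂_id (f : x ⟶ y) : map₂ β (𝟙 f) = 𝟙 _ :=
  of₀_injective (k := k) (of₀_map₂ β _)

theorem map₂_comp {f g h : x ⟶ y} (η : f ⟶ g) (θ : g ⟶ h) :
    map₂ β (η ≫ θ) = map₂ β η ≫ map₂ β θ := by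
  apply of₀_injective (k := k)
  rw [of₀_comp, of₀_map₂, of₀_map₂, of₀_map₂, UQ.tot₂_comp, totMap_comp]

theorem map₂_whiskerLeft (f : x ⟶ y) {g h : y ⟶ z} (η : g ⟶ h) :
    map₂ β (f ◁ η) = S.map₁ f ◁ map₂ β η := by
  apply of₀_injective (k := k)
  refine (of₀_map₂ β _).trans ((totMap_whiskerLeft β f (UQ.tot₂ η)).trans ?_)
  exact (congrArg (of₁ k (S.map₁ f) ◁ ·) (of₀_map₂ β η).symm).trans (of₀_whiskerLeft _ _).symm

theorem map₂_whiskerRight {f g : x ⟶ y} (η : f ⟶ g) (h : y ⟶ z) :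
    map₂ β (η ▷ h) = map₂ β η ▷ S.map₁ h := by
  apply of₀_injective (k := k)
  refine (of₀_map₂ β _).trans ((totMap_whiskerRight β (UQ.tot₂ η) h).trans ?_)
  exact (congrArg (· ▷ of₁ k (S.map₁ h)) (of₀_map₂ β η).symm).trans (of₀_whiskerRight _ _).symm

theorem map₂_associator {w : UQ r} (e : w ⟶ x) (f : x ⟶ y) (g : y ⟶ z) :
    map₂ β (α_ e f g).hom = (α_ (S.map₁ e) (S.map₁ f) (S.map₁ g)).hom :=
  of₀_injective (k := k) (of₀_map₂ β _)

theorem map₂_leftUnitor (f : x ⟶ y) : map₂ β (λ_ f).hom = (λ_ (S.map₁ f)).hom :=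
  of₀_injective (k := k) (of₀_map₂ β _)

theorem map₂_rightUnitor (f : x ⟶ y) : map₂ β (ρ_ f).hom = (ρ_ (S.map₁ f)).hom :=
  of₀_injective (k := k) (of₀_map₂ β _)

theorem map₂_add {f g : x ⟶ y} (η θ : f ⟶ g) : map₂ β (η + θ) = map₂ β η + map₂ β θ := by
  apply of₀_injective (k := k)
  rw [of₀_add, of₀_map₂, of₀_map₂, of₀_map₂]
  exact β.evQ_add _ _ _

theorem map₂_smul {f g : x ⟶ y} (c : k) (η : f ⟶ g) : map₂ β (c • η) = c • map₂ β η := by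
  apply of₀_injective (k := k)
  rw [of₀_smul, of₀_map₂, of₀_map₂]
  exact β.evQ_smul _ _ _

theorem map₂_shift {f g : x ⟶ y} (η : f ⟶ g) (l : ℤ) : map₂ β (η⟦l⟧') = (map₂ β η)⟦l⟧' := by
  apply of₀_injective (k := k)
  refine (of₀_map₂ β _).trans ((congrArg (totMap β) (UQ.tot₂_shift η l)).trans ?_)
  rw [totMap_comp, totMap_comp]
  exact (congrArg (fun z => (un k (S.map₁ f) l).hom ≫ z ≫ (un k (S.map₁ g) l).inv)
    (of₀_map₂ β η)).symm.trans (of₀_shift (map₂ β η) l).symm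

theorem map₂_shiftFunctorZero (f : x ⟶ y) :
    map₂ β ((shiftFunctorZero (x ⟶ y) ℤ).hom.app f) =
      (shiftFunctorZero (ob x.wt ⟶ ob y.wt) ℤ).hom.app (S.map₁ f) := by
  apply of₀_injective (k := k)
  refine (of₀_map₂ β _).trans ?_
  exact (congrArg (totMap β) (UQ.tot₂_shiftFunctorZero_hom f)).trans (un_zero (S.map₁ f))

theorem map₂_shiftFunctorAdd (f : x ⟶ y) (l m : ℤ) :
    map₂ β ((shiftFunctorAdd (x ⟶ y) l m).inv.app f) =
      (shiftFunctorAdd (ob x.wt ⟶ ob y.wt) l m).inv.app (S.map₁ f) := by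
  apply of₀_injective (k := k)
  refine (of₀_map₂ β _).trans ?_
  rw [UQ.tot₂_shiftFunctorAdd_inv, totMap_comp, totMap_comp]
  exact (of₀_shiftFunctorAdd_inv (S.map₁ f) l m).symm

theorem map₂_compShift (f : x ⟶ y) (g : y ⟶ z) (l : ℤ) :
    map₂ β (((precomp z f).commShiftIso l).hom.app g) =
      ((precomp (ob z.wt) (S.map₁ f)).commShiftIso l).hom.app (S.map₁ g) := by
  apply of₀_injective (k := k)
  refine (of₀_map₂ β _).trans ((congrArg (totMap β) (UQ.tot₂_compShift f g l)).trans ?_)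
  refine (totMap_comp β (f := f ≫ g⟦l⟧) (g := f ≫ g) (h := (f ≫ g)⟦l⟧) _ _).trans ?_
  exact (congrArg (· ≫ _) (totMap_whiskerLeft β f (g := g⟦l⟧) (h := g) (UQ.un g l).hom)).trans
    (of₀_compShift (S.map₁ f) (S.map₁ g) l).symm

theorem map₂_shiftComp (f : x ⟶ y) (g : y ⟶ z) (l : ℤ) :
    map₂ β (((postcomp x g).commShiftIso l).hom.app f) =
      ((postcomp (ob x.wt) (S.map₁ g)).commShiftIso l).hom.app (S.map₁ f) := by
  apply of₀_injective (k := k)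
  refine (of₀_map₂ β _).trans ((congrArg (totMap β) (UQ.tot₂_shiftComp f g l)).trans ?_)
  refine (totMap_comp β (f := f⟦l⟧ ≫ g) (g := f ≫ g) (h := (f ≫ g)⟦l⟧) _ _).trans ?_
  exact (congrArg (· ≫ _) (totMap_whiskerRight β (f := f⟦l⟧) (g := f) (UQ.un f l).hom g)).trans
    (of₀_shiftComp (S.map₁ f) (S.map₁ g) l).symm

end

/-- The 2-functor `U_Q(sl₂) ⥤ K`, without its compatibility with the grading shifts. -/
noncomputable def pseudofunctor : Pseudofunctor (UQ r) K where
  obj x := ob x.wt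
  map f := S.map₁ f
  map₂ η := map₂ β η
  map₂_id f := map₂_id β f
  map₂_comp η θ := map₂_comp β η θ
  mapId x := Iso.refl _
  mapComp f g := Iso.refl _
  map₂_whisker_left f g h η := by
    rw [map₂_whiskerLeft]
    exact ((Category.id_comp _).trans (Category.comp_id _)).symm
  map₂_whisker_right η h := by
    rw [map₂_whiskerRight]
    exact ((Category.id_comp _).trans (Category.comp_id _)).symm
  map₂_associator f g h := by
    rw [map₂_associator]
    exact associator_eq_refl_comp _ _ _
  map₂_left_unitor f := by
    rw [map₂_leftUnitor]
    exact leftUnitor_eq_refl_comp _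
  map₂_right_unitor f := by
    rw [map₂_rightUnitor]
    exact rightUnitor_eq_refl_comp _

end SL2.StrongRep

end

/-! ### Compatibility with the grading shifts and with the generators -/

section

open GrBicat Tot

section

variable {C : Type*} [Category* C] [HasShift C ℤ]

theorem refl_comp_shift_refl_comp {X Y : C} (m : ℤ) (f : X⟦m⟧ ⟶ Y) :
    (Iso.refl (X⟦m⟧)).hom ≫ (Iso.refl X).hom⟦m⟧' ≫ f = f := by
  simp

theorem comp_refl_comp_shift_refl {X Y : C} (m : ℤ) (f : X ⟶ Y⟦m⟧) :
    f ≫ (Iso.refl (Y⟦m⟧)).hom ≫ (Iso.refl Y).hom⟦m⟧' = f := by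
  simp

variable {K : Type u} [Bicategory.{w, v} K] {a b c : K}

theorem refl_comp_refl_whiskerRight_comp {f : a ⟶ b} {g : b ⟶ c} {h : a ⟶ c} (x : f ≫ g ⟶ h) :
    (Iso.refl (f ≫ g)).hom ≫ (Iso.refl f).hom ▷ g ≫ x = x := by
  simp

theorem refl_comp_whiskerLeft_refl_comp {f : a ⟶ b} {g : b ⟶ c} {h : a ⟶ c} (x : f ≫ g ⟶ h) :
    (Iso.refl (f ≫ g)).hom ≫ f ◁ (Iso.refl g).hom ≫ x = x := by
  simp

theorem conj_refl_refl [GradedAdditiveBicategory K] {f g : a ⟶ b} {p : ℤ} (x : ShiftedHom f g p) :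
    SL2.ShiftedHom₂.conj (Iso.refl f) (Iso.refl g) x = x := by
  simp [SL2.ShiftedHom₂.conj]

end

namespace SL2.StrongRep

variable {k : Type t} [Field k] {r : kˣ} {K : Type u} [Bicategory.{w, v} K]
  [GradedAdditiveBicategory K] [GradedLinearBicategory k K] {ob : ℤ → K} {S : StrongRep r ob}
  (β : Sys.Bi S.sys)

/-- On hom categories, the 2-functor commutes with the grading shifts strictly. -/
@[reducible] noncomputable def mapCommShift (x y : UQ r) :
    ((pseudofunctor β).mapFunctor x y).CommShift ℤ where
  commShiftIso l := NatIso.ofComponents (fun f => Iso.refl ((S.map₁ f)⟦l⟧)) (fun {f g} η =>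
    (Category.comp_id _).trans ((map₂_shift β η l).trans (Category.id_comp _).symm))
  commShiftIso_zero := by
    ext f
    rw [Functor.CommShift.isoZero_hom_app]
    refine Eq.trans ?_ (congrArg (· ≫ _) (map₂_shiftFunctorZero β f)).symm
    exact (Iso.hom_inv_id_app (shiftFunctorZero (ob x.wt ⟶ ob y.wt) ℤ) (S.map₁ f)).symm
  commShiftIso_add l m := by
    ext f
    rw [Functor.CommShift.isoAdd_hom_app]
    refine Eq.trans ?_ (congrArg (map₂ β ((shiftFunctorAdd (x ⟶ y) l m).hom.app f) ≫ ·)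
      ((refl_comp_shift_refl_comp (C := ob x.wt ⟶ ob y.wt) (X := (S.map₁ f)⟦l⟧) m _).trans (map₂_shiftFunctorAdd β f l m).symm)).symm
    exact (map₂_id β _).symm.trans ((congrArg (map₂ β) (Iso.hom_inv_id_app
      (shiftFunctorAdd (x ⟶ y) l m) f).symm).trans (map₂_comp β _ _))

/-- The graded 2-functor `U_Q(sl₂) ⥤ K`. -/
noncomputable def gradedPseudofunctor : GradedLinearPseudofunctor k (UQ r) K where
  toPseudofunctor := pseudofunctor β
  additive x y := { map_add := map₂_add β _ _ }
  linear x y := { map_smul := fun η c => map₂_smul β c η }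
  commShift x y := mapCommShift β x y
  mapComp_shift_left {x y z} f g n := by
    exact (refl_comp_refl_whiskerRight_comp _).trans ((map₂_shiftComp β f g n).symm.trans
      (comp_refl_comp_shift_refl (C := ob x.wt ⟶ ob z.wt) (Y := S.map₁ f ≫ S.map₁ g) n _).symm)
  mapComp_shift_right {x y z} f g n := by
    exact (refl_comp_whiskerLeft_refl_comp _).trans ((map₂_compShift β f g n).symm.trans
      (comp_refl_comp_shift_refl (C := ob x.wt ⟶ ob z.wt) (Y := S.map₁ f ≫ S.map₁ g) n _).symm)

/-- On the class of a diagram of degree `p`, the 2-functor is the evaluation of the diagram. -/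
theorem of₂_map_ofDiagram {x y : UQ r} {f g : x ⟶ y} {p : ℤ}
    (d : Diagram k (a := x.wt) (b := y.wt) f g p) :
    of₂ k ((UQ.ofDiagram (r := r) d).map ((gradedPseudofunctor β).mapFunctor x y)) =
      β.ev₂ (sums k K) d := by
  refine (of₂_eq _).trans ?_
  refine (congrArg (fun z => of₀ k z ≫ (un k (S.map₁ g) p).hom) (Category.comp_id
    (map₂ β (UQ.ofDiagram (r := r) d)))).trans ?_
  refine (congrArg (· ≫ (un k (S.map₁ g) p).hom) (of₀_map₂ β _)).trans ?_
  exact (Category.assoc _ _ _).trans ((congrArg (β.ev₂ (sums k K) d ≫ ·)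
    (Iso.inv_hom_id (un k (S.map₁ g) p))).trans (Category.comp_id _))

/-- The 2-functor has the required values on the generators. -/
theorem extends_gradedPseudofunctor : Extends (gradedPseudofunctor β) S where
  map_E _ _ _ := rfl
  map_F _ _ _ := rfl
  map_dotE _ _ _ := of₂_injective (k := k) (of₂_map_ofDiagram β _)
  map_crossE _ _ _ _ _ := of₂_injective (k := k)
    ((congrArg (of₂ k) (conj_refl_refl _)).trans (of₂_map_ofDiagram β _))

end SL2.StrongRep

end

theorem mainTheorem2 {k : Type t} [Field k] (r : kˣ) {K : Type u} [Bicategory.{w, v} K]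
    [GradedAdditiveBicategory K] [GradedLinearBicategory k K] (ob : ℤ → K)
    (S : SL2.StrongRep r ob) :
    ∃ (Φ : GradedLinearPseudofunctor k (SL2.UQ r) K) (h : ob = fun n => Φ.obj ⟨n⟩),
      SL2.Extends Φ (h ▸ S) := by
  obtain ⟨β⟩ := Sys.exists_bi S.sys
  exact ⟨SL2.StrongRep.gradedPseudofunctor β, rfl, SL2.StrongRep.extends_gradedPseudofunctor β⟩
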